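/- Let $X$ be a Hermitian manifold of complex dimension $n$ (Hausdorff, second countable, with a smooth Hermitian metric), embedded as an open subset in a Hausdorff space $Z$, for example as an open Hermitian submanifold in a Hermitian complex space $Z$. Let $\varphi\in C^0(X,\mathbb R)$ and let $L^2_*(X,\varphi)$ be the Hilbert space of complex valued differential forms $u$ of all degrees on $X$ with $\|u\|^2=\int_X|u|^2e^{-\varphi}\,dV_X<\infty$. Write $\Omega\subset\subset X$ if $\Omega\subset X$ is open with compact closure in $X$. Let $T:\operatorname{Dom}T\subset L^2_*(X,\varphi)\to L^2_*(X,\varphi)$ be a densely defined closed operator such that the smooth forms with compact support belong to $\operatorname{Dom}T\cap\operatorname{Dom}T^*$, $T$ acts on them as a linear partial differential operator of first order with smooth coefficients, and $T^2=0$ (i.e. $\mathcal R(T)\subset\ker T$). Assume that $T$ is elliptic in the interior of $X$: for each $\Omega\subset\subset X$ there is $C_\Omega>0$ such that $$\|u\|^2_{W^{1,2}_*(\Omega,\varphi)}\le C_\Omega\left(\|u\|^2_{L^2_*(\Omega,\varphi)}+\|Tu\|^2_{L^2_*(\Omega,\varphi)}+\|T^*u\|^2_{L^2_*(\Omega,\varphi)}\right)$$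 for all smooth forms $u$ with compact support in $\Omega$. Let $P=T^*T+TT^*$ on $\{u\in\operatorname{Dom}T\cap\operatorname{Dom}T^*: Tu\in\operatorname{Dom}T^*,\ T^*u\in\operatorname{Dom}T\}$. Let $V_1,V_2,V_3\subset L^2_*(X,\varphi)$ be closed subspaces such that $T(\operatorname{Dom}T\cap V_1)\subset V_2$, $T(\operatorname{Dom}T\cap V_2)\subset V_3$, the operators $T|_{V_1}:V_1\to V_2$ and $T|_{V_2}:V_2\to V_3$ are densely defined with closed range, and their Hilbert space adjoints are $(T|_{V_1})^*=T^*|_{V_2}:V_2\to V_1$ and $(T|_{V_2})^*=T^*|_{V_3}:V_3\to V_2$. Assume that $V_2$ is closed under multiplication with smooth compactly supported functions. Then $P$ maps $\operatorname{Dom}P\cap V_2$ into $V_2$, and $Q=P|_{V_2}:V_2\to V_2$ is self-adjoint with closed range. There is a unique bounded operator $Q^{-1}:V_2\to V_2$ (the Green operator) that vanishes on $\ker Q$ and inverts $Q:\operatorname{Dom}Q\cap\mathcal R(Q)\to\mathcal R(Q)$ on $\mathcal R(Q)$. Let $D=\{u\in V_2:u\in\operatorname{Dom}T\cap\operatorname{Dom}T^*\cap\mathcal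 R(Q)\}$ with the norm $\|u\|_D^2=\|Tu\|^2+\|T^*u\|^2$. The following conditions are equivalent: (i) The Green operator $Q^{-1}:V_2\to V_2$ is compact. (ii) The injection of $D$ into $L^2_*(X,\varphi)$ is compact. (iii) For all $\epsilon>0$ there is $\Omega\subset\subset X$ such that $\|u\|_{L^2_*(X\setminus\Omega,\varphi)}<\epsilon$ for all $u\in D$ with $\|u\|_D<1$. (iv) There is a smooth function $\psi:X\to\mathbb R$, $\psi>0$, with $\psi(z)\to\infty$ as $z\to bX$, such that $$(Qu,u)\ge\int_X\psi|u|^2e^{-\varphi}\,dV_X\quad\text{for all }u\in\operatorname{Dom}Q\cap\mathcal R(Q).$$ Here $bX$ is the boundary of $X$ in $Z$, to which the point at infinity of $Z$ is added if $X$ is not relatively compact in $Z$; so $\psi(z)\to\infty$ as $z\to bX$ means that the sets $\{\psi\le c\}$ are relatively compact in $X$. -/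

import Mathlib

open scoped Manifold ContDiff Topology InnerProductSpace
open MeasureTheory Bundle Set Filter

set_option linter.unusedSectionVars false

namespace GreenOp

noncomputable section

/-! ### Complex manifolds with a Hermitian metric -/

/-- The model space `ℂⁿ`, with its Euclidean norm. -/
abbrev Cn (n : ℕ) : Type := EuclideanSpace ℂ (Fin n)

/-- A complex manifold is in particular a smooth real manifold. -/
instance isManifoldReal (n : ℕ) (X : Type*) [TopologicalSpace X] [ChartedSpace (Cn n) X]
    [IsManifold 𝓘(ℂ, Cn n) ω X] : IsManifold 𝓘(ℝ, Cn n) ∞ X := by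
  apply isManifold_of_contDiffOn
  intro e e' he he'
  have h := HasGroupoid.compatible (G := contDiffGroupoid ω 𝓘(ℂ, Cn n)) he he'
  rw [contDiffGroupoid, mem_groupoid_of_pregroupoid] at h
  exact (ContDiffOn.restrict_scalars ℝ h.1).of_le le_top

theorem finrank_Cn (n : ℕ) : Module.finrank ℝ (Cn n) = 2 * n := by
  rw [← Module.finrank_mul_finrank ℝ ℂ (Cn n)]; simp

/-- An orthonormal real basis of `ℂⁿ = ℝ²ⁿ`. -/
def stdBasis (n : ℕ) : OrthonormalBasis (Fin (2 * n)) ℝ (Cn n) :=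
  (stdOrthonormalBasis ℝ (Cn n)).reindex (finCongr (finrank_Cn n))

section
variable {n : ℕ} {X : Type*} [TopologicalSpace X] [ChartedSpace (Cn n) X]
  [IsManifold 𝓘(ℂ, Cn n) ω X]

/-- The tangent vector at `z` whose coordinates in the chart at `p` are `v`
(meaningful for `z` in the domain of that chart). -/
def chartVec (p z : X) : Cn n →L[ℝ] TangentSpace 𝓘(ℝ, Cn n) z :=
  (trivializationAt (Cn n) (TangentSpace 𝓘(ℝ, Cn n)) p).symmL ℝ z

/-- The coordinates in the chart at `p` of a tangent vector at `z`
(meaningful for `z` in the domain of that chart). -/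
def chartCoord (p z : X) : TangentSpace 𝓘(ℝ, Cn n) z →L[ℝ] Cn n :=
  (trivializationAt (Cn n) (TangentSpace 𝓘(ℝ, Cn n)) p).continuousLinearMapAt ℝ z

/-- Multiplication by `i` on the tangent space at `x`. -/
def complexStructure (x : X) (v : TangentSpace 𝓘(ℝ, Cn n) x) : TangentSpace 𝓘(ℝ, Cn n) x :=
  chartVec x x (Complex.I • chartCoord x x v)

variable [RiemannianBundle (fun x : X => TangentSpace 𝓘(ℝ, Cn n) x)]
  [IsContMDiffRiemannianBundle 𝓘(ℝ, Cn n) ∞ (Cn n) (fun x : X => TangentSpace 𝓘(ℝ, Cn n) x)]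


instance (x : X) : FiniteDimensional ℝ (TangentSpace 𝓘(ℝ, Cn n) x) :=
  inferInstanceAs (FiniteDimensional ℝ (Cn n))
theorem finrank_tangent (x : X) :
    Module.finrank ℝ (TangentSpace 𝓘(ℝ, Cn n) x) = Fintype.card (Fin (2 * n)) := by
  rw [Fintype.card_fin]
  exact finrank_Cn n

variable (n X) in
/-- The Riemannian metric is Hermitian: multiplication by `i` is an isometry of each tangent
space. -/
def IsHermitianMetric : Prop :=
  ∀ (x : X) (v w : TangentSpace 𝓘(ℝ, Cn n) x),
    inner ℝ (complexStructure x v) (complexStructure x w) = inner ℝ v w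

/-- The Gram matrix at `z` of the metric in the coordinates of the chart at `p`. -/
def gramMatrix (p z : X) : Matrix (Fin (2 * n)) (Fin (2 * n)) ℝ :=
  Matrix.of fun i j => inner ℝ (chartVec p z (stdBasis n i)) (chartVec p z (stdBasis n j))

variable (n X) in
/-- A Borel measurable orthonormal frame of the (real) tangent bundle. Measurability is tested in
the coordinates of each chart. -/
structure BorelFrame [MeasurableSpace X] where
  basis : ∀ x : X, OrthonormalBasis (Fin (2 * n)) ℝ (TangentSpace 𝓘(ℝ, Cn n) x)
  measurable_coord : ∀ (p : X) (i : Fin (2 * n)),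
    Measurable fun z : (chartAt (Cn n) p).source => chartCoord p (z : X) (basis z i)

theorem continuousOn_chartVec (p : X) {h : X → Cn n}
    (hh : ContinuousOn h (chartAt (Cn n) p).source) :
    ContinuousOn (fun z => (⟨z, chartVec p z (h z)⟩ : TangentBundle 𝓘(ℝ, Cn n) X))
      (chartAt (Cn n) p).source := by
  have := (trivializationAt (Cn n) (TangentSpace 𝓘(ℝ, Cn n) : X → Type) p).continuousOn_symm
  refine (this.comp (continuousOn_id.prodMk hh) ?_).congr ?_
  · intro z hz
    simpa using hz
  · intro z hz
    simp only [chartVec, Function.comp, id]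
    rw [Trivialization.symmL_apply]
    simpa using hz

theorem continuousOn_inner_chartVec (p : X) {h k : X → Cn n}
    (hh : ContinuousOn h (chartAt (Cn n) p).source)
    (hk : ContinuousOn k (chartAt (Cn n) p).source) :
    ContinuousOn (fun z => inner ℝ (chartVec p z (h z)) (chartVec p z (k z)))
      (chartAt (Cn n) p).source := by
  have : IsContinuousRiemannianBundle (Cn n) (fun x : X => TangentSpace 𝓘(ℝ, Cn n) x) := by
    obtain ⟨g, h1, h2⟩ := IsContMDiffRiemannianBundle.exists_contMDiff
      (IB := 𝓘(ℝ, Cn n)) (n := ∞) (F := Cn n) (E := fun x : X => TangentSpace 𝓘(ℝ, Cn n) x)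
    exact ⟨g, h1.continuous, h2⟩
  exact (continuousOn_chartVec p hh).inner_bundle (continuousOn_chartVec p hk)

theorem linearIndependent_chartVec (p : X) {z : X} (hz : z ∈ (chartAt (Cn n) p).source) :
    LinearIndependent ℝ (fun j => chartVec p z (stdBasis n j)) := by
  have hz' : z ∈ (trivializationAt (Cn n) (TangentSpace 𝓘(ℝ, Cn n) : X → Type) p).baseSet := by
    simpa using hz
  have h1 : LinearIndependent ℝ (fun j => stdBasis n j) := (stdBasis n).orthonormal.linearIndependent
  refine h1.map' (chartVec p z).toLinearMap (LinearMap.ker_eq_bot_of_inverse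
    (g := (chartCoord p z).toLinearMap) ?_)
  ext1 v
  exact Trivialization.continuousLinearMapAt_symmL _ hz' v

open InnerProductSpace in
theorem exists_gramSchmidt (p : X) (i : Fin (2 * n)) : ∃ h : X → Cn n,
    ContinuousOn h (chartAt (Cn n) p).source ∧ ∀ z ∈ (chartAt (Cn n) p).source,
      gramSchmidt ℝ (fun j => chartVec p z (stdBasis n j)) i = chartVec p z (h z) := by
  induction i using WellFoundedLT.induction with
  | ind i ih =>
    choose! h hc he using ih
    refine ⟨fun z => stdBasis n i - ∑ j ∈ Finset.Iio i,
      (inner ℝ (chartVec p z (h j z)) (chartVec p z (stdBasis n i)) /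
        inner ℝ (chartVec p z (h j z)) (chartVec p z (h j z))) • h j z, ?_, ?_⟩
    · refine continuousOn_const.sub (continuousOn_finsetSum _ fun j hj => ?_)
      have hj' := Finset.mem_Iio.1 hj
      refine ContinuousOn.smul (ContinuousOn.div
        (continuousOn_inner_chartVec p (hc j hj') continuousOn_const)
        (continuousOn_inner_chartVec p (hc j hj') (hc j hj')) ?_) (hc j hj')
      intro z hz
      rw [← he j hj' z hz, inner_self_ne_zero]
      exact gramSchmidt_ne_zero _ (linearIndependent_chartVec p hz)
    · intro z hz
      rw [eq_sub_of_add_eq (gramSchmidt_def'' ℝ _ i).symm, map_sub, map_sum]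
      congr 1
      refine Finset.sum_congr rfl fun j hj => ?_
      rw [he j (Finset.mem_Iio.1 hj) z hz, map_smul, real_inner_self_eq_norm_sq]
      rfl

variable (n) in
/-- The frame obtained at `z` from the coordinate frame of the chart at `p` by the Gram-Schmidt
process. -/
def gsBasis (p z : X) : OrthonormalBasis (Fin (2 * n)) ℝ (TangentSpace 𝓘(ℝ, Cn n) z) :=
  InnerProductSpace.gramSchmidtOrthonormalBasis (finrank_tangent (n := n) z)
    (fun j => chartVec p z (stdBasis n j))

open InnerProductSpace in
theorem exists_gramSchmidtNormed (p : X) (i : Fin (2 * n)) : ∃ h : X → Cn n,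
    ContinuousOn h (chartAt (Cn n) p).source ∧ ∀ z ∈ (chartAt (Cn n) p).source,
      gsBasis n p z i = chartVec p z (h z) := by
  obtain ⟨h, hc, he⟩ := exists_gramSchmidt (n := n) p i
  have hs : ContinuousOn
      (fun z => Real.sqrt (inner ℝ (chartVec p z (h z)) (chartVec p z (h z))))
      (chartAt (Cn n) p).source :=
    Real.continuous_sqrt.comp_continuousOn (continuousOn_inner_chartVec p hc hc)
  refine ⟨fun z => (Real.sqrt (inner ℝ (chartVec p z (h z)) (chartVec p z (h z))))⁻¹ • h z,
    (hs.inv₀ ?_).smul hc, ?_⟩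
  · intro z hz
    rw [← he z hz, real_inner_self_eq_norm_sq, Real.sqrt_sq (norm_nonneg _), norm_ne_zero_iff]
    exact gramSchmidt_ne_zero _ (linearIndependent_chartVec p hz)
  · intro z hz
    have h1 : ‖gramSchmidtNormed ℝ (fun j => chartVec p z (stdBasis n j)) i‖ = 1 :=
      gramSchmidtNormed_unit_length i (linearIndependent_chartVec p hz)
    have h2 : gramSchmidtNormed ℝ (fun j => chartVec p z (stdBasis n j)) i ≠ 0 := fun h0 => by
      rw [h0, norm_zero] at h1
      exact zero_ne_one h1
    have h3 : gsBasis n p z i = gramSchmidtNormed ℝ (fun j => chartVec p z (stdBasis n j)) i :=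
      gramSchmidtOrthonormalBasis_apply _ h2
    rw [h3, gramSchmidtNormed, he z hz, map_smul,
      real_inner_self_eq_norm_sq, Real.sqrt_sq (norm_nonneg _)]
    rfl

variable [MeasurableSpace X] [BorelSpace X]

open InnerProductSpace in
open scoped Classical in
theorem nonempty_borelFrame [SecondCountableTopology X] : Nonempty (BorelFrame n X) := by
  rcases isEmpty_or_nonempty X with hX | hX
  · exact ⟨⟨fun x => isEmptyElim x, fun p => isEmptyElim p⟩⟩
  obtain ⟨s, hs, hsU⟩ := TopologicalSpace.countable_cover_nhds
    (fun x : X => (chartAt (Cn n) x).open_source.mem_nhds (mem_chart_source (Cn n) x))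
  have hne : s.Nonempty := by
    by_contra h
    rw [not_nonempty_iff_eq_empty] at h
    obtain ⟨x⟩ := hX
    simpa [h] using hsU.ge (mem_univ x)
  obtain ⟨f, rfl⟩ := hs.exists_eq_range hne
  have hcov : ∀ x : X, ∃ k : ℕ, x ∈ (chartAt (Cn n) (f k)).source := fun x => by
    simpa using hsU.ge (mem_univ x)
  choose h hc he using fun p : X => exists_gramSchmidtNormed (n := n) p
  refine ⟨⟨fun x => gsBasis n (f (Nat.find (hcov x))) x, fun p i => ?_⟩⟩
  let g : ℕ → (chartAt (Cn n) p).source → Cn n := fun k =>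
    {z : (chartAt (Cn n) p).source | (z : X) ∈ (chartAt (Cn n) (f k)).source}.piecewise
      (fun z => chartCoord p (z : X) (chartVec (f k) (z : X) (h (f k) i z))) (fun _ => 0)
  have hset : ∀ k, MeasurableSet
      {z : (chartAt (Cn n) p).source | (z : X) ∈ (chartAt (Cn n) (f k)).source} := fun k =>
    ((chartAt (Cn n) (f k)).open_source.preimage continuous_subtype_val).measurableSet
  have hg : ∀ k, Measurable (g k) := fun k => by
    refine ContinuousOn.measurable_piecewise ?_ continuousOn_const (hset k)
    have h1 := continuousOn_coordChange ℝ
      (trivializationAt (Cn n) (TangentSpace 𝓘(ℝ, Cn n) : X → Type) (f k))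
      (trivializationAt (Cn n) (TangentSpace 𝓘(ℝ, Cn n) : X → Type) p)
    simp only [TangentBundle.trivializationAt_baseSet] at h1
    have h2 := h1.clm_apply ((hc (f k) i).mono inter_subset_left)
    refine (h2.comp continuous_subtype_val.continuousOn fun z hz => ⟨hz, z.2⟩).congr ?_
    intro z hz
    have hz' : (z : X) ∈ (chartAt (Cn n) (f k)).source := hz
    have hz2 : (z : X) ∈ (chartAt (Cn n) p).source := z.2
    simp only [chartCoord, chartVec, Function.comp]
    have hb : (z : X) ∈
        (trivializationAt (Cn n) (TangentSpace 𝓘(ℝ, Cn n) : X → Type) (f k)).baseSet := hz'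
    have hb2 : (z : X) ∈
        (trivializationAt (Cn n) (TangentSpace 𝓘(ℝ, Cn n) : X → Type) p).baseSet := hz2
    refine Eq.trans ?_ (Trivialization.coordChangeL_apply _ _ ⟨hb, hb2⟩ _).symm
    rw [Trivialization.symmL_apply _ hb]
    exact Trivialization.continuousLinearMapAt_apply_of_mem _ _ hb2 _
  convert Measurable.find hg hset fun z => hcov z using 1
  ext1 z
  have hz := Nat.find_spec (hcov z)
  rw [he _ _ _ hz]
  have hgz : ∀ k, (z : X) ∈ (chartAt (Cn n) (f k)).source →
      g k z = chartCoord p (z : X) (chartVec (f k) (z : X) (h (f k) i z)) :=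
    fun k hk => if_pos hk
  exact (hgz _ hz).symm

variable (n X) in
/-- A fixed Borel orthonormal frame `e₁, …, e₂ₙ` of the tangent bundle of `X`. -/
def borelFrame [SecondCountableTopology X] : BorelFrame n X :=
  Classical.choice nonempty_borelFrame

/-! ### Volume measure and square integrable forms -/

/-- The Riemannian volume `√(det g) dx` of the domain of the chart at `p`, as a measure on `X`
(zero outside that domain). -/
def chartVolume (p : X) : Measure X :=
  ((volume.restrict (chartAt (Cn n) p).target).withDensity fun y =>
    ENNReal.ofReal (Real.sqrt (gramMatrix (n := n) p ((chartAt (Cn n) p).symm y)).det)).map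
      (chartAt (Cn n) p).symm

variable (n X) in
/-- The Riemannian volume measure `dV_X`: the least measure that dominates the volume of each
chart domain. As these local volumes agree on overlaps, it restricts to each of them. -/
def volumeMeasure : Measure X := ⨆ p : X, chartVolume (n := n) p

variable (n) in
/-- The measure `e^{-φ} dV_X`. -/
def weightedVolume (φ : X → ℝ) : Measure X :=
  (volumeMeasure n X).withDensity fun x => ENNReal.ofReal (Real.exp (-φ x))

variable (n) in
/-- The Hilbert space `L²_*(X, φ)` of square integrable complex valued forms of all degrees.
A form `u` is given by its coefficients `u_s = u(e_{s₁}, …, e_{s_k})`, `s = {s₁ < … < s_k}`, in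
the orthonormal frame `borelFrame n X`; its pointwise norm is `|u|² = ∑ₛ |u_s|²`, because the
products of the dual frame are an orthonormal basis of the exterior algebra. -/
abbrev L2Forms (φ : X → ℝ) : Type _ :=
  Lp (EuclideanSpace ℂ (Finset (Fin (2 * n)))) 2 (weightedVolume n φ)

/-- The norm of `u` in `L²_*(S, φ)`, for `S ⊆ X`. -/
def normOn {φ : X → ℝ} (S : Set X) (u : L2Forms n φ) : ℝ :=
  Real.sqrt (∫ x in S, ‖u x‖ ^ 2 ∂weightedVolume n φ)

/-! ### Smooth forms and differential operators -/

variable (n X) in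
/-- Complex valued differential forms of all degrees (no regularity): the component of degree `k`
at `x` is an alternating `k`-form on the real tangent space at `x`. -/
abbrev DiffForm : Type _ := ∀ (x : X) (k : ℕ), TangentSpace 𝓘(ℝ, Cn n) x [⋀^Fin k]→ₗ[ℝ] ℂ

/-- The coefficient `η(e_{s₁}, …, e_{s_k})`, `s = {s₁ < … < s_k}`, of the form `η` at `x`. -/
def coeffAt (η : DiffForm n X) (x : X) (e : Fin (2 * n) → TangentSpace 𝓘(ℝ, Cn n) x)
    (s : Finset (Fin (2 * n))) : ℂ :=
  η x s.card fun i => e (s.orderEmbOfFin rfl i)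

/-- The coefficients of `η` in the coordinates of the chart at `p`, as functions of the
coordinates. -/
def chartCoeff (η : DiffForm n X) (p : X) (s : Finset (Fin (2 * n))) (y : Cn n) : ℂ :=
  coeffAt η ((chartAt (Cn n) p).symm y)
    (fun i => chartVec p ((chartAt (Cn n) p).symm y) (stdBasis n i)) s

/-- The partial derivatives of the coefficients of `η` in the chart at `p`. -/
def chartDeriv (η : DiffForm n X) (p : X) (i : Fin (2 * n)) (s : Finset (Fin (2 * n)))
    (y : Cn n) : ℂ :=
  fderiv ℝ (chartCoeff η p s) y (stdBasis n i)

/-- `η` is a smooth form. -/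
def IsSmoothForm (η : DiffForm n X) : Prop :=
  ∀ (p : X) (s : Finset (Fin (2 * n))),
    ContDiffOn ℝ ∞ (chartCoeff η p s) (chartAt (Cn n) p).target

/-- `η` is a smooth form with compact support in `Ω`. -/
def IsTestForm (Ω : Set X) (η : DiffForm n X) : Prop :=
  IsSmoothForm η ∧ ∃ K : Set X, IsCompact K ∧ K ⊆ Ω ∧ ∀ x ∉ K, η x = 0

/-- `u` is the class of the form `η` in `L²_*(X, φ)`. -/
def IsClassOf [SecondCountableTopology X] {φ : X → ℝ} (u : L2Forms n φ) (η : DiffForm n X) :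
    Prop :=
  ⇑u =ᵐ[weightedVolume n φ] fun x =>
    WithLp.toLp 2 fun s => coeffAt η x (fun i => (borelFrame n X).basis x i) s

/-- `A` is a linear differential operator of order at most one with smooth coefficients on the
smooth forms on `X`. -/
def IsFirstOrderDiffOp (A : DiffForm n X → DiffForm n X) : Prop :=
  ∀ p : X, ∃ (a : Fin (2 * n) → Finset (Fin (2 * n)) → Finset (Fin (2 * n)) → Cn n → ℂ)
    (b : Finset (Fin (2 * n)) → Finset (Fin (2 * n)) → Cn n → ℂ),
    (∀ i s t, ContDiffOn ℝ ∞ (a i s t) (chartAt (Cn n) p).target) ∧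
    (∀ s t, ContDiffOn ℝ ∞ (b s t) (chartAt (Cn n) p).target) ∧
    ∀ η : DiffForm n X, IsSmoothForm η → ∀ s, ∀ y ∈ (chartAt (Cn n) p).target,
      chartCoeff (A η) p s y =
        ∑ t, (b s t y * chartCoeff η p t y + ∑ i, a i s t y * chartDeriv η p i t y)

/-- `T` is a densely defined closed operator on `L²_*(X, φ)` that acts on the smooth forms with
compact support as a linear differential operator of first order with smooth coefficients; these
forms lie in the domains of `T` and of its adjoint. -/
structure IsClosedDiffOperator [SecondCountableTopology X] {φ : X → ℝ}
    (T : L2Forms n φ →ₗ.[ℂ] L2Forms n φ) : Prop where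
  dense : Dense (T.domain : Set (L2Forms n φ))
  closed : T.IsClosed
  acts : ∃ A : DiffForm n X → DiffForm n X, IsFirstOrderDiffOp A ∧
    ∀ η, IsTestForm univ η → ∀ u : L2Forms n φ, IsClassOf u η →
      ∃ f, (u, f) ∈ T.graph ∧ IsClassOf f (A η)
  mem_adjoint : ∀ η, IsTestForm univ η → ∀ u : L2Forms n φ, IsClassOf u η →
    u ∈ (LinearPMap.adjoint T).domain

/-- The square of the Sobolev norm `W^{1,2}_*(Ω, φ)` of a smooth form, computed with finitely many
charts at the points `p a` on the compact sets `K a`. -/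
def sobolevSq (φ : X → ℝ) {m : ℕ} (p : Fin m → X) (K : Fin m → Set X) (Ω : Set X)
    (η : DiffForm n X) : ℝ :=
  ∑ a, ∫ x in K a ∩ Ω, ∑ s, (‖chartCoeff η (p a) s (chartAt (Cn n) (p a) x)‖ ^ 2 +
    ∑ i, ‖chartDeriv η (p a) i s (chartAt (Cn n) (p a) x)‖ ^ 2) ∂weightedVolume n φ

/-- The Gårding inequality
`‖u‖²_{W^{1,2}(Ω, φ)} ≤ C_Ω (‖u‖²_{L²(Ω, φ)} + ‖T u‖²_{L²(Ω, φ)} + ‖T* u‖²_{L²(Ω, φ)})`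
for smooth forms `u` with compact support in `Ω`, for each relatively compact open `Ω`. The
Sobolev norm on `Ω` is defined by a cover of the closure of `Ω` by finitely many compact sets in
chart domains; different covers give equivalent norms. -/
def GardingInequality [SecondCountableTopology X] {φ : X → ℝ}
    (T : L2Forms n φ →ₗ.[ℂ] L2Forms n φ) : Prop :=
  ∀ Ω : Set X, IsOpen Ω → IsCompact (closure Ω) →
    ∀ (m : ℕ) (p : Fin m → X) (K : Fin m → Set X),
      (∀ a, IsCompact (K a) ∧ K a ⊆ (chartAt (Cn n) (p a)).source) → closure Ω ⊆ ⋃ a, K a →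
      ∃ C > 0, ∀ η, IsTestForm Ω η → ∀ u f g : L2Forms n φ, IsClassOf u η →
        (u, f) ∈ T.graph → (u, g) ∈ (LinearPMap.adjoint T).graph →
        sobolevSq φ p K Ω η ≤ C * (normOn Ω u ^ 2 + normOn Ω f ^ 2 + normOn Ω g ^ 2)

variable (n) in
/-- A set of square integrable forms is stable under multiplication with smooth functions with
compact support. -/
def StableUnderCutoff {φ : X → ℝ} (V : Set (L2Forms n φ)) : Prop :=
  ∀ χ : X → ℝ, ContMDiff 𝓘(ℝ, Cn n) 𝓘(ℝ, ℝ) ∞ χ → HasCompactSupport χ →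
    ∀ u ∈ V, ∀ w : L2Forms n φ, (⇑w =ᵐ[weightedVolume n φ] fun x => χ x • u x) → w ∈ V

end

/-! ### Unbounded operators -/

section Operators

variable {H : Type*} [NormedAddCommGroup H] [InnerProductSpace ℂ H]

/-- The composition `A B` of two unbounded operators, on `{u ∈ Dom B | B u ∈ Dom A}`. -/
def pcomp (A B : H →ₗ.[ℂ] H) : H →ₗ.[ℂ] H :=
  A.comp (B.domRestrict ((A.domain.comap B.toFun).map B.domain.subtype)) (by
    rintro ⟨x, hx, hxB⟩
    obtain ⟨y, hy, rfl⟩ := hx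
    exact hy)

/-- The part of the unbounded operator `A` between the subspaces `V` and `W`: it sends `u ∈ V` to
`A u`, on the domain `{u ∈ V | u ∈ Dom A, A u ∈ W}`. -/
def part (A : H →ₗ.[ℂ] H) (V W : Submodule ℂ H) : V →ₗ.[ℂ] W :=
  (A.graph.comap (V.subtype.prodMap W.subtype)).toLinearPMap

theorem mem_graph_part (A : H →ₗ.[ℂ] H) (V W : Submodule ℂ H) (v : V) (w : W) :
    (v, w) ∈ (part A V W).graph ↔ ((v : H), (w : H)) ∈ A.graph := by
  rw [part, Submodule.toLinearPMap_graph_eq]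
  · rfl
  · rintro ⟨x, y⟩ hxy h0
    have h1 : ((x : H), (y : H)) ∈ A.graph := hxy
    have h2 : (x : H) = 0 := by simpa using congrArg Subtype.val h0
    exact Subtype.ext (A.graph_fst_eq_zero_snd h1 h2)

theorem mem_graph_pcomp (A B : H →ₗ.[ℂ] H) (u w : H) :
    (u, w) ∈ (pcomp A B).graph ↔ ∃ v, (u, v) ∈ B.graph ∧ (v, w) ∈ A.graph := by
  simp only [LinearPMap.mem_graph_iff]
  constructor
  · rintro ⟨⟨x, hx, hxB⟩, rfl, rfl⟩
    exact ⟨_, ⟨⟨x, hxB⟩, rfl, rfl⟩, ⟨_, rfl, rfl⟩⟩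
  · rintro ⟨_, ⟨y, rfl, rfl⟩, z, hz, rfl⟩
    have hy : (y : H) ∈ (A.domain.comap B.toFun).map B.domain.subtype :=
      ⟨y, show B y ∈ A.domain from hz ▸ z.2, rfl⟩
    refine ⟨⟨y, hy, y.2⟩, rfl, ?_⟩
    exact congrArg A (Subtype.ext hz.symm)

variable [CompleteSpace H]

/-- The operator `P = T* T + T T*`, on
`{u ∈ Dom T ∩ Dom T* | T u ∈ Dom T*, T* u ∈ Dom T}`. -/
def laplacian (T : H →ₗ.[ℂ] H) : H →ₗ.[ℂ] H :=
  pcomp (LinearPMap.adjoint T) T + pcomp T (LinearPMap.adjoint T)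

/-- The operator `Q = P|_V : V → V`. -/
def boxOp (T : H →ₗ.[ℂ] H) (V : Submodule ℂ H) : V →ₗ.[ℂ] V :=
  part (laplacian T) V V

/-- `T` maps `V` to `W`, the operator `T|_V : V → W` is densely defined with closed range, and its
adjoint is `T*|_W : W → V`. -/
structure IsClosedRangePair (T : H →ₗ.[ℂ] H) (V W : Submodule ℂ H) [CompleteSpace V] : Prop where
  mapsTo : ∀ u f, (u, f) ∈ T.graph → u ∈ V → f ∈ W
  closed_range : IsClosed (range (part T V W))
  dense : Dense ((part T V W).domain : Set V)
  adjoint_mapsTo : ∀ u f, (u, f) ∈ (LinearPMap.adjoint T).graph → u ∈ W → f ∈ V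
  adjoint_eq : LinearPMap.adjoint (part T V W) = part (LinearPMap.adjoint T) W V

/-- `N` is the Green operator of `Q`: it inverts `Q : Dom Q ∩ R(Q) → R(Q)` and vanishes on
`ker Q`. -/
def IsGreenOperator {V : Submodule ℂ H} (Q : V →ₗ.[ℂ] V) (N : V →L[ℂ] V) : Prop :=
  (∀ f ∈ range Q, N f ∈ range Q ∧ (N f, f) ∈ Q.graph) ∧ ∀ u, (u, 0) ∈ Q.graph → N u = 0

/-- The space `D = {u ∈ V | u ∈ Dom T ∩ Dom T* ∩ R(Q)}`. -/
def energySubmodule (T : H →ₗ.[ℂ] H) (V : Submodule ℂ H) : Submodule ℂ H :=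
  T.domain ⊓ (LinearPMap.adjoint T).domain ⊓
    (LinearMap.range (boxOp T V).toFun).map V.subtype

/-- The space `D`, to be equipped with the norm `‖u‖_D² = ‖T u‖² + ‖T* u‖²`. -/
def EnergySpace (T : H →ₗ.[ℂ] H) (V : Submodule ℂ H) : Type _ := energySubmodule T V

instance (T : H →ₗ.[ℂ] H) (V : Submodule ℂ H) : AddCommGroup (EnergySpace T V) :=
  inferInstanceAs (AddCommGroup (energySubmodule T V))

instance (T : H →ₗ.[ℂ] H) (V : Submodule ℂ H) : Module ℂ (EnergySpace T V) :=
  inferInstanceAs (Module ℂ (energySubmodule T V))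

/-- The injection of `D` into the ambient Hilbert space. -/
def EnergySpace.incl (T : H →ₗ.[ℂ] H) (V : Submodule ℂ H) : EnergySpace T V →ₗ[ℂ] H :=
  (energySubmodule T V).subtype

/-- The map `u ↦ (T u, T* u)` on `D`. -/
def EnergySpace.toPair (T : H →ₗ.[ℂ] H) (V : Submodule ℂ H) :
    EnergySpace T V →ₗ[ℂ] WithLp 2 (H × H) :=
  (WithLp.linearEquiv 2 ℂ (H × H)).symm.toLinearMap ∘ₗ
    ((T.toFun ∘ₗ Submodule.inclusion (inf_le_left.trans inf_le_left)).prod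
      ((LinearPMap.adjoint T).toFun ∘ₗ Submodule.inclusion (inf_le_left.trans inf_le_right)) :
      energySubmodule T V →ₗ[ℂ] H × H)

/-- The norm `‖u‖_D² = ‖T u‖² + ‖T* u‖²` on `D`. -/
instance (T : H →ₗ.[ℂ] H) (V : Submodule ℂ H) : SeminormedAddCommGroup (EnergySpace T V) :=
  SeminormedAddCommGroup.induced _ _ (EnergySpace.toPair T V)

theorem EnergySpace.norm_sq (T : H →ₗ.[ℂ] H) (V : Submodule ℂ H) (u : EnergySpace T V) (f g : H)
    (hf : (EnergySpace.incl T V u, f) ∈ T.graph)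
    (hg : (EnergySpace.incl T V u, g) ∈ (LinearPMap.adjoint T).graph) :
    ‖u‖ ^ 2 = ‖f‖ ^ 2 + ‖g‖ ^ 2 := by
  obtain ⟨x, hx, rfl⟩ := (LinearPMap.mem_graph_iff _).1 hf
  obtain ⟨y, hy, rfl⟩ := (LinearPMap.mem_graph_iff _).1 hg
  have h1 : ‖u‖ = ‖EnergySpace.toPair T V u‖ := rfl
  rw [h1, WithLp.prod_norm_sq_eq_of_L2]
  have h2 : (EnergySpace.toPair T V u).fst = T x := congrArg T (Subtype.ext hx.symm)
  have h3 : (EnergySpace.toPair T V u).snd = LinearPMap.adjoint T y :=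
    congrArg (LinearPMap.adjoint T) (Subtype.ext hy.symm)
  rw [h2, h3]

end Operators

/-! ### Approaching the boundary -/

/-- For an open embedding `ι : X → Z`, the filter on `X` of the points `z` that approach the boundary
`bX` of `X` in `Z`; if `X` is not relatively compact in `Z`, the ideal boundary at infinity of `Z`
belongs to `bX`. -/
def approachBoundary {X Z : Type*} [TopologicalSpace Z] (ι : X → Z) : Filter X :=
  comap ι (𝓝ˢ (frontier (range ι)) ⊔ cocompact Z)

theorem approachBoundary_eq_cocompact {X Z : Type*} [TopologicalSpace X] [TopologicalSpace Z]
    [T2Space Z] {ι : X → Z} (hι : Topology.IsOpenEmbedding ι) :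
    approachBoundary ι = cocompact X := by
  ext S
  simp only [approachBoundary, mem_comap, mem_sup, mem_cocompact]
  constructor
  · rintro ⟨W, ⟨hW, K, hK, hKW⟩, hWS⟩
    obtain ⟨U, hU, hFU, hUW⟩ := mem_nhdsSet_iff_exists.1 hW
    have hC : IsCompact ((K ∩ closure (range ι)) \ U) :=
      (hK.inter_right isClosed_closure).diff hU
    refine ⟨ι ⁻¹' ((K ∩ closure (range ι)) \ U), hι.isInducing.isCompact_preimage' hC ?_, ?_⟩
    · rintro z ⟨⟨-, hz⟩, hzU⟩
      by_contra h
      exact hzU (hFU ⟨hz, fun h' => h (interior_subset h')⟩)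
    · intro x hx
      refine hWS ?_
      by_contra h
      refine hx ⟨⟨?_, subset_closure (mem_range_self x)⟩, fun h' => h (hUW h')⟩
      by_contra hk
      exact h (hKW hk)
  · rintro ⟨C, hC, hCS⟩
    have hC' := hC.image hι.continuous
    refine ⟨(ι '' C)ᶜ, ⟨hC'.isClosed.isOpen_compl.mem_nhdsSet.2 ?_, ι '' C, hC', subset_rfl⟩, ?_⟩
    · rintro z hz ⟨x, -, rfl⟩
      rw [hι.isOpen_range.frontier_eq] at hz
      exact hz.2 (mem_range_self x)
    · intro x hx
      exact hCS fun h => hx (mem_image_of_mem ι h)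

end

end GreenOp

open GreenOp

/-!
The operator `Q` is the Laplacian of the Hilbert complex `T : V₁ → V₂ → V₃` of closed operators with
closed range. Hence its range is the orthogonal complement of its kernel, which consists of the
harmonic elements, and `Q` is self-adjoint and has a Green operator `N`
(`IsHilbertLaplacian.opRange_eq`, `isHilbertLaplacian_boxOp`). The form of `Q` is the square of the
norm of the energy space `D`. From `‖v‖³ ≤ ‖N v‖ ‖v‖_D²` on `D`, and since `N` maps bounded sets
to bounded sets of `D`, it follows that `N` is compact if and only if `D` is compactly embedded
(`isCompactOperator_green_iff`).

The remaining conditions are about the tails `‖u‖_{L²(X ∖ Ω)}`, `u ∈ D`.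
* If the unit ball of `D` is totally bounded, a finite net has uniformly small tails
  (`exists_tail_lt_of_totallyBounded`).
* If the tails are uniformly small, the unit ball of `D` is totally bounded by interior
  compactness (`totallyBounded_of_tail`).
* If the squares of the tails off `Ω_j` are at most `2^{-j-1} ‖u‖_D²`, the weight `ψ` is a multiple of
  `1 + ∑ θ_j`, where `θ_j` is smooth, vanishes on `Ω_j`, and is `1` off a compact set
  (`exists_weight_of_tail`).
* Conversely, a weight gives small tails first for elements of the domain of `Q`. By duality this
  carries over to all of `D`, without the density of this domain in `D`
  (`exists_tail_lt_of_weight`).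

Interior compactness (`exists_local_compactness`) is the only place where ellipticity is used: near
each point, the norm of `u` is bounded by finitely many continuous functionals of `u` and a small
multiple of `‖u‖ + ‖T u‖ + ‖T* u‖`. It needs some care, because `φ` is merely continuous: the formal
adjoint of `T` contains derivatives of `φ`, so that neither density of smooth forms in the graph
norm of `T` and `T*` nor interior `W^{1,2}` regularity are at hand. The argument runs as follows, in
charts.
* As smooth forms lie in the domain of `T*`, the derivatives of `e^{-φ}` that occur in the adjoint
  are square integrable (`exists_weak_weight`). With the commutator estimate of Friedrichs, applied
  to `e^{-φ}` instead of `u` (`norm_gradient_mollify_le`), the Euclidean weak equation `T u = f`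
  holds for smooth test functions (`integral_inner_chartRep`). The weak equation `T* u = g` for such
  test functions is immediate.
* The Gårding inequality for oscillating forms `e^{2πi⟨y, ξ⟩} χ c` of high frequency shows that the
  principal symbols of `T` and `T*` are jointly injective (`exists_norm_le_symbolAt`).
* The coefficients are frozen at a point. For a cutoff `v` of `u`, the symbol estimate and
  Plancherel's theorem bound the Fourier transform of `v` for frequencies of size at least `R` by
  `R⁻¹ (‖u‖ + ‖T u‖ + ‖T* u‖)` and a small multiple of `‖v‖` (`integral_norm_sq_le_of_symbol`).
  This uses no derivatives of `u`. On the remaining frequencies the Fourier transform of `v` is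
  Lipschitz continuous, and finitely many of its values suffice (`exists_low_frequency`).
-/

namespace GreenOp

noncomputable section

/-! ### Closed operators with closed range -/

section ClosedOperators

variable {E F : Type*} [NormedAddCommGroup E] [InnerProductSpace ℂ E]
  [NormedAddCommGroup F] [InnerProductSpace ℂ F]

theorem exists_mem_graph_of_mem_range {A : E →ₗ.[ℂ] F} {y : F} (hy : y ∈ range A) :
    ∃ x, (x, y) ∈ A.graph := by
  obtain ⟨x, rfl⟩ := hy
  exact ⟨x, A.mem_graph x⟩

theorem mem_range_of_mem_graph {A : E →ₗ.[ℂ] F} {x : E} {y : F} (h : (x, y) ∈ A.graph) :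
    y ∈ range A := by
  obtain ⟨x', -, rfl⟩ := (LinearPMap.mem_graph_iff _).1 h
  exact ⟨x', rfl⟩

/-- The kernel of an unbounded operator, as a subspace of the ambient space. -/
def opKer (A : E →ₗ.[ℂ] F) : Submodule ℂ E := A.graph.comap (LinearMap.inl ℂ E F)

/-- The range of an unbounded operator. -/
def opRange (A : E →ₗ.[ℂ] F) : Submodule ℂ F := A.graph.map (LinearMap.snd ℂ E F)

theorem mem_opKer {A : E →ₗ.[ℂ] F} {x : E} : x ∈ opKer A ↔ (x, 0) ∈ A.graph := Iff.rfl

theorem mem_opRange {A : E →ₗ.[ℂ] F} {y : F} : y ∈ opRange A ↔ ∃ x, (x, y) ∈ A.graph := by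
  simp [opRange, Submodule.mem_map]

theorem coe_opRange (A : E →ₗ.[ℂ] F) : (opRange A : Set F) = range A := by
  ext y
  exact mem_opRange.trans ⟨fun ⟨_, h⟩ => mem_range_of_mem_graph h, exists_mem_graph_of_mem_range⟩

theorem isClosed_opKer {A : E →ₗ.[ℂ] F} (hA : A.IsClosed) : IsClosed (opKer A : Set E) := by
  have : IsClosed (A.graph : Set (E × F)) := hA
  exact this.preimage (by fun_prop : Continuous fun x : E => (x, (0 : F)))

variable [CompleteSpace E]

theorem inner_adjoint_graph {A : E →ₗ.[ℂ] F} (hd : Dense (A.domain : Set E)) {x : E} {y : F}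
    {v : F} {w : E} (h : (x, y) ∈ A.graph) (h' : (v, w) ∈ A.adjoint.graph) :
    inner ℂ w x = inner ℂ v y := by
  obtain ⟨x', rfl, rfl⟩ := (LinearPMap.mem_graph_iff _).1 h
  obtain ⟨v', rfl, rfl⟩ := (LinearPMap.mem_graph_iff _).1 h'
  exact LinearPMap.adjoint_isFormalAdjoint hd v' x'

theorem mem_adjoint_graph {A : E →ₗ.[ℂ] F} (hd : Dense (A.domain : Set E)) {v : F} {w : E}
    (h : ∀ x y, (x, y) ∈ A.graph → inner ℂ w x = inner ℂ v y) : (v, w) ∈ A.adjoint.graph := by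
  have h1 : ∀ x : A.domain, inner ℂ w (x : E) = inner ℂ v (A x) := fun x => h _ _ (A.mem_graph x)
  have hv : v ∈ A.adjoint.domain := LinearPMap.mem_adjoint_domain_of_exists v ⟨w, h1⟩
  exact (LinearPMap.mem_graph_iff _).2 ⟨⟨v, hv⟩, rfl, LinearPMap.adjoint_apply_eq hd ⟨v, hv⟩ h1⟩

/-- A closed operator with closed range has a bounded inverse from its range to the orthogonal
complement of its kernel, by the closed graph theorem. -/
theorem exists_bounded_inverse [CompleteSpace F] {A : E →ₗ.[ℂ] F} (hA : A.IsClosed)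
    (hr : IsClosed (range A)) :
    ∃ B : opRange A →L[ℂ] E, ∀ y, (B y, (y : F)) ∈ A.graph ∧ B y ∈ (opKer A)ᗮ := by
  have : CompleteSpace (opKer A) := (isClosed_opKer hA).completeSpace_coe
  have : CompleteSpace (opRange A) := by
    refine IsClosed.completeSpace_coe (hs := ?_)
    rw [coe_opRange]
    exact hr
  have huniq : ∀ x y, x ∈ (opKer A)ᗮ → y ∈ (opKer A)ᗮ → ∀ z, (x, z) ∈ A.graph →
      (y, z) ∈ A.graph → x = y := by
    intro x y hx hy z hxz hyz
    have h1 : x - y ∈ opKer A := by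
      have := A.graph.sub_mem hxz hyz
      rwa [Prod.mk_sub_mk, sub_self] at this
    have h2 := Submodule.sub_mem _ hx hy
    rw [← sub_eq_zero, ← inner_self_eq_zero (𝕜 := ℂ)]
    exact h2 _ h1
  have hex : ∀ y : opRange A, ∃ x, (x, (y : F)) ∈ A.graph ∧ x ∈ (opKer A)ᗮ := by
    rintro ⟨y, hy⟩
    obtain ⟨x, hx⟩ := mem_opRange.1 hy
    refine ⟨x - (opKer A).starProjection x, ?_, Submodule.sub_starProjection_mem_orthogonal x⟩
    have := A.graph.sub_mem hx (mem_opKer.1 ((opKer A).starProjection_apply_mem x))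
    rwa [Prod.mk_sub_mk, sub_zero] at this
  choose B hB hB' using hex
  let B' : opRange A →ₗ[ℂ] E :=
    { toFun := B
      map_add' := fun y z => huniq _ _ (hB' _) (Submodule.add_mem _ (hB' _) (hB' _)) _ (hB _)
        (A.graph.add_mem (hB y) (hB z))
      map_smul' := fun c y => huniq _ _ (hB' _) (Submodule.smul_mem _ c (hB' _)) _ (hB _)
        (A.graph.smul_mem c (hB y)) }
  have hg : IsClosed (B'.graph : Set (opRange A × E)) := by
    have hAc : IsClosed (A.graph : Set (E × F)) := hA
    have h1 : IsClosed {p : opRange A × E | (p.2, (p.1 : F)) ∈ A.graph} :=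
      hAc.preimage (by fun_prop : Continuous fun p : opRange A × E => (p.2, (p.1 : F)))
    have h2 : IsClosed {p : opRange A × E | p.2 ∈ (opKer A)ᗮ} :=
      (Submodule.isClosed_orthogonal _).preimage continuous_snd
    convert h1.inter h2 using 1
    ext ⟨y, x⟩
    simp only [SetLike.mem_coe, LinearMap.mem_graph_iff, mem_inter_iff, Set.mem_ofPred_eq]
    constructor
    · rintro rfl
      exact ⟨hB y, hB' y⟩
    · rintro ⟨h1, h2⟩
      exact huniq _ _ h2 (hB' y) _ h1 (hB y)
  exact ⟨⟨B', B'.continuous_of_isClosed_graph hg⟩, fun y => ⟨hB y, hB' y⟩⟩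

/-- The orthogonal complement of the kernel of a closed operator with closed range is covered by
the adjoint, applied to the range of the operator. -/
theorem exists_adjoint_eq_of_mem_orthogonal_ker [CompleteSpace F] {A : E →ₗ.[ℂ] F}
    (hd : Dense (A.domain : Set E)) (hA : A.IsClosed) (hr : IsClosed (range A)) {f : E}
    (hf : f ∈ (opKer A)ᗮ) : ∃ a ∈ opRange A, (a, f) ∈ A.adjoint.graph := by
  have : CompleteSpace (opRange A) := by
    refine IsClosed.completeSpace_coe (hs := ?_)
    rw [coe_opRange]
    exact hr
  obtain ⟨B, hB⟩ := exists_bounded_inverse hA hr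
  refine ⟨ContinuousLinearMap.adjoint B f, Subtype.coe_prop _, mem_adjoint_graph hd ?_⟩
  intro x y hxy
  have hy : y ∈ opRange A := mem_opRange.2 ⟨x, hxy⟩
  have h1 : inner ℂ ((ContinuousLinearMap.adjoint B f : opRange A) : F) y =
      inner ℂ (ContinuousLinearMap.adjoint B f) (⟨y, hy⟩ : opRange A) := rfl
  rw [h1, ContinuousLinearMap.adjoint_inner_left]
  have h2 : x - B ⟨y, hy⟩ ∈ opKer A := by
    have := A.graph.sub_mem hxy (hB ⟨y, hy⟩).1
    rwa [Prod.mk_sub_mk, sub_self] at this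
  have h3 := (Submodule.mem_orthogonal' _ _).1 hf _ h2
  rwa [inner_sub_right, sub_eq_zero] at h3

theorem isClosed_part {H : Type*} [NormedAddCommGroup H] [InnerProductSpace ℂ H]
    {A : H →ₗ.[ℂ] H} (hA : A.IsClosed) (V W : Submodule ℂ H) : (part A V W).IsClosed := by
  have hAc : IsClosed (A.graph : Set (H × H)) := hA
  have h1 : IsClosed {p : V × W | ((p.1 : H), (p.2 : H)) ∈ A.graph} :=
    hAc.preimage (by fun_prop : Continuous fun p : V × W => ((p.1 : H), (p.2 : H)))
  refine (congrArg IsClosed (Set.ext fun p => ?_)).mp h1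
  exact (mem_graph_part A V W p.1 p.2).symm

end ClosedOperators

/-! ### The Laplacian of a Hilbert complex -/

section HilbertComplex

variable {E₁ E₂ E₃ : Type*} [NormedAddCommGroup E₁] [InnerProductSpace ℂ E₁] [CompleteSpace E₁]
  [NormedAddCommGroup E₂] [InnerProductSpace ℂ E₂] [CompleteSpace E₂]
  [NormedAddCommGroup E₃] [InnerProductSpace ℂ E₃] [CompleteSpace E₃]

/-- `Q = R* R + S S*` is the Laplacian of the Hilbert complex `S : E₁ → E₂`, `R : E₂ → E₃` of closed
densely defined operators with closed range. -/
structure IsHilbertLaplacian (S : E₁ →ₗ.[ℂ] E₂) (R : E₂ →ₗ.[ℂ] E₃) (Q : E₂ →ₗ.[ℂ] E₂) : Prop where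
  denseS : Dense (S.domain : Set E₁)
  denseR : Dense (R.domain : Set E₂)
  closedS : S.IsClosed
  closedR : R.IsClosed
  rangeS : IsClosed (range S)
  rangeR : IsClosed (range R)
  comp_eq_zero : ∀ x y, (x, y) ∈ S.graph → (y, 0) ∈ R.graph
  graph_iff : ∀ u w, (u, w) ∈ Q.graph ↔ ∃ a f b g, (u, a) ∈ R.graph ∧ (a, f) ∈ R.adjoint.graph ∧
    (u, b) ∈ S.adjoint.graph ∧ (b, g) ∈ S.graph ∧ w = f + g

namespace IsHilbertLaplacian

variable {S : E₁ →ₗ.[ℂ] E₂} {R : E₂ →ₗ.[ℂ] E₃} {Q : E₂ →ₗ.[ℂ] E₂} (h : IsHilbertLaplacian S R Q)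

include h

/-- `(Q u, v) = (R u, R v) + (S* u, S* v)`. -/
theorem inner_eq {u w v : E₂} {a a' : E₃} {b b' : E₁} (hQ : (u, w) ∈ Q.graph)
    (ha : (u, a) ∈ R.graph) (hb : (u, b) ∈ S.adjoint.graph)
    (ha' : (v, a') ∈ R.graph) (hb' : (v, b') ∈ S.adjoint.graph) :
    inner ℂ w v = inner ℂ a a' + inner ℂ b b' := by
  obtain ⟨a₁, f, b₁, g, h1, h2, h3, h4, rfl⟩ := (h.graph_iff _ _).1 hQ
  obtain rfl : a₁ = a := LinearPMap.mem_graph_snd_inj' _ h1 ha rfl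
  obtain rfl : b₁ = b := LinearPMap.mem_graph_snd_inj' _ h3 hb rfl
  rw [inner_add_left, inner_adjoint_graph h.denseR ha' h2, ← inner_conj_symm b₁,
    inner_adjoint_graph h.denseS h4 hb', inner_conj_symm]

theorem exists_of_mem_graph {u w : E₂} (hQ : (u, w) ∈ Q.graph) :
    ∃ a b, (u, a) ∈ R.graph ∧ (u, b) ∈ S.adjoint.graph := by
  obtain ⟨a₁, f, b₁, g, h1, h2, h3, h4, rfl⟩ := (h.graph_iff _ _).1 hQ
  exact ⟨_, _, h1, h3⟩

theorem inner_self_eq {u w : E₂} {a : E₃} {b : E₁} (hQ : (u, w) ∈ Q.graph)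
    (ha : (u, a) ∈ R.graph) (hb : (u, b) ∈ S.adjoint.graph) :
    inner ℂ w u = ((‖a‖ ^ 2 + ‖b‖ ^ 2 : ℝ) : ℂ) := by
  rw [h.inner_eq hQ ha hb ha hb, inner_self_eq_norm_sq_to_K, inner_self_eq_norm_sq_to_K]
  push_cast
  rfl

theorem symmetric {u w v z : E₂} (hu : (u, w) ∈ Q.graph) (hv : (v, z) ∈ Q.graph) :
    inner ℂ w v = inner ℂ u z := by
  obtain ⟨a, b, ha, hb⟩ := h.exists_of_mem_graph hu
  obtain ⟨a', b', ha', hb'⟩ := h.exists_of_mem_graph hv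
  rw [h.inner_eq hu ha hb ha' hb', ← inner_conj_symm u, h.inner_eq hv ha' hb' ha hb, map_add,
    inner_conj_symm, inner_conj_symm]

theorem mem_opKer_iff {u : E₂} :
    u ∈ opKer Q ↔ (u, 0) ∈ R.graph ∧ (u, 0) ∈ S.adjoint.graph := by
  constructor
  · intro hu
    rw [mem_opKer] at hu
    obtain ⟨a, b, ha, hb⟩ := h.exists_of_mem_graph hu
    have h1 := h.inner_self_eq hu ha hb
    rw [inner_zero_left, eq_comm, Complex.ofReal_eq_zero] at h1
    have h2 : a = 0 := by
      rw [← norm_eq_zero, ← sq_eq_zero_iff]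
      nlinarith [sq_nonneg ‖a‖, sq_nonneg ‖b‖]
    have h3 : b = 0 := by
      rw [← norm_eq_zero, ← sq_eq_zero_iff]
      nlinarith [sq_nonneg ‖a‖, sq_nonneg ‖b‖]
    exact ⟨h2 ▸ ha, h3 ▸ hb⟩
  · rintro ⟨h1, h2⟩
    exact (h.graph_iff _ _).2 ⟨0, 0, 0, 0, h1, Submodule.zero_mem _, h2, Submodule.zero_mem _,
      (add_zero _).symm⟩

theorem opRange_le : opRange Q ≤ (opKer Q)ᗮ := by
  intro w hw
  obtain ⟨u, hu⟩ := mem_opRange.1 hw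
  rw [Submodule.mem_orthogonal']
  intro v hv
  rw [h.symmetric hu (mem_opKer.1 hv), inner_zero_right]

/-- The range of the Laplacian is the orthogonal complement of the harmonic space. A form `f`
orthogonal to the harmonic space splits into `f₁` in the range of `S` and `f₂` orthogonal to the
kernel of `R`; the equations `S S* y = f₁` and `R* R u = f₂` are solved separately. -/
theorem opRange_eq : opRange Q = (opKer Q)ᗮ := by
  refine le_antisymm h.opRange_le fun f hf => ?_
  have : CompleteSpace (opRange S) := by
    refine IsClosed.completeSpace_coe (hs := ?_)
    rw [coe_opRange]
    exact h.rangeS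
  have : CompleteSpace (opKer S) := (isClosed_opKer h.closedS).completeSpace_coe
  set f₁ := (opRange S).starProjection f with hf₁
  have hadj : ∀ z ∈ (opRange S)ᗮ, (z, 0) ∈ S.adjoint.graph := by
    intro z hz
    refine mem_adjoint_graph h.denseS fun x y hxy => ?_
    rw [inner_zero_left, (Submodule.mem_orthogonal' _ _).1 hz y (mem_opRange.2 ⟨x, hxy⟩)]
  have hf₁m : f₁ ∈ opRange S := (opRange S).starProjection_apply_mem f
  have hf₂m : f - f₁ ∈ (opRange S)ᗮ := Submodule.sub_starProjection_mem_orthogonal f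
  have hSR : ∀ y ∈ opRange S, (y, 0) ∈ R.graph := fun y hy => by
    obtain ⟨x, hx⟩ := mem_opRange.1 hy
    exact h.comp_eq_zero x y hx
  have hker : ∀ z ∈ opRange S, z ∈ (opKer Q)ᗮ := by
    intro z hz
    obtain ⟨x, hx⟩ := mem_opRange.1 hz
    rw [Submodule.mem_orthogonal]
    intro v hv
    rw [← inner_adjoint_graph h.denseS hx (h.mem_opKer_iff.1 hv).2, inner_zero_left]
  -- the part of `f` orthogonal to the range of `S` is orthogonal to the kernel of `R`
  have hf₂ : f - f₁ ∈ (opKer R)ᗮ := by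
    rw [Submodule.mem_orthogonal']
    intro v hv
    set v₁ := (opRange S).starProjection v
    have hv₁ : v₁ ∈ opRange S := (opRange S).starProjection_apply_mem v
    have hv₂ : v - v₁ ∈ (opRange S)ᗮ := Submodule.sub_starProjection_mem_orthogonal v
    have hv₂' : v - v₁ ∈ opKer Q := by
      refine h.mem_opKer_iff.2 ⟨?_, hadj _ hv₂⟩
      have := R.graph.sub_mem (mem_opKer.1 hv) (hSR _ hv₁)
      rwa [Prod.mk_sub_mk, sub_self] at this
    have h1 : inner ℂ (f - f₁) (v - v₁) = 0 :=
      (Submodule.mem_orthogonal' _ _).1 (Submodule.sub_mem _ hf (hker _ hf₁m)) _ hv₂'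
    have h2 : inner ℂ (f - f₁) v₁ = 0 := (Submodule.mem_orthogonal' _ _).1 hf₂m _ hv₁
    rw [inner_sub_right, h2, sub_zero] at h1
    exact h1
  obtain ⟨a, ha, haf⟩ := exists_adjoint_eq_of_mem_orthogonal_ker h.denseR h.closedR h.rangeR hf₂
  obtain ⟨B, hB⟩ := exists_bounded_inverse h.closedR h.rangeR
  obtain ⟨B', hB'⟩ := exists_bounded_inverse h.closedS h.rangeS
  set u := B ⟨a, ha⟩
  have hu : (u, 0) ∈ S.adjoint.graph := by
    refine mem_adjoint_graph h.denseS fun x y hxy => ?_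
    rw [inner_zero_left, eq_comm]
    exact (Submodule.mem_orthogonal' _ _).1 (hB ⟨a, ha⟩).2 _ (h.comp_eq_zero x y hxy)
  obtain ⟨y, hy, hyx⟩ :=
    exists_adjoint_eq_of_mem_orthogonal_ker h.denseS h.closedS h.rangeS (hB' ⟨f₁, hf₁m⟩).2
  refine mem_opRange.2 ⟨u + y, (h.graph_iff _ _).2 ⟨a, f - f₁, B' ⟨f₁, hf₁m⟩, f₁, ?_, haf, ?_,
    (hB' ⟨f₁, hf₁m⟩).1, (sub_add_cancel _ _).symm⟩⟩
  · have := R.graph.add_mem (hB ⟨a, ha⟩).1 (hSR y hy)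
    rwa [Prod.mk_add_mk, add_zero] at this
  · have := S.adjoint.graph.add_mem hu hyx
    rwa [Prod.mk_add_mk, zero_add] at this

theorem isClosed_range : IsClosed (range Q) := by
  rw [← coe_opRange, h.opRange_eq]
  exact Submodule.isClosed_orthogonal _

/-- As an operator that is not yet known to be closed, `Q` has a closed kernel because the kernel
consists of the harmonic elements. -/
theorem isClosed_opKer' : IsClosed (opKer Q : Set E₂) := by
  have h1 := isClosed_opKer h.closedR
  have h2 := isClosed_opKer (LinearPMap.adjoint_isClosed h.denseS)
  refine (congrArg IsClosed (Set.ext fun u => ?_)).mp (h1.inter h2)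
  exact h.mem_opKer_iff.symm

/-- An element orthogonal to the domain is orthogonal to the kernel, hence of the form `Q u`, and
`(Q u, u) = 0` makes `u` harmonic. -/
theorem dense_domain : Dense (Q.domain : Set E₂) := by
  have : CompleteSpace (opKer Q) := h.isClosed_opKer'.completeSpace_coe
  rw [Submodule.dense_iff_topologicalClosure_eq_top,
    Submodule.topologicalClosure_eq_top_iff, Submodule.eq_bot_iff]
  intro x hx
  have hdom : ∀ u w, (u, w) ∈ Q.graph → inner ℂ u x = 0 := fun u w huw =>
    hx u (LinearPMap.mem_domain_of_mem_graph huw)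
  have hx1 : x ∈ opRange Q := by
    rw [h.opRange_eq, Submodule.mem_orthogonal]
    exact fun u hu => hdom u 0 hu
  obtain ⟨u, hu⟩ := mem_opRange.1 hx1
  obtain ⟨a, b, ha, hb⟩ := h.exists_of_mem_graph hu
  have h1 := h.inner_self_eq hu ha hb
  rw [← inner_conj_symm, hdom u x hu, map_zero, eq_comm, Complex.ofReal_eq_zero] at h1
  have h2 : u ∈ opKer Q := by
    refine h.mem_opKer_iff.2 ⟨?_, ?_⟩
    · have h2 : a = 0 := by
        rw [← norm_eq_zero, ← sq_eq_zero_iff]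
        nlinarith [sq_nonneg ‖a‖, sq_nonneg ‖b‖]
      exact h2 ▸ ha
    · have h3 : b = 0 := by
        rw [← norm_eq_zero, ← sq_eq_zero_iff]
        nlinarith [sq_nonneg ‖a‖, sq_nonneg ‖b‖]
      exact h3 ▸ hb
  exact LinearPMap.mem_graph_snd_inj' _ hu h2 rfl

/-- If `(v, w)` is in the graph of the adjoint, then `w` is orthogonal to the kernel, hence
`w = Q y`, and `v - y` is orthogonal to the range, hence harmonic. -/
theorem isSelfAdjoint : IsSelfAdjoint Q := by
  have : CompleteSpace (opKer Q) := h.isClosed_opKer'.completeSpace_coe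
  have hd := h.dense_domain
  rw [LinearPMap.isSelfAdjoint_def]
  refine LinearPMap.eq_of_eq_graph (le_antisymm ?_ ?_)
  · rintro ⟨v, w⟩ hvw
    have hw : w ∈ opRange Q := by
      rw [h.opRange_eq, Submodule.mem_orthogonal']
      intro u hu
      rw [inner_adjoint_graph hd (mem_opKer.1 hu) hvw, inner_zero_right]
    obtain ⟨y, hy⟩ := mem_opRange.1 hw
    have hvy : v - y ∈ opKer Q := by
      rw [← Submodule.orthogonal_orthogonal (opKer Q), ← h.opRange_eq, Submodule.mem_orthogonal']
      intro z hz
      obtain ⟨u, hu⟩ := mem_opRange.1 hz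
      rw [inner_sub_left, ← inner_adjoint_graph hd hu hvw, h.symmetric hy hu, sub_self]
    have := Q.graph.add_mem (mem_opKer.1 hvy) hy
    rwa [Prod.mk_add_mk, sub_add_cancel, zero_add] at this
  · rintro ⟨u, w⟩ huw
    exact mem_adjoint_graph hd fun x y hxy => h.symmetric huw hxy

/-- The Green operator is the bounded inverse of `Q` on its range, composed with the orthogonal
projection to the range. -/
theorem existsUnique_green : ∃! N : E₂ →L[ℂ] E₂,
    (∀ f ∈ range Q, N f ∈ range Q ∧ (N f, f) ∈ Q.graph) ∧ ∀ u, (u, 0) ∈ Q.graph → N u = 0 := by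
  have : CompleteSpace (opKer Q) := h.isClosed_opKer'.completeSpace_coe
  have : CompleteSpace (opRange Q) := by
    refine IsClosed.completeSpace_coe (hs := ?_)
    rw [coe_opRange]
    exact h.isClosed_range
  have hQc : Q.IsClosed := h.isSelfAdjoint.isClosed
  obtain ⟨B, hB⟩ := exists_bounded_inverse hQc h.isClosed_range
  refine ⟨B ∘L (opRange Q).orthogonalProjectionOnto, ⟨fun f hf => ?_, fun u hu => ?_⟩, ?_⟩
  · have hf' : f ∈ opRange Q := by rwa [← SetLike.mem_coe, coe_opRange]
    have h1 : (opRange Q).orthogonalProjectionOnto f = ⟨f, hf'⟩ :=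
      Submodule.orthogonalProjectionOnto_mem_subspace_eq_self ⟨f, hf'⟩
    simp only [ContinuousLinearMap.comp_apply, h1]
    refine ⟨?_, (hB _).1⟩
    have h2 := (hB ⟨f, hf'⟩).2
    rw [← h.opRange_eq, ← SetLike.mem_coe, coe_opRange] at h2
    exact h2
  · have : (opRange Q).orthogonalProjectionOnto u = 0 := by
      refine (opRange Q).orthogonalProjectionOnto_eq_zero_iff.2 ?_
      rw [h.opRange_eq]
      exact Submodule.le_orthogonal_orthogonal _ hu
    simp [this]
  · rintro N ⟨hN1, hN2⟩
    ext1 x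
    set x₁ := (opRange Q).orthogonalProjectionOnto x with hx₁
    have hx₂ : x - x₁ ∈ opKer Q := by
      rw [← Submodule.orthogonal_orthogonal (opKer Q), ← h.opRange_eq]
      exact Submodule.sub_starProjection_mem_orthogonal x
    have hr : (x₁ : E₂) ∈ range Q := by
      rw [← coe_opRange]
      exact x₁.2
    have h1 : N x = N x₁ := by
      rw [← sub_eq_zero, ← map_sub]
      exact hN2 _ hx₂
    obtain ⟨h2, h3⟩ := hN1 _ hr
    rw [h1]
    change N x₁ = B x₁
    have h4 : N x₁ - B x₁ ∈ opKer Q := by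
      have := Q.graph.sub_mem h3 (hB x₁).1
      rwa [Prod.mk_sub_mk, sub_self] at this
    have h5 : N x₁ - B x₁ ∈ (opKer Q)ᗮ := by
      refine Submodule.sub_mem _ ?_ (hB x₁).2
      rw [← h.opRange_eq, ← SetLike.mem_coe, coe_opRange]
      exact h2
    rw [← sub_eq_zero, ← inner_self_eq_zero (𝕜 := ℂ)]
    exact h5 _ h4

end IsHilbertLaplacian

end HilbertComplex

/-! ### Compactness of the Green operator and of the energy space -/

section Compactness

/-- A map `f` that is controlled on `s` by maps with totally bounded image has totally bounded
image. -/
theorem totallyBounded_image_of_control {α M : Type*} {Y : Type*} [PseudoMetricSpace M]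
    [PseudoMetricSpace Y] {s : Set α} {f : α → M}
    (h : ∀ ε > 0, ∃ (g : α → Y) (δ : ℝ), 0 < δ ∧
      TotallyBounded (g '' s) ∧ ∀ x ∈ s, ∀ y ∈ s, dist (g x) (g y) < δ → dist (f x) (f y) < ε) :
    TotallyBounded (f '' s) := by
  rw [Metric.totallyBounded_iff]
  intro ε hε
  obtain ⟨g, δ, hδ, hg, hgf⟩ := h ε hε
  obtain ⟨t, hts, htf, ht⟩ := Metric.finite_approx_of_totallyBounded hg δ hδ
  obtain ⟨t', ht's, ht'f, rfl⟩ := Set.Finite.exists_subset_finite_image_eq htf hts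
  refine ⟨f '' t', ht'f.image f, ?_⟩
  rintro _ ⟨x, hx, rfl⟩
  have := ht (mem_image_of_mem g hx)
  simp only [mem_iUnion, Metric.mem_ball, mem_image, exists_prop, exists_exists_and_eq_and] at this ⊢
  obtain ⟨y, hy, hxy⟩ := this
  exact ⟨y, hy, hgf x hx y (ht's hy) hxy⟩

theorem isCompactOperator_iff_totallyBounded {M₁ M₂ : Type*} [SeminormedAddCommGroup M₁]
    [NormedAddCommGroup M₂] [NormedSpace ℂ M₂] [CompleteSpace M₂] [NormedSpace ℂ M₁]
    (f : M₁ →ₗ[ℂ] M₂) :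
    IsCompactOperator f ↔ TotallyBounded (f '' Metric.ball 0 1) := by
  rw [isCompactOperator_iff_isCompact_closure_image_ball f one_pos]
  exact ⟨fun h => h.totallyBounded.subset subset_closure,
    fun h => h.closure.isCompact_of_isClosed isClosed_closure⟩

end Compactness

section Energy

variable {H : Type*} [NormedAddCommGroup H] [InnerProductSpace ℂ H] [CompleteSpace H]

theorem mem_graph_add (A B : H →ₗ.[ℂ] H) (u w : H) :
    (u, w) ∈ (A + B).graph ↔ ∃ f g, (u, f) ∈ A.graph ∧ (u, g) ∈ B.graph ∧ w = f + g := by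
  simp only [LinearPMap.mem_graph_iff]
  constructor
  · rintro ⟨x, rfl, rfl⟩
    exact ⟨_, _, ⟨⟨x, x.2.1⟩, rfl, rfl⟩, ⟨⟨x, x.2.2⟩, rfl, rfl⟩, LinearPMap.add_apply A B x⟩
  · rintro ⟨_, _, ⟨x, rfl, rfl⟩, ⟨y, hy, rfl⟩, rfl⟩
    refine ⟨⟨x, x.2, hy ▸ y.2⟩, rfl, ?_⟩
    obtain ⟨y, hy'⟩ := y
    obtain rfl : y = x := hy
    exact LinearPMap.add_apply A B _

theorem mem_graph_laplacian (T : H →ₗ.[ℂ] H) (u w : H) :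
    (u, w) ∈ (laplacian T).graph ↔ ∃ a f b g, (u, a) ∈ T.graph ∧ (a, f) ∈ T.adjoint.graph ∧
      (u, b) ∈ T.adjoint.graph ∧ (b, g) ∈ T.graph ∧ w = f + g := by
  simp only [laplacian, mem_graph_add, mem_graph_pcomp]
  constructor
  · rintro ⟨f, g, ⟨a, h1, h2⟩, ⟨b, h3, h4⟩, h5⟩
    exact ⟨a, f, b, g, h1, h2, h3, h4, h5⟩
  · rintro ⟨a, f, b, g, h1, h2, h3, h4, h5⟩
    exact ⟨f, g, ⟨a, h1, h2⟩, ⟨b, h3, h4⟩, h5⟩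

variable {T : H →ₗ.[ℂ] H} {V₁ V₂ V₃ : Submodule ℂ H} [CompleteSpace V₁] [CompleteSpace V₂]
  [CompleteSpace V₃]

theorem mem_of_mem_graph_laplacian (h₁₂ : IsClosedRangePair T V₁ V₂)
    (h₂₃ : IsClosedRangePair T V₂ V₃) {u w : H} (h : (u, w) ∈ (laplacian T).graph) (hu : u ∈ V₂) :
    w ∈ V₂ := by
  obtain ⟨a, f, b, g, h1, h2, h3, h4, rfl⟩ := (mem_graph_laplacian T u w).1 h
  exact V₂.add_mem (h₂₃.adjoint_mapsTo _ _ h2 (h₂₃.mapsTo _ _ h1 hu))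
    (h₁₂.mapsTo _ _ h4 (h₁₂.adjoint_mapsTo _ _ h3 hu))

theorem isHilbertLaplacian_boxOp (hT : T.IsClosed)
    (hTT : ∀ u f, (u, f) ∈ T.graph → (f, 0) ∈ T.graph)
    (h₁₂ : IsClosedRangePair T V₁ V₂) (h₂₃ : IsClosedRangePair T V₂ V₃) :
    IsHilbertLaplacian (part T V₁ V₂) (part T V₂ V₃) (boxOp T V₂) where
  denseS := h₁₂.dense
  denseR := h₂₃.dense
  closedS := isClosed_part hT _ _
  closedR := isClosed_part hT _ _
  rangeS := h₁₂.closed_range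
  rangeR := h₂₃.closed_range
  comp_eq_zero x y hxy := by
    rw [mem_graph_part] at hxy ⊢
    exact hTT _ _ hxy
  graph_iff u w := by
    rw [boxOp, mem_graph_part, mem_graph_laplacian, h₁₂.adjoint_eq, h₂₃.adjoint_eq]
    simp only [mem_graph_part]
    constructor
    · rintro ⟨a, f, b, g, h1, h2, h3, h4, h5⟩
      have ha := h₂₃.mapsTo _ _ h1 u.2
      have hf := h₂₃.adjoint_mapsTo _ _ h2 ha
      have hb := h₁₂.adjoint_mapsTo _ _ h3 u.2
      have hg := h₁₂.mapsTo _ _ h4 hb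
      exact ⟨⟨a, ha⟩, ⟨f, hf⟩, ⟨b, hb⟩, ⟨g, hg⟩, h1, h2, h3, h4, Subtype.ext h5⟩
    · rintro ⟨a, f, b, g, h1, h2, h3, h4, h5⟩
      exact ⟨a, f, b, g, h1, h2, h3, h4, congrArg Subtype.val h5⟩

/-- An element of the energy space as an element `v` of `V₂`, with `T v` and `T* v` in `V₃` and `V₁`. -/
theorem EnergySpace.exists_rep (h₁₂ : IsClosedRangePair T V₁ V₂)
    (h₂₃ : IsClosedRangePair T V₂ V₃) (u : EnergySpace T V₂) :
    ∃ v : V₂, (v : H) = EnergySpace.incl T V₂ u ∧ v ∈ range (boxOp T V₂) ∧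
      ∃ a b, (v, a) ∈ (part T V₂ V₃).graph ∧ (v, b) ∈ (part T V₁ V₂).adjoint.graph ∧
        ‖u‖ ^ 2 = ‖a‖ ^ 2 + ‖b‖ ^ 2 := by
  have hu := u.2
  simp only [energySubmodule, Submodule.mem_inf] at hu
  obtain ⟨⟨h1, h2⟩, v, ⟨z, hz⟩, hv⟩ := hu
  have hv' : (v : H) = EnergySpace.incl T V₂ u := hv
  obtain ⟨a, ha⟩ := LinearPMap.mem_domain_iff.1 h1
  obtain ⟨b, hb⟩ := LinearPMap.mem_domain_iff.1 h2
  have ha' : ((v : H), a) ∈ T.graph := hv' ▸ ha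
  have hb' : ((v : H), b) ∈ T.adjoint.graph := hv' ▸ hb
  refine ⟨v, hv', ⟨z, hz⟩, ⟨a, h₂₃.mapsTo _ _ ha' v.2⟩, ⟨b, h₁₂.adjoint_mapsTo _ _ hb' v.2⟩,
    (mem_graph_part _ _ _ _ _).2 ha', ?_, EnergySpace.norm_sq T V₂ u a b ha hb⟩
  rw [h₁₂.adjoint_eq]
  exact (mem_graph_part _ _ _ _ _).2 hb'

theorem EnergySpace.exists_of_mem_graph (h₁₂ : IsClosedRangePair T V₁ V₂) {v : V₂}
    {a : V₃} {b : V₁} (hv : v ∈ range (boxOp T V₂)) (ha : (v, a) ∈ (part T V₂ V₃).graph)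
    (hb : (v, b) ∈ (part T V₁ V₂).adjoint.graph) :
    ∃ u : EnergySpace T V₂, EnergySpace.incl T V₂ u = v ∧ ‖u‖ ^ 2 = ‖a‖ ^ 2 + ‖b‖ ^ 2 := by
  rw [h₁₂.adjoint_eq, mem_graph_part] at hb
  rw [mem_graph_part] at ha
  have h1 : (v : H) ∈ energySubmodule T V₂ := by
    simp only [energySubmodule, Submodule.mem_inf]
    refine ⟨⟨LinearPMap.mem_domain_of_mem_graph ha, LinearPMap.mem_domain_of_mem_graph hb⟩,
      v, ?_, rfl⟩
    obtain ⟨z, hz⟩ := hv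
    exact ⟨z, hz⟩
  exact ⟨(⟨v, h1⟩ : energySubmodule T V₂), rfl, EnergySpace.norm_sq T V₂ _ _ _ ha hb⟩

/-- The Cauchy-Schwarz inequality for the form of `Q`: with `f = Q w`, the functional `v ↦ (f, v)` on
the energy space is bounded by the energy `(f, w)` of `w`. -/
theorem EnergySpace.norm_inner_sq_le (hT : T.IsClosed)
    (hTT : ∀ u f, (u, f) ∈ T.graph → (f, 0) ∈ T.graph)
    (h₁₂ : IsClosedRangePair T V₁ V₂) (h₂₃ : IsClosedRangePair T V₂ V₃) {w f v : V₂}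
    (hwf : (w, f) ∈ (boxOp T V₂).graph) {u : EnergySpace T V₂}
    (huv : EnergySpace.incl T V₂ u = v) :
    0 ≤ (inner ℂ f w).re ∧ ‖(inner ℂ f v : ℂ)‖ ^ 2 ≤ (inner ℂ f w).re * ‖u‖ ^ 2 := by
  have hQ := isHilbertLaplacian_boxOp hT hTT h₁₂ h₂₃
  obtain ⟨v', hv', -, a', b', ha', hb', hu⟩ := EnergySpace.exists_rep h₁₂ h₂₃ u
  obtain rfl : v' = v := Subtype.ext (hv'.trans huv)
  obtain ⟨a, b, ha, hb⟩ := hQ.exists_of_mem_graph hwf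
  rw [hQ.inner_eq hwf ha hb ha' hb', hQ.inner_self_eq hwf ha hb, Complex.ofReal_re, hu]
  refine ⟨by positivity, ?_⟩
  have h1 : ‖inner ℂ a a' + inner ℂ b b'‖ ≤ ‖a‖ * ‖a'‖ + ‖b‖ * ‖b'‖ :=
    (norm_add_le _ _).trans (add_le_add (norm_inner_le_norm _ _) (norm_inner_le_norm _ _))
  calc ‖inner ℂ a a' + inner ℂ b b'‖ ^ 2 ≤ (‖a‖ * ‖a'‖ + ‖b‖ * ‖b'‖) ^ 2 :=
        pow_le_pow_left₀ (norm_nonneg _) h1 2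
    _ ≤ _ := by nlinarith [sq_nonneg (‖a‖ * ‖b'‖ - ‖b‖ * ‖a'‖)]

/-- On the energy space, `‖v‖⁴ = |(Q N v, v)|² ≤ (v, N v) ‖v‖_D²`, so that `N` controls the norm of
the Hilbert space. -/
theorem EnergySpace.norm_pow_le (hT : T.IsClosed)
    (hTT : ∀ u f, (u, f) ∈ T.graph → (f, 0) ∈ T.graph)
    (h₁₂ : IsClosedRangePair T V₁ V₂) (h₂₃ : IsClosedRangePair T V₂ V₃) {N : V₂ →L[ℂ] V₂}
    (hN : IsGreenOperator (boxOp T V₂) N) (u : EnergySpace T V₂) {v : V₂}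
    (huv : EnergySpace.incl T V₂ u = v) : ‖v‖ ^ 3 ≤ ‖N v‖ * ‖u‖ ^ 2 := by
  obtain ⟨v', hv', hr, -⟩ := EnergySpace.exists_rep h₁₂ h₂₃ u
  obtain rfl : v' = v := Subtype.ext (hv'.trans huv)
  have h1 := (EnergySpace.norm_inner_sq_le hT hTT h₁₂ h₂₃ (hN.1 v' hr).2 huv).2
  have h2 : (inner ℂ v' (N v')).re ≤ ‖v'‖ * ‖N v'‖ :=
    (Complex.re_le_norm _).trans (norm_inner_le_norm _ _)
  rw [inner_self_eq_norm_sq_to_K, norm_pow, RCLike.norm_ofReal, abs_norm] at h1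
  rcases (norm_nonneg v').eq_or_lt with h0 | h0
  · rw [← h0, zero_pow three_ne_zero]
    positivity
  · have h3 : ‖v'‖ * ‖v'‖ ^ 3 ≤ ‖v'‖ * (‖N v'‖ * ‖u‖ ^ 2) := by
      calc ‖v'‖ * ‖v'‖ ^ 3 = (‖v'‖ ^ 2) ^ 2 := by ring
        _ ≤ _ := h1
        _ ≤ (‖v'‖ * ‖N v'‖) * ‖u‖ ^ 2 := by gcongr
        _ = _ := by ring
    exact le_of_mul_le_mul_left h3 h0

/-- The injection of the energy space into the Hilbert space is bounded. -/
theorem EnergySpace.exists_norm_le (hT : T.IsClosed)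
    (hTT : ∀ u f, (u, f) ∈ T.graph → (f, 0) ∈ T.graph)
    (h₁₂ : IsClosedRangePair T V₁ V₂) (h₂₃ : IsClosedRangePair T V₂ V₃) :
    ∃ C > 0, ∀ u : EnergySpace T V₂, ‖EnergySpace.incl T V₂ u‖ ^ 2 ≤ C * ‖u‖ ^ 2 := by
  obtain ⟨N, hN, -⟩ := (isHilbertLaplacian_boxOp hT hTT h₁₂ h₂₃).existsUnique_green
  refine ⟨‖N‖ + 1, by positivity, fun u => ?_⟩
  obtain ⟨v, hv, -⟩ := EnergySpace.exists_rep h₁₂ h₂₃ u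
  rw [← hv, ← Submodule.coe_norm]
  have h1 := EnergySpace.norm_pow_le hT hTT h₁₂ h₂₃ hN u hv.symm
  rcases (norm_nonneg v).eq_or_lt with h0 | h0
  · rw [← h0, zero_pow two_ne_zero]
    positivity
  · have h3 : ‖v‖ * ‖v‖ ^ 2 ≤ ‖v‖ * ((‖N‖ + 1) * ‖u‖ ^ 2) := by
      calc ‖v‖ * ‖v‖ ^ 2 = ‖v‖ ^ 3 := by ring
        _ ≤ _ := h1
        _ ≤ (‖N‖ * ‖v‖) * ‖u‖ ^ 2 := by gcongr; exact N.le_opNorm v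
        _ ≤ ((‖N‖ + 1) * ‖v‖) * ‖u‖ ^ 2 := by gcongr; linarith
        _ = _ := by ring
    exact le_of_mul_le_mul_left h3 h0

noncomputable instance (T : H →ₗ.[ℂ] H) (V : Submodule ℂ H) : NormedSpace ℂ (EnergySpace T V) :=
  NormedSpace.induced ℂ _ _ (EnergySpace.toPair T V)

/-- The Green operator `N` is compact if and only if the energy space is compactly embedded. One
direction holds because `N` factors through the energy space; the other one because `N` controls
the norm of the Hilbert space on bounded sets of the energy space. -/
theorem isCompactOperator_green_iff (hT : T.IsClosed)
    (hTT : ∀ u f, (u, f) ∈ T.graph → (f, 0) ∈ T.graph)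
    (h₁₂ : IsClosedRangePair T V₁ V₂) (h₂₃ : IsClosedRangePair T V₂ V₃) {N : V₂ →L[ℂ] V₂}
    (hN : IsGreenOperator (boxOp T V₂) N) :
    IsCompactOperator N ↔ TotallyBounded (EnergySpace.incl T V₂ '' Metric.ball 0 1) := by
  have hQ := isHilbertLaplacian_boxOp hT hTT h₁₂ h₂₃
  rw [show IsCompactOperator N ↔ _ from isCompactOperator_iff_totallyBounded N.toLinearMap]
  constructor
  · intro hNc
    choose v hv hr hex using fun u : EnergySpace T V₂ => EnergySpace.exists_rep h₁₂ h₂₃ u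
    obtain ⟨C, hC, hCb⟩ := EnergySpace.exists_norm_le hT hTT h₁₂ h₂₃
    -- the ball of the energy space is mapped into a ball of `V₂`
    have hNb : TotallyBounded (N.toLinearMap '' Metric.ball 0 (C + 1)) := by
      rw [← isCompactOperator_iff_totallyBounded] at hNc
      exact (hNc.isCompact_closure_image_ball (C + 1)).totallyBounded.subset subset_closure
    refine totallyBounded_image_of_control (Y := V₂) fun ε hε =>
      ⟨fun u => N (v u), ε ^ 3 / 4, by positivity, hNb.subset ?_, ?_⟩
    · rintro _ ⟨u, hu, rfl⟩
      refine ⟨v u, ?_, rfl⟩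
      rw [mem_ball_zero_iff] at hu ⊢
      rw [Submodule.coe_norm, hv]
      have h1 : ‖u‖ ^ 2 ≤ 1 := pow_le_one₀ (norm_nonneg _) hu.le
      have h2 := hCb u
      nlinarith [norm_nonneg (EnergySpace.incl T V₂ u)]
    · intro x hx y hy hxy
      rw [dist_eq_norm] at hxy ⊢
      rw [← map_sub] at hxy ⊢
      have hvv : EnergySpace.incl T V₂ (x - y) = ((v x - v y : V₂) : H) := by
        rw [map_sub, Submodule.coe_sub, hv, hv]
      have h1 := EnergySpace.norm_pow_le hT hTT h₁₂ h₂₃ hN (x - y) hvv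
      rw [hvv, ← Submodule.coe_norm]
      rw [mem_ball_zero_iff] at hx hy
      have h2 : ‖x - y‖ ≤ 2 := (norm_sub_le x y).trans (by linarith)
      have h3 : ‖x - y‖ ^ 2 ≤ 2 ^ 2 := pow_le_pow_left₀ (norm_nonneg _) h2 2
      refine lt_of_pow_lt_pow_left₀ 3 hε.le ?_
      calc _ ≤ _ := h1
        _ ≤ ‖N (v x - v y)‖ * 2 ^ 2 := by gcongr
        _ < ε ^ 3 := by linarith
  · intro hD
    have hproj : ∀ x : V₂, ∃ y ∈ range (boxOp T V₂), N x = N y ∧ ‖y‖ ≤ ‖x‖ := by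
      intro x
      have : CompleteSpace (opRange (boxOp T V₂)) := by
        refine IsClosed.completeSpace_coe (hs := ?_)
        rw [coe_opRange]
        exact hQ.isClosed_range
      have : CompleteSpace (opKer (boxOp T V₂)) := hQ.isClosed_opKer'.completeSpace_coe
      refine ⟨(opRange (boxOp T V₂)).starProjection x, ?_, ?_,
        Submodule.norm_starProjection_apply_le _ x⟩
      · rw [← coe_opRange]
        exact Submodule.starProjection_apply_mem _ x
      · rw [← sub_eq_zero, ← map_sub]
        refine hN.2 _ (mem_opKer.1 ?_)
        rw [← Submodule.orthogonal_orthogonal (opKer (boxOp T V₂)), ← hQ.opRange_eq]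
        exact Submodule.sub_starProjection_mem_orthogonal x
    choose p hp hNp hpn using hproj
    have hex : ∀ x : V₂, ∃ u : EnergySpace T V₂, EnergySpace.incl T V₂ u = N x ∧
        ‖u‖ ^ 2 ≤ ‖N‖ * ‖x‖ ^ 2 := by
      intro x
      obtain ⟨h1, h2⟩ := hN.1 (p x) (hp x)
      obtain ⟨a, b, ha, hb⟩ := hQ.exists_of_mem_graph h2
      obtain ⟨u, hu, hu'⟩ := EnergySpace.exists_of_mem_graph h₁₂ h1 ha hb
      refine ⟨u, by rw [hu, ← hNp], ?_⟩
      have h3 := congrArg Complex.re (hQ.inner_self_eq h2 ha hb)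
      rw [Complex.ofReal_re] at h3
      rw [hu', ← h3]
      calc (inner ℂ (p x) (N (p x))).re ≤ ‖p x‖ * ‖N (p x)‖ :=
            (Complex.re_le_norm _).trans (norm_inner_le_norm _ _)
        _ ≤ ‖p x‖ * (‖N‖ * ‖p x‖) := by gcongr; exact N.le_opNorm _
        _ = ‖N‖ * ‖p x‖ ^ 2 := by ring
        _ ≤ _ := by gcongr; exact hpn x
    choose u hu hun using hex
    rw [← isCompactOperator_iff_totallyBounded] at hD
    have hDb : TotallyBounded (EnergySpace.incl T V₂ '' Metric.ball 0 (‖N‖ + 1)) :=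
      (hD.isCompact_closure_image_ball (‖N‖ + 1)).totallyBounded.subset subset_closure
    refine totallyBounded_image_of_control (Y := H) fun ε hε =>
      ⟨fun x => (N x : H), ε, hε, hDb.subset ?_, fun x _ y _ hxy => hxy⟩
    rintro _ ⟨x, hx, rfl⟩
    refine ⟨u x, ?_, hu x⟩
    rw [mem_ball_zero_iff] at hx ⊢
    have h1 : ‖x‖ ^ 2 ≤ 1 := pow_le_one₀ (norm_nonneg _) hx.le
    have h2 := hun x
    nlinarith [norm_nonneg (u x), norm_nonneg N]

end Energy

/-! ### Coefficients of alternating forms in different frames -/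

section Compound

/-- The entry of the compound matrix of `O` at `(s, t)`: the minor of `O` with rows `s` and columns
`t`, and zero if `s` and `t` have different cardinality. -/
def compound {N : ℕ} (O : Matrix (Fin N) (Fin N) ℝ) (s t : Finset (Fin N)) : ℝ :=
  if h : t.card = s.card then
    (Matrix.of fun i j : Fin s.card => O (s.orderEmbOfFin rfl i) (t.orderEmbOfFin h j)).det
  else 0

theorem compound_of_card {N : ℕ} (O : Matrix (Fin N) (Fin N) ℝ) {s t : Finset (Fin N)}
    {k : ℕ} (hs : s.card = k) (ht : t.card = k) :
    compound O s t =
      (Matrix.of fun i j : Fin k => O (s.orderEmbOfFin hs i) (t.orderEmbOfFin ht j)).det := by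
  subst hs
  rw [compound, dif_pos ht]

theorem compound_of_card_ne {N : ℕ} (O : Matrix (Fin N) (Fin N) ℝ) {s t : Finset (Fin N)}
    (h : t.card ≠ s.card) : compound O s t = 0 := dif_neg h

theorem sum_eq_sum_powersetCard {N : ℕ} {R : Type*} [AddCommMonoid R] (k : ℕ)
    (f : Finset (Fin N) → R) (hf : ∀ t, t.card ≠ k → f t = 0) :
    ∑ t, f t = ∑ t : Set.powersetCard (Fin N) k, f t.1 := by
  classical
  have h1 : ∑ t : {t : Finset (Fin N) // t.card = k}, f t.1 =
      ∑ t ∈ Finset.univ.filter (fun t : Finset (Fin N) => t.card = k), f t := by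
    rw [← Finset.sum_subtype_eq_sum_filter]
    exact Finset.sum_congr (by ext; simp) fun _ _ => rfl
  have h2 : ∑ t : Set.powersetCard (Fin N) k, f t.1 =
      ∑ t : {t : Finset (Fin N) // t.card = k}, f t.1 := by
    refine Fintype.sum_equiv (Equiv.subtypeEquivRight fun t => ?_) _ _ fun _ => rfl
    rfl
  rw [h2, h1, Finset.sum_filter]
  exact Finset.sum_congr rfl fun t _ => by
    split_ifs with h
    · rfl
    · exact hf t h

variable {M : Type*} [AddCommGroup M] [Module ℝ M]

/-- The value of an alternating form on vectors `v`, from its coefficients in a basis. -/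
theorem alternating_eq_sum {N k : ℕ} (b : Module.Basis (Fin N) ℝ M) (f : M [⋀^Fin k]→ₗ[ℝ] ℂ)
    (v : Fin k → M) :
    f v = ∑ t : Set.powersetCard (Fin N) k,
      ((Matrix.of fun i j => b.repr (v i) (t.1.orderEmbOfFin t.2 j)).det : ℂ) *
        f fun j => b (t.1.orderEmbOfFin t.2 j) := by
  have h1 := (b.exteriorPower k).sum_repr (exteriorPower.ιMulti ℝ k v)
  have h2 := congrArg (exteriorPower.alternatingMapLinearEquiv f) h1
  rw [exteriorPower.alternatingMapLinearEquiv_apply_ιMulti, map_sum] at h2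
  rw [← h2]
  refine Finset.sum_congr rfl fun t _ => ?_
  rw [map_smul, exteriorPower.basis_repr_apply, exteriorPower.ιMultiDual_apply_ιMulti,
    exteriorPower.basis_apply, exteriorPower.ιMulti_family,
    exteriorPower.alternatingMapLinearEquiv_apply_ιMulti, Complex.real_smul]
  rfl

/-- A change of frames acts on the coefficients of forms by compound matrices. -/
theorem coeff_eq_sum_compound {N : ℕ} (b : Module.Basis (Fin N) ℝ M)
    (η : ∀ k : ℕ, M [⋀^Fin k]→ₗ[ℝ] ℂ) (e : Fin N → M) (s : Finset (Fin N)) :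
    (η s.card fun i => e (s.orderEmbOfFin rfl i)) =
      ∑ t, (compound (Matrix.of fun i j => b.repr (e i) j) s t : ℂ) *
        η t.card fun i => b (t.orderEmbOfFin rfl i) := by
  rw [alternating_eq_sum b, sum_eq_sum_powersetCard s.card]
  · refine Finset.sum_congr rfl fun t _ => ?_
    rw [compound_of_card _ rfl t.2]
    congr 1
    obtain ⟨t, ht⟩ := t
    have : ∀ k (h : t.card = k), (η k fun i => b (t.orderEmbOfFin h i)) =
        η t.card fun i => b (t.orderEmbOfFin rfl i) := by
      rintro k rfl
      rfl
    exact this _ ht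
  · intro t ht
    rw [compound_of_card_ne _ ht, Complex.ofReal_zero, zero_mul]

/-- The form with given coefficients in a basis. -/
def formOfCoeff {N : ℕ} (b : Module.Basis (Fin N) ℝ M) (c : Finset (Fin N) → ℂ) (k : ℕ) :
    M [⋀^Fin k]→ₗ[ℝ] ℂ :=
  exteriorPower.alternatingMapLinearEquiv.symm
    ((b.exteriorPower k).constr ℝ fun t : Set.powersetCard (Fin N) k => c t.1)

theorem formOfCoeff_apply_basis {N : ℕ} (b : Module.Basis (Fin N) ℝ M) (c : Finset (Fin N) → ℂ)
    (s : Finset (Fin N)) : formOfCoeff b c s.card (fun i => b (s.orderEmbOfFin rfl i)) = c s := by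
  rw [formOfCoeff, exteriorPower.alternatingMapLinearEquiv_symm_apply]
  have : exteriorPower.ιMulti ℝ s.card (fun i => b (s.orderEmbOfFin rfl i)) =
      b.exteriorPower s.card ⟨s, rfl⟩ := by
    rw [exteriorPower.basis_apply]
    rfl
  rw [LinearMap.compAlternatingMap_apply, this, Module.Basis.constr_basis]

/-- The coefficients in a frame determine those in any other frame. -/
theorem injective_compound {N : ℕ} (b e : Module.Basis (Fin N) ℝ M) (c : Finset (Fin N) → ℂ)
    (h : ∀ s, ∑ t, (compound (Matrix.of fun i j => b.repr (e i) j) s t : ℂ) * c t = 0) : c = 0 := by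
  have h1 : ∀ s : Finset (Fin N),
      formOfCoeff b c s.card (fun i => e (s.orderEmbOfFin rfl i)) = 0 := by
    intro s
    rw [coeff_eq_sum_compound b]
    simp only [formOfCoeff_apply_basis]
    exact h s
  ext s
  rw [← formOfCoeff_apply_basis b c s, coeff_eq_sum_compound e]
  simp [h1]

end Compound

/-- The Gram matrix of the compound of an orthonormal frame, in terms of the inverse of the Gram
matrix of the basis: this is the Cauchy-Binet formula. -/
theorem sum_compound_mul_compound {N : ℕ} {M : Type*} [NormedAddCommGroup M]
    [InnerProductSpace ℝ M] [FiniteDimensional ℝ M] (b : Module.Basis (Fin N) ℝ M)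
    (e : OrthonormalBasis (Fin N) ℝ M) (t s : Finset (Fin N)) :
    ∑ r, compound (Matrix.of fun i j => b.repr (e i) j) r t *
      compound (Matrix.of fun i j => b.repr (e i) j) r s =
    compound (Matrix.of fun i j => inner ℝ (b i) (b j))⁻¹ t s := by
  set G : Matrix (Fin N) (Fin N) ℝ := Matrix.of fun i j => inner ℝ (b i) (b j) with hG
  have hGu : IsUnit G.det := by
    have h1 : G = Matrix.gram ℝ b := by ext i j; simp [hG, Matrix.gram]
    have h2 : (Matrix.gram ℝ b).PosDef := Matrix.posDef_gram_of_linearIndependent b.linearIndependent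
    rw [h1]
    exact h2.det_pos.ne'.isUnit
  -- the dual basis with respect to the inner product
  let d : Fin N → M := fun i => ∑ j, G⁻¹ i j • b j
  have hd : ∀ i (v : M), inner ℝ (d i) v = b.repr v i := by
    intro i v
    have h1 : ∀ k, inner ℝ (d i) (b k) = b.repr (b k) i := by
      intro k
      have h2 := congrFun (congrFun (Matrix.nonsing_inv_mul G hGu) i) k
      rw [Matrix.mul_apply] at h2
      simp only [d, sum_inner, real_inner_smul_left]
      rw [b.repr_self, Finsupp.single_apply]
      rw [Matrix.one_apply] at h2
      simp only [hG, Matrix.of_apply] at h2 ⊢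
      rw [h2]
      simp [eq_comm]
    have h3 : innerₗ M (d i) = b.coord i := b.ext h1
    exact congrFun (congrArg DFunLike.coe h3) v
  have hdd : ∀ i j, inner ℝ (d i) (d j) = G⁻¹ i j := by
    intro i j
    rw [hd]
    have hsymm : G⁻¹ j i = G⁻¹ i j := by
      have h1 : G.transpose = G := by ext i j; simp [hG, real_inner_comm]
      have h2 : (G⁻¹).transpose = G⁻¹ := by rw [Matrix.transpose_nonsing_inv, h1]
      exact congrFun (congrFun h2 i) j
    rw [← hsymm]
    simp [d, map_sum, Finsupp.single_apply]
  by_cases hc : s.card = t.card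
  · have h1 := (e.exteriorPower t.card).sum_inner_mul_inner
      (exteriorPower.ιMulti ℝ t.card fun i => d (t.orderEmbOfFin rfl i))
      (exteriorPower.ιMulti ℝ t.card fun i => d (s.orderEmbOfFin hc i))
    rw [exteriorPower.inner_ιMulti_ιMulti] at h1
    simp only [hdd] at h1
    rw [compound_of_card _ rfl hc, sum_eq_sum_powersetCard t.card]
    · rw [← Matrix.det_transpose]
      refine Eq.trans ?_ (h1.trans ?_)
      · refine Finset.sum_congr rfl fun r _ => ?_
        have he : e.exteriorPower t.card r = exteriorPower.ιMulti ℝ t.card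
            fun i => e (r.1.orderEmbOfFin r.2 i) := by
          rw [← OrthonormalBasis.coe_toBasis, OrthonormalBasis.toBasis_exteriorPower,
            exteriorPower.basis_apply, exteriorPower.ιMulti_family]
          congr 1
        rw [he, exteriorPower.inner_ιMulti_ιMulti, exteriorPower.inner_ιMulti_ιMulti,
          compound_of_card _ r.2 rfl, compound_of_card _ r.2 hc]
        congr 1
        · congr 1
          ext i j
          simp [hd]
        · rw [← Matrix.det_transpose]
          congr 1
          ext i j
          simp [← hd, real_inner_comm]
      · congr 1
    · intro r hr
      rw [compound_of_card_ne _ (Ne.symm hr), zero_mul]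
  · rw [compound_of_card_ne _ hc]
    refine Finset.sum_eq_zero fun r _ => ?_
    by_cases hr : t.card = r.card
    · rw [compound_of_card_ne (s := r) (t := s) _ (fun h => hc (h.trans hr.symm)), mul_zero]
    · rw [compound_of_card_ne _ hr, zero_mul]

/-! ### Charts: coordinate changes and the Gram matrix -/

section Charts

variable {n : ℕ} {X : Type*} [TopologicalSpace X] [ChartedSpace (Cn n) X]
  [IsManifold 𝓘(ℂ, Cn n) ω X]

theorem chartCoord_chartVec {p z : X} (hz : z ∈ (chartAt (Cn n) p).source) (v : Cn n) :
    chartCoord p z (chartVec p z v) = v := by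
  have hz' : z ∈ (trivializationAt (Cn n) (TangentSpace 𝓘(ℝ, Cn n) : X → Type) p).baseSet := by
    simpa using hz
  exact Trivialization.continuousLinearMapAt_symmL _ hz' v

theorem chartVec_chartCoord {p z : X} (hz : z ∈ (chartAt (Cn n) p).source)
    (v : TangentSpace 𝓘(ℝ, Cn n) z) : chartVec p z (chartCoord p z v) = v := by
  have hz' : z ∈ (trivializationAt (Cn n) (TangentSpace 𝓘(ℝ, Cn n) : X → Type) p).baseSet := by
    simpa using hz
  exact Trivialization.symmL_continuousLinearMapAt _ hz' v

theorem chartCoord_chartVec_eq {p q z : X} (hp : z ∈ (chartAt (Cn n) p).source)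
    (hq : z ∈ (chartAt (Cn n) q).source) (v : Cn n) :
    chartCoord p z (chartVec q z v) = tangentCoordChange 𝓘(ℝ, Cn n) q p z v := by
  simp only [chartCoord, chartVec]
  rw [TangentBundle.continuousLinearMapAt_trivializationAt_eq_core hp,
    TangentBundle.symmL_trivializationAt_eq_core hq]
  exact tangentCoordChange_comp (I := 𝓘(ℝ, Cn n)) (w := q) (x := z) (y := p) (z := z)
    (by simpa using ⟨hq, hp⟩)

/-- The derivative of a change of charts expresses the frame of one chart in the other one. -/
theorem hasFDerivAt_chartChange {p q : X} {y : Cn n} (hy : y ∈ (chartAt (Cn n) q).target)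
    (hp : (chartAt (Cn n) q).symm y ∈ (chartAt (Cn n) p).source) :
    HasFDerivAt (chartAt (Cn n) p ∘ (chartAt (Cn n) q).symm)
      (tangentCoordChange 𝓘(ℝ, Cn n) q p ((chartAt (Cn n) q).symm y)) y := by
  have hq := (chartAt (Cn n) q).map_target hy
  have h := hasFDerivWithinAt_tangentCoordChange (I := 𝓘(ℝ, Cn n)) (x := q) (y := p)
    (z := (chartAt (Cn n) q).symm y) (by simpa using ⟨hq, hp⟩)
  simp only [mfld_simps, hasFDerivWithinAt_univ] at h
  rw [(chartAt (Cn n) q).right_inv hy] at h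
  exact h

theorem contDiffOn_chartChange (p q : X) :
    ContDiffOn ℝ ∞ (chartAt (Cn n) p ∘ (chartAt (Cn n) q).symm)
      ((chartAt (Cn n) q).target ∩ (chartAt (Cn n) q).symm ⁻¹' (chartAt (Cn n) p).source) := by
  have h := HasGroupoid.compatible (G := contDiffGroupoid ∞ 𝓘(ℝ, Cn n))
    (chart_mem_atlas (Cn n) q) (chart_mem_atlas (Cn n) p)
  rw [contDiffGroupoid, mem_groupoid_of_pregroupoid] at h
  have h1 := h.1
  simp only [contDiffPregroupoid, mfld_simps] at h1
  exact h1

theorem isOpen_chartInter (p q : X) :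
    IsOpen ((chartAt (Cn n) q).target ∩
      (chartAt (Cn n) q).symm ⁻¹' (chartAt (Cn n) p).source) :=
  (chartAt (Cn n) q).isOpen_inter_preimage_symm (chartAt (Cn n) p).open_source

theorem contDiffOn_tangentCoordChange (p q : X) :
    ContDiffOn ℝ ∞ (fun y => tangentCoordChange 𝓘(ℝ, Cn n) q p ((chartAt (Cn n) q).symm y))
      ((chartAt (Cn n) q).target ∩ (chartAt (Cn n) q).symm ⁻¹' (chartAt (Cn n) p).source) := by
  have h1 := (contDiffOn_chartChange (n := n) p q).fderiv_of_isOpen (m := ∞) (isOpen_chartInter p q)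
    (by simp)
  refine h1.congr fun y hy => ?_
  exact (hasFDerivAt_chartChange hy.1 hy.2).fderiv.symm

variable [RiemannianBundle (fun x : X => TangentSpace 𝓘(ℝ, Cn n) x)]
  [IsContMDiffRiemannianBundle 𝓘(ℝ, Cn n) ∞ (Cn n) (fun x : X => TangentSpace 𝓘(ℝ, Cn n) x)]

/-- The coordinate frame of the chart at `p`, as a basis of the tangent space at `z`. -/
def chartBasis (p z : X) (hz : z ∈ (chartAt (Cn n) p).source) :
    Module.Basis (Fin (2 * n)) ℝ (TangentSpace 𝓘(ℝ, Cn n) z) :=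
  basisOfLinearIndependentOfCardEqFinrank' _ (linearIndependent_chartVec p hz)
    (finrank_tangent z).symm

theorem chartBasis_apply {p z : X} (hz : z ∈ (chartAt (Cn n) p).source) (i : Fin (2 * n)) :
    chartBasis p z hz i = chartVec p z (stdBasis n i) := by
  simp [chartBasis]

theorem chartBasis_repr {p z : X} (hz : z ∈ (chartAt (Cn n) p).source)
    (v : TangentSpace 𝓘(ℝ, Cn n) z) (i : Fin (2 * n)) :
    (chartBasis p z hz).repr v i = inner ℝ (stdBasis n i) (chartCoord p z v) := by
  have h : (chartBasis p z hz).coord i =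
      (innerₗ (Cn n) (stdBasis n i)) ∘ₗ (chartCoord p z).toLinearMap := by
    refine (chartBasis p z hz).ext fun j => ?_
    have h1 : chartCoord p z (chartBasis p z hz j) = stdBasis n j := by
      rw [chartBasis_apply, chartCoord_chartVec hz]
    change (chartBasis p z hz).repr _ i = inner ℝ (stdBasis n i) (chartCoord p z _)
    rw [h1, Module.Basis.repr_self, Finsupp.single_apply, OrthonormalBasis.inner_eq_ite]
    simp [eq_comm]
  exact congrFun (congrArg DFunLike.coe h) v

theorem contDiffOn_gramMatrix (p : X) (i j : Fin (2 * n)) :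
    ContDiffOn ℝ ∞ (fun y => gramMatrix (n := n) p ((chartAt (Cn n) p).symm y) i j)
      (chartAt (Cn n) p).target := by
  have hs : ∀ v : Cn n, ContMDiffOn 𝓘(ℝ, Cn n) (𝓘(ℝ, Cn n).prod 𝓘(ℝ, Cn n)) ∞
      (fun z => (⟨z, chartVec p z v⟩ : TangentBundle 𝓘(ℝ, Cn n) X)) (chartAt (Cn n) p).source := by
    intro v
    have h1 := (trivializationAt (Cn n) (TangentSpace 𝓘(ℝ, Cn n) : X → Type)
      p).contMDiffOn_symm (IB := 𝓘(ℝ, Cn n)) (n := ∞)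
    have h2 : ContMDiffOn 𝓘(ℝ, Cn n) (𝓘(ℝ, Cn n).prod 𝓘(ℝ, Cn n)) ∞
        (fun z : X => (z, v)) (chartAt (Cn n) p).source :=
      (contMDiff_id.prodMk contMDiff_const).contMDiffOn
    refine (h1.comp h2 ?_).congr ?_
    · intro z hz
      simpa using hz
    · intro z hz
      have hz' : z ∈ (trivializationAt (Cn n) (TangentSpace 𝓘(ℝ, Cn n) : X → Type) p).baseSet := by
        simpa using hz
      simp only [chartVec, Function.comp]
      rw [Trivialization.symmL_apply _ hz']
      exact Trivialization.mk_symm _ hz' v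
  have h3 := (hs (stdBasis n i)).inner_bundle (hs (stdBasis n j))
  have h4 : ContMDiffOn 𝓘(ℝ, Cn n) 𝓘(ℝ, Cn n) ∞ (chartAt (Cn n) p).symm
      (chartAt (Cn n) p).target := contMDiffOn_chart_symm
  exact (h3.comp h4 fun y hy => (chartAt (Cn n) p).map_target hy).contDiffOn

theorem gramMatrix_eq {p z : X} (hz : z ∈ (chartAt (Cn n) p).source) :
    gramMatrix (n := n) p z =
      Matrix.of fun i j => inner ℝ (chartBasis p z hz i) (chartBasis p z hz j) := by
  ext i j
  simp [gramMatrix, chartBasis_apply]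

theorem gramMatrix_det_pos {p z : X} (hz : z ∈ (chartAt (Cn n) p).source) :
    0 < (gramMatrix (n := n) p z).det := by
  have h1 : gramMatrix (n := n) p z = Matrix.gram ℝ (chartBasis p z hz) := by
    rw [gramMatrix_eq hz]
    ext i j
    simp [Matrix.gram]
  rw [h1]
  exact (Matrix.posDef_gram_of_linearIndependent (chartBasis p z hz).linearIndependent).det_pos

/-- The Riemannian density `√(det g)` in the chart at `p`. -/
def chartDensity (p : X) (y : Cn n) : ℝ :=
  Real.sqrt (gramMatrix (n := n) p ((chartAt (Cn n) p).symm y)).det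

theorem contDiffOn_gramMatrix_det (p : X) :
    ContDiffOn ℝ ∞ (fun y => (gramMatrix (n := n) p ((chartAt (Cn n) p).symm y)).det)
      (chartAt (Cn n) p).target := by
  simp only [Matrix.det_apply]
  refine ContDiffOn.sum fun σ _ => ContDiffOn.const_smul _ ?_
  exact contDiffOn_prod fun i _ => contDiffOn_gramMatrix p _ _

theorem chartDensity_pos {p : X} {y : Cn n} (hy : y ∈ (chartAt (Cn n) p).target) :
    0 < chartDensity p y :=
  Real.sqrt_pos.2 (gramMatrix_det_pos ((chartAt (Cn n) p).map_target hy))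

theorem contDiffOn_chartDensity (p : X) :
    ContDiffOn ℝ ∞ (chartDensity p) (chartAt (Cn n) p).target := fun y hy =>
  (contDiffOn_gramMatrix_det p y hy).sqrt
    (gramMatrix_det_pos ((chartAt (Cn n) p).map_target hy)).ne'

theorem contDiffOn_gramMatrix_inv (p : X) (i j : Fin (2 * n)) :
    ContDiffOn ℝ ∞ (fun y => (gramMatrix (n := n) p ((chartAt (Cn n) p).symm y))⁻¹ i j)
      (chartAt (Cn n) p).target := by
  have h1 : ContDiffOn ℝ ∞
      (fun y => (gramMatrix (n := n) p ((chartAt (Cn n) p).symm y)).adjugate i j)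
      (chartAt (Cn n) p).target := by
    simp only [Matrix.adjugate_apply, Matrix.det_apply]
    refine ContDiffOn.sum fun σ _ => ContDiffOn.const_smul _ ?_
    refine contDiffOn_prod fun k _ => ?_
    by_cases h : σ k = j
    · simp only [h, Matrix.updateRow_self]
      exact contDiffOn_const
    · simp only [Matrix.updateRow_ne h]
      exact contDiffOn_gramMatrix p _ _
  have h2 := (contDiffOn_gramMatrix_det (n := n) p).inv
    fun y hy => (gramMatrix_det_pos ((chartAt (Cn n) p).map_target hy)).ne'
  refine (h2.mul h1).congr fun y hy => ?_
  rw [Matrix.inv_def, Ring.inverse_eq_inv']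
  rfl

theorem contDiffOn_compound {O : Cn n → Matrix (Fin (2 * n)) (Fin (2 * n)) ℝ} {U : Set (Cn n)}
    (hO : ∀ i j, ContDiffOn ℝ ∞ (fun y => O y i j) U) (s t : Finset (Fin (2 * n))) :
    ContDiffOn ℝ ∞ (fun y => compound (O y) s t) U := by
  by_cases h : t.card = s.card
  · simp only [compound_of_card _ rfl h, Matrix.det_apply]
    exact ContDiffOn.sum fun σ _ => ContDiffOn.const_smul _ (contDiffOn_prod fun i _ => hO _ _)
  · simp only [compound_of_card_ne _ h]
    exact contDiffOn_const

end Charts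

/-! ### The volume measure in a chart -/

section Volume

variable {n : ℕ} {X : Type*} [TopologicalSpace X] [ChartedSpace (Cn n) X]
  [IsManifold 𝓘(ℂ, Cn n) ω X]
  [RiemannianBundle (fun x : X => TangentSpace 𝓘(ℝ, Cn n) x)]
  [IsContMDiffRiemannianBundle 𝓘(ℝ, Cn n) ∞ (Cn n) (fun x : X => TangentSpace 𝓘(ℝ, Cn n) x)]
  [MeasurableSpace X] [BorelSpace X]

theorem aemeasurable_chart_symm (p : X) :
    AEMeasurable (chartAt (Cn n) p).symm (volume.restrict (chartAt (Cn n) p).target) :=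
  (chartAt (Cn n) p).continuousOn_symm.aemeasurable (chartAt (Cn n) p).open_target.measurableSet

theorem aemeasurable_of_continuousOn_target (p : X) {f : Cn n → ℝ}
    (hf : ContinuousOn f (chartAt (Cn n) p).target) :
    AEMeasurable (fun y => ENNReal.ofReal (f y)) (volume.restrict (chartAt (Cn n) p).target) :=
  (hf.aemeasurable (chartAt (Cn n) p).open_target.measurableSet).ennreal_ofReal

theorem chartVolume_eq (p : X) : chartVolume (n := n) p =
    ((volume.restrict (chartAt (Cn n) p).target).withDensity
      fun y => ENNReal.ofReal (chartDensity p y)).map (chartAt (Cn n) p).symm := rfl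

theorem measurableSet_target_inter_preimage_symm (p : X) {s : Set X} (hs : MeasurableSet s) :
    MeasurableSet ((chartAt (Cn n) p).target ∩ (chartAt (Cn n) p).symm ⁻¹' s) := by
  have h := (chartAt (Cn n) p).continuousOn_symm
  have h1 : Measurable ((chartAt (Cn n) p).target.domRestrict (chartAt (Cn n) p).symm) :=
    (continuousOn_iff_continuous_domRestrict.1 h).measurable
  have h2 := ((chartAt (Cn n) p).open_target.measurableSet).subtype_image (h1 hs)
  convert h2 using 1
  ext y
  simp only [mem_inter_iff, mem_preimage, mem_image, Subtype.exists, exists_and_right,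
    exists_eq_right]
  exact ⟨fun h => ⟨h.1, h.2⟩, fun ⟨h1, h2⟩ => ⟨h1, h2⟩⟩

theorem chartVolume_apply (p : X) {s : Set X} (hs : MeasurableSet s) :
    chartVolume (n := n) p s =
      ∫⁻ y in (chartAt (Cn n) p).target ∩ (chartAt (Cn n) p).symm ⁻¹' s,
        ENNReal.ofReal (chartDensity p y) := by
  have hm := measurableSet_target_inter_preimage_symm (n := n) p hs
  rw [chartVolume_eq, Measure.map_apply_of_aemeasurable
    ((aemeasurable_chart_symm p).mono_ac (withDensity_absolutelyContinuous _ _)) hs]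
  have h1 : ((chartAt (Cn n) p).symm ⁻¹' s : Set (Cn n)) =ᵐ[(volume.restrict
      (chartAt (Cn n) p).target).withDensity fun y => ENNReal.ofReal (chartDensity p y)]
      ((chartAt (Cn n) p).target ∩ (chartAt (Cn n) p).symm ⁻¹' s : Set (Cn n)) := by
    refine (withDensity_absolutelyContinuous _ _).ae_le ?_
    filter_upwards [ae_restrict_mem (chartAt (Cn n) p).open_target.measurableSet] with y hy
    refine propext ⟨fun h => ⟨hy, h⟩, fun h => h.2⟩
  rw [measure_congr h1, withDensity_apply _ hm, Measure.restrict_restrict hm,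
    inter_eq_left.2 inter_subset_left]

theorem chartVolume_compl_source (p : X) :
    chartVolume (n := n) p (chartAt (Cn n) p).sourceᶜ = 0 := by
  rw [chartVolume_apply p (chartAt (Cn n) p).open_source.measurableSet.compl]
  have : (chartAt (Cn n) p).target ∩ (chartAt (Cn n) p).symm ⁻¹' (chartAt (Cn n) p).sourceᶜ = ∅ := by
    ext y
    simp only [mem_inter_iff, mem_preimage, mem_compl_iff, mem_empty_iff_false, iff_false, not_and,
      not_not]
    exact fun hy => (chartAt (Cn n) p).map_target hy
  rw [this]
  simp

theorem gramMatrix_chartChange {p q z : X} (hp : z ∈ (chartAt (Cn n) p).source)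
    (hq : z ∈ (chartAt (Cn n) q).source) :
    (gramMatrix (n := n) q z).det =
      (tangentCoordChange 𝓘(ℝ, Cn n) q p z).det ^ 2 * (gramMatrix (n := n) p z).det := by
  set D := tangentCoordChange 𝓘(ℝ, Cn n) q p z with hD
  set J := LinearMap.toMatrix (stdBasis n).toBasis (stdBasis n).toBasis D.toLinearMap with hJ
  have h1 : ∀ i, chartVec q z (stdBasis n i) = ∑ k, J k i • chartVec p z (stdBasis n k) := by
    intro i
    have h2 : D (stdBasis n i) = ∑ k, J k i • stdBasis n k := by
      have := ((stdBasis n).toBasis.sum_repr (D (stdBasis n i))).symm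
      rw [this]
      refine Finset.sum_congr rfl fun k _ => ?_
      rw [hJ, LinearMap.toMatrix_apply]
      simp
    rw [← chartVec_chartCoord hp (chartVec q z (stdBasis n i)), chartCoord_chartVec_eq hp hq,
      ← hD, h2, map_sum]
    simp
  have h2 : gramMatrix (n := n) q z = J.transpose * gramMatrix (n := n) p z * J := by
    ext i j
    simp only [gramMatrix, Matrix.of_apply, h1, sum_inner, inner_sum, real_inner_smul_left,
      real_inner_smul_right, Matrix.mul_apply, Matrix.transpose_apply, Finset.sum_mul]
    refine Finset.sum_congr rfl fun k _ => Finset.sum_congr rfl fun l _ => ?_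
    ring
  have h3 : J.det = D.det := by
    rw [hJ, LinearMap.det_toMatrix]
  rw [h2, Matrix.det_mul, Matrix.det_mul, Matrix.det_transpose, h3]
  ring

/-- The volumes of two charts agree on the overlap of their domains. -/
theorem chartVolume_eq_of_subset {p q : X} {s : Set X} (hs : MeasurableSet s)
    (hp : s ⊆ (chartAt (Cn n) p).source) (hq : s ⊆ (chartAt (Cn n) q).source) :
    chartVolume (n := n) p s = chartVolume (n := n) q s := by
  rw [chartVolume_apply p hs, chartVolume_apply q hs]
  set ep := chartAt (Cn n) p
  set eq := chartAt (Cn n) q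
  have himg : (ep ∘ eq.symm) '' (eq.target ∩ eq.symm ⁻¹' s) = ep.target ∩ ep.symm ⁻¹' s := by
    ext y
    constructor
    · rintro ⟨x, ⟨hx, hxs⟩, rfl⟩
      refine ⟨ep.map_source (hp hxs), ?_⟩
      rw [mem_preimage, Function.comp_apply, ep.left_inv (hp hxs)]
      exact hxs
    · rintro ⟨hy, hys⟩
      refine ⟨eq (ep.symm y), ⟨eq.map_source (hq hys), ?_⟩, ?_⟩
      · rw [mem_preimage, eq.left_inv (hq hys)]
        exact hys
      · rw [Function.comp_apply, eq.left_inv (hq hys), ep.right_inv hy]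
  have hinj : InjOn (ep ∘ eq.symm) (eq.target ∩ eq.symm ⁻¹' s) := by
    rintro x ⟨hx, hxs⟩ y ⟨hy, hys⟩ hxy
    exact eq.symm.injOn hx hy (ep.injOn (hp hxs) (hp hys) hxy)
  rw [← himg, lintegral_image_eq_lintegral_abs_det_fderiv_mul volume
    (measurableSet_target_inter_preimage_symm q hs)
    (fun y hy => (hasFDerivAt_chartChange hy.1 (hp hy.2)).hasFDerivWithinAt) hinj]
  refine setLIntegral_congr_fun (measurableSet_target_inter_preimage_symm q hs) fun y hy => ?_
  have h1 : ep.symm ((ep ∘ eq.symm) y) = eq.symm y := by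
    rw [Function.comp_apply, ep.left_inv (hp hy.2)]
  simp only [chartDensity]
  rw [h1, gramMatrix_chartChange (hp hy.2) (hq hy.2), Real.sqrt_mul (sq_nonneg _), Real.sqrt_sq_eq_abs,
    ENNReal.ofReal_mul (abs_nonneg _)]

/-- As the volumes of the charts agree on overlaps, their supremum restricts to each of them. -/
theorem volumeMeasure_restrict_source (p : X) :
    (volumeMeasure n X).restrict (chartAt (Cn n) p).source = chartVolume (n := n) p := by
  have hsm : MeasurableSet (chartAt (Cn n) p).source :=
    (chartAt (Cn n) p).open_source.measurableSet
  have hcp : ∀ (q : X) (s : Set X), MeasurableSet s →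
      chartVolume (n := n) q s = chartVolume (n := n) q (s ∩ (chartAt (Cn n) q).source) := by
    intro q s hs
    rw [← measure_inter_add_sdiff s (chartAt (Cn n) q).open_source.measurableSet,
      measure_mono_null (sdiff_subset_compl s _) (chartVolume_compl_source q), add_zero]
  have hle : volumeMeasure n X ≤ chartVolume (n := n) p +
      (volumeMeasure n X).restrict (chartAt (Cn n) p).sourceᶜ := by
    refine iSup_le fun q => Measure.le_iff.2 fun s hs => ?_
    rw [Measure.add_apply, Measure.restrict_apply hs, ← measure_inter_add_sdiff s hsm]
    refine add_le_add ?_ ?_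
    · rw [hcp q _ (hs.inter hsm), ← chartVolume_eq_of_subset (p := p)
        ((hs.inter hsm).inter (chartAt (Cn n) q).open_source.measurableSet)
        (fun x hx => hx.1.2) (fun x hx => hx.2)]
      exact measure_mono fun x hx => hx.1.1
    · exact Measure.le_iff'.1 (le_iSup (fun q : X => chartVolume (n := n) q) q) _
  refine le_antisymm (Measure.le_iff.2 fun s hs => ?_) (Measure.le_iff.2 fun s hs => ?_)
  · rw [Measure.restrict_apply hs]
    refine (Measure.le_iff'.1 hle _).trans ?_
    rw [Measure.add_apply, Measure.restrict_apply (hs.inter hsm)]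
    have : s ∩ (chartAt (Cn n) p).source ∩ (chartAt (Cn n) p).sourceᶜ = ∅ := by
      ext x
      simp
    rw [this, measure_empty, add_zero]
    exact measure_mono inter_subset_left
  · rw [Measure.restrict_apply hs, hcp p s hs]
    exact Measure.le_iff'.1 (le_iSup (fun q : X => chartVolume (n := n) q) p) _

theorem withDensity_map {α β : Type*} [MeasurableSpace α] [MeasurableSpace β] {ν : Measure α}
    [SFinite ν] {f : α → β} (hf : AEMeasurable f ν) {g : β → ENNReal} (hg : Measurable g) :
    (ν.map f).withDensity g = (ν.withDensity (g ∘ f)).map f := by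
  ext s hs
  rw [withDensity_apply _ hs, ← lintegral_indicator hs,
    lintegral_map' (hg.indicator hs).aemeasurable hf,
    Measure.map_apply_of_aemeasurable (hf.mono_ac (withDensity_absolutelyContinuous _ _)) hs,
    withDensity_apply', ← lintegral_indicator₀ (hf.nullMeasurableSet_preimage hs)]
  rfl

/-- The density of `e^{-φ} dV_X` in the chart at `p`. -/
def chartWeight (φ : X → ℝ) (p : X) (y : Cn n) : ℝ :=
  Real.exp (-φ ((chartAt (Cn n) p).symm y)) * chartDensity p y

theorem chartWeight_pos (φ : X → ℝ) {p : X} {y : Cn n} (hy : y ∈ (chartAt (Cn n) p).target) :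
    0 < chartWeight φ p y := mul_pos (Real.exp_pos _) (chartDensity_pos hy)

theorem continuousOn_chartWeight {φ : X → ℝ} (hφ : Continuous φ) (p : X) :
    ContinuousOn (chartWeight (n := n) φ p) (chartAt (Cn n) p).target :=
  (Real.continuous_exp.comp_continuousOn
    (hφ.comp_continuousOn (chartAt (Cn n) p).continuousOn_symm).neg).mul
    (contDiffOn_chartDensity p).continuousOn

/-- In the chart at `p`, the measure `e^{-φ} dV_X` has the density `chartWeight φ p`. -/
theorem weightedVolume_restrict_source {φ : X → ℝ} (hφ : Continuous φ) (p : X) :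
    (weightedVolume n φ).restrict (chartAt (Cn n) p).source =
      ((volume.restrict (chartAt (Cn n) p).target).withDensity
        fun y => ENNReal.ofReal (chartWeight φ p y)).map (chartAt (Cn n) p).symm := by
  have hsm : MeasurableSet (chartAt (Cn n) p).source :=
    (chartAt (Cn n) p).open_source.measurableSet
  have hφm : Measurable fun x => ENNReal.ofReal (Real.exp (-φ x)) :=
    (Real.continuous_exp.comp hφ.neg).measurable.ennreal_ofReal
  rw [weightedVolume, restrict_withDensity hsm, volumeMeasure_restrict_source, chartVolume_eq]
  have had := aemeasurable_of_continuousOn_target (n := n) p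
    (contDiffOn_chartDensity (n := n) p).continuousOn
  have hsy := aemeasurable_chart_symm (n := n) p
  rw [withDensity_map (hsy.mono_ac (withDensity_absolutelyContinuous _ _)) hφm,
    ← withDensity_mul₀ had (hφm.comp_aemeasurable hsy)]
  congr 2
  ext y
  rw [chartWeight, ENNReal.ofReal_mul (Real.exp_pos _).le, mul_comm]
  rfl

end Volume

/-! ### The metric on forms in a chart -/

/-- The space of the coefficients of a form at a point. -/
abbrev Coef (n : ℕ) : Type := EuclideanSpace ℂ (Finset (Fin (2 * n)))

/-- The operator on coefficients given by the compound of a real matrix. -/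
def compoundCLM {n : ℕ} (O : Matrix (Fin (2 * n)) (Fin (2 * n)) ℝ) : Coef n →L[ℂ] Coef n :=
  Matrix.toEuclideanCLM (𝕜 := ℂ) (Matrix.of fun s t => (compound O s t : ℂ))

theorem compoundCLM_apply {n : ℕ} (O : Matrix (Fin (2 * n)) (Fin (2 * n)) ℝ) (c : Coef n)
    (s : Finset (Fin (2 * n))) : compoundCLM O c s = ∑ t, (compound O s t : ℂ) * c t := by
  simp [compoundCLM, Matrix.ofLp_toEuclideanCLM, Matrix.mulVec, dotProduct]

theorem compoundCLM_eq_sum {n : ℕ} (O : Matrix (Fin (2 * n)) (Fin (2 * n)) ℝ) :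
    compoundCLM O = ∑ s, ∑ t, compound O s t •
      (Matrix.toEuclideanCLM (𝕜 := ℂ) (Matrix.single s t (1 : ℂ)) : Coef n →L[ℂ] Coef n) := by
  have h1 : (Matrix.of fun s t => (compound O s t : ℂ)) =
      ∑ s, ∑ t, (compound O s t : ℂ) • Matrix.single s t (1 : ℂ) := by
    conv_lhs => rw [Matrix.matrix_eq_sum_single (Matrix.of fun s t => (compound O s t : ℂ))]
    simp [Matrix.smul_single]
  rw [compoundCLM, h1, map_sum]
  refine Finset.sum_congr rfl fun s _ => ?_
  rw [map_sum]
  refine Finset.sum_congr rfl fun t _ => ?_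
  rw [map_smul]
  ext c
  simp

section FormMetric

variable {n : ℕ} {X : Type*} [TopologicalSpace X] [ChartedSpace (Cn n) X]
  [IsManifold 𝓘(ℂ, Cn n) ω X]
  [RiemannianBundle (fun x : X => TangentSpace 𝓘(ℝ, Cn n) x)]
  [IsContMDiffRiemannianBundle 𝓘(ℝ, Cn n) ∞ (Cn n) (fun x : X => TangentSpace 𝓘(ℝ, Cn n) x)]
  [MeasurableSpace X] [BorelSpace X] [SecondCountableTopology X]

/-- The coordinates of the Borel frame at `z` in the chart at `p`. -/
def frameMatrix (p z : X) : Matrix (Fin (2 * n)) (Fin (2 * n)) ℝ :=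
  Matrix.of fun i j => inner ℝ (stdBasis n j) (chartCoord p z ((borelFrame n X).basis z i))

/-- The map from the coefficients of a form in the chart at `p` to those in the Borel frame. -/
def toFrame (p z : X) : Coef n →L[ℂ] Coef n := compoundCLM (frameMatrix p z)

/-- The metric on forms times the Riemannian density, in the coordinates of the chart at `p`. -/
def formMetric (p : X) (y : Cn n) : Coef n →L[ℂ] Coef n :=
  chartDensity p y • compoundCLM (gramMatrix (n := n) p ((chartAt (Cn n) p).symm y))⁻¹

theorem frameMatrix_eq {p z : X} (hz : z ∈ (chartAt (Cn n) p).source) :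
    frameMatrix (n := n) p z =
      Matrix.of fun i j => (chartBasis p z hz).repr ((borelFrame n X).basis z i) j := by
  ext i j
  simp [frameMatrix, chartBasis_repr]

theorem inner_toFrame {p : X} {y : Cn n} (hy : y ∈ (chartAt (Cn n) p).target) (c c' : Coef n) :
    chartDensity p y * inner ℂ (toFrame p ((chartAt (Cn n) p).symm y) c)
      (toFrame p ((chartAt (Cn n) p).symm y) c') = inner ℂ c (formMetric p y c') := by
  have hz := (chartAt (Cn n) p).map_target hy
  set z := (chartAt (Cn n) p).symm y
  have h1 : ContinuousLinearMap.adjoint (toFrame (n := n) p z) * toFrame p z =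
      compoundCLM (gramMatrix (n := n) p z)⁻¹ := by
    rw [← ContinuousLinearMap.star_eq_adjoint, toFrame, compoundCLM, compoundCLM, ← map_star,
      ← map_mul]
    congr 1
    ext t s
    have h2 := sum_compound_mul_compound (chartBasis p z hz) ((borelFrame n X).basis z) t s
    rw [← frameMatrix_eq, ← gramMatrix_eq] at h2
    rw [Matrix.mul_apply, Matrix.of_apply, ← h2]
    push_cast
    simp [Matrix.star_apply]
  rw [formMetric, _root_.smul_apply, ← h1, mul_apply_eq_comp,
    RCLike.real_smul_eq_coe_smul (K := ℂ), inner_smul_right, ContinuousLinearMap.adjoint_inner_right]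
  rfl

theorem toFrame_injective {p z : X} (hz : z ∈ (chartAt (Cn n) p).source) {c : Coef n}
    (hc : toFrame p z c = 0) : c = 0 := by
  have h := injective_compound (chartBasis p z hz) ((borelFrame n X).basis z).toBasis c.ofLp
    fun s => by
      have h1 := congrFun (congrArg WithLp.ofLp hc) s
      rw [toFrame, compoundCLM_apply, frameMatrix_eq hz] at h1
      simpa using h1
  ext s
  simpa using congrFun h s

theorem inner_formMetric_self_pos {p : X} {y : Cn n} (hy : y ∈ (chartAt (Cn n) p).target)
    {c : Coef n} (hc : c ≠ 0) : 0 < (inner ℂ c (formMetric p y c)).re := by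
  rw [← inner_toFrame hy, inner_self_eq_norm_sq_to_K]
  have h1 : toFrame p ((chartAt (Cn n) p).symm y) c ≠ 0 := fun h =>
    hc (toFrame_injective ((chartAt (Cn n) p).map_target hy) h)
  have h2 := chartDensity_pos hy
  have h3 := norm_pos_iff.2 h1
  have h4 : ((chartDensity p y : ℂ) *
      ((‖toFrame p ((chartAt (Cn n) p).symm y) c‖ : ℝ) : ℂ) ^ 2).re =
      chartDensity p y * ‖toFrame p ((chartAt (Cn n) p).symm y) c‖ ^ 2 := by
    rw [← Complex.ofReal_pow, ← Complex.ofReal_mul, Complex.ofReal_re]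
  exact h4 ▸ mul_pos h2 (pow_pos h3 2)

theorem adjoint_formMetric {p : X} {y : Cn n} (hy : y ∈ (chartAt (Cn n) p).target) :
    ContinuousLinearMap.adjoint (formMetric p y) = formMetric p y := by
  refine (ContinuousLinearMap.eq_adjoint_iff _ _).2 (fun c c' => ?_) |>.symm
  rw [← inner_conj_symm, ← inner_toFrame hy, ← inner_toFrame hy, map_mul, inner_conj_symm,
    Complex.conj_ofReal]

theorem isUnit_formMetric {p : X} {y : Cn n} (hy : y ∈ (chartAt (Cn n) p).target) :
    IsUnit (formMetric p y) := by
  have hinj : Function.Injective (formMetric p y) := by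
    refine (injective_iff_map_eq_zero _).2 fun c hc => ?_
    by_contra h
    have := inner_formMetric_self_pos hy h
    rw [hc, inner_zero_right] at this
    exact lt_irrefl _ this
  exact ContinuousLinearMap.isUnit_iff_bijective.2
    ⟨hinj, (LinearMap.injective_iff_surjective (f := (formMetric p y).toLinearMap)).1 hinj⟩

theorem contDiffOn_formMetric (p : X) :
    ContDiffOn ℝ ∞ (formMetric (n := n) p) (chartAt (Cn n) p).target := by
  refine (contDiffOn_chartDensity p).smul ?_
  simp only [compoundCLM_eq_sum]
  exact ContDiffOn.sum fun s _ => ContDiffOn.sum fun t _ =>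
    (contDiffOn_compound (fun i j => contDiffOn_gramMatrix_inv p i j) s t).smul contDiffOn_const

/-- The inverse of the metric on forms. -/
def formMetricInv (p : X) (y : Cn n) : Coef n →L[ℂ] Coef n := Ring.inverse (formMetric p y)

theorem contDiffOn_formMetricInv (p : X) :
    ContDiffOn ℝ ∞ (formMetricInv (n := n) p) (chartAt (Cn n) p).target := by
  intro y hy
  obtain ⟨v, hv⟩ := isUnit_formMetric hy
  have h1 : ContDiffAt ℝ ∞ (Ring.inverse : (Coef n →L[ℂ] Coef n) → _) (formMetric p y) :=
    hv ▸ contDiffAt_ringInverse ℝ v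
  exact h1.comp_contDiffWithinAt y (contDiffOn_formMetric p y hy)

theorem formMetricInv_apply {p : X} {y : Cn n} (hy : y ∈ (chartAt (Cn n) p).target) (c : Coef n) :
    formMetricInv p y (formMetric p y c) = c := by
  have := Ring.inverse_mul_cancel _ (isUnit_formMetric hy)
  exact congrFun (congrArg DFunLike.coe this) c

theorem formMetric_inv_apply {p : X} {y : Cn n} (hy : y ∈ (chartAt (Cn n) p).target) (c : Coef n) :
    formMetric p y (formMetricInv p y c) = c := by
  have := Ring.mul_inverse_cancel _ (isUnit_formMetric hy)
  exact congrFun (congrArg DFunLike.coe this) c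

theorem inner_formMetric_left {p : X} {y : Cn n} (hy : y ∈ (chartAt (Cn n) p).target)
    (c c' : Coef n) : inner ℂ (formMetric p y c) c' = inner ℂ c (formMetric p y c') := by
  conv_lhs => rw [← adjoint_formMetric hy]
  rw [ContinuousLinearMap.adjoint_inner_left]

/-- The coefficients in the chart at `p` of the form whose coefficients in the Borel frame
are `u`. -/
def chartRep (p : X) (u : X → Coef n) (y : Cn n) : Coef n :=
  formMetricInv p y (chartDensity p y •
    ContinuousLinearMap.adjoint (toFrame p ((chartAt (Cn n) p).symm y))
      (u ((chartAt (Cn n) p).symm y)))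

theorem chartRep_eq_of_toFrame {p : X} {y : Cn n} (hy : y ∈ (chartAt (Cn n) p).target)
    {u : X → Coef n} {c : Coef n}
    (h : u ((chartAt (Cn n) p).symm y) = toFrame p ((chartAt (Cn n) p).symm y) c) :
    chartRep p u y = c := by
  rw [chartRep, h]
  conv_rhs => rw [← formMetricInv_apply hy c]
  congr 1
  refine ext_inner_left ℂ fun c' => ?_
  rw [← inner_toFrame hy, RCLike.real_smul_eq_coe_smul (K := ℂ), inner_smul_right,
    ContinuousLinearMap.adjoint_inner_right]
  rfl

theorem toFrame_chartRep {p : X} {y : Cn n} (hy : y ∈ (chartAt (Cn n) p).target)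
    (u : X → Coef n) :
    toFrame p ((chartAt (Cn n) p).symm y) (chartRep p u y) = u ((chartAt (Cn n) p).symm y) := by
  have hinj : Function.Injective (toFrame p ((chartAt (Cn n) p).symm y)) :=
    (injective_iff_map_eq_zero _).2 fun c hc =>
      toFrame_injective ((chartAt (Cn n) p).map_target hy) hc
  obtain ⟨c, hc⟩ := (LinearMap.injective_iff_surjective
    (f := (toFrame p ((chartAt (Cn n) p).symm y)).toLinearMap)).1 hinj (u ((chartAt (Cn n) p).symm y))
  have hc' : toFrame p ((chartAt (Cn n) p).symm y) c = u ((chartAt (Cn n) p).symm y) := hc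
  rw [chartRep_eq_of_toFrame hy hc'.symm, hc']

end FormMetric

/-! ### Square integrable forms in a chart -/

section ChartClass

variable {n : ℕ} {X : Type*} [TopologicalSpace X] [ChartedSpace (Cn n) X]
  [IsManifold 𝓘(ℂ, Cn n) ω X]
  [RiemannianBundle (fun x : X => TangentSpace 𝓘(ℝ, Cn n) x)]
  [IsContMDiffRiemannianBundle 𝓘(ℝ, Cn n) ∞ (Cn n) (fun x : X => TangentSpace 𝓘(ℝ, Cn n) x)]
  [MeasurableSpace X] [BorelSpace X] [SecondCountableTopology X] {φ : X → ℝ}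

theorem inner_self_eq_ofReal {E : Type*} [NormedAddCommGroup E] [InnerProductSpace ℂ E] (x : E) :
    (inner ℂ x x : ℂ) = ((‖x‖ ^ 2 : ℝ) : ℂ) := by
  rw [inner_self_eq_norm_sq_to_K]
  push_cast
  rfl

theorem norm_sq_eq_integral (u : L2Forms n φ) :
    ‖u‖ ^ 2 = ∫ x, ‖u x‖ ^ 2 ∂weightedVolume n φ := by
  have h1 := inner_self_eq_ofReal u
  rw [L2.inner_def] at h1
  simp only [inner_self_eq_ofReal] at h1
  rw [integral_complex_ofReal] at h1
  exact (Complex.ofReal_injective h1).symm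

theorem formMetric_bounds {p : X} {y : Cn n} (hy : y ∈ (chartAt (Cn n) p).target)
    (u : X → Coef n) :
    ‖chartRep p u y‖ ^ 2 ≤ ‖formMetricInv p y‖ *
        (chartDensity p y * ‖u ((chartAt (Cn n) p).symm y)‖ ^ 2) ∧
      chartDensity p y * ‖u ((chartAt (Cn n) p).symm y)‖ ^ 2 ≤
        ‖formMetric p y‖ * ‖chartRep p u y‖ ^ 2 := by
  set z := (chartAt (Cn n) p).symm y with hz
  set c := chartRep p u y with hc
  set c' := formMetricInv p y c with hc'
  have hd := (chartDensity_pos hy).le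
  have hself : ∀ b : Coef n, chartDensity p y * ‖toFrame p z b‖ ^ 2 =
      (inner ℂ b (formMetric p y b)).re := by
    intro b
    rw [← inner_toFrame hy, inner_self_eq_norm_sq_to_K]
    change _ = ((chartDensity p y : ℂ) * ((‖toFrame p z b‖ : ℝ) : ℂ) ^ 2).re
    rw [← Complex.ofReal_pow, ← Complex.ofReal_mul, Complex.ofReal_re]
  have hu : toFrame p z c = u z := toFrame_chartRep hy u
  constructor
  · have h1 : chartDensity p y * ‖toFrame p z c'‖ ^ 2 ≤ ‖formMetricInv p y‖ * ‖c‖ ^ 2 := by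
      rw [hself, formMetric_inv_apply hy]
      calc (inner ℂ c' c).re ≤ ‖c'‖ * ‖c‖ := (Complex.re_le_norm _).trans (norm_inner_le_norm _ _)
        _ ≤ (‖formMetricInv p y‖ * ‖c‖) * ‖c‖ := by gcongr; exact ContinuousLinearMap.le_opNorm _ _
        _ = _ := by ring
    have h2 : ‖c‖ ^ 2 ≤ chartDensity p y * (‖toFrame p z c‖ * ‖toFrame p z c'‖) := by
      have h3 : inner ℂ c c = chartDensity p y * inner ℂ (toFrame p z c) (toFrame p z c') := by
        rw [inner_toFrame hy, formMetric_inv_apply hy]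
      have h4 : ‖c‖ ^ 2 = ‖(inner ℂ c c : ℂ)‖ := by
        rw [inner_self_eq_norm_sq_to_K, norm_pow, RCLike.norm_ofReal, abs_norm]
      rw [h4, h3, norm_mul, Complex.norm_real, Real.norm_of_nonneg hd]
      gcongr
      exact norm_inner_le_norm _ _
    rw [← hu]
    rcases (norm_nonneg c).eq_or_lt with h0 | h0
    · rw [← h0, zero_pow two_ne_zero]
      positivity
    have h5 : ‖c‖ ^ 2 * ‖c‖ ^ 2 ≤ ‖c‖ ^ 2 * (‖formMetricInv p y‖ *
        (chartDensity p y * ‖toFrame p z c‖ ^ 2)) := by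
      calc ‖c‖ ^ 2 * ‖c‖ ^ 2 = (‖c‖ ^ 2) ^ 2 := by ring
        _ ≤ (chartDensity p y * (‖toFrame p z c‖ * ‖toFrame p z c'‖)) ^ 2 := by gcongr
        _ = (chartDensity p y * ‖toFrame p z c‖ ^ 2) *
            (chartDensity p y * ‖toFrame p z c'‖ ^ 2) := by ring
        _ ≤ (chartDensity p y * ‖toFrame p z c‖ ^ 2) * (‖formMetricInv p y‖ * ‖c‖ ^ 2) := by
          gcongr
        _ = _ := by ring
    exact le_of_mul_le_mul_left h5 (by positivity)
  · rw [← hu, hself]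
    calc (inner ℂ c (formMetric p y c)).re ≤ ‖c‖ * ‖formMetric p y c‖ :=
          (Complex.re_le_norm _).trans (norm_inner_le_norm _ _)
      _ ≤ ‖c‖ * (‖formMetric p y‖ * ‖c‖) := by gcongr; exact ContinuousLinearMap.le_opNorm _ _
      _ = _ := by ring

theorem stronglyMeasurable_toFrame (p : X) :
    StronglyMeasurable fun z : (chartAt (Cn n) p).source => toFrame (n := n) p (z : X) := by
  have h1 : ∀ i j, Measurable fun z : (chartAt (Cn n) p).source =>
      frameMatrix (n := n) p (z : X) i j := by
    intro i j
    have := (borelFrame n X).measurable_coord p i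
    simp only [frameMatrix, Matrix.of_apply]
    exact ((continuous_const.inner continuous_id).measurable).comp this
  have h2 : ∀ s t, Measurable fun z : (chartAt (Cn n) p).source =>
      compound (frameMatrix (n := n) p (z : X)) s t := by
    intro s t
    by_cases h : t.card = s.card
    · simp only [compound_of_card _ rfl h, Matrix.det_apply]
      refine Finset.measurable_fun_sum _ fun σ _ => Measurable.const_smul ?_ _
      exact Finset.measurable_fun_prod _ fun i _ => h1 _ _
    · simp only [compound_of_card_ne _ h]
      exact measurable_const
  simp only [toFrame, compoundCLM_eq_sum]
  refine Finset.stronglyMeasurable_fun_sum _ fun s _ =>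
    Finset.stronglyMeasurable_fun_sum _ fun t _ => ?_
  exact (h2 s t).stronglyMeasurable.smul_const _

theorem aestronglyMeasurable_toFrame (φ : X → ℝ) (p : X) :
    AEStronglyMeasurable (fun z => toFrame (n := n) p z)
      ((weightedVolume n φ).restrict (chartAt (Cn n) p).source) := by
  have hs := (chartAt (Cn n) p).open_source.measurableSet
  have h1 := (stronglyMeasurable_toFrame (n := n) p).aestronglyMeasurable
    (μ := (weightedVolume n φ).comap Subtype.val)
  have h2 := (MeasurableEmbedding.subtype_coe hs).aestronglyMeasurable_map_iff
    (g := fun z => toFrame (n := n) p z) (μ := (weightedVolume n φ).comap Subtype.val)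
  rw [(MeasurableEmbedding.subtype_coe hs).map_comap, Subtype.range_coe] at h2
  exact h2.2 h1

theorem aemeasurable_chartWeight (hφ : Continuous φ) (p : X) :
    AEMeasurable (fun y => ENNReal.ofReal (chartWeight (n := n) φ p y))
      (volume.restrict (chartAt (Cn n) p).target) :=
  aemeasurable_of_continuousOn_target p (continuousOn_chartWeight hφ p)

theorem restrict_target_absolutelyContinuous (hφ : Continuous φ) (p : X) :
    (volume.restrict (chartAt (Cn n) p).target) ≪
      (volume.restrict (chartAt (Cn n) p).target).withDensity
        fun y => ENNReal.ofReal (chartWeight φ p y) := by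
  refine withDensity_absolutelyContinuous' (aemeasurable_chartWeight hφ p) ?_
  filter_upwards [ae_restrict_mem (chartAt (Cn n) p).open_target.measurableSet] with y hy
  exact (ENNReal.ofReal_pos.2 (chartWeight_pos φ hy)).ne'

theorem aemeasurable_chart_symm' (φ : X → ℝ) (p : X) :
    AEMeasurable (chartAt (Cn n) p).symm ((volume.restrict (chartAt (Cn n) p).target).withDensity
        fun y => ENNReal.ofReal (chartWeight φ p y)) :=
  (aemeasurable_chart_symm p).mono_ac (withDensity_absolutelyContinuous _ _)

theorem aestronglyMeasurable_comp_symm (hφ : Continuous φ) (p : X) {G : Type*}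
    [TopologicalSpace G] {f : X → G}
    (hf : AEStronglyMeasurable f ((weightedVolume n φ).restrict (chartAt (Cn n) p).source)) :
    AEStronglyMeasurable (fun y => f ((chartAt (Cn n) p).symm y))
      (volume.restrict (chartAt (Cn n) p).target) := by
  rw [weightedVolume_restrict_source hφ] at hf
  exact (hf.comp_aemeasurable (aemeasurable_chart_symm' φ p)).mono_ac
    (restrict_target_absolutelyContinuous hφ p)

theorem ae_target_of_ae (hφ : Continuous φ) (p : X) {P : X → Prop}
    (h : ∀ᵐ x ∂(weightedVolume n φ), P x) :
    ∀ᵐ y ∂(volume.restrict (chartAt (Cn n) p).target), P ((chartAt (Cn n) p).symm y) := by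
  have h1 := ae_restrict_of_ae (s := (chartAt (Cn n) p).source) h
  rw [weightedVolume_restrict_source hφ] at h1
  exact (restrict_target_absolutelyContinuous hφ p).ae_le
    (ae_of_ae_map (aemeasurable_chart_symm' φ p) h1)

theorem lintegral_source (hφ : Continuous φ) (p : X) {f : X → ENNReal}
    (hf : AEMeasurable f ((weightedVolume n φ).restrict (chartAt (Cn n) p).source)) :
    ∫⁻ x in (chartAt (Cn n) p).source, f x ∂weightedVolume n φ =
      ∫⁻ y in (chartAt (Cn n) p).target,
        ENNReal.ofReal (chartWeight φ p y) * f ((chartAt (Cn n) p).symm y) := by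
  rw [weightedVolume_restrict_source hφ] at hf ⊢
  rw [lintegral_map' hf (aemeasurable_chart_symm' φ p)]
  exact lintegral_withDensity_eq_lintegral_mul₀' (aemeasurable_chartWeight hφ p)
    (hf.comp_aemeasurable (aemeasurable_chart_symm' φ p))

theorem integral_source (hφ : Continuous φ) (p : X) {G : Type*} [NormedAddCommGroup G]
    [NormedSpace ℝ G] {f : X → G}
    (hf : AEStronglyMeasurable f ((weightedVolume n φ).restrict (chartAt (Cn n) p).source)) :
    ∫ x in (chartAt (Cn n) p).source, f x ∂weightedVolume n φ =
      ∫ y in (chartAt (Cn n) p).target, chartWeight φ p y • f ((chartAt (Cn n) p).symm y) := by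
  rw [weightedVolume_restrict_source hφ] at hf ⊢
  rw [integral_map (aemeasurable_chart_symm' φ p) hf,
    integral_withDensity_eq_integral_toReal_smul₀ (aemeasurable_chartWeight hφ p)
      (Eventually.of_forall fun _ => ENNReal.ofReal_lt_top)]
  refine setIntegral_congr_fun (chartAt (Cn n) p).open_target.measurableSet fun y hy => ?_
  rw [ENNReal.toReal_ofReal (chartWeight_pos φ hy).le]

theorem integrableOn_source (hφ : Continuous φ) (p : X) {G : Type*} [NormedAddCommGroup G]
    [NormedSpace ℝ G] {f : X → G} (hf : Integrable f (weightedVolume n φ)) :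
    IntegrableOn (fun y => chartWeight φ p y • f ((chartAt (Cn n) p).symm y))
      (chartAt (Cn n) p).target := by
  have h1 := hf.integrableOn (s := (chartAt (Cn n) p).source)
  rw [IntegrableOn, weightedVolume_restrict_source hφ] at h1
  have h2 := h1.comp_aemeasurable (aemeasurable_chart_symm' φ p)
  rw [integrable_withDensity_iff_integrable_smul₀' (aemeasurable_chartWeight hφ p)
    (Eventually.of_forall fun _ => ENNReal.ofReal_lt_top)] at h2
  refine (integrableOn_congr_fun (fun y hy => ?_)
    (chartAt (Cn n) p).open_target.measurableSet).1 h2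
  simp only [Function.comp]
  rw [ENNReal.toReal_ofReal (chartWeight_pos φ hy).le]

theorem aestronglyMeasurable_chartRep (hφ : Continuous φ) (p : X) (u : L2Forms n φ) :
    AEStronglyMeasurable (chartRep p u) (volume.restrict (chartAt (Cn n) p).target) := by
  have ht := (chartAt (Cn n) p).open_target.measurableSet
  have happ : Continuous fun q : (Coef n →L[ℂ] Coef n) × Coef n => q.1 q.2 :=
    isBoundedBilinearMap_apply.continuous
  have h1 : AEStronglyMeasurable (fun z => ContinuousLinearMap.adjoint (toFrame (n := n) p z) (u z))
      ((weightedVolume n φ).restrict (chartAt (Cn n) p).source) := by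
    refine happ.comp_aestronglyMeasurable (AEStronglyMeasurable.prodMk ?_
      (Lp.aestronglyMeasurable u).restrict)
    exact (LinearIsometryEquiv.continuous ContinuousLinearMap.adjoint).comp_aestronglyMeasurable
      (aestronglyMeasurable_toFrame φ p)
  have h2 := aestronglyMeasurable_comp_symm hφ p h1
  refine happ.comp_aestronglyMeasurable (AEStronglyMeasurable.prodMk
    ((contDiffOn_formMetricInv p).continuousOn.aestronglyMeasurable ht) ?_)
  exact ((contDiffOn_chartDensity p).continuousOn.aestronglyMeasurable ht).smul h2

/-- `e^{-φ}` in the chart at `p`. -/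
def chartExp (φ : X → ℝ) (p : X) (y : Cn n) : ℝ := Real.exp (-φ ((chartAt (Cn n) p).symm y))

theorem chartExp_pos (φ : X → ℝ) (p : X) (y : Cn n) : 0 < chartExp φ p y := Real.exp_pos _

theorem continuousOn_chartExp (hφ : Continuous φ) (p : X) :
    ContinuousOn (chartExp (n := n) φ p) (chartAt (Cn n) p).target :=
  Real.continuous_exp.comp_continuousOn
    (hφ.comp_continuousOn (chartAt (Cn n) p).continuousOn_symm).neg

/-- On compact subsets of a chart, the norm of `L²_*(X, φ)` dominates the Euclidean one. -/
theorem exists_lintegral_chartRep_le (hφ : Continuous φ) (p : X) {K : Set (Cn n)}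
    (hK : IsCompact K) (hKt : K ⊆ (chartAt (Cn n) p).target) :
    ∃ C : ℝ, 0 < C ∧ ∀ u : L2Forms n φ, MemLp (chartRep p u) 2 (volume.restrict K) ∧
      ∫ y in K, ‖chartRep p u y‖ ^ 2 ≤ C * ‖u‖ ^ 2 := by
  have ht := (chartAt (Cn n) p).open_target.measurableSet
  have hc : ContinuousOn (fun y => ‖formMetricInv p y‖ * (chartExp φ p y)⁻¹) K :=
    (((contDiffOn_formMetricInv p).continuousOn.mono hKt).norm).mul
      (((continuousOn_chartExp hφ p).mono hKt).inv₀ fun y _ => (chartExp_pos φ p y).ne')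
  obtain ⟨C, hC⟩ := (hK.bddAbove_image hc)
  refine ⟨max C 1, by positivity, fun u => ?_⟩
  have hint : Integrable (fun x => ‖u x‖ ^ 2) (weightedVolume n φ) :=
    (memLp_two_iff_integrable_sq_norm (Lp.aestronglyMeasurable u)).1 (Lp.memLp u)
  have hint2 := (integrableOn_source hφ p hint)
  have hint3 := hint2.mono_set hKt
  have hb : ∀ y ∈ K, ‖chartRep p u y‖ ^ 2 ≤
      max C 1 * (chartWeight φ p y • ‖u ((chartAt (Cn n) p).symm y)‖ ^ 2) := by
    intro y hy
    have h1 := (formMetric_bounds (hKt hy) u).1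
    have h2 : ‖formMetricInv p y‖ * (chartExp φ p y)⁻¹ ≤ max C 1 :=
      (hC (mem_image_of_mem _ hy)).trans (le_max_left _ _)
    have h3 := chartExp_pos φ p y
    have h4 : ‖formMetricInv p y‖ ≤ max C 1 * chartExp φ p y := by
      rwa [← div_eq_mul_inv, div_le_iff₀ h3] at h2
    have h5 := chartDensity_pos (hKt hy)
    calc _ ≤ _ := h1
      _ ≤ (max C 1 * chartExp φ p y) *
        (chartDensity p y * ‖u ((chartAt (Cn n) p).symm y)‖ ^ 2) := by gcongr
      _ = _ := by
        rw [smul_eq_mul, chartWeight, chartExp]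
        ring
  have hm : AEStronglyMeasurable (chartRep p u) (volume.restrict K) :=
    (aestronglyMeasurable_chartRep hφ p u).mono_measure (Measure.restrict_mono hKt le_rfl)
  have hi : Integrable (fun y => ‖chartRep p u y‖ ^ 2) (volume.restrict K) := by
    refine (hint3.const_mul (max C 1)).mono' (hm.norm.pow 2) ?_
    filter_upwards [ae_restrict_mem hK.measurableSet] with y hy
    rw [Real.norm_of_nonneg (by positivity)]
    exact hb y hy
  refine ⟨(memLp_two_iff_integrable_sq_norm hm).2 hi, ?_⟩
  calc ∫ y in K, ‖chartRep p u y‖ ^ 2 ≤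
      ∫ y in K, max C 1 * (chartWeight φ p y • ‖u ((chartAt (Cn n) p).symm y)‖ ^ 2) :=
        setIntegral_mono_on hi (hint3.const_mul _) hK.measurableSet hb
    _ = max C 1 * ∫ y in K, (chartWeight φ p y • ‖u ((chartAt (Cn n) p).symm y)‖ ^ 2) :=
        integral_const_mul _ _
    _ ≤ max C 1 * ∫ y in (chartAt (Cn n) p).target,
        (chartWeight φ p y • ‖u ((chartAt (Cn n) p).symm y)‖ ^ 2) := by
      refine mul_le_mul_of_nonneg_left ?_ (by positivity)
      refine setIntegral_mono_set hint2 ?_ (Eventually.of_forall hKt)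
      filter_upwards [ae_restrict_mem ht] with y hy
      exact mul_nonneg (chartWeight_pos φ hy).le (by positivity)
    _ = max C 1 * ∫ x in (chartAt (Cn n) p).source, ‖u x‖ ^ 2 ∂weightedVolume n φ := by
      rw [integral_source hφ p hint.aestronglyMeasurable.restrict]
    _ ≤ max C 1 * ∫ x, ‖u x‖ ^ 2 ∂weightedVolume n φ := by
      refine mul_le_mul_of_nonneg_left ?_ (by positivity)
      exact setIntegral_le_integral hint (Eventually.of_forall fun x => by positivity)
    _ = max C 1 * ‖u‖ ^ 2 := by
      rw [norm_sq_eq_integral]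

end ChartClass

section ChartClass

variable {n : ℕ} {X : Type*} [TopologicalSpace X] [ChartedSpace (Cn n) X]
  [IsManifold 𝓘(ℂ, Cn n) ω X]
  [RiemannianBundle (fun x : X => TangentSpace 𝓘(ℝ, Cn n) x)]
  [IsContMDiffRiemannianBundle 𝓘(ℝ, Cn n) ∞ (Cn n) (fun x : X => TangentSpace 𝓘(ℝ, Cn n) x)]
  [MeasurableSpace X] [BorelSpace X] [SecondCountableTopology X] {φ : X → ℝ}

theorem integrableOn_source_iff (hφ : Continuous φ) (p : X) {G : Type*} [NormedAddCommGroup G]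
    [NormedSpace ℝ G] {f : X → G}
    (hf : AEStronglyMeasurable f ((weightedVolume n φ).restrict (chartAt (Cn n) p).source)) :
    IntegrableOn f (chartAt (Cn n) p).source (weightedVolume n φ) ↔
      IntegrableOn (fun y => chartWeight φ p y • f ((chartAt (Cn n) p).symm y))
        (chartAt (Cn n) p).target := by
  rw [IntegrableOn, weightedVolume_restrict_source hφ] at *
  rw [integrable_map_measure hf (aemeasurable_chart_symm' φ p),
    integrable_withDensity_iff_integrable_smul₀' (aemeasurable_chartWeight hφ p)
    (Eventually.of_forall fun _ => ENNReal.ofReal_lt_top)]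
  refine (integrableOn_congr_fun (fun y hy => ?_)
    (chartAt (Cn n) p).open_target.measurableSet)
  simp only [Function.comp]
  rw [ENNReal.toReal_ofReal (chartWeight_pos φ hy).le]

/-- A continuous function with compact support in an open set. -/
structure IsCutoff {E F : Type*} [TopologicalSpace E] [TopologicalSpace F] [Zero F]
    (U : Set E) (g : E → F) : Prop where
  continuous : Continuous g
  compact : HasCompactSupport g
  subset : tsupport g ⊆ U

theorem IsCutoff.eq_zero {E F : Type*} [TopologicalSpace E] [TopologicalSpace F] [Zero F]
    {U : Set E} {g : E → F} (hg : IsCutoff U g) {y : E} (hy : y ∉ U) : g y = 0 :=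
  image_eq_zero_of_notMem_tsupport fun h => hy (hg.subset h)

theorem IsCutoff.of_eq_zero {E F F' : Type*} [TopologicalSpace E] [TopologicalSpace F] [Zero F]
    [TopologicalSpace F'] [Zero F'] {U : Set E} (hU : IsOpen U) {g : E → F} (hg : IsCutoff U g)
    {h : E → F'} (hc : ContinuousOn h U) (h0 : ∀ y, y ∉ tsupport g → h y = 0) : IsCutoff U h := by
  have hsub : tsupport h ⊆ tsupport g :=
    closure_minimal (fun y hy => by_contra fun h' => hy (h0 y h')) (isClosed_tsupport g)
  refine ⟨?_, hg.compact.of_isClosed_subset (isClosed_tsupport h) hsub, hsub.trans hg.subset⟩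
  rw [continuous_iff_continuousAt]
  intro y
  by_cases hy : y ∈ U
  · exact hc.continuousAt (hU.mem_nhds hy)
  · have h1 : h =ᶠ[𝓝 y] fun _ => 0 := by
      filter_upwards [(isClosed_tsupport g).isOpen_compl.mem_nhds
        (fun h' => hy (hg.subset h'))] with z hz
      exact h0 z hz
    exact (continuousAt_const).congr h1.symm

theorem IsCutoff.integrable {n : ℕ} {F : Type*} [NormedAddCommGroup F] {U : Set (Cn n)}
    {g : Cn n → F} (hg : IsCutoff U g) : Integrable g :=
  hg.continuous.integrable_of_hasCompactSupport hg.compact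

/-- The form with coefficients `g` in the chart at `p`, extended by zero, in the Borel frame. -/
def chartFun (p : X) (g : Cn n → Coef n) : X → Coef n :=
  (chartAt (Cn n) p).source.indicator fun x => toFrame p x (g (chartAt (Cn n) p x))

theorem chartFun_symm {p : X} {y : Cn n} (hy : y ∈ (chartAt (Cn n) p).target)
    (g : Cn n → Coef n) : chartFun p g ((chartAt (Cn n) p).symm y) =
      toFrame p ((chartAt (Cn n) p).symm y) (g y) := by
  rw [chartFun, indicator_of_mem ((chartAt (Cn n) p).map_target hy),
    (chartAt (Cn n) p).right_inv hy]

theorem aestronglyMeasurable_chartFun (φ : X → ℝ) (p : X) {g : Cn n → Coef n}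
    (hg : Continuous g) : AEStronglyMeasurable (chartFun p g) (weightedVolume n φ) := by
  have hs := (chartAt (Cn n) p).open_source.measurableSet
  rw [chartFun, aestronglyMeasurable_indicator_iff hs]
  have happ : Continuous fun q : (Coef n →L[ℂ] Coef n) × Coef n => q.1 q.2 :=
    isBoundedBilinearMap_apply.continuous
  refine happ.comp_aestronglyMeasurable (AEStronglyMeasurable.prodMk
    (aestronglyMeasurable_toFrame φ p) ?_)
  exact (hg.comp_continuousOn (chartAt (Cn n) p).continuousOn).aestronglyMeasurable hs

theorem isCutoff_inner_formMetric (hφ : Continuous φ) (p : X) {g : Cn n → Coef n}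
    (hg : IsCutoff (chartAt (Cn n) p).target g) :
    IsCutoff (chartAt (Cn n) p).target fun y => chartExp φ p y • formMetric p y (g y) := by
  refine hg.of_eq_zero (chartAt (Cn n) p).open_target ?_ fun y hy => ?_
  · exact (continuousOn_chartExp hφ p).smul
      ((contDiffOn_formMetric p).continuousOn.clm_apply hg.continuous.continuousOn)
  · rw [image_eq_zero_of_notMem_tsupport hy, map_zero, smul_zero]

theorem memLp_chartFun (hφ : Continuous φ) (p : X) {g : Cn n → Coef n}
    (hg : IsCutoff (chartAt (Cn n) p).target g) :
    MemLp (chartFun p g) 2 (weightedVolume n φ) := by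
  have hm := aestronglyMeasurable_chartFun φ p hg.continuous
  rw [memLp_two_iff_integrable_sq_norm hm]
  have h0 : ∀ x ∉ (chartAt (Cn n) p).source, ‖chartFun p g x‖ ^ 2 = 0 := fun x hx => by
    rw [chartFun, indicator_of_notMem hx, norm_zero, zero_pow two_ne_zero]
  rw [← integrableOn_univ]
  refine IntegrableOn.of_forall_sdiff_eq_zero (s := (chartAt (Cn n) p).source) ?_
    MeasurableSet.univ fun x hx => h0 x hx.2
  refine (integrableOn_source_iff hφ p (hm.norm.pow 2).restrict).2 ?_
  have h1 : IsCutoff (chartAt (Cn n) p).target fun y =>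
      (inner ℂ (g y) (chartExp φ p y • formMetric p y (g y))).re := by
    refine hg.of_eq_zero (chartAt (Cn n) p).open_target ?_ fun y hy => ?_
    · exact Complex.continuous_re.comp_continuousOn (hg.continuous.continuousOn.inner
        (isCutoff_inner_formMetric hφ p hg).continuous.continuousOn)
    · rw [image_eq_zero_of_notMem_tsupport hy, inner_zero_left, Complex.zero_re]
  refine (integrableOn_congr_fun (fun y hy => ?_)
    (chartAt (Cn n) p).open_target.measurableSet).1 h1.integrable.integrableOn
  rw [Pi.pow_apply, chartFun_symm hy, RCLike.real_smul_eq_coe_smul (K := ℂ), inner_smul_right,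
    ← inner_toFrame hy, inner_self_eq_ofReal, chartWeight, chartExp]
  change ((_ : ℝ) * (((_ : ℝ) : ℂ) * ((_ : ℝ) : ℂ)) : ℂ).re = _
  rw [← Complex.ofReal_mul, ← Complex.ofReal_mul, Complex.ofReal_re, smul_eq_mul, mul_assoc]
  rfl

open scoped Classical in
variable (φ) in
/-- The class in `L²_*(X, φ)` of the form with coefficients `g` in the chart at `p`, for a
continuous `g` with compact support in the range of the chart. -/
def chartClass (p : X) (g : Cn n → Coef n) : L2Forms n φ :=
  if h : MemLp (chartFun p g) 2 (weightedVolume n φ) then h.toLp else 0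

theorem coeFn_chartClass (hφ : Continuous φ) (p : X) {g : Cn n → Coef n}
    (hg : IsCutoff (chartAt (Cn n) p).target g) :
    ⇑(chartClass φ p g) =ᵐ[weightedVolume n φ] chartFun p g := by
  rw [chartClass, dif_pos (memLp_chartFun hφ p hg)]
  exact MemLp.coeFn_toLp _

theorem inner_chartClass (hφ : Continuous φ) (p : X) {g : Cn n → Coef n}
    (hg : IsCutoff (chartAt (Cn n) p).target g) (u : L2Forms n φ) :
    inner ℂ u (chartClass φ p g) =
      ∫ y, inner ℂ (chartRep p u y) (chartExp φ p y • formMetric p y (g y)) := by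
  have hm := (Lp.aestronglyMeasurable u).inner (𝕜 := ℂ) (aestronglyMeasurable_chartFun φ p hg.continuous)
  have h1 : inner ℂ u (chartClass φ p g) =
      ∫ x, inner ℂ (u x) (chartFun p g x) ∂weightedVolume n φ := by
    rw [L2.inner_def]
    refine integral_congr_ae ?_
    filter_upwards [coeFn_chartClass hφ p hg] with x hx
    rw [hx]
  rw [h1, ← setIntegral_eq_integral_of_forall_compl_eq_zero (s := (chartAt (Cn n) p).source)
    fun x hx => by rw [chartFun, indicator_of_notMem hx, inner_zero_right],
    integral_source hφ p hm.restrict]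
  refine Eq.trans ?_ (setIntegral_eq_integral_of_forall_compl_eq_zero
    (s := (chartAt (Cn n) p).target)
    fun y hy => by rw [hg.eq_zero hy, map_zero, smul_zero, inner_zero_right])
  refine setIntegral_congr_fun (chartAt (Cn n) p).open_target.measurableSet fun y hy => ?_
  rw [chartFun_symm hy, ← toFrame_chartRep hy u, RCLike.real_smul_eq_coe_smul (K := ℂ),
    RCLike.real_smul_eq_coe_smul (K := ℂ), inner_smul_right,
    ← inner_toFrame hy, chartWeight, chartExp, smul_eq_mul, RCLike.ofReal_mul, mul_assoc]
  rfl

theorem chartRep_chartClass (hφ : Continuous φ) (p : X) {g : Cn n → Coef n}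
    (hg : IsCutoff (chartAt (Cn n) p).target g) :
    ∀ᵐ y ∂(volume.restrict (chartAt (Cn n) p).target), chartRep p (chartClass φ p g) y = g y := by
  filter_upwards [ae_target_of_ae hφ p (coeFn_chartClass hφ p hg),
    ae_restrict_mem (chartAt (Cn n) p).open_target.measurableSet] with y hy hyt
  refine chartRep_eq_of_toFrame hyt ?_
  rw [hy, chartFun_symm hyt]

/-- On the image of a compact subset of a chart, the Euclidean norm dominates the norm of
`L²_*(X, φ)`. -/
theorem exists_normOn_le (hφ : Continuous φ) (p : X) {K : Set (Cn n)}
    (hK : IsCompact K) (hKt : K ⊆ (chartAt (Cn n) p).target) :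
    ∃ C : ℝ, 0 < C ∧ ∀ (u : L2Forms n φ) (O : Set X), MeasurableSet O →
      O ⊆ (chartAt (Cn n) p).symm '' K →
      normOn O u ^ 2 ≤ C * ∫ y in K, ‖chartRep p u y‖ ^ 2 := by
  have ht := (chartAt (Cn n) p).open_target.measurableSet
  have hc : ContinuousOn (fun y => chartExp φ p y * ‖formMetric p y‖) K :=
    ((continuousOn_chartExp hφ p).mono hKt).mul ((contDiffOn_formMetric p).continuousOn.mono hKt).norm
  obtain ⟨C, hC⟩ := (hK.bddAbove_image hc)
  obtain ⟨C', hC', hmem⟩ := exists_lintegral_chartRep_le hφ p hK hKt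
  refine ⟨max C 1, by positivity, fun u O hO hOK => ?_⟩
  have hint : Integrable (fun x => ‖u x‖ ^ 2) (weightedVolume n φ) :=
    (memLp_two_iff_integrable_sq_norm (Lp.aestronglyMeasurable u)).1 (Lp.memLp u)
  have hOs : O ⊆ (chartAt (Cn n) p).source := by
    rintro x hx
    obtain ⟨y, hy, rfl⟩ := hOK hx
    exact (chartAt (Cn n) p).map_target (hKt hy)
  have hi2 := (hmem u).1.integrable_norm_pow two_ne_zero
  have hintO : Integrable (O.indicator fun x => ‖u x‖ ^ 2) (weightedVolume n φ) :=
    hint.indicator hO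
  have h1 : normOn O u ^ 2 = ∫ x in (chartAt (Cn n) p).source,
      O.indicator (fun x => ‖u x‖ ^ 2) x ∂weightedVolume n φ := by
    rw [normOn, Real.sq_sqrt (integral_nonneg fun x => by positivity),
      setIntegral_indicator hO, inter_eq_right.2 hOs]
  rw [h1, integral_source hφ p hintO.aestronglyMeasurable.restrict]
  have hz : ∀ y ∈ (chartAt (Cn n) p).target \ K, chartWeight φ p y •
      O.indicator (fun x => ‖u x‖ ^ 2) ((chartAt (Cn n) p).symm y) = 0 := by
    intro y hy
    rw [indicator_of_notMem, smul_zero]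
    intro h
    obtain ⟨y', hy', he⟩ := hOK h
    exact hy.2 ((chartAt (Cn n) p).symm.injOn (hKt hy') hy.1 he ▸ hy')
  rw [setIntegral_eq_of_subset_of_forall_sdiff_eq_zero ht hKt hz, ← integral_const_mul]
  refine setIntegral_mono_on ((integrableOn_source hφ p hintO).mono_set hKt)
    (hi2.const_mul _) hK.measurableSet fun y hy => ?_
  have h2 := (formMetric_bounds (hKt hy) u).2
  have h3 : O.indicator (fun x => ‖u x‖ ^ 2) ((chartAt (Cn n) p).symm y) ≤
      ‖u ((chartAt (Cn n) p).symm y)‖ ^ 2 := indicator_le_self' (fun _ _ => by positivity) _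
  have h4 : chartExp φ p y * ‖formMetric p y‖ ≤ max C 1 :=
    (hC (mem_image_of_mem _ hy)).trans (le_max_left _ _)
  have h5 := chartExp_pos φ p y
  calc _ ≤ chartWeight φ p y * ‖u ((chartAt (Cn n) p).symm y)‖ ^ 2 :=
        mul_le_mul_of_nonneg_left h3 (chartWeight_pos φ (hKt hy)).le
    _ = chartExp φ p y * (chartDensity p y * ‖u ((chartAt (Cn n) p).symm y)‖ ^ 2) := by
      rw [chartWeight, chartExp, mul_assoc]
    _ ≤ chartExp φ p y * (‖formMetric p y‖ * ‖chartRep p u y‖ ^ 2) := by gcongr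
    _ = chartExp φ p y * ‖formMetric p y‖ * ‖chartRep p u y‖ ^ 2 := by ring
    _ ≤ _ := by gcongr

end ChartClass

/-! ### Smooth forms with compact support -/

section TestForms

variable {n : ℕ} {X : Type*} [TopologicalSpace X] [ChartedSpace (Cn n) X]
  [IsManifold 𝓘(ℂ, Cn n) ω X]
  [RiemannianBundle (fun x : X => TangentSpace 𝓘(ℝ, Cn n) x)]
  [IsContMDiffRiemannianBundle 𝓘(ℝ, Cn n) ∞ (Cn n) (fun x : X => TangentSpace 𝓘(ℝ, Cn n) x)]

/-- The coefficients of `η` in the chart at `p`, as a vector valued function. -/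
def formRep (η : DiffForm n X) (p : X) (y : Cn n) : Coef n :=
  WithLp.toLp 2 fun s => chartCoeff η p s y

theorem contDiffOn_formRep {η : DiffForm n X} (hη : IsSmoothForm η) (p : X) :
    ContDiffOn ℝ ∞ (formRep η p) (chartAt (Cn n) p).target :=
  contDiffOn_piLp' 2 fun s => hη p s

theorem fderiv_formRep {η : DiffForm n X} (hη : IsSmoothForm η) (p : X) {y : Cn n}
    (hy : y ∈ (chartAt (Cn n) p).target) (i : Fin (2 * n)) (s : Finset (Fin (2 * n))) :
    fderiv ℝ (formRep η p) y (stdBasis n i) s = chartDeriv η p i s y := by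
  have h1 : DifferentiableAt ℝ (formRep η p) y :=
    ((contDiffOn_formRep hη p).contDiffAt
      ((chartAt (Cn n) p).open_target.mem_nhds hy)).differentiableAt (by simp)
  have h2 := ((EuclideanSpace.proj s : Coef n →L[ℂ] ℂ).restrictScalars ℝ).hasFDerivAt.comp y
    h1.hasFDerivAt
  have h3 : (fun y => chartCoeff η p s y) =
      ((EuclideanSpace.proj s : Coef n →L[ℂ] ℂ).restrictScalars ℝ) ∘ formRep η p := rfl
  rw [chartDeriv, show chartCoeff η p s = _ from h3, h2.fderiv]
  rfl

open scoped Classical in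
/-- The form with coefficients `g` in the chart at `p`, extended by zero. -/
def chartForm (p : X) (g : Cn n → Coef n) : DiffForm n X := fun x k =>
  if hx : x ∈ (chartAt (Cn n) p).source then
    formOfCoeff (chartBasis p x hx) (fun s => g (chartAt (Cn n) p x) s) k
  else 0

theorem formOfCoeff_zero {N : ℕ} {M : Type*} [AddCommGroup M] [Module ℝ M]
    (b : Module.Basis (Fin N) ℝ M) (k : ℕ) : formOfCoeff b (fun _ => 0) k = 0 := by
  rw [formOfCoeff]
  have : ((b.exteriorPower k).constr ℝ fun _ : Set.powersetCard (Fin N) k => (0 : ℂ)) = 0 :=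
    (b.exteriorPower k).ext fun i => by simp
  rw [this, map_zero]

theorem chartForm_eq_zero {p : X} {g : Cn n → Coef n} {x : X}
    (hx : x ∈ (chartAt (Cn n) p).source → g (chartAt (Cn n) p x) = 0) : chartForm p g x = 0 := by
  ext1 k
  rw [chartForm]
  split_ifs with h
  · rw [hx h]
    exact formOfCoeff_zero _ k
  · rfl

/-- The change of the coefficients of a form from the chart at `p` to the chart at `q`. -/
theorem formRep_eq {p q : X} (η : DiffForm n X) {y : Cn n} (hy : y ∈ (chartAt (Cn n) q).target)
    (hz : (chartAt (Cn n) q).symm y ∈ (chartAt (Cn n) p).source) (s : Finset (Fin (2 * n))) :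
    chartCoeff η q s y = ∑ t, (compound (Matrix.of fun i j => inner ℝ (stdBasis n j)
      (tangentCoordChange 𝓘(ℝ, Cn n) q p ((chartAt (Cn n) q).symm y) (stdBasis n i))) s t : ℂ) *
      chartCoeff η p t (chartAt (Cn n) p ((chartAt (Cn n) q).symm y)) := by
  have h1 := coeff_eq_sum_compound (chartBasis p _ hz) (η ((chartAt (Cn n) q).symm y))
    (fun i => chartVec q ((chartAt (Cn n) q).symm y) (stdBasis n i)) s
  have h2 : (Matrix.of fun i j => (chartBasis p _ hz).repr
      (chartVec q ((chartAt (Cn n) q).symm y) (stdBasis n i)) j) =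
      Matrix.of fun i j => inner ℝ (stdBasis n j)
      (tangentCoordChange 𝓘(ℝ, Cn n) q p ((chartAt (Cn n) q).symm y) (stdBasis n i)) := by
    ext i j
    rw [Matrix.of_apply, Matrix.of_apply, chartBasis_repr,
      chartCoord_chartVec_eq hz ((chartAt (Cn n) q).map_target hy)]
  rw [h2] at h1
  rw [chartCoeff, coeffAt, h1]
  refine Finset.sum_congr rfl fun t _ => ?_
  rw [chartCoeff, (chartAt (Cn n) p).left_inv hz, coeffAt]
  simp only [chartBasis_apply]

theorem formRep_chartForm {p : X} {g : Cn n → Coef n} {y : Cn n}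
    (hy : y ∈ (chartAt (Cn n) p).target) : formRep (chartForm p g) p y = g y := by
  ext s
  have hz := (chartAt (Cn n) p).map_target hy
  change chartCoeff (chartForm p g) p s y = g y s
  have h1 := formOfCoeff_apply_basis (chartBasis p _ hz)
    (fun s => g (chartAt (Cn n) p ((chartAt (Cn n) p).symm y)) s) s
  rw [chartCoeff, coeffAt, chartForm, dif_pos hz]
  simp only [chartBasis_apply, (chartAt (Cn n) p).right_inv hy] at h1 ⊢
  exact h1

theorem isCompact_image_tsupport {p : X} {g : Cn n → Coef n}
    (hg : IsCutoff (chartAt (Cn n) p).target g) :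
    IsCompact ((chartAt (Cn n) p).symm '' tsupport g) :=
  hg.compact.isCompact.image_of_continuousOn
    ((chartAt (Cn n) p).continuousOn_symm.mono hg.subset)

theorem chartForm_eq_zero_of_notMem {p : X} {g : Cn n → Coef n} {x : X}
    (hx : x ∉ (chartAt (Cn n) p).symm '' tsupport g) : chartForm p g x = 0 := by
  refine chartForm_eq_zero fun h => image_eq_zero_of_notMem_tsupport fun h' => hx ?_
  exact ⟨_, h', (chartAt (Cn n) p).left_inv h⟩

theorem isTestForm_chartForm [T2Space X] {p : X} {g : Cn n → Coef n}
    (hg : IsCutoff (chartAt (Cn n) p).target g) (hs : ContDiff ℝ ∞ g) {W : Set X}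
    (hW : (chartAt (Cn n) p).symm '' tsupport g ⊆ W) : IsTestForm W (chartForm p g) := by
  refine ⟨fun q s => ?_, _, isCompact_image_tsupport hg, hW,
    fun x hx => chartForm_eq_zero_of_notMem hx⟩
  intro y hy
  refine ContDiffAt.contDiffWithinAt ?_
  by_cases hz : (chartAt (Cn n) q).symm y ∈ (chartAt (Cn n) p).source
  · have hopen := isOpen_chartInter (n := n) p q
    have hmem : y ∈ (chartAt (Cn n) q).target ∩
      (chartAt (Cn n) q).symm ⁻¹' (chartAt (Cn n) p).source := ⟨hy, hz⟩
    have h1 : ContDiffOn ℝ ∞ (fun y => ∑ t, (compound (Matrix.of fun i j =>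
      inner ℝ (stdBasis n j) (tangentCoordChange 𝓘(ℝ, Cn n) q p ((chartAt (Cn n) q).symm y)
        (stdBasis n i))) s t : ℂ) * g (chartAt (Cn n) p ((chartAt (Cn n) q).symm y)) t)
        ((chartAt (Cn n) q).target ∩
      (chartAt (Cn n) q).symm ⁻¹' (chartAt (Cn n) p).source) := by
      refine ContDiffOn.sum fun t _ => ContDiffOn.mul ?_ ?_
      · refine Complex.ofRealCLM.contDiff.comp_contDiffOn (contDiffOn_compound (fun i j => ?_) s t)
        exact contDiffOn_const.inner ℝ
          ((contDiffOn_tangentCoordChange p q).clm_apply contDiffOn_const)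
      · have h2 : ContDiff ℝ ∞ fun y => g y t :=
          ((EuclideanSpace.proj t : Coef n →L[ℂ] ℂ).restrictScalars ℝ).contDiff.comp hs
        exact h2.comp_contDiffOn (contDiffOn_chartChange p q)
    refine (h1.contDiffAt (hopen.mem_nhds hmem)).congr_of_eventuallyEq ?_
    filter_upwards [hopen.mem_nhds hmem] with y' hy'
    rw [formRep_eq _ hy'.1 hy'.2]
    refine Finset.sum_congr rfl fun t _ => ?_
    congr 1
    exact congrFun (congrArg WithLp.ofLp
      (formRep_chartForm ((chartAt (Cn n) p).map_source hy'.2))) t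
  · have hcl := (isCompact_image_tsupport hg).isClosed
    have hopen := (chartAt (Cn n) q).isOpen_inter_preimage_symm hcl.isOpen_compl
    have hmem : y ∈ (chartAt (Cn n) q).target ∩
        (chartAt (Cn n) q).symm ⁻¹' ((chartAt (Cn n) p).symm '' tsupport g)ᶜ := by
      refine ⟨hy, fun h => hz ?_⟩
      obtain ⟨y', hy', he⟩ := h
      rw [← he]
      exact (chartAt (Cn n) p).map_target (hg.subset hy')
    refine (contDiffAt_const (c := (0 : ℂ))).congr_of_eventuallyEq ?_
    filter_upwards [hopen.mem_nhds hmem] with y' hy'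
    rw [chartCoeff, coeffAt, chartForm_eq_zero_of_notMem hy'.2]
    rfl

variable [MeasurableSpace X] [BorelSpace X] [SecondCountableTopology X] {φ : X → ℝ}

theorem coeffAt_borelFrame (η : DiffForm n X) {p x : X} (hx : x ∈ (chartAt (Cn n) p).source) :
    WithLp.toLp 2 (fun s => coeffAt η x (fun i => (borelFrame n X).basis x i) s) =
      toFrame p x (formRep η p (chartAt (Cn n) p x)) := by
  ext s
  rw [toFrame, compoundCLM_apply, frameMatrix_eq hx]
  change coeffAt _ _ _ _ = _
  rw [coeffAt, coeff_eq_sum_compound (chartBasis p x hx) (η x)]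
  refine Finset.sum_congr rfl fun t _ => ?_
  congr 1
  change _ = chartCoeff _ _ _ _
  rw [chartCoeff, (chartAt (Cn n) p).left_inv hx, coeffAt]
  simp only [chartBasis_apply]

theorem isClassOf_chartClass (hφ : Continuous φ) {p : X} {g : Cn n → Coef n}
    (hg : IsCutoff (chartAt (Cn n) p).target g) : IsClassOf (chartClass φ p g) (chartForm p g) := by
  rw [IsClassOf]
  filter_upwards [coeFn_chartClass hφ p hg] with x hx
  rw [hx, chartFun]
  by_cases h : x ∈ (chartAt (Cn n) p).source
  · rw [indicator_of_mem h, coeffAt_borelFrame _ h,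
      formRep_chartForm ((chartAt (Cn n) p).map_source h)]
  · rw [indicator_of_notMem h]
    ext s
    change 0 = coeffAt _ _ _ _
    rw [coeffAt, chartForm_eq_zero fun h' => absurd h' h]
    rfl

theorem chartRep_of_isClassOf (hφ : Continuous φ) (p : X) {u : L2Forms n φ} {η : DiffForm n X}
    (h : IsClassOf u η) :
    ∀ᵐ y ∂(volume.restrict (chartAt (Cn n) p).target), chartRep p u y = formRep η p y := by
  filter_upwards [ae_target_of_ae hφ p h,
    ae_restrict_mem (chartAt (Cn n) p).open_target.measurableSet] with y hy hyt
  refine chartRep_eq_of_toFrame hyt ?_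
  rw [hy, coeffAt_borelFrame η ((chartAt (Cn n) p).map_target hyt),
    (chartAt (Cn n) p).right_inv hyt]

end TestForms

/-! ### The operator in a chart -/

section LocalSymbol

variable {n : ℕ} {X : Type*} [TopologicalSpace X] [ChartedSpace (Cn n) X]
  [IsManifold 𝓘(ℂ, Cn n) ω X]
  [RiemannianBundle (fun x : X => TangentSpace 𝓘(ℝ, Cn n) x)]
  [IsContMDiffRiemannianBundle 𝓘(ℝ, Cn n) ∞ (Cn n) (fun x : X => TangentSpace 𝓘(ℝ, Cn n) x)]
  [MeasurableSpace X] [BorelSpace X] [SecondCountableTopology X] {φ : X → ℝ}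

/-- The coefficients of `u` in the chart at `p`, lowered by the metric and the weight: the pairing
of `L²_*(X, φ)` with forms supported in the chart becomes the Euclidean pairing of coefficients. -/
def lowerRep (φ : X → ℝ) (p : X) (u : X → Coef n) (y : Cn n) : Coef n :=
  chartExp φ p y • formMetric p y (chartRep p u y)

/-- The inverse of the metric and the weight applied to `w`. -/
def raise (φ : X → ℝ) (p : X) (w : Cn n → Coef n) (y : Cn n) : Coef n :=
  (chartExp φ p y)⁻¹ • formMetricInv p y (w y)

theorem isCutoff_raise (hφ : Continuous φ) {p : X} {w : Cn n → Coef n}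
    (hw : IsCutoff (chartAt (Cn n) p).target w) :
    IsCutoff (chartAt (Cn n) p).target (raise φ p w) := by
  refine hw.of_eq_zero (chartAt (Cn n) p).open_target ?_ fun y hy => ?_
  · exact ((continuousOn_chartExp hφ p).inv₀ fun y _ => (chartExp_pos φ p y).ne').smul
      ((contDiffOn_formMetricInv p).continuousOn.clm_apply hw.continuous.continuousOn)
  · rw [raise, image_eq_zero_of_notMem_tsupport hy, map_zero, smul_zero]

theorem inner_chartClass_eq_lowerRep (hφ : Continuous φ) {p : X} {g : Cn n → Coef n}
    (hg : IsCutoff (chartAt (Cn n) p).target g) (u : L2Forms n φ) :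
    inner ℂ u (chartClass φ p g) = ∫ y, inner ℂ (lowerRep φ p u y) (g y) := by
  rw [inner_chartClass hφ p hg]
  refine integral_congr_ae (Eventually.of_forall fun y => ?_)
  simp only
  by_cases hy : y ∈ (chartAt (Cn n) p).target
  · rw [lowerRep, RCLike.real_smul_eq_coe_smul (K := ℂ), RCLike.real_smul_eq_coe_smul (K := ℂ),
      inner_smul_right, inner_smul_left, inner_formMetric_left hy, RCLike.conj_ofReal]
  · rw [hg.eq_zero hy, map_zero, smul_zero, inner_zero_right, inner_zero_right]

/-- The class of `raise φ p w` represents the Euclidean pairing with `w` of the coefficients in the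
chart at `p`. -/
theorem inner_chartClass_raise (hφ : Continuous φ) {p : X} {w : Cn n → Coef n}
    (hw : IsCutoff (chartAt (Cn n) p).target w) (u : L2Forms n φ) :
    inner ℂ u (chartClass φ p (raise φ p w)) = ∫ y, inner ℂ (chartRep p u y) (w y) := by
  rw [inner_chartClass hφ p (isCutoff_raise hφ hw)]
  refine integral_congr_ae (Eventually.of_forall fun y => ?_)
  simp only
  by_cases hy : y ∈ (chartAt (Cn n) p).target
  · congr 1
    rw [raise, ContinuousLinearMap.map_smul_of_tower, formMetric_inv_apply hy, smul_smul,
      mul_inv_cancel₀ (chartExp_pos φ p y).ne', one_smul]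
  · rw [raise, hw.eq_zero hy, map_zero, smul_zero, map_zero, smul_zero]

theorem exists_norm_clm_le {F : Type*} [NormedAddCommGroup F] {K : Set (Cn n)} (hK : IsCompact K)
    {f : Cn n → F} (hf : ContinuousOn f K) : ∃ C : ℝ, 0 < C ∧ ∀ y ∈ K, ‖f y‖ ≤ C := by
  obtain ⟨C, hC⟩ := hK.bddAbove_image hf.norm
  exact ⟨max C 1, by positivity, fun y hy => (hC (mem_image_of_mem _ hy)).trans (le_max_left _ _)⟩

theorem exists_lowerRep_le (hφ : Continuous φ) (p : X) {K : Set (Cn n)}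
    (hK : IsCompact K) (hKt : K ⊆ (chartAt (Cn n) p).target) :
    ∃ C : ℝ, 0 < C ∧ ∀ u : L2Forms n φ, MemLp (lowerRep φ p u) 2 (volume.restrict K) ∧
      ∫ y in K, ‖lowerRep φ p u y‖ ^ 2 ≤ C * ‖u‖ ^ 2 := by
  have ht := (chartAt (Cn n) p).open_target.measurableSet
  obtain ⟨C₁, hC₁, h1⟩ := exists_lintegral_chartRep_le hφ p hK hKt
  have hcont : ContinuousOn (fun y => chartExp φ p y • formMetric p y) (chartAt (Cn n) p).target :=
    (continuousOn_chartExp hφ p).smul (contDiffOn_formMetric p).continuousOn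
  obtain ⟨C₂, hC₂, h2⟩ := exists_norm_clm_le hK (hcont.mono hKt)
  have hle : ∀ (u : L2Forms n φ), ∀ y ∈ K, ‖lowerRep φ p u y‖ ≤ C₂ * ‖chartRep p u y‖ := by
    intro u y hy
    exact (ContinuousLinearMap.le_opNorm (chartExp φ p y • formMetric p y) _).trans
      (by gcongr; exact h2 y hy)
  refine ⟨C₂ ^ 2 * C₁, by positivity, fun u => ?_⟩
  have hm : AEStronglyMeasurable (lowerRep φ p u) (volume.restrict K) := by
    have happ : Continuous fun q : (Coef n →L[ℂ] Coef n) × Coef n => q.1 q.2 :=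
      isBoundedBilinearMap_apply.continuous
    refine (happ.comp_aestronglyMeasurable (AEStronglyMeasurable.prodMk
      (hcont.aestronglyMeasurable ht) (aestronglyMeasurable_chartRep hφ p u))).mono_measure
      (Measure.restrict_mono hKt le_rfl)
  have hmem : MemLp (lowerRep φ p u) 2 (volume.restrict K) := by
    refine (h1 u).1.of_le_mul (c := C₂) hm ?_
    filter_upwards [ae_restrict_mem hK.measurableSet] with y hy using hle u y hy
  refine ⟨hmem, ?_⟩
  calc ∫ y in K, ‖lowerRep φ p u y‖ ^ 2 ≤ ∫ y in K, C₂ ^ 2 * ‖chartRep p u y‖ ^ 2 := by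
        refine setIntegral_mono_on (hmem.integrable_norm_pow two_ne_zero)
          (((h1 u).1.integrable_norm_pow two_ne_zero).const_mul _) hK.measurableSet fun y hy => ?_
        rw [← mul_pow]
        gcongr
        exact hle u y hy
    _ ≤ C₂ ^ 2 * (C₁ * ‖u‖ ^ 2) := by
        rw [integral_const_mul]
        gcongr
        exact (h1 u).2
    _ = _ := by ring

theorem eq_zero_of_chartRep_eq_zero (hφ : Continuous φ) {u : L2Forms n φ}
    (h : ∀ p : X, ∀ᵐ y ∂(volume.restrict (chartAt (Cn n) p).target), chartRep p u y = 0) :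
    u = 0 := by
  rw [Lp.eq_zero_iff_ae_eq_zero]
  change weightedVolume n φ {x | ¬ u x = (0 : X → Coef n) x} = 0
  refine measure_null_of_locally_null _ fun p _ => ?_
  refine ⟨_, inter_mem_nhdsWithin _ ((chartAt (Cn n) p).open_source.mem_nhds
    (mem_chart_source _ p)), ?_⟩
  have hs := (chartAt (Cn n) p).open_source.measurableSet
  have hm : AEMeasurable (fun x => ‖u x‖ₑ) ((weightedVolume n φ).restrict
      (chartAt (Cn n) p).source) := (Lp.aestronglyMeasurable u).restrict.enorm
  have h1 := lintegral_source hφ p hm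
  have h2 : ∫⁻ y in (chartAt (Cn n) p).target, ENNReal.ofReal (chartWeight φ p y) *
      ‖u ((chartAt (Cn n) p).symm y)‖ₑ = 0 := by
    rw [lintegral_eq_zero_of_ae_eq_zero]
    filter_upwards [h p, ae_restrict_mem (chartAt (Cn n) p).open_target.measurableSet] with y hy hyt
    rw [← toFrame_chartRep hyt u, hy, map_zero, enorm_zero, mul_zero]
    rfl
  rw [h2, lintegral_eq_zero_iff' hm, EventuallyEq, ae_restrict_iff' hs] at h1
  refine measure_mono_null ?_ h1
  rintro x ⟨hx, hxs⟩ hx'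
  exact hx (by simpa using hx' hxs)

/-- The first order operator `∑ aᵢ ∂ᵢ + b`. -/
def diffOp (a : Fin (2 * n) → Cn n → Coef n →L[ℂ] Coef n) (b : Cn n → Coef n →L[ℂ] Coef n)
    (g : Cn n → Coef n) (y : Cn n) : Coef n :=
  b y (g y) + ∑ i, a i y (fderiv ℝ g y (stdBasis n i))

theorem fderiv_eq_zero_of_notMem_tsupport {E F : Type*} [NormedAddCommGroup E] [NormedSpace ℝ E]
    [NormedAddCommGroup F] [NormedSpace ℝ F] {g : E → F} {y : E} (hy : y ∉ tsupport g) :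
    fderiv ℝ g y = 0 := by
  by_contra h
  exact hy (support_fderiv_subset ℝ h)

theorem diffOp_eq_zero {a : Fin (2 * n) → Cn n → Coef n →L[ℂ] Coef n}
    {b : Cn n → Coef n →L[ℂ] Coef n} {g : Cn n → Coef n} {y : Cn n} (hy : y ∉ tsupport g) :
    diffOp a b g y = 0 := by
  simp [diffOp, fderiv_eq_zero_of_notMem_tsupport hy, image_eq_zero_of_notMem_tsupport hy]

theorem isCutoff_diffOp {a : Fin (2 * n) → Cn n → Coef n →L[ℂ] Coef n}
    {b : Cn n → Coef n →L[ℂ] Coef n} {U : Set (Cn n)} (hU : IsOpen U)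
    (ha : ∀ i, ContinuousOn (a i) U) (hb : ContinuousOn b U) {g : Cn n → Coef n}
    (hg : IsCutoff U g) (hs : ContDiff ℝ ∞ g) : IsCutoff U (diffOp a b g) := by
  refine hg.of_eq_zero hU ?_ fun y hy => diffOp_eq_zero hy
  refine (hb.clm_apply hg.continuous.continuousOn).add (continuousOn_finsetSum _ fun i _ => ?_)
  exact (ha i).clm_apply (((hs.continuous_fderiv (by simp)).clm_apply continuous_const).continuousOn)

/-- In the chart at `p`, the operator `T` is `∑ aᵢ ∂ᵢ + b` on smooth forms. -/
structure IsLocalSymbol (T : L2Forms n φ →ₗ.[ℂ] L2Forms n φ) (p : X)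
    (a : Fin (2 * n) → Cn n → Coef n →L[ℂ] Coef n) (b : Cn n → Coef n →L[ℂ] Coef n) : Prop where
  contDiffOn_a : ∀ i, ContDiffOn ℝ ∞ (a i) (chartAt (Cn n) p).target
  contDiffOn_b : ContDiffOn ℝ ∞ b (chartAt (Cn n) p).target
  acts : ∀ η, IsTestForm univ η → ∀ u f : L2Forms n φ, IsClassOf u η → (u, f) ∈ T.graph →
    ∀ᵐ y ∂(volume.restrict (chartAt (Cn n) p).target), chartRep p f y = diffOp a b (formRep η p) y
  mem_graph : ∀ g : Cn n → Coef n, IsCutoff (chartAt (Cn n) p).target g → ContDiff ℝ ∞ g →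
    (chartClass φ p g, chartClass φ p (diffOp a b g)) ∈ T.graph

theorem coeffCLM_apply (m : Finset (Fin (2 * n)) → Finset (Fin (2 * n)) → ℂ) (c : Coef n)
    (s : Finset (Fin (2 * n))) :
    (Matrix.toEuclideanCLM (𝕜 := ℂ) (Matrix.of m) : Coef n →L[ℂ] Coef n) c s = ∑ t, m s t * c t := by
  simp [Matrix.ofLp_toEuclideanCLM, Matrix.mulVec, dotProduct]

theorem contDiffOn_coeffCLM {m : Finset (Fin (2 * n)) → Finset (Fin (2 * n)) → Cn n → ℂ}
    {U : Set (Cn n)} (hm : ∀ s t, ContDiffOn ℝ ∞ (m s t) U) :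
    ContDiffOn ℝ ∞ (fun y => (Matrix.toEuclideanCLM (𝕜 := ℂ) (Matrix.of fun s t => m s t y) :
      Coef n →L[ℂ] Coef n)) U := by
  have h1 : ∀ y, (Matrix.toEuclideanCLM (𝕜 := ℂ) (Matrix.of fun s t => m s t y) :
      Coef n →L[ℂ] Coef n) = ∑ s, ∑ t, m s t y •
      (Matrix.toEuclideanCLM (𝕜 := ℂ) (Matrix.single s t (1 : ℂ)) : Coef n →L[ℂ] Coef n) := by
    intro y
    conv_lhs => rw [Matrix.matrix_eq_sum_single (Matrix.of fun s t => m s t y)]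
    rw [map_sum]
    refine Finset.sum_congr rfl fun s _ => ?_
    rw [map_sum]
    refine Finset.sum_congr rfl fun t _ => ?_
    rw [← map_smul, Matrix.smul_single]
    simp
  simp only [h1]
  exact ContDiffOn.sum fun s _ => ContDiffOn.sum fun t _ => (hm s t).smul contDiffOn_const

theorem exists_isLocalSymbol [T2Space X] (hφ : Continuous φ) {T : L2Forms n φ →ₗ.[ℂ] L2Forms n φ}
    (hT : IsClosedDiffOperator T) (p : X) : ∃ a b, IsLocalSymbol T p a b := by
  obtain ⟨A, hA, hTA⟩ := hT.acts
  choose a b ha hb hab using hA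
  let a' : ∀ q : X, Fin (2 * n) → Cn n → Coef n →L[ℂ] Coef n := fun q i y =>
    Matrix.toEuclideanCLM (𝕜 := ℂ) (Matrix.of fun s t => a q i s t y)
  let b' : ∀ q : X, Cn n → Coef n →L[ℂ] Coef n := fun q y =>
    Matrix.toEuclideanCLM (𝕜 := ℂ) (Matrix.of fun s t => b q s t y)
  have ha' : ∀ q i, ContDiffOn ℝ ∞ (a' q i) (chartAt (Cn n) q).target := fun q i =>
    contDiffOn_coeffCLM (ha q i)
  have hb' : ∀ q, ContDiffOn ℝ ∞ (b' q) (chartAt (Cn n) q).target := fun q =>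
    contDiffOn_coeffCLM (hb q)
  have hrep : ∀ (q : X) (η : DiffForm n X), IsSmoothForm η → ∀ y ∈ (chartAt (Cn n) q).target,
      formRep (A η) q y = diffOp (a' q) (b' q) (formRep η q) y := by
    intro q η hη y hy
    ext s
    have h1 := hab q η hη s y hy
    change chartCoeff (A η) q s y = _
    rw [h1, diffOp, Finset.sum_add_distrib, PiLp.add_apply, WithLp.ofLp_sum, Finset.sum_apply,
      coeffCLM_apply]
    congr 1
    rw [Finset.sum_comm]
    refine Finset.sum_congr rfl fun i _ => ?_
    rw [coeffCLM_apply]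
    refine Finset.sum_congr rfl fun t _ => ?_
    rw [fderiv_formRep hη q hy]
  refine ⟨a' p, b' p, ha' p, hb' p, fun η hη u f hu hf => ?_, fun g hg hs => ?_⟩
  · obtain ⟨f', hf', hfc⟩ := hTA η hη u hu
    have he : f = f' := T.mem_graph_snd_inj hf hf' rfl
    subst he
    filter_upwards [chartRep_of_isClassOf hφ p hfc,
      ae_restrict_mem (chartAt (Cn n) p).open_target.measurableSet] with y hy hyt
    rw [hy, hrep p η hη.1 y hyt]
  · have hη := isTestForm_chartForm hg hs (subset_univ _)
    obtain ⟨f, hf, hfc⟩ := hTA _ hη _ (isClassOf_chartClass hφ hg)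
    have hcut := isCutoff_diffOp (chartAt (Cn n) p).open_target (fun i => (ha' p i).continuousOn)
      (hb' p).continuousOn hg hs
    convert hf
    refine Lp.ext ?_
    filter_upwards [hfc, coeFn_chartClass hφ p hcut] with x hx hx'
    rw [hx, hx', chartFun]
    by_cases h : x ∈ (chartAt (Cn n) p).source
    · have hy := (chartAt (Cn n) p).map_source h
      rw [indicator_of_mem h, coeffAt_borelFrame _ h, hrep p _ hη.1 _ hy]
      congr 1
      have he : formRep (chartForm p g) p =ᶠ[𝓝 (chartAt (Cn n) p x)] g := by
        filter_upwards [(chartAt (Cn n) p).open_target.mem_nhds hy] with y hy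
        exact formRep_chartForm hy
      rw [diffOp, diffOp, he.fderiv_eq, he.eq_of_nhds]
    · rw [indicator_of_notMem h, coeffAt_borelFrame _ (mem_chart_source (Cn n) x),
        hrep x _ hη.1 _ (mem_chart_target _ x)]
      have hnot : x ∉ (chartAt (Cn n) p).symm '' tsupport g := fun ⟨y', hy', he⟩ =>
        h (he ▸ (chartAt (Cn n) p).map_target (hg.subset hy'))
      have he : formRep (chartForm p g) x =ᶠ[𝓝 (chartAt (Cn n) x x)] fun _ => 0 := by
        filter_upwards [((chartAt (Cn n) x).isOpen_inter_preimage_symm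
          (isCompact_image_tsupport hg).isClosed.isOpen_compl).mem_nhds
          ⟨mem_chart_target _ x, by simpa using hnot⟩] with y hy
        ext s
        change chartCoeff _ _ _ _ = 0
        rw [chartCoeff, coeffAt, chartForm_eq_zero_of_notMem hy.2]
        rfl
      rw [diffOp, he.fderiv_eq, he.eq_of_nhds]
      simp

variable (n φ) in
/-- The classes of the smooth forms with compact support. -/
def testForms : Submodule ℂ (L2Forms n φ) where
  carrier := {u | ∃ η : DiffForm n X, IsTestForm univ η ∧ IsClassOf u η}
  zero_mem' := by
    refine ⟨0, ⟨fun p s => contDiffOn_const (c := (0 : ℂ)), ∅, isCompact_empty, subset_univ _,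
      fun _ _ => rfl⟩, ?_⟩
    filter_upwards [Lp.coeFn_zero (Coef n) 2 (weightedVolume n φ)] with x hx
    rw [hx]
    rfl
  add_mem' := by
    rintro u v ⟨η, ⟨hs, K, hK, -, h0⟩, hc⟩ ⟨η', ⟨hs', K', hK', -, h0'⟩, hc'⟩
    refine ⟨η + η', ⟨fun p s => (hs p s).add (hs' p s), K ∪ K', hK.union hK', subset_univ _,
      fun x hx => ?_⟩, ?_⟩
    · rw [Pi.add_apply, h0 x fun h => hx (Or.inl h), h0' x fun h => hx (Or.inr h), add_zero]
    · filter_upwards [hc, hc', Lp.coeFn_add u v] with x h1 h2 h3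
      rw [h3, Pi.add_apply, h1, h2]
      rfl
  smul_mem' := by
    rintro c u ⟨η, ⟨hs, K, hK, -, h0⟩, hc⟩
    refine ⟨c • η, ⟨fun p s => (hs p s).const_smul c, K, hK, subset_univ _, fun x hx => ?_⟩, ?_⟩
    · rw [Pi.smul_apply, h0 x hx, smul_zero]
    · filter_upwards [hc, Lp.coeFn_smul c u] with x h1 h2
      rw [h2, Pi.smul_apply, h1]
      rfl

/-- A form orthogonal to all smooth forms with compact support has vanishing lowered coefficients in
each chart, by the fundamental lemma of the calculus of variations. -/
theorem dense_testForms [T2Space X] (hφ : Continuous φ) :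
    Dense (testForms n φ : Set (L2Forms n φ)) := by
  rw [Submodule.dense_iff_topologicalClosure_eq_top, Submodule.topologicalClosure_eq_top_iff,
    Submodule.eq_bot_iff]
  intro u hu
  refine eq_zero_of_chartRep_eq_zero hφ fun p => ?_
  have ht := (chartAt (Cn n) p).open_target
  have hloc : LocallyIntegrableOn (lowerRep φ p u) (chartAt (Cn n) p).target volume := by
    rw [locallyIntegrableOn_iff ht.isLocallyClosed]
    intro K hKt hK
    obtain ⟨C, -, hC⟩ := exists_lowerRep_le hφ p hK hKt
    have : IsFiniteMeasure (volume.restrict K) := ⟨by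
      rw [Measure.restrict_apply_univ]
      exact hK.measure_lt_top⟩
    exact (hC u).1.integrable one_le_two
  have h0 := ht.ae_eq_zero_of_integral_contDiff_smul_eq_zero hloc fun γ hγ hγc hγs => by
    refine ext_inner_right ℂ fun c => ?_
    have hcut : IsCutoff (chartAt (Cn n) p).target γ := ⟨hγ.continuous, hγc, hγs⟩
    have hg : IsCutoff (chartAt (Cn n) p).target fun y => γ y • c :=
      hcut.of_eq_zero ht (hγ.continuous.smul continuous_const).continuousOn fun y hy => by
        rw [image_eq_zero_of_notMem_tsupport hy, zero_smul]
    have h1 := inner_chartClass_eq_lowerRep hφ hg u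
    rw [(Submodule.mem_orthogonal' _ _).1 hu _ ⟨_, isTestForm_chartForm hg
      (hγ.smul contDiff_const) (subset_univ _), isClassOf_chartClass hφ hg⟩] at h1
    have hint : Integrable fun y => γ y • lowerRep φ p u y :=
      (locallyIntegrableOn_iff ht.isLocallyClosed).1 hloc (tsupport γ) hγs hγc
        |>.continuousOn_smul hγ.continuous.continuousOn hγc |>.integrable_of_forall_notMem_eq_zero
        fun y hy => by rw [image_eq_zero_of_notMem_tsupport hy, zero_smul]
    rw [inner_zero_left, ← inner_conj_symm, ← integral_inner hint, ← integral_conj, h1]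
    refine integral_congr_ae (Eventually.of_forall fun y => ?_)
    simp only
    rw [inner_conj_symm, RCLike.real_smul_eq_coe_smul (K := ℂ),
      RCLike.real_smul_eq_coe_smul (K := ℂ), inner_smul_right, inner_smul_left, RCLike.conj_ofReal]
  rw [ae_restrict_iff' ht.measurableSet]
  filter_upwards [h0] with y hy hyt
  have h1 := hy hyt
  rw [lowerRep, smul_eq_zero_iff_right (chartExp_pos φ p y).ne'] at h1
  rw [← formMetricInv_apply hyt (chartRep p u y), h1, map_zero]

end LocalSymbol

/-! ### Integration by parts -/

section Flat

variable {n : ℕ}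

theorem IsCutoff.contDiff_of_eq_zero {E F F' : Type*} [NormedAddCommGroup E] [NormedSpace ℝ E]
    [NormedAddCommGroup F] [NormedAddCommGroup F'] [NormedSpace ℝ F'] {U : Set E} (hU : IsOpen U)
    {g : E → F} (hg : IsCutoff U g) {h : E → F'} (hc : ContDiffOn ℝ ∞ h U)
    (h0 : ∀ y, y ∉ tsupport g → h y = 0) : ContDiff ℝ ∞ h := by
  rw [contDiff_iff_contDiffAt]
  intro y
  by_cases hy : y ∈ U
  · exact hc.contDiffAt (hU.mem_nhds hy)
  · refine (contDiffAt_const (c := (0 : F'))).congr_of_eventuallyEq ?_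
    filter_upwards [(isClosed_tsupport g).isOpen_compl.mem_nhds
        (fun h' => hy (hg.subset h'))] with z hz
    exact h0 z hz

theorem contDiffOn_clm_apply_real {E : Type*} [NormedAddCommGroup E] [NormedSpace ℝ E]
    {c : E → Coef n →L[ℂ] Coef n} {u : E → Coef n} {U : Set E} {k : ℕ∞}
    (hc : ContDiffOn ℝ k c U) (hu : ContDiffOn ℝ k u U) :
    ContDiffOn ℝ k (fun y => c y (u y)) U := by
  have h1 : ContDiffOn ℝ k (fun y => ContinuousLinearMap.restrictScalarsL ℂ (Coef n) (Coef n) ℝ ℝ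
      (c y)) U := (ContinuousLinearMap.contDiff _).comp_contDiffOn hc
  exact h1.clm_apply hu

theorem hasFDerivAt_clm_apply_real {E : Type*} [NormedAddCommGroup E] [NormedSpace ℝ E]
    {c : E → Coef n →L[ℂ] Coef n} {u : E → Coef n} {y : E}
    (hc : DifferentiableAt ℝ c y) (hu : DifferentiableAt ℝ u y) :
    DifferentiableAt ℝ (fun y => c y (u y)) y ∧ ∀ e, fderiv ℝ (fun y => c y (u y)) y e =
      fderiv ℝ c y e (u y) + c y (fderiv ℝ u y e) := by
  let L := ContinuousLinearMap.restrictScalarsL ℂ (Coef n) (Coef n) ℝ ℝ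
  have h1 : HasFDerivAt (fun y => L (c y)) (L.comp (fderiv ℝ c y)) y :=
    L.hasFDerivAt.comp y hc.hasFDerivAt
  have h2 := h1.clm_apply hu.hasFDerivAt
  refine ⟨h2.differentiableAt, fun e => ?_⟩
  rw [show (fun y => c y (u y)) = fun y => L (c y) (u y) from rfl, h2.fderiv, add_comm]
  rfl

theorem hasCompactSupport_fderiv_apply {F' : Type*} [NormedAddCommGroup F'] [NormedSpace ℝ F']
    {F : Cn n → F'} (hc : HasCompactSupport F) (e : Cn n) :
    HasCompactSupport fun y => fderiv ℝ F y e :=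
  hc.mono' fun y hy => by
    by_contra h
    have h1 : fderiv ℝ F y e ≠ 0 := hy
    rw [fderiv_eq_zero_of_notMem_tsupport h] at h1
    exact h1 rfl

theorem integral_fderiv_eq_zero {F : Cn n → ℂ} (hF : ContDiff ℝ ∞ F) (hc : HasCompactSupport F)
    (e : Cn n) : ∫ y, fderiv ℝ F y e = 0 := by
  have hcont : Continuous fun y => fderiv ℝ F y e :=
    (hF.continuous_fderiv (by simp)).clm_apply continuous_const
  have hsupp := hasCompactSupport_fderiv_apply hc e
  have h1 := integral_smul_fderiv_eq_neg_fderiv_smul_of_integrable (μ := volume) (𝕜 := ℝ)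
    (f := fun _ : Cn n => (1 : ℝ)) (g := F) (v := e) (by simp)
    (by simpa using hcont.integrable_of_hasCompactSupport hsupp)
    (by simpa using hF.continuous.integrable_of_hasCompactSupport hc)
    (fun x _ => differentiableAt_const _) (fun x _ => hF.differentiable (by simp) x)
  simpa using h1

/-- The zero order coefficient of the formal transpose of `∑ aᵢ ∂ᵢ + b`. -/
def transposeB (a : Fin (2 * n) → Cn n → Coef n →L[ℂ] Coef n) (b : Cn n → Coef n →L[ℂ] Coef n)
    (y : Cn n) : Coef n →L[ℂ] Coef n :=
  ContinuousLinearMap.adjoint (b y) -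
    ∑ i, ContinuousLinearMap.adjoint (fderiv ℝ (a i) y (stdBasis n i))

/-- The formal transpose of `∑ aᵢ ∂ᵢ + b`, for the Euclidean pairing. -/
def transposeOp (a : Fin (2 * n) → Cn n → Coef n →L[ℂ] Coef n) (b : Cn n → Coef n →L[ℂ] Coef n)
    (w : Cn n → Coef n) : Cn n → Coef n :=
  diffOp (fun i y => -ContinuousLinearMap.adjoint (a i y)) (transposeB a b) w

variable {U : Set (Cn n)} {a : Fin (2 * n) → Cn n → Coef n →L[ℂ] Coef n}
  {b : Cn n → Coef n →L[ℂ] Coef n}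

theorem continuousOn_adjoint {f : Cn n → Coef n →L[ℂ] Coef n} (hf : ContinuousOn f U) :
    ContinuousOn (fun y => ContinuousLinearMap.adjoint (f y)) U :=
  (LinearIsometryEquiv.continuous ContinuousLinearMap.adjoint).comp_continuousOn hf

theorem continuousOn_transposeB (hU : IsOpen U) (ha : ∀ i, ContDiffOn ℝ ∞ (a i) U)
    (hb : ContDiffOn ℝ ∞ b U) : ContinuousOn (transposeB a b) U :=
  (continuousOn_adjoint hb.continuousOn).sub (continuousOn_finsetSum _ fun i _ =>
    continuousOn_adjoint (((ha i).continuousOn_fderiv_of_isOpen hU (by simp)).clm_apply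
      continuousOn_const))

theorem isCutoff_transposeOp (hU : IsOpen U) (ha : ∀ i, ContDiffOn ℝ ∞ (a i) U)
    (hb : ContDiffOn ℝ ∞ b U) {w : Cn n → Coef n} (hw : IsCutoff U w) (hs : ContDiff ℝ ∞ w) :
    IsCutoff U (transposeOp a b w) :=
  isCutoff_diffOp hU (fun i => (continuousOn_adjoint (ha i).continuousOn).neg)
    (continuousOn_transposeB hU ha hb) hw hs

theorem continuousOn_diffOp (hU : IsOpen U) (ha : ∀ i, ContinuousOn (a i) U)
    (hb : ContinuousOn b U) {v : Cn n → Coef n} (hv : ContDiffOn ℝ ∞ v U) :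
    ContinuousOn (diffOp a b v) U :=
  (hb.clm_apply hv.continuousOn).add (continuousOn_finsetSum _ fun i _ =>
    (ha i).clm_apply ((hv.continuousOn_fderiv_of_isOpen hU (by simp)).clm_apply
      continuousOn_const))

/-- Green's identity for a first order operator. -/
theorem integral_inner_diffOp (hU : IsOpen U) (ha : ∀ i, ContDiffOn ℝ ∞ (a i) U)
    (hb : ContDiffOn ℝ ∞ b U) {v w : Cn n → Coef n} (hv : ContDiffOn ℝ ∞ v U)
    (hw : IsCutoff U w) (hs : ContDiff ℝ ∞ w) :
    ∫ y, inner ℂ (diffOp a b v y) (w y) = ∫ y, inner ℂ (v y) (transposeOp a b w y) := by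
  let F : Fin (2 * n) → Cn n → ℂ := fun i y => inner ℂ (a i y (v y)) (w y)
  have hF0 : ∀ i y, y ∉ tsupport w → F i y = 0 := fun i y hy => by
    simp only [F, image_eq_zero_of_notMem_tsupport hy, inner_zero_right]
  have hFon : ∀ i, ContDiffOn ℝ ∞ (F i) U := fun i =>
    (contDiffOn_clm_apply_real (ha i) hv).inner ℂ hs.contDiffOn
  have hF : ∀ i, ContDiff ℝ ∞ (F i) := fun i => hw.contDiff_of_eq_zero hU (hFon i) (hF0 i)
  have hFc : ∀ i, IsCutoff U (F i) := fun i => hw.of_eq_zero hU (hFon i).continuousOn (hF0 i)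
  have hcut1 : IsCutoff U fun y => inner ℂ (diffOp a b v y) (w y) :=
    hw.of_eq_zero hU ((continuousOn_diffOp hU (fun i => (ha i).continuousOn) hb.continuousOn
      hv).inner hs.continuous.continuousOn) fun y hy => by
      rw [image_eq_zero_of_notMem_tsupport hy, inner_zero_right]
  have hcut2 : IsCutoff U fun y => inner ℂ (v y) (transposeOp a b w y) :=
    hw.of_eq_zero hU (hv.continuousOn.inner
      (isCutoff_transposeOp hU ha hb hw hs).continuous.continuousOn) fun y hy => by
      rw [transposeOp, diffOp_eq_zero hy, inner_zero_right]
  rw [← sub_eq_zero, ← integral_sub hcut1.integrable hcut2.integrable]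
  have hpt : ∀ y, inner ℂ (diffOp a b v y) (w y) - inner ℂ (v y) (transposeOp a b w y) =
      ∑ i, fderiv ℝ (F i) y (stdBasis n i) := by
    intro y
    by_cases hy : y ∈ U
    · have hd : ∀ {F' : Type} [NormedAddCommGroup F'] [NormedSpace ℝ F'] {f : Cn n → F'},
          ContDiffOn ℝ ∞ f U → DifferentiableAt ℝ f y := fun h =>
        (h.contDiffAt (hU.mem_nhds hy)).differentiableAt (by simp)
      have hFd : ∀ i, fderiv ℝ (F i) y (stdBasis n i) =
          inner ℂ (a i y (v y)) (fderiv ℝ w y (stdBasis n i)) +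
          inner ℂ (fderiv ℝ (a i) y (stdBasis n i) (v y) +
            a i y (fderiv ℝ v y (stdBasis n i))) (w y) := by
        intro i
        have h1 := hasFDerivAt_clm_apply_real (hd (ha i)) (hd hv)
        rw [← h1.2]
        exact fderiv_inner_apply ℂ h1.1 (hs.differentiable (by simp) y) _
      simp only [hFd, diffOp, transposeOp, transposeB, inner_add_left, inner_add_right, sum_inner,
        inner_sum, ContinuousLinearMap.adjoint_inner_right, _root_.sub_apply, _root_.neg_apply,
        _root_.sum_apply, inner_sub_right, inner_neg_right, Finset.sum_add_distrib,
        Finset.sum_neg_distrib]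
      ring
    · have hy' : y ∉ tsupport w := fun h => hy (hw.subset h)
      rw [image_eq_zero_of_notMem_tsupport hy', inner_zero_right, transposeOp,
        diffOp_eq_zero hy', inner_zero_right, sub_zero]
      refine (Finset.sum_eq_zero fun i _ => ?_).symm
      rw [fderiv_eq_zero_of_notMem_tsupport fun h => hy ((hFc i).subset h)]
      rfl
  simp only [hpt]
  rw [integral_finsetSum]
  · exact Finset.sum_eq_zero fun i _ => integral_fderiv_eq_zero (hF i) (hFc i).compact _
  · intro i _
    exact Continuous.integrable_of_hasCompactSupport
      (((hF i).continuous_fderiv (by simp)).clm_apply continuous_const)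
      (hasCompactSupport_fderiv_apply (hFc i).compact _)

/-! ### Mollifiers -/

/-- Mollifiers of radius `ε` whose gradients have integral of order `1 / ε`. -/
theorem exists_mollifier (n : ℕ) : ∃ C : ℝ, 0 < C ∧ ∀ ε : ℝ, 0 < ε → ∃ ρ : Cn n → ℝ,
    ContDiff ℝ ∞ ρ ∧ (∀ x, 0 ≤ ρ x) ∧ (∀ x, ε ≤ ‖x‖ → ρ x = 0) ∧ ∫ x, ρ x = 1 ∧
      ∀ i, ε * ∫ x, ‖fderiv ℝ ρ x (stdBasis n i)‖ ≤ C := by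
  let f : ContDiffBump (0 : Cn n) := ⟨1 / 2, 1, by norm_num, by norm_num⟩
  let ρ : Cn n → ℝ := f.normed volume
  have hρ : ContDiff ℝ ∞ ρ := f.contDiff_normed
  let c : Fin (2 * n) → ℝ := fun i => ∫ x, ‖fderiv ℝ ρ x (stdBasis n i)‖
  have hc0 : ∀ i, 0 ≤ c i := fun i => integral_nonneg fun x => norm_nonneg _
  refine ⟨∑ i, c i + 1, by have := Finset.sum_nonneg fun i (_ : i ∈ Finset.univ) => hc0 i; linarith,
    fun ε hε => ⟨fun x => (ε ^ (2 * n))⁻¹ * ρ (ε⁻¹ • x), ?_, ?_, ?_, ?_, ?_⟩⟩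
  · exact contDiff_const.mul (hρ.comp (contDiff_const_smul _))
  · exact fun x => mul_nonneg (by positivity) (f.nonneg_normed _)
  · intro x hx
    have h1 : ρ (ε⁻¹ • x) = 0 := by
      have h2 : ε⁻¹ • x ∉ Function.support ρ := by
        rw [f.support_normed_eq, mem_ball_zero_iff, norm_smul, norm_inv, Real.norm_of_nonneg hε.le]
        change ¬ _ < (1 : ℝ)
        rw [not_lt, ← div_eq_inv_mul, one_le_div hε]
        exact hx
      exact Function.notMem_support.1 h2
    simp only [h1, mul_zero]
  · rw [integral_const_mul, Measure.integral_comp_inv_smul, finrank_Cn,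
      show ∫ x, ρ x = 1 from f.integral_normed, smul_eq_mul, mul_one,
      abs_of_nonneg (by positivity), inv_mul_cancel₀ (by positivity)]
  · intro i
    have h1 : ∀ x, fderiv ℝ (fun x => (ε ^ (2 * n))⁻¹ * ρ (ε⁻¹ • x)) x (stdBasis n i) =
        (ε ^ (2 * n))⁻¹ * (ε⁻¹ * fderiv ℝ ρ (ε⁻¹ • x) (stdBasis n i)) := by
      intro x
      have h2 : HasFDerivAt (fun x : Cn n => ε⁻¹ • x) (ε⁻¹ • ContinuousLinearMap.id ℝ (Cn n)) x :=
        (hasFDerivAt_id x).const_smul ε⁻¹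
      have h3 := (((hρ.differentiable (by simp)) (ε⁻¹ • x)).hasFDerivAt.comp x h2).const_mul
        (ε ^ (2 * n))⁻¹
      rw [show (fun x => (ε ^ (2 * n))⁻¹ * ρ (ε⁻¹ • x)) =
        fun y => (ε ^ (2 * n))⁻¹ * (ρ ∘ fun x => ε⁻¹ • x) y from rfl, h3.fderiv]
      simp
    simp only [h1, norm_mul, norm_inv, norm_pow, Real.norm_of_nonneg hε.le]
    rw [integral_const_mul, integral_const_mul,
      Measure.integral_comp_inv_smul volume (fun x => ‖fderiv ℝ ρ x (stdBasis n i)‖), finrank_Cn,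
      smul_eq_mul, abs_of_nonneg (by positivity)]
    have h4 : ε * ((ε ^ (2 * n))⁻¹ * (ε⁻¹ * (ε ^ (2 * n) * c i))) = c i := by
      field_simp
    rw [h4]
    have := Finset.single_le_sum (fun i _ => hc0 i) (Finset.mem_univ i)
    linarith

/-- Averages do not increase the norm in `L²`. -/
theorem integral_sq_convolution_le {ρ β : Cn n → ℝ} (hρ : Continuous ρ)
    (hρc : HasCompactSupport ρ) (hρ0 : ∀ x, 0 ≤ ρ x) (hρ1 : ∫ x, ρ x = 1) (hβ : Integrable β)
    (hβ2 : Integrable fun x => β x ^ 2) :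
    Integrable (fun x => (∫ y, ρ (x - y) * β y) ^ 2) ∧
      ∫ x, (∫ y, ρ (x - y) * β y) ^ 2 ≤ ∫ x, β x ^ 2 := by
  have hρi : Integrable ρ := hρ.integrable_of_hasCompactSupport hρc
  have hconv : ∀ f : Cn n → ℝ, (fun x => ∫ y, ρ (x - y) * f y) =
      convolution ρ f (ContinuousLinearMap.mul ℝ ℝ) volume := by
    intro f
    ext x
    rw [convolution_mul_swap]
  obtain ⟨M, hM⟩ := hρ.bounded_above_of_compact_support hρc
  have hint : ∀ {f : Cn n → ℝ}, Integrable f → ∀ x, Integrable fun y => ρ (x - y) * f y := by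
    intro f hf x
    exact hf.bdd_mul (c := M) (hρ.comp (continuous_const.sub continuous_id)).aestronglyMeasurable
      (Eventually.of_forall fun y => hM _)
  have hpt : ∀ x, (∫ y, ρ (x - y) * β y) ^ 2 ≤ ∫ y, ρ (x - y) * β y ^ 2 := by
    intro x
    set m := ∫ y, ρ (x - y) * β y with hm
    have h1 : 0 ≤ ∫ y, ρ (x - y) * (β y - m) ^ 2 :=
      integral_nonneg fun y => mul_nonneg (hρ0 _) (sq_nonneg _)
    have hρx : Integrable fun y => ρ (x - y) := hρi.comp_sub_left x
    have h2 : ∀ y, ρ (x - y) * (β y - m) ^ 2 =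
        ρ (x - y) * β y ^ 2 - 2 * m * (ρ (x - y) * β y) + m ^ 2 * ρ (x - y) := fun y => by ring
    simp only [h2] at h1
    have h3 : Integrable fun y => ρ (x - y) * β y ^ 2 - 2 * m * (ρ (x - y) * β y) :=
      (hint hβ2 x).sub ((hint hβ x).const_mul _)
    rw [integral_add h3 (hρx.const_mul _),
      integral_sub (hint hβ2 x) ((hint hβ x).const_mul _), integral_const_mul, integral_const_mul,
      ← hm, integral_sub_left_eq_self ρ volume x, hρ1] at h1
    nlinarith
  have hi2 : Integrable fun x => ∫ y, ρ (x - y) * β y ^ 2 := by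
    rw [hconv]
    exact hρi.integrable_convolution _ hβ2
  have hi1 : Integrable fun x => ∫ y, ρ (x - y) * β y := by
    rw [hconv]
    exact hρi.integrable_convolution _ hβ
  have hi : Integrable (fun x => (∫ y, ρ (x - y) * β y) ^ 2) := by
    refine hi2.mono' (hi1.aestronglyMeasurable.pow 2) (Eventually.of_forall fun x => ?_)
    rw [Real.norm_of_nonneg (sq_nonneg _)]
    exact hpt x
  refine ⟨hi, (integral_mono hi hi2 hpt).trans_eq ?_⟩
  rw [hconv, integral_convolution (L := ContinuousLinearMap.mul ℝ ℝ) hρi hβ2]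
  simp [hρ1]

end Flat

section Mollified

variable {n : ℕ}

/-- The integral of a mollifier `ρ` centred at `x` against `κ`. -/
def mollify (ρ κ : Cn n → ℝ) (x : Cn n) : ℝ := ∫ y, ρ (x - y) * κ y

theorem mollify_eq (ρ κ : Cn n → ℝ) :
    mollify ρ κ = convolution ρ κ (ContinuousLinearMap.mul ℝ ℝ) volume := by
  ext x
  rw [convolution_mul_swap, mollify]

theorem contDiff_mollify {ρ κ : Cn n → ℝ} (hρ : ContDiff ℝ ∞ ρ) (hρc : HasCompactSupport ρ)
    (hκ : Continuous κ) : ContDiff ℝ ∞ (mollify ρ κ) := by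
  rw [mollify_eq]
  exact hρc.contDiff_convolution_left _ hρ hκ.locallyIntegrable

theorem fderiv_mollify {ρ κ : Cn n → ℝ} (hρ : ContDiff ℝ ∞ ρ) (hρc : HasCompactSupport ρ)
    (hκ : Continuous κ) (x e : Cn n) :
    fderiv ℝ (mollify ρ κ) x e = ∫ y, fderiv ℝ ρ (x - y) e * κ y := by
  have h1 := hρc.hasFDerivAt_convolution_left (ContinuousLinearMap.mul ℝ ℝ) (μ := volume)
    (hρ.of_le (by simp)) hκ.locallyIntegrable x
  rw [mollify_eq, h1.fderiv, convolution_eq_swap, ContinuousLinearMap.integral_apply]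
  · rfl
  · have hc : HasCompactSupport (fderiv ℝ ρ) := hρc.fderiv ℝ
    have h2 := hc.convolutionExists_left_of_continuous_right
      (L := (ContinuousLinearMap.mul ℝ ℝ).precompL (Cn n)) (μ := volume)
      ((hρ.continuous_fderiv (by simp)).locallyIntegrable) hκ x
    exact h2.integrable_swap

theorem hasCompactSupport_of_radius {ρ : Cn n → ℝ} {ε : ℝ} (hρs : ∀ x, ε ≤ ‖x‖ → ρ x = 0) :
    tsupport ρ ⊆ Metric.closedBall 0 ε ∧ HasCompactSupport ρ := by
  have h1 : tsupport ρ ⊆ Metric.closedBall 0 ε := by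
    refine closure_minimal (fun x hx => ?_) Metric.isClosed_closedBall
    rw [mem_closedBall_zero_iff]
    by_contra h
    exact hx (hρs x (not_le.1 h).le)
  exact ⟨h1, (isCompact_closedBall _ _).of_isClosed_subset (isClosed_tsupport _) h1⟩

theorem abs_mollify_sub_le {ρ κ : Cn n → ℝ} {ε : ℝ} (hρ : ContDiff ℝ ∞ ρ) (hρ0 : ∀ x, 0 ≤ ρ x)
    (hρs : ∀ x, ε ≤ ‖x‖ → ρ x = 0) (hρ1 : ∫ x, ρ x = 1) (hκ : Continuous κ) {x : Cn n} {m M : ℝ}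
    (hM : ∀ y, dist x y ≤ ε → m ≤ κ y ∧ κ y ≤ M) :
    m ≤ mollify ρ κ x ∧ mollify ρ κ x ≤ M := by
  have hρc := (hasCompactSupport_of_radius hρs).2
  have hρi : Integrable fun y => ρ (x - y) :=
    (hρ.continuous.integrable_of_hasCompactSupport hρc).comp_sub_left x
  have hρ1' : ∫ y, ρ (x - y) = 1 := by rw [integral_sub_left_eq_self ρ volume x, hρ1]
  have hi : Integrable fun y => ρ (x - y) * κ y := by
    have h2 := hρc.convolutionExists_left_of_continuous_right
      (L := ContinuousLinearMap.mul ℝ ℝ) (μ := volume) hρ.continuous.locallyIntegrable hκ x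
    exact h2.integrable_swap
  have hb : ∀ y, m * ρ (x - y) ≤ ρ (x - y) * κ y ∧ ρ (x - y) * κ y ≤ M * ρ (x - y) := by
    intro y
    rcases le_or_gt ε ‖x - y‖ with h | h
    · simp [hρs _ h]
    · have h1 := hM y (by rw [dist_eq_norm]; exact h.le)
      have h2 := hρ0 (x - y)
      constructor <;> nlinarith
  constructor
  · have := integral_mono (hρi.const_mul m) hi fun y => (hb y).1
    rwa [integral_const_mul, hρ1', mul_one] at this
  · have := integral_mono hi (hρi.const_mul M) fun y => (hb y).2
    rwa [integral_const_mul, hρ1', mul_one] at this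

/-- If `κ` satisfies weakly a first order equation with a right hand side `B`, then the same
derivative of the mollified function is bounded by the average of `‖B‖`, up to a bounded error.
This is the commutator estimate of Friedrichs; it uses only that `κ` is bounded. -/
theorem norm_gradient_mollify_le {y₀ : Cn n} {r ε M Mb L C : ℝ} {κ ρ : Cn n → ℝ}
    {a : Fin (2 * n) → Cn n → Coef n →L[ℂ] Coef n} {b : Cn n → Coef n →L[ℂ] Coef n}
    {B : Cn n → Coef n} {e : Coef n} (hκ : Continuous κ)
    (hM : ∀ y ∈ Metric.closedBall y₀ r, |κ y| ≤ M)
    (hMb : ∀ y ∈ Metric.closedBall y₀ r, ‖b y‖ ≤ Mb)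
    (ha : ∀ i, ContinuousOn (a i) (Metric.closedBall y₀ r))
    (hb : ContinuousOn b (Metric.closedBall y₀ r))
    (hL0 : 0 ≤ L)
    (hL : ∀ i, ∀ x ∈ Metric.closedBall y₀ r, ∀ y ∈ Metric.closedBall y₀ r,
      ‖a i x - a i y‖ ≤ L * ‖x - y‖)
    (hB : IntegrableOn B (Metric.closedBall y₀ r))
    (hweak : ∀ v : Cn n → Coef n, IsCutoff (Metric.ball y₀ r) v → ContDiff ℝ ∞ v →
      ∫ y, inner ℂ (B y) (v y) = ∫ y, (κ y : ℂ) * inner ℂ e (diffOp a b v y))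
    (hρ : ContDiff ℝ ∞ ρ) (hρ0 : ∀ x, 0 ≤ ρ x) (hρs : ∀ x, ε ≤ ‖x‖ → ρ x = 0)
    (hρ1 : ∫ x, ρ x = 1) (hρC : ∀ i, ε * ∫ x, ‖fderiv ℝ ρ x (stdBasis n i)‖ ≤ C)
    {x : Cn n} (hε : 0 < ε) (hx : dist x y₀ + ε < r) :
    ‖∑ i, fderiv ℝ (mollify ρ κ) x (stdBasis n i) • ContinuousLinearMap.adjoint (a i x) e‖ ≤
      (∫ y, ρ (x - y) * ‖B y‖) + M * ‖e‖ * (Mb + (2 * n : ℕ) * (L * C)) := by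
  obtain ⟨hts, hρc⟩ := hasCompactSupport_of_radius hρs
  have hxr : x ∈ Metric.closedBall y₀ r := by
    rw [Metric.mem_closedBall]
    linarith
  have hM0 : 0 ≤ M := (abs_nonneg _).trans (hM x hxr)
  have hMb0 : 0 ≤ Mb := (norm_nonneg _).trans (hMb x hxr)
  have hsub : ∀ y, ‖x - y‖ ≤ ε → y ∈ Metric.ball y₀ r := by
    intro y hy
    rw [Metric.mem_ball]
    have h1 := dist_triangle y x y₀
    rw [dist_comm y x, dist_eq_norm x y] at h1
    linarith
  have hbc : Metric.ball y₀ r ⊆ Metric.closedBall y₀ r := Metric.ball_subset_closedBall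
  set G := ∑ i, fderiv ℝ (mollify ρ κ) x (stdBasis n i) • ContinuousLinearMap.adjoint (a i x) e
    with hG
  -- the test function is the mollifier centred at `x`
  set v : Cn n → Coef n := fun y => ρ (x - y) • G with hv
  have hρx : ContDiff ℝ ∞ fun y => ρ (x - y) := hρ.comp (contDiff_const.sub contDiff_id)
  have hvs : ContDiff ℝ ∞ v := hρx.smul contDiff_const
  have hzero : ∀ y, ε < ‖x - y‖ → ρ (x - y) = 0 ∧ fderiv ℝ ρ (x - y) = 0 := by
    intro y hy
    refine ⟨hρs _ hy.le, fderiv_eq_zero_of_notMem_tsupport fun h => ?_⟩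
    have := hts h
    rw [mem_closedBall_zero_iff] at this
    linarith
  have hsuppρ : tsupport (fun y => ρ (x - y)) ⊆ Metric.closedBall x ε := by
    refine closure_minimal (fun y hy => ?_) Metric.isClosed_closedBall
    rw [Metric.mem_closedBall, dist_comm, dist_eq_norm]
    by_contra h
    exact hy (hzero y (not_le.1 h)).1
  have hcutρ : IsCutoff (Metric.ball y₀ r) fun y => ρ (x - y) := by
    refine ⟨hρx.continuous, (isCompact_closedBall x ε).of_isClosed_subset (isClosed_tsupport _)
      hsuppρ, fun y hy => hsub y ?_⟩
    have := hsuppρ hy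
    rwa [Metric.mem_closedBall, dist_comm, dist_eq_norm] at this
  have hcutv : IsCutoff (Metric.ball y₀ r) v :=
    hcutρ.of_eq_zero Metric.isOpen_ball hvs.continuous.continuousOn fun y hy => by
      rw [hv]
      simp only
      rw [image_eq_zero_of_notMem_tsupport hy, zero_smul]
  have hfd : ∀ y i, fderiv ℝ v y (stdBasis n i) = -(fderiv ℝ ρ (x - y) (stdBasis n i) • G) := by
    intro y i
    have h1 : HasFDerivAt (fun y => x - y) (-ContinuousLinearMap.id ℝ (Cn n)) y :=
      (hasFDerivAt_id y).const_sub x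
    have h2 := (((hρ.differentiable (by simp)) (x - y)).hasFDerivAt.comp y h1).smul_const G
    rw [show v = fun y => (ρ ∘ fun y => x - y) y • G from rfl, h2.fderiv]
    simp
  have hterm : ∀ i, fderiv ℝ (mollify ρ κ) x (stdBasis n i) =
      ∫ y, fderiv ℝ ρ (x - y) (stdBasis n i) * κ y := fun i => fderiv_mollify hρ hρc hκ x _
  have hcutd : ∀ i, IsCutoff (Metric.ball y₀ r) fun y => fderiv ℝ ρ (x - y) (stdBasis n i) := by
    intro i
    have hcont : Continuous fun y => fderiv ℝ ρ (x - y) (stdBasis n i) :=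
      ((hρ.continuous_fderiv (by simp)).comp (continuous_const.sub continuous_id)).clm_apply
        continuous_const
    have hs : tsupport (fun y => fderiv ℝ ρ (x - y) (stdBasis n i)) ⊆ Metric.closedBall x ε := by
      refine closure_minimal (fun y hy => ?_) Metric.isClosed_closedBall
      rw [Metric.mem_closedBall, dist_comm, dist_eq_norm]
      by_contra h
      exact hy (by simp only [(hzero y (not_le.1 h)).2]; rfl)
    refine ⟨hcont, (isCompact_closedBall x ε).of_isClosed_subset (isClosed_tsupport _) hs,
      fun y hy => hsub y ?_⟩
    have := hs hy
    rwa [Metric.mem_closedBall, dist_comm, dist_eq_norm] at this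
  set Ψ : Cn n → ℂ := fun y => (κ y : ℂ) * inner ℂ e (diffOp a b v y) +
    ∑ i, ((fderiv ℝ ρ (x - y) (stdBasis n i) * κ y : ℝ) : ℂ) * inner ℂ e (a i x G) with hΨ
  have hcut1 : IsCutoff (Metric.ball y₀ r) fun y => (κ y : ℂ) * inner ℂ e (diffOp a b v y) := by
    have hd := isCutoff_diffOp (a := a) (b := b) Metric.isOpen_ball (fun i => (ha i).mono hbc)
      (hb.mono hbc) hcutv hvs
    refine hd.of_eq_zero Metric.isOpen_ball ?_ fun y hy => by
      rw [image_eq_zero_of_notMem_tsupport hy, inner_zero_right, mul_zero]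
    exact ((Complex.continuous_ofReal.comp hκ).mul
      (continuous_const.inner hd.continuous)).continuousOn
  have hcut2 : ∀ i, IsCutoff (Metric.ball y₀ r) fun y =>
      ((fderiv ℝ ρ (x - y) (stdBasis n i) * κ y : ℝ) : ℂ) * inner ℂ e (a i x G) := by
    intro i
    refine (hcutd i).of_eq_zero Metric.isOpen_ball ?_ fun y hy => by
      rw [image_eq_zero_of_notMem_tsupport hy, zero_mul, Complex.ofReal_zero, zero_mul]
    exact ((Complex.continuous_ofReal.comp ((hcutd i).continuous.mul hκ)).mul
      continuous_const).continuousOn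
  have hGc : ∀ c : Coef n, inner ℂ G c =
      ∑ i, (fderiv ℝ (mollify ρ κ) x (stdBasis n i) : ℂ) * inner ℂ e (a i x c) := by
    intro c
    rw [hG, sum_inner]
    refine Finset.sum_congr rfl fun i _ => ?_
    rw [RCLike.real_smul_eq_coe_smul (K := ℂ), inner_smul_left, RCLike.conj_ofReal,
      ContinuousLinearMap.adjoint_inner_left]
    rfl
  have hint : ∫ y, Ψ y = (∫ y, inner ℂ (B y) (v y)) + inner ℂ G G := by
    rw [hΨ, integral_add hcut1.integrable (integrable_finsetSum _ fun i _ => (hcut2 i).integrable),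
      ← hweak v hcutv hvs, integral_finsetSum _ fun i _ => (hcut2 i).integrable, hGc]
    congr 1
    refine Finset.sum_congr rfl fun i _ => ?_
    rw [integral_mul_const, integral_complex_ofReal, hterm]
  have hvy : ∀ y, v y = ρ (x - y) • G := fun _ => rfl
  have hΨb : ∀ y, ‖Ψ y‖ ≤ M * ‖e‖ * ‖G‖ *
      (Mb * ρ (x - y) + L * ε * ∑ i, ‖fderiv ℝ ρ (x - y) (stdBasis n i)‖) := by
    intro y
    rcases lt_or_ge ε ‖x - y‖ with h | h
    · have h1 : Ψ y = 0 := by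
        simp only [hΨ, diffOp, hfd, (hzero y h).2, hvy, (hzero y h).1]
        simp
      rw [h1, norm_zero]
      exact mul_nonneg (by positivity) (add_nonneg (mul_nonneg hMb0 (hρ0 _)) (by positivity))
    · have hy := hbc (hsub y h)
      have h1 : Ψ y = (κ y : ℂ) * (inner ℂ e (ρ (x - y) • b y G) +
          ∑ i, inner ℂ e (fderiv ℝ ρ (x - y) (stdBasis n i) • (a i x - a i y) G)) := by
        simp only [hΨ, diffOp, hfd, hvy, inner_add_right, mul_add, inner_sum, Finset.mul_sum,
          add_assoc, ← Finset.sum_add_distrib]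
        congr 1
        · rw [ContinuousLinearMap.map_smul_of_tower]
        · refine Finset.sum_congr rfl fun i _ => ?_
          rw [map_neg, ContinuousLinearMap.map_smul_of_tower, _root_.sub_apply, smul_sub,
            inner_sub_right, inner_neg_right, RCLike.real_smul_eq_coe_smul (K := ℂ),
            RCLike.real_smul_eq_coe_smul (K := ℂ), inner_smul_right, inner_smul_right]
          push_cast
          simp only [Complex.coe_algebraMap]
          ring
      rw [h1, norm_mul, Complex.norm_real, Real.norm_eq_abs]
      have h2 : ‖inner ℂ e (ρ (x - y) • b y G)‖ ≤ ‖e‖ * (ρ (x - y) * (Mb * ‖G‖)) := by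
        refine (norm_inner_le_norm _ _).trans ?_
        rw [norm_smul, Real.norm_of_nonneg (hρ0 _)]
        gcongr
        · exact hρ0 _
        · exact (ContinuousLinearMap.le_opNorm _ _).trans (by gcongr; exact hMb y hy)
      have h3 : ∀ i, ‖inner ℂ e (fderiv ℝ ρ (x - y) (stdBasis n i) • (a i x - a i y) G)‖ ≤
          ‖e‖ * (‖fderiv ℝ ρ (x - y) (stdBasis n i)‖ * (L * ε * ‖G‖)) := by
        intro i
        refine (norm_inner_le_norm _ _).trans ?_
        rw [norm_smul]
        gcongr
        refine (ContinuousLinearMap.le_opNorm _ _).trans ?_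
        gcongr
        exact (hL i x hxr y hy).trans (by gcongr)
      calc |κ y| * ‖inner ℂ e (ρ (x - y) • b y G) +
            ∑ i, inner ℂ e (fderiv ℝ ρ (x - y) (stdBasis n i) • (a i x - a i y) G)‖
          ≤ M * (‖e‖ * (ρ (x - y) * (Mb * ‖G‖)) +
            ∑ i, ‖e‖ * (‖fderiv ℝ ρ (x - y) (stdBasis n i)‖ * (L * ε * ‖G‖))) := by
            refine mul_le_mul (hM y hy) ?_ (norm_nonneg _) hM0
            refine (norm_add_le _ _).trans (add_le_add h2 ((norm_sum_le _ _).trans ?_))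
            exact Finset.sum_le_sum fun i _ => h3 i
        _ = _ := by
            rw [← Finset.mul_sum, ← Finset.sum_mul]
            ring
  have hρi : Integrable fun y => ρ (x - y) :=
    (hρ.continuous.integrable_of_hasCompactSupport hρc).comp_sub_left x
  have hρ1' : ∫ y, ρ (x - y) = 1 := by rw [integral_sub_left_eq_self ρ volume x, hρ1]
  have hdi : ∀ i, Integrable fun y => ‖fderiv ℝ ρ (x - y) (stdBasis n i)‖ := fun i =>
    (hcutd i).integrable.norm
  have h1 : ‖∫ y, Ψ y‖ ≤ M * ‖e‖ * ‖G‖ * (Mb + (2 * n : ℕ) * (L * C)) := by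
    have h2 : Integrable fun y => Mb * ρ (x - y) +
        L * ε * ∑ i, ‖fderiv ℝ ρ (x - y) (stdBasis n i)‖ :=
      (hρi.const_mul Mb).add ((integrable_finsetSum _ fun i _ => hdi i).const_mul _)
    refine (norm_integral_le_of_norm_le (h2.const_mul _) (Eventually.of_forall hΨb)).trans ?_
    rw [integral_const_mul]
    refine mul_le_mul_of_nonneg_left ?_ (by positivity)
    rw [integral_add (hρi.const_mul Mb) ((integrable_finsetSum _ fun i _ => hdi i).const_mul _),
      integral_const_mul, integral_const_mul, hρ1', mul_one, integral_finsetSum _ fun i _ => hdi i]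
    refine add_le_add le_rfl ?_
    calc L * ε * ∑ i, ∫ y, ‖fderiv ℝ ρ (x - y) (stdBasis n i)‖
        = ∑ i, L * (ε * ∫ y, ‖fderiv ℝ ρ y (stdBasis n i)‖) := by
          rw [Finset.mul_sum]
          refine Finset.sum_congr rfl fun i _ => ?_
          rw [integral_sub_left_eq_self (fun y => ‖fderiv ℝ ρ y (stdBasis n i)‖) volume x, mul_assoc]
      _ ≤ ∑ _i : Fin (2 * n), L * C := by
          gcongr with i
          exact hρC i
      _ = _ := by rw [Finset.sum_const, Finset.card_univ, Fintype.card_fin, nsmul_eq_mul]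
  have hBi : Integrable fun y => ρ (x - y) * ‖B y‖ := by
    have h2 : IntegrableOn (fun y => ρ (x - y) * ‖B y‖) (Metric.closedBall y₀ r) := by
      obtain ⟨D, hD⟩ := hcutρ.continuous.bounded_above_of_compact_support hcutρ.compact
      exact hB.norm.bdd_mul (c := D) hcutρ.continuous.aestronglyMeasurable
        (Eventually.of_forall fun y => hD y)
    refine h2.integrable_of_forall_notMem_eq_zero fun y hy => ?_
    rw [hcutρ.eq_zero fun h => hy (hbc h), zero_mul]
  have h2 : ‖∫ y, inner ℂ (B y) (v y)‖ ≤ ‖G‖ * ∫ y, ρ (x - y) * ‖B y‖ := by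
    rw [← integral_const_mul]
    refine norm_integral_le_of_norm_le (hBi.const_mul _) (Eventually.of_forall fun y => ?_)
    refine (norm_inner_le_norm _ _).trans_eq ?_
    rw [hv]
    simp only
    rw [norm_smul, Real.norm_of_nonneg (hρ0 _)]
    ring
  have h3 : ‖G‖ * ‖G‖ ≤ ‖G‖ * ((∫ y, ρ (x - y) * ‖B y‖) +
      M * ‖e‖ * (Mb + (2 * n : ℕ) * (L * C))) := by
    have h4 : ‖G‖ * ‖G‖ = ‖(inner ℂ G G : ℂ)‖ := by
      rw [inner_self_eq_ofReal, Complex.norm_real, Real.norm_of_nonneg (by positivity), sq]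
    rw [h4, eq_sub_of_add_eq' hint.symm]
    refine (norm_sub_le _ _).trans ?_
    linarith
  rcases (norm_nonneg G).eq_or_lt with h0 | h0
  · rw [← h0]
    have hC0 : 0 ≤ (2 * n : ℕ) * (L * C) := by
      rcases Nat.eq_zero_or_pos (2 * n) with hn | hn
      · simp [hn]
      · have hC : 0 ≤ C := le_trans (mul_nonneg hε.le (integral_nonneg fun _ => norm_nonneg _))
          (hρC ⟨0, hn⟩)
        positivity
    exact add_nonneg (integral_nonneg fun y => mul_nonneg (hρ0 _) (norm_nonneg _)) (by positivity)
  · exact le_of_mul_le_mul_left h3 h0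

end Mollified

/-! ### The adjoint on smooth forms -/

section Adjoint

theorem norm_le_of_dense {H : Type*} [NormedAddCommGroup H] [InnerProductSpace ℂ H] {S : Set H}
    (hS : Dense S) {h : H} {M : ℝ} (hM0 : 0 ≤ M) (hM : ∀ x ∈ S, ‖(inner ℂ h x : ℂ)‖ ≤ M * ‖x‖) :
    ‖h‖ ≤ M := by
  have h1 : ∀ x, ‖(inner ℂ h x : ℂ)‖ ≤ M * ‖x‖ := by
    have hcl : IsClosed {x : H | ‖(inner ℂ h x : ℂ)‖ ≤ M * ‖x‖} :=
      isClosed_le (continuous_const.inner continuous_id).norm (continuous_const.mul continuous_norm)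
    intro x
    exact hcl.closure_subset_iff.2 (fun y hy => hM y hy) (hS x)
  have h2 := h1 h
  rw [inner_self_eq_ofReal, Complex.norm_real, Real.norm_of_nonneg (by positivity), sq] at h2
  rcases (norm_nonneg h).eq_or_lt with h0 | h0
  · rwa [← h0]
  · exact le_of_mul_le_mul_right h2 h0

theorem integral_norm_mul_norm_le {α F G : Type*} [MeasurableSpace α] {μ : Measure α}
    [NormedAddCommGroup F] [NormedAddCommGroup G] {f : α → F} {g : α → G} (hf : MemLp f 2 μ)
    (hg : MemLp g 2 μ) :
    ∫ x, ‖f x‖ * ‖g x‖ ∂μ ≤ Real.sqrt (∫ x, ‖f x‖ ^ 2 ∂μ) * Real.sqrt (∫ x, ‖g x‖ ^ 2 ∂μ) := by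
  have h := integral_mul_norm_le_Lp_mul_Lq (μ := μ) (f := fun x => ‖f x‖) (g := fun x => ‖g x‖)
    (Real.HolderConjugate.two_two) (by simpa using hf.norm) (by simpa using hg.norm)
  simpa [Real.sqrt_eq_rpow] using h

variable {n : ℕ} {X : Type*} [TopologicalSpace X] [ChartedSpace (Cn n) X]
  [IsManifold 𝓘(ℂ, Cn n) ω X]
  [RiemannianBundle (fun x : X => TangentSpace 𝓘(ℝ, Cn n) x)]
  [IsContMDiffRiemannianBundle 𝓘(ℝ, Cn n) ∞ (Cn n) (fun x : X => TangentSpace 𝓘(ℝ, Cn n) x)]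
  [MeasurableSpace X] [BorelSpace X] [SecondCountableTopology X] {φ : X → ℝ}

theorem integrable_inner_of_memLp {α : Type*} [MeasurableSpace α] {μ : Measure α}
    {f g : α → Coef n} (hf : MemLp f 2 μ) (hg : MemLp g 2 μ) :
    Integrable (fun x => (inner ℂ (f x) (g x) : ℂ)) μ :=
  (hf.norm.integrable_mul hg.norm).mono' (hf.aestronglyMeasurable.inner hg.aestronglyMeasurable)
    (Eventually.of_forall fun _ => norm_inner_le_norm _ _)

theorem inner_coef (c d : Coef n) : inner ℂ c d =
    ∑ k, (starRingEnd ℂ) (c k) * inner ℂ (EuclideanSpace.single k (1 : ℂ) : Coef n) d := by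
  rw [PiLp.inner_apply]
  refine Finset.sum_congr rfl fun k _ => ?_
  rw [EuclideanSpace.inner_single_left, map_one, one_mul, RCLike.inner_apply, mul_comm]

theorem IsCutoff.mono {E F : Type*} [TopologicalSpace E] [TopologicalSpace F] [Zero F]
    {U V : Set E} {g : E → F} (hg : IsCutoff U g) (h : U ⊆ V) : IsCutoff V g :=
  ⟨hg.continuous, hg.compact, hg.subset.trans h⟩

variable {T : L2Forms n φ →ₗ.[ℂ] L2Forms n φ} {p : X}
  {a : Fin (2 * n) → Cn n → Coef n →L[ℂ] Coef n} {b : Cn n → Coef n →L[ℂ] Coef n}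

theorem exists_mem_adjoint_graph [T2Space X] (hφ : Continuous φ) (hT : IsClosedDiffOperator T)
    {g : Cn n → Coef n} (hg : IsCutoff (chartAt (Cn n) p).target g) (hs : ContDiff ℝ ∞ g) :
    ∃ h, (chartClass φ p g, h) ∈ (LinearPMap.adjoint T).graph := by
  have h1 := hT.mem_adjoint _ (isTestForm_chartForm hg hs (subset_univ _)) _
    (isClassOf_chartClass hφ hg)
  exact ⟨_, (LinearPMap.mem_graph (LinearPMap.adjoint T) ⟨_, h1⟩)⟩

/-- The weight `e^{-φ}` satisfies weakly a first order equation with right hand side in `L²`: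
this is the regularity of the continuous function `φ` that is forced by the assumption that smooth
forms belong to the domain of the adjoint. -/
theorem exists_weak_weight [T2Space X] (hφ : Continuous φ) (hT : IsClosedDiffOperator T)
    (hsym : IsLocalSymbol T p a b) {y₀ : Cn n} {r₁ r₂ : ℝ} (h0 : 0 < r₁) (h12 : r₁ < r₂)
    (hr : Metric.closedBall y₀ r₂ ⊆ (chartAt (Cn n) p).target) :
    ∃ h : Finset (Fin (2 * n)) → L2Forms n φ, ∀ k, ∀ v : Cn n → Coef n,
      IsCutoff (Metric.ball y₀ r₁) v → ContDiff ℝ ∞ v →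
      ∫ y, inner ℂ (lowerRep φ p (h k) y) (v y) =
        ∫ y, (chartExp φ p y : ℂ) * inner ℂ (EuclideanSpace.single k (1 : ℂ)) (diffOp a b v y) := by
  have ht := (chartAt (Cn n) p).open_target
  let χ : ContDiffBump y₀ := ⟨r₁, r₂, h0, h12⟩
  have hχ : IsCutoff (chartAt (Cn n) p).target χ :=
    ⟨χ.continuous, χ.hasCompactSupport, by rw [χ.tsupport_eq]; exact hr⟩
  let g : Finset (Fin (2 * n)) → Cn n → Coef n := fun k y =>
    χ y • formMetricInv p y (EuclideanSpace.single k (1 : ℂ))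
  have hg0 : ∀ k y, y ∉ tsupport χ → g k y = 0 := fun k y hy => by
    simp only [g, image_eq_zero_of_notMem_tsupport hy, zero_smul]
  have hgs : ∀ k, ContDiffOn ℝ ∞ (g k) (chartAt (Cn n) p).target := fun k =>
    χ.contDiff.contDiffOn.smul
      (contDiffOn_clm_apply_real (contDiffOn_formMetricInv p) contDiffOn_const)
  have hg : ∀ k, IsCutoff (chartAt (Cn n) p).target (g k) := fun k =>
    hχ.of_eq_zero ht (hgs k).continuousOn (hg0 k)
  choose h hh using fun k => exists_mem_adjoint_graph hφ hT (hg k)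
    (hχ.contDiff_of_eq_zero ht (hgs k) (hg0 k))
  refine ⟨h, fun k v hv hvs => ?_⟩
  have hsub : Metric.ball y₀ r₁ ⊆ (chartAt (Cn n) p).target :=
    (Metric.ball_subset_closedBall.trans (Metric.closedBall_subset_closedBall h12.le)).trans hr
  have hvU := hv.mono hsub
  have hd := isCutoff_diffOp ht (fun i => (hsym.contDiffOn_a i).continuousOn)
    hsym.contDiffOn_b.continuousOn hvU hvs
  rw [← inner_chartClass_eq_lowerRep hφ hvU,
    inner_adjoint_graph hT.dense (hsym.mem_graph v hvU hvs) (hh k), inner_chartClass hφ p hd]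
  have hae := (ae_restrict_iff' ht.measurableSet).1 (chartRep_chartClass hφ p (hg k))
  refine integral_congr_ae ?_
  filter_upwards [hae] with y hy
  by_cases hyv : y ∈ tsupport v
  · have hyU := hvU.subset hyv
    have hχ1 : χ y = 1 := χ.one_of_mem_closedBall (Metric.ball_subset_closedBall (hv.subset hyv))
    rw [hy hyU, RCLike.real_smul_eq_coe_smul (K := ℂ), inner_smul_right, ← inner_formMetric_left hyU]
    simp only [g, hχ1, one_smul]
    rw [formMetric_inv_apply hyU]
    rfl
  · rw [diffOp_eq_zero hyv, map_zero, smul_zero, inner_zero_right, inner_zero_right, mul_zero]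

/-- The lowered coefficients of the adjoint applied to the form with lowered coefficients
`e^{-φ} W`, where `B k` is this expression for the constant `W` with value the `k`-th basis
vector. -/
def adjointRep (φ : X → ℝ) (p : X) (a : Fin (2 * n) → Cn n → Coef n →L[ℂ] Coef n)
    (B : Finset (Fin (2 * n)) → Cn n → Coef n) (W : Cn n → Coef n) (y : Cn n) : Coef n :=
  ∑ k, W y k • B k y - chartExp φ p y • ∑ i, ContinuousLinearMap.adjoint (a i y)
    (fderiv ℝ W y (stdBasis n i))

theorem memLp_two_of_bounded_smul {K : Set (Cn n)} {f : Cn n → ℂ} {B : Cn n → Coef n}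
    (hK : IsCompact K) (hf : ContinuousOn f K) (hB : MemLp B 2 (volume.restrict K)) :
    MemLp (fun y => f y • B y) 2 (volume.restrict K) := by
  obtain ⟨C, hC, h⟩ := exists_norm_clm_le hK hf
  refine hB.of_le_mul (c := C) ((hf.aestronglyMeasurable hK.measurableSet).smul
    hB.aestronglyMeasurable) ?_
  filter_upwards [ae_restrict_mem hK.measurableSet] with y hy
  rw [norm_smul]
  gcongr
  exact h y hy

theorem memLp_of_continuousOn {F : Type*} [NormedAddCommGroup F] {K : Set (Cn n)}
    {f : Cn n → F} (hK : IsCompact K) (hf : ContinuousOn f K) :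
    MemLp f 2 (volume.restrict K) := by
  have : IsFiniteMeasure (volume.restrict K) := ⟨by
    rw [Measure.restrict_apply_univ]
    exact hK.measure_lt_top⟩
  obtain ⟨C, hC, h⟩ := exists_norm_clm_le hK hf
  have hm : AEStronglyMeasurable f (volume.restrict K) := by
    have hsep : SecondCountableTopologyEither (Cn n) F := inferInstance
    exact hf.aestronglyMeasurable hK.measurableSet
  exact MemLp.of_bound hm C ((ae_restrict_mem hK.measurableSet).mono fun y hy => h y hy)

theorem memLp_adjointRep (hφ : Continuous φ) {K : Set (Cn n)} (hK : IsCompact K)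
    (hKt : K ⊆ (chartAt (Cn n) p).target)
    (ha : ∀ i, ContinuousOn (a i) (chartAt (Cn n) p).target)
    {B : Finset (Fin (2 * n)) → Cn n → Coef n} (hB : ∀ k, MemLp (B k) 2 (volume.restrict K))
    {W : Cn n → Coef n} (hW : ContDiff ℝ ∞ W) :
    MemLp (adjointRep φ p a B W) 2 (volume.restrict K) := by
  refine MemLp.sub (memLp_finsetSum _ fun k _ => ?_) (memLp_of_continuousOn hK ?_)
  · refine memLp_two_of_bounded_smul hK ?_ (hB k)
    exact ((EuclideanSpace.proj k : Coef n →L[ℂ] ℂ).continuous.comp hW.continuous).continuousOn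
  · refine ((continuousOn_chartExp hφ p).mono hKt).smul (continuousOn_finsetSum _ fun i _ => ?_)
    exact ((continuousOn_adjoint (ha i)).mono hKt).clm_apply
      (((hW.continuous_fderiv (by simp)).clm_apply continuous_const).continuousOn)

/-- Leibniz's rule for the adjoint, in weak form. -/
theorem integral_inner_adjointRep (hφ : Continuous φ) {y₀ : Cn n} {r₁ : ℝ}
    (hr : Metric.closedBall y₀ r₁ ⊆ (chartAt (Cn n) p).target)
    (ha : ∀ i, ContDiffOn ℝ ∞ (a i) (chartAt (Cn n) p).target)
    (hb : ContDiffOn ℝ ∞ b (chartAt (Cn n) p).target)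
    {B : Finset (Fin (2 * n)) → Cn n → Coef n}
    (hB : ∀ k, MemLp (B k) 2 (volume.restrict (Metric.closedBall y₀ r₁)))
    (hweak : ∀ k, ∀ v : Cn n → Coef n, IsCutoff (Metric.ball y₀ r₁) v → ContDiff ℝ ∞ v →
      ∫ y, inner ℂ (B k y) (v y) =
        ∫ y, (chartExp φ p y : ℂ) * inner ℂ (EuclideanSpace.single k (1 : ℂ)) (diffOp a b v y))
    {W v : Cn n → Coef n} (hW : IsCutoff (Metric.ball y₀ r₁) W) (hWs : ContDiff ℝ ∞ W)
    (hv : ContDiffOn ℝ ∞ v (chartAt (Cn n) p).target) :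
    ∫ y, inner ℂ (W y) (chartExp φ p y • diffOp a b v y) =
      ∫ y in Metric.closedBall y₀ r₁, inner ℂ (adjointRep φ p a B W y) (v y) := by
  set K := Metric.closedBall y₀ r₁ with hKdef
  have hK : IsCompact K := isCompact_closedBall _ _
  have hbK : Metric.ball y₀ r₁ ⊆ K := Metric.ball_subset_closedBall
  have hU := Metric.isOpen_ball (x := y₀) (ε := r₁)
  have ht := (chartAt (Cn n) p).open_target
  let w : Finset (Fin (2 * n)) → Cn n → ℂ := fun k y => W y k
  have hwW : ∀ k y, y ∉ tsupport W → w k y = 0 := fun k y hy => by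
    simp [w, image_eq_zero_of_notMem_tsupport hy]
  have hws : ∀ k, ContDiff ℝ ∞ (w k) := fun k =>
    ((EuclideanSpace.proj k : Coef n →L[ℂ] ℂ).restrictScalars ℝ).contDiff.comp hWs
  have hfw : ∀ k y e, fderiv ℝ (w k) y e = fderiv ℝ W y e k := by
    intro k y e
    have h2 := ((EuclideanSpace.proj k : Coef n →L[ℂ] ℂ).restrictScalars ℝ).hasFDerivAt.comp y
      (hWs.differentiable (by simp) y).hasFDerivAt
    rw [show w k = ((EuclideanSpace.proj k : Coef n →L[ℂ] ℂ).restrictScalars ℝ) ∘ W from rfl,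
      h2.fderiv]
    rfl
  let V : Finset (Fin (2 * n)) → Cn n → Coef n := fun k y => (starRingEnd ℂ) (w k y) • v y
  have hVon : ∀ k, ContDiffOn ℝ ∞ (V k) (Metric.ball y₀ r₁) := fun k =>
    ((Complex.conjCLE.contDiff.comp (hws k)).contDiffOn).smul (hv.mono (hbK.trans hr))
  have hV0 : ∀ k y, y ∉ tsupport W → V k y = 0 := fun k y hy => by
    simp only [V, hwW k y hy, map_zero, zero_smul]
  have hVc : ∀ k, IsCutoff (Metric.ball y₀ r₁) (V k) := fun k =>
    hW.of_eq_zero hU (hVon k).continuousOn (hV0 k)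
  have hVs : ∀ k, ContDiff ℝ ∞ (V k) := fun k => hW.contDiff_of_eq_zero hU (hVon k) (hV0 k)
  have hVsupp : ∀ k, tsupport (V k) ⊆ tsupport W := fun k => by
    refine closure_minimal (fun z hz => ?_) (isClosed_tsupport W)
    by_contra h
    exact hz (hV0 k z h)
  -- the derivative of the test function is a sum of two terms
  have hDV : ∀ k, ∀ y ∈ Metric.ball y₀ r₁, diffOp a b (V k) y =
      (starRingEnd ℂ) (W y k) • diffOp a b v y +
        ∑ i, (starRingEnd ℂ) (fderiv ℝ W y (stdBasis n i) k) • a i y (v y) := by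
    intro k y hy
    have hvd : HasFDerivAt v (fderiv ℝ v y) y :=
      ((hv.contDiffAt (ht.mem_nhds (hr (hbK hy)))).differentiableAt (by simp)).hasFDerivAt
    have hcd : HasFDerivAt (fun y => (starRingEnd ℂ) (w k y)) _ y :=
      (Complex.conjCLE.toContinuousLinearMap.hasFDerivAt).comp y
        ((hws k).differentiable (by simp) y).hasFDerivAt
    have h1 : ∀ e, fderiv ℝ (V k) y e = (starRingEnd ℂ) (w k y) • fderiv ℝ v y e +
        (starRingEnd ℂ) (fderiv ℝ W y e k) • v y := by
      intro e
      rw [show V k = (fun y => (starRingEnd ℂ) (w k y)) • v from rfl, (hcd.smul hvd).fderiv, ← hfw]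
      rfl
    have hVy : V k y = (starRingEnd ℂ) (w k y) • v y := rfl
    simp only [diffOp, h1, hVy, map_add, map_smul, smul_add, Finset.sum_add_distrib, Finset.smul_sum,
      add_assoc]
    rfl
  have hcut : ∀ {f : Cn n → ℂ}, ContinuousOn f (Metric.ball y₀ r₁) →
      (∀ y, y ∉ tsupport W → f y = 0) → Integrable f := fun hf h0 =>
    (hW.of_eq_zero hU hf h0).integrable
  have hWz : ∀ y, y ∉ tsupport W → W y = 0 := fun y hy => image_eq_zero_of_notMem_tsupport hy
  have hdWz : ∀ y, y ∉ tsupport W → fderiv ℝ W y = 0 := fun y hy =>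
    fderiv_eq_zero_of_notMem_tsupport hy
  have hEc : ContinuousOn (chartExp (n := n) φ p) (Metric.ball y₀ r₁) :=
    (continuousOn_chartExp hφ p).mono (hbK.trans hr)
  have hDc : ContinuousOn (diffOp a b v) (Metric.ball y₀ r₁) :=
    (continuousOn_diffOp ht (fun i => (ha i).continuousOn) hb.continuousOn hv).mono (hbK.trans hr)
  have hfdc : ∀ i, Continuous fun y => fderiv ℝ W y (stdBasis n i) := fun i =>
    (hWs.continuous_fderiv (by simp)).clm_apply continuous_const
  have hac : ∀ i, ContinuousOn (fun y => a i y (v y)) (Metric.ball y₀ r₁) := fun i =>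
    ((ha i).continuousOn.clm_apply hv.continuousOn).mono (hbK.trans hr)
  have hI1 : Integrable fun y => inner ℂ (W y) (chartExp φ p y • diffOp a b v y) :=
    hcut (hWs.continuous.continuousOn.inner (hEc.smul hDc)) fun y hy => by
      rw [hWz y hy, inner_zero_left]
  have hI2 : Integrable fun y => inner ℂ (chartExp φ p y • ∑ i, ContinuousLinearMap.adjoint (a i y)
      (fderiv ℝ W y (stdBasis n i))) (v y) := by
    refine hcut ((hEc.smul (continuousOn_finsetSum _ fun i _ => ?_)).inner
      (hv.continuousOn.mono (hbK.trans hr))) fun y hy => by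
      simp only [hdWz y hy, _root_.zero_apply, map_zero, Finset.sum_const_zero, smul_zero,
        inner_zero_left]
    exact (continuousOn_adjoint ((ha i).continuousOn.mono (hbK.trans hr))).clm_apply
      (hfdc i).continuousOn
  have hI3 : ∀ k, Integrable fun y => inner ℂ (W y k • B k y) (v y) := by
    intro k
    have h1 : IntegrableOn (fun y => inner ℂ (B k y) (V k y)) K :=
      integrable_inner_of_memLp (hB k) (memLp_of_continuousOn hK (hVc k).continuous.continuousOn)
    refine (h1.integrable_of_forall_notMem_eq_zero fun y hy => ?_).congr
      (Eventually.of_forall fun y => ?_)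
    · rw [hV0 k y fun h => hy (hbK (hW.subset h)), inner_zero_right]
    · simp only [V, w, inner_smul_left, inner_smul_right]
  have hsum : ∑ k, ∫ y, inner ℂ (W y k • B k y) (v y) =
      (∫ y, inner ℂ (W y) (chartExp φ p y • diffOp a b v y)) +
      ∫ y, inner ℂ (chartExp φ p y • ∑ i, ContinuousLinearMap.adjoint (a i y)
      (fderiv ℝ W y (stdBasis n i))) (v y) := by
    have h1 : ∀ k, ∫ y, inner ℂ (W y k • B k y) (v y) =
        ∫ y, (chartExp φ p y : ℂ) * inner ℂ (EuclideanSpace.single k (1 : ℂ))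
          (diffOp a b (V k) y) := by
      intro k
      rw [← hweak k _ (hVc k) (hVs k)]
      refine integral_congr_ae (Eventually.of_forall fun y => ?_)
      simp only [V, w, inner_smul_left, inner_smul_right]
    have hI4 : ∀ k, Integrable fun y => (chartExp φ p y : ℂ) *
        inner ℂ (EuclideanSpace.single k (1 : ℂ)) (diffOp a b (V k) y) := by
      intro k
      refine hcut ((Complex.continuous_ofReal.comp_continuousOn hEc).mul
        (continuousOn_const.inner ((continuousOn_diffOp hU (fun i => (ha i).continuousOn.mono
          (hbK.trans hr)) (hb.continuousOn.mono (hbK.trans hr)) (hVon k))))) fun y hy => ?_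
      have h2 : y ∉ tsupport (V k) := fun h => hy (hVsupp k h)
      rw [diffOp_eq_zero h2, inner_zero_right, mul_zero]
    rw [Finset.sum_congr rfl fun k _ => h1 k, ← integral_finsetSum _ fun k _ => hI4 k,
      ← integral_add hI1 hI2]
    refine integral_congr_ae (Eventually.of_forall fun y => ?_)
    simp only
    by_cases hy : y ∈ tsupport W
    · have hyb := hW.subset hy
      rw [Finset.sum_congr rfl fun k _ => by rw [hDV k y hyb], ← Finset.mul_sum,
        RCLike.real_smul_eq_coe_smul (K := ℂ), RCLike.real_smul_eq_coe_smul (K := ℂ),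
        inner_smul_right, inner_smul_left, RCLike.conj_ofReal, ← mul_add]
      congr 1
      rw [inner_coef (W y), sum_inner]
      simp only [ContinuousLinearMap.adjoint_inner_left, inner_add_right, inner_smul_right, inner_sum,
        Finset.sum_add_distrib]
      congr 1
      rw [Finset.sum_comm]
      exact Finset.sum_congr rfl fun i _ => (inner_coef _ _).symm
    · have h2 : ∀ k, y ∉ tsupport (V k) := fun k h => hy (hVsupp k h)
      simp only [diffOp_eq_zero (h2 _), hWz y hy, hdWz y hy, _root_.zero_apply, map_zero,
        Finset.sum_const_zero, smul_zero, inner_zero_left, inner_zero_right, mul_zero, add_zero]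
  rw [eq_sub_of_add_eq hsum.symm, ← integral_finsetSum _ fun k _ => hI3 k,
    ← integral_sub (integrable_finsetSum _ fun k _ => hI3 k) hI2]
  refine Eq.trans ?_ (setIntegral_eq_integral_of_forall_compl_eq_zero (s := K) fun y hy => ?_).symm
  · refine integral_congr_ae (Eventually.of_forall fun y => ?_)
    simp only
    rw [adjointRep, inner_sub_left, sum_inner]
  · have hy' : y ∉ tsupport W := fun h => hy (hbK (hW.subset h))
    rw [adjointRep, hdWz y hy', hWz y hy']
    simp

/-- A bound for the adjoint on smooth forms with support in a ball. -/
theorem exists_norm_adjoint_le [T2Space X] (hφ : Continuous φ) (hT : IsClosedDiffOperator T)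
    (hsym : IsLocalSymbol T p a b) {y₀ : Cn n} {r₁ : ℝ}
    (hr : Metric.closedBall y₀ r₁ ⊆ (chartAt (Cn n) p).target)
    {B : Finset (Fin (2 * n)) → Cn n → Coef n}
    (hB : ∀ k, MemLp (B k) 2 (volume.restrict (Metric.closedBall y₀ r₁)))
    (hweak : ∀ k, ∀ v : Cn n → Coef n, IsCutoff (Metric.ball y₀ r₁) v → ContDiff ℝ ∞ v →
      ∫ y, inner ℂ (B k y) (v y) =
        ∫ y, (chartExp φ p y : ℂ) * inner ℂ (EuclideanSpace.single k (1 : ℂ)) (diffOp a b v y)) :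
    ∃ C : ℝ, 0 < C ∧ ∀ W : Cn n → Coef n, IsCutoff (Metric.ball y₀ r₁) W → ContDiff ℝ ∞ W →
      ∃ h, (chartClass φ p fun y => formMetricInv p y (W y), h) ∈ (LinearPMap.adjoint T).graph ∧
        ‖h‖ ^ 2 ≤ C * ∫ y in Metric.closedBall y₀ r₁, ‖adjointRep φ p a B W y‖ ^ 2 := by
  have ht := (chartAt (Cn n) p).open_target
  have hK : IsCompact (Metric.closedBall y₀ r₁) := isCompact_closedBall _ _
  obtain ⟨C, hC, hCle⟩ := exists_lintegral_chartRep_le (φ := φ) hφ p hK hr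
  refine ⟨C, hC, fun W hW hWs => ?_⟩
  have hWU : IsCutoff (chartAt (Cn n) p).target W :=
    hW.mono (Metric.ball_subset_closedBall.trans hr)
  have hgon : ContDiffOn ℝ ∞ (fun y => formMetricInv p y (W y)) (chartAt (Cn n) p).target :=
    contDiffOn_clm_apply_real (contDiffOn_formMetricInv p) hWs.contDiffOn
  have hg0 : ∀ y, y ∉ tsupport W → formMetricInv p y (W y) = 0 := fun y hy => by
    rw [image_eq_zero_of_notMem_tsupport hy, map_zero]
  have hg := hWU.of_eq_zero ht hgon.continuousOn hg0
  obtain ⟨h, hh⟩ := exists_mem_adjoint_graph hφ hT hg (hWU.contDiff_of_eq_zero ht hgon hg0)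
  refine ⟨h, hh, ?_⟩
  have hF := memLp_adjointRep (a := a) hφ hK hr (fun i => (hsym.contDiffOn_a i).continuousOn) hB hWs
  set A := ∫ y in Metric.closedBall y₀ r₁, ‖adjointRep φ p a B W y‖ ^ 2 with hA
  have hA0 : 0 ≤ A := integral_nonneg fun _ => by positivity
  have hle : ‖h‖ ≤ Real.sqrt (C * A) := by
    refine norm_le_of_dense (dense_testForms hφ) (Real.sqrt_nonneg _) ?_
    rintro u ⟨η, hη, hu⟩
    obtain ⟨D, -, hD⟩ := hT.acts
    obtain ⟨f, hf, -⟩ := hD η hη u hu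
    have hact := (ae_restrict_iff' ht.measurableSet).1 (hsym.acts η hη u f hu hf)
    have hrep := ae_restrict_of_ae_restrict_of_subset hr (chartRep_of_isClassOf hφ p hu)
    have h1 : inner ℂ h u =
        ∫ y in Metric.closedBall y₀ r₁, inner ℂ (adjointRep φ p a B W y) (chartRep p u y) := by
      rw [inner_adjoint_graph hT.dense hf hh, ← inner_conj_symm, inner_chartClass hφ p hg,
        ← integral_conj]
      refine Eq.trans ?_ ((integral_inner_adjointRep hφ hr hsym.contDiffOn_a hsym.contDiffOn_b hB
        hweak hW hWs (contDiffOn_formRep hη.1 p)).trans ?_)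
      · refine integral_congr_ae ?_
        filter_upwards [hact] with y hy
        by_cases hyW : y ∈ tsupport W
        · have hyU := hWU.subset hyW
          rw [inner_conj_symm, hy hyU, formMetric_inv_apply hyU,
            RCLike.real_smul_eq_coe_smul (K := ℂ), RCLike.real_smul_eq_coe_smul (K := ℂ),
            inner_smul_left, inner_smul_right, RCLike.conj_ofReal]
        · rw [image_eq_zero_of_notMem_tsupport hyW, map_zero, map_zero, smul_zero, inner_zero_right,
            map_zero, inner_zero_left]
      · refine integral_congr_ae ?_
        filter_upwards [hrep] with y hy
        rw [hy]
    rw [h1]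
    refine (norm_integral_le_integral_norm _).trans ?_
    calc ∫ y in Metric.closedBall y₀ r₁, ‖inner ℂ (adjointRep φ p a B W y) (chartRep p u y)‖
        ≤ ∫ y in Metric.closedBall y₀ r₁, ‖adjointRep φ p a B W y‖ * ‖chartRep p u y‖ :=
          integral_mono_of_nonneg (Eventually.of_forall fun _ => norm_nonneg _)
            (hF.norm.integrable_mul (hCle u).1.norm)
            (Eventually.of_forall fun y => norm_inner_le_norm _ _)
      _ ≤ Real.sqrt A * Real.sqrt (∫ y in Metric.closedBall y₀ r₁, ‖chartRep p u y‖ ^ 2) :=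
          integral_norm_mul_norm_le hF (hCle u).1
      _ ≤ Real.sqrt A * Real.sqrt (C * ‖u‖ ^ 2) := by
          gcongr
          exact (hCle u).2
      _ = Real.sqrt (C * A) * ‖u‖ := by
          rw [Real.sqrt_mul hC.le, Real.sqrt_mul hC.le, Real.sqrt_sq (norm_nonneg _)]
          ring
  calc ‖h‖ ^ 2 ≤ Real.sqrt (C * A) ^ 2 := by gcongr
    _ = C * A := Real.sq_sqrt (by positivity)

end Adjoint

/-! ### The weak equation for the operator -/

section WeakEquation

variable {n : ℕ} {X : Type*} [TopologicalSpace X] [ChartedSpace (Cn n) X]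
  [IsManifold 𝓘(ℂ, Cn n) ω X]
  [RiemannianBundle (fun x : X => TangentSpace 𝓘(ℝ, Cn n) x)]
  [IsContMDiffRiemannianBundle 𝓘(ℝ, Cn n) ∞ (Cn n) (fun x : X => TangentSpace 𝓘(ℝ, Cn n) x)]
  [MeasurableSpace X] [BorelSpace X] [SecondCountableTopology X] {φ : X → ℝ}

theorem exists_lipschitz_of_contDiffOn {F : Type*} [NormedAddCommGroup F] [NormedSpace ℝ F]
    {U K : Set (Cn n)} (hU : IsOpen U) (hK : IsCompact K) (hKU : K ⊆ U) (hc : Convex ℝ K)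
    {f : Cn n → F} (hf : ContDiffOn ℝ ∞ f U) :
    ∃ L : ℝ, 0 < L ∧ ∀ x ∈ K, ∀ y ∈ K, ‖f x - f y‖ ≤ L * ‖x - y‖ := by
  obtain ⟨L, hL, h⟩ := exists_norm_clm_le hK
    ((hf.continuousOn_fderiv_of_isOpen hU (by simp)).mono hKU)
  refine ⟨L, hL, fun x hx y hy => hc.norm_image_sub_le_of_norm_fderiv_le (𝕜 := ℝ)
    (fun z hz => ((hf.contDiffAt (hU.mem_nhds (hKU hz))).differentiableAt (by simp))) h hy hx⟩

theorem tendsto_mollify {κ : Cn n → ℝ} (hκ : Continuous κ) {ρ : ℕ → Cn n → ℝ} {ε : ℕ → ℝ}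
    (hε : Tendsto ε atTop (𝓝 0)) (hρ : ∀ j, ContDiff ℝ ∞ (ρ j)) (hρ0 : ∀ j x, 0 ≤ ρ j x)
    (hρs : ∀ j x, ε j ≤ ‖x‖ → ρ j x = 0) (hρ1 : ∀ j, ∫ x, ρ j x = 1) (x : Cn n) :
    Tendsto (fun j => mollify (ρ j) κ x) atTop (𝓝 (κ x)) := by
  rw [Metric.tendsto_atTop]
  intro δ hδ
  obtain ⟨η, hη, h⟩ := Metric.continuous_iff.1 hκ x (δ / 2) (by positivity)
  obtain ⟨N, hN⟩ := eventually_atTop.1 (hε.eventually (gt_mem_nhds hη))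
  refine ⟨N, fun j hj => ?_⟩
  have h1 := abs_mollify_sub_le (hρ j) (hρ0 j) (hρs j) (hρ1 j) hκ (x := x) (m := κ x - δ / 2)
    (M := κ x + δ / 2) fun y hy => by
      have h2 := h y (by rw [dist_comm]; exact hy.trans_lt (hN j hj))
      rw [Real.dist_eq, abs_lt] at h2
      constructor <;> linarith
  rw [Real.dist_eq, abs_lt]
  constructor <;> linarith

variable {p : X} {a : Fin (2 * n) → Cn n → Coef n →L[ℂ] Coef n} {b : Cn n → Coef n →L[ℂ] Coef n}

theorem sum_smul_single (c : Coef n) :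
    ∑ k, c k • (EuclideanSpace.single k (1 : ℂ) : Coef n) = c := by
  ext s
  simp [Finset.sum_apply, Pi.single_apply]

/-- A pointwise bound for the adjoint on `W = w / κ`. -/
theorem norm_adjointRep_div_le {κ : Cn n → ℝ} {w : Cn n → Coef n}
    {B : Finset (Fin (2 * n)) → Cn n → Coef n} {y : Cn n} {m M Ca Cw Cd : ℝ} (hm : 0 < m)
    (hκ : DifferentiableAt ℝ κ y) (hκm : m ≤ κ y) (hM : chartExp φ p y ≤ M)
    (hw : DifferentiableAt ℝ w y) (hCw : ‖w y‖ ≤ Cw) (hCa : ∀ i, ‖a i y‖ ≤ Ca)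
    (hCd : ∀ i, ‖fderiv ℝ w y (stdBasis n i)‖ ≤ Cd) :
    ‖adjointRep φ p a B (fun y => (κ y)⁻¹ • w y) y‖ ≤
      m⁻¹ * Cw * ∑ k, ‖B k y‖ + M * (m⁻¹ * ((2 * n : ℕ) * (Ca * Cd)) + (m⁻¹) ^ 2 * (Cw *
        ∑ k, ‖∑ i, fderiv ℝ κ y (stdBasis n i) • ContinuousLinearMap.adjoint (a i y)
          (EuclideanSpace.single k (1 : ℂ))‖)) := by
  have hκ0 : 0 < κ y := hm.trans_le hκm
  have hCw0 : 0 ≤ Cw := (norm_nonneg _).trans hCw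
  have hM0 : 0 ≤ M := (chartExp_pos φ p y).le.trans hM
  have hinv : (κ y)⁻¹ ≤ m⁻¹ := inv_anti₀ hm hκm
  have hfd : ∀ i, fderiv ℝ (fun y => (κ y)⁻¹ • w y) y (stdBasis n i) =
      (κ y)⁻¹ • fderiv ℝ w y (stdBasis n i) -
        ((κ y)⁻¹ ^ 2) • fderiv ℝ κ y (stdBasis n i) • w y := by
    intro i
    have h1 : HasFDerivAt (fun y => (κ y)⁻¹) (-((κ y) ^ 2)⁻¹ • fderiv ℝ κ y) y :=
      (hasDerivAt_inv hκ0.ne').comp_hasFDerivAt y hκ.hasFDerivAt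
    rw [show (fun y => (κ y)⁻¹ • w y) = (fun y => (κ y)⁻¹) • w from rfl,
      (h1.smul hw.hasFDerivAt).fderiv]
    simp only [_root_.add_apply, _root_.smul_apply, ContinuousLinearMap.smulRight_apply,
      neg_smul, _root_.neg_apply, smul_smul, inv_pow, smul_eq_mul, sub_eq_add_neg]
  set S : Coef n → Coef n := fun c => ∑ i, fderiv ℝ κ y (stdBasis n i) •
    ContinuousLinearMap.adjoint (a i y) c with hS
  have hSw : S (w y) = ∑ k, w y k • S (EuclideanSpace.single k (1 : ℂ)) := by
    simp only [hS, Finset.smul_sum]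
    rw [Finset.sum_comm]
    refine Finset.sum_congr rfl fun i _ => ?_
    conv_lhs => rw [← sum_smul_single (w y), map_sum, Finset.smul_sum]
    refine Finset.sum_congr rfl fun k _ => ?_
    rw [map_smul, smul_comm]
  have hwk : ∀ k, ‖w y k‖ ≤ Cw := fun k => (PiLp.norm_apply_le (w y) k).trans hCw
  have hval : adjointRep φ p a B (fun y => (κ y)⁻¹ • w y) y =
      ∑ k, ((κ y)⁻¹ • w y k) • B k y - chartExp φ p y • ((κ y)⁻¹ • ∑ i,
        ContinuousLinearMap.adjoint (a i y) (fderiv ℝ w y (stdBasis n i)) -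
        ((κ y)⁻¹ ^ 2) • S (w y)) := by
    rw [adjointRep]
    congr 2
    simp only [hfd, map_sub, ContinuousLinearMap.map_smul_of_tower, Finset.sum_sub_distrib,
      Finset.smul_sum, hS]
  rw [hval]
  have h1 : ‖∑ k, ((κ y)⁻¹ • w y k) • B k y‖ ≤ m⁻¹ * Cw * ∑ k, ‖B k y‖ := by
    rw [Finset.mul_sum]
    refine (norm_sum_le _ _).trans (Finset.sum_le_sum fun k _ => ?_)
    rw [norm_smul, norm_smul, norm_inv, Real.norm_of_nonneg hκ0.le]
    gcongr
    exact hwk k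
  have h2 : ‖(κ y)⁻¹ • ∑ i, ContinuousLinearMap.adjoint (a i y)
      (fderiv ℝ w y (stdBasis n i))‖ ≤ m⁻¹ * ((2 * n : ℕ) * (Ca * Cd)) := by
    rw [norm_smul, norm_inv, Real.norm_of_nonneg hκ0.le]
    gcongr
    refine (norm_sum_le _ _).trans ?_
    calc ∑ i, ‖ContinuousLinearMap.adjoint (a i y) (fderiv ℝ w y (stdBasis n i))‖
        ≤ ∑ _i : Fin (2 * n), Ca * Cd := by
          refine Finset.sum_le_sum fun i _ => (ContinuousLinearMap.le_opNorm _ _).trans ?_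
          rw [LinearIsometryEquiv.norm_map]
          have := (norm_nonneg _).trans (hCa i)
          gcongr
          · exact hCa i
          · exact hCd i
      _ = _ := by rw [Finset.sum_const, Finset.card_univ, Fintype.card_fin, nsmul_eq_mul]
  have h3 : ‖((κ y)⁻¹ ^ 2) • S (w y)‖ ≤
      (m⁻¹) ^ 2 * (Cw * ∑ k, ‖S (EuclideanSpace.single k (1 : ℂ))‖) := by
    rw [norm_smul, norm_pow, norm_inv, Real.norm_of_nonneg hκ0.le]
    gcongr
    rw [hSw, Finset.mul_sum]
    refine (norm_sum_le _ _).trans (Finset.sum_le_sum fun k _ => ?_)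
    rw [norm_smul]
    gcongr
    exact hwk k
  refine (norm_sub_le _ _).trans (add_le_add h1 ?_)
  rw [norm_smul, Real.norm_of_nonneg (chartExp_pos φ p y).le]
  exact mul_le_mul hM ((norm_sub_le _ _).trans (add_le_add h2 h3)) (norm_nonneg _) hM0

end WeakEquation

section WeakEquation

variable {n : ℕ} {X : Type*} [TopologicalSpace X] [ChartedSpace (Cn n) X]
  [IsManifold 𝓘(ℂ, Cn n) ω X]
  [RiemannianBundle (fun x : X => TangentSpace 𝓘(ℝ, Cn n) x)]
  [IsContMDiffRiemannianBundle 𝓘(ℝ, Cn n) ∞ (Cn n) (fun x : X => TangentSpace 𝓘(ℝ, Cn n) x)]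
  [MeasurableSpace X] [BorelSpace X] [SecondCountableTopology X] {φ : X → ℝ}
  {p : X} {a : Fin (2 * n) → Cn n → Coef n →L[ℂ] Coef n} {b : Cn n → Coef n →L[ℂ] Coef n}

/-- A pointwise bound by functions that are bounded in `L²` gives a bound in `L²`. -/
theorem setIntegral_sq_le_of_norm_le {K : Set (Cn n)} (hK : IsCompact K) {ι : Type*} [Fintype ι]
    {F : Cn n → Coef n} {f g : ι → Cn n → ℝ} {D E : ℝ}
    (hf : ∀ k, IntegrableOn (fun y => f k y ^ 2) K) (hg : ∀ k, IntegrableOn (fun y => g k y ^ 2) K)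
    (hfE : ∀ k, ∫ y in K, f k y ^ 2 ≤ E) (hgE : ∀ k, ∫ y in K, g k y ^ 2 ≤ E)
    (hF : ∀ y ∈ K, ‖F y‖ ≤ D * (1 + ∑ k, f k y + ∑ k, g k y)) :
    ∫ y in K, ‖F y‖ ^ 2 ≤
      D ^ 2 * (3 * (volume.real K + Fintype.card ι * (Fintype.card ι * E) +
        Fintype.card ι * (Fintype.card ι * E))) := by
  have h1 : ∀ (h : ι → ℝ), (∑ k, h k) ^ 2 ≤ Fintype.card ι * ∑ k, h k ^ 2 := fun h => by
    have := sq_sum_le_card_mul_sum_sq (s := Finset.univ) (f := h)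
    rwa [Finset.card_univ] at this
  have hint : IntegrableOn (fun y => D ^ 2 * (3 * (1 + Fintype.card ι * ∑ k, f k y ^ 2 +
      Fintype.card ι * ∑ k, g k y ^ 2))) K := by
    have hs0 : Integrable (fun _ : Cn n => (1 : ℝ)) (volume.restrict K) :=
      integrableOn_const (hK.measure_lt_top.ne)
    have hs1 : Integrable (fun y => (Fintype.card ι : ℝ) * ∑ k, f k y ^ 2) (volume.restrict K) :=
      (integrable_finsetSum _ fun k _ => hf k).const_mul _
    have hs2 : Integrable (fun y => (Fintype.card ι : ℝ) * ∑ k, g k y ^ 2) (volume.restrict K) :=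
      (integrable_finsetSum _ fun k _ => hg k).const_mul _
    exact (((hs0.add hs1).add hs2).const_mul 3).const_mul (D ^ 2)
  calc ∫ y in K, ‖F y‖ ^ 2 ≤ ∫ y in K, D ^ 2 * (3 * (1 + Fintype.card ι * ∑ k, f k y ^ 2 +
      Fintype.card ι * ∑ k, g k y ^ 2)) := by
        refine integral_mono_of_nonneg (Eventually.of_forall fun y => by positivity) hint ?_
        filter_upwards [ae_restrict_mem hK.measurableSet] with y hy
        have h2 := hF y hy
        have h3 := h1 fun k => f k y
        have h4 := h1 fun k => g k y
        calc ‖F y‖ ^ 2 ≤ (D * (1 + ∑ k, f k y + ∑ k, g k y)) ^ 2 := by gcongr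
          _ = D ^ 2 * (1 + ∑ k, f k y + ∑ k, g k y) ^ 2 := by ring
          _ ≤ D ^ 2 * (3 * (1 + (∑ k, f k y) ^ 2 + (∑ k, g k y) ^ 2)) := by
              gcongr
              nlinarith [sq_nonneg (1 - ∑ k, f k y), sq_nonneg (1 - ∑ k, g k y),
                sq_nonneg (∑ k, f k y - ∑ k, g k y)]
          _ ≤ _ := by gcongr
    _ = D ^ 2 * (3 * (volume.real K + Fintype.card ι * (∑ k, ∫ y in K, f k y ^ 2) +
        Fintype.card ι * (∑ k, ∫ y in K, g k y ^ 2))) := by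
        have hs1 := (integrable_finsetSum (μ := volume.restrict K) Finset.univ
          fun k _ => hf k).const_mul (Fintype.card ι : ℝ)
        have hs2 := (integrable_finsetSum (μ := volume.restrict K) Finset.univ
          fun k _ => hg k).const_mul (Fintype.card ι : ℝ)
        have hs0 : IntegrableOn (fun _ : Cn n => (1 : ℝ)) K := integrableOn_const
          (hK.measure_lt_top.ne)
        have hs01 : Integrable (fun y => 1 + (Fintype.card ι : ℝ) * ∑ k, f k y ^ 2)
          (volume.restrict K) := hs0.add hs1
        rw [integral_const_mul, integral_const_mul, integral_add hs01 hs2, integral_add hs0 hs1,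
          integral_const_mul, integral_const_mul, integral_finsetSum _ fun k _ => hf k,
          integral_finsetSum _ fun k _ => hg k]
        simp [Measure.real]
    _ ≤ _ := by
        have h5 : ∑ k, ∫ y in K, f k y ^ 2 ≤ Fintype.card ι * E := by
          refine (Finset.sum_le_sum fun k _ => hfE k).trans_eq ?_
          rw [Finset.sum_const, Finset.card_univ, nsmul_eq_mul]
        have h6 : ∑ k, ∫ y in K, g k y ^ 2 ≤ Fintype.card ι * E := by
          refine (Finset.sum_le_sum fun k _ => hgE k).trans_eq ?_
          rw [Finset.sum_const, Finset.card_univ, nsmul_eq_mul]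
        gcongr

/-- The terms of `norm_adjointRep_div_le`, collected into one constant. -/
theorem add_mul_add_mul_le {A M A₂ q q' s₁ s₂ s₃ N : ℝ} (hA : 0 ≤ A) (hM : 0 ≤ M) (hA₂ : 0 ≤ A₂)
    (hq : 0 ≤ q) (hq' : 0 ≤ q') (h₁ : 0 ≤ s₁) (h₂ : 0 ≤ s₂) (hN : 0 ≤ N) (h₃ : s₃ ≤ s₂ + N) :
    A * s₁ + M * (A₂ + q * (q' * s₃)) ≤
      (A + M * A₂ + M * (q * q') * (1 + N)) * (1 + s₁ + s₂) := by
  have h4 : M * (q * (q' * s₃)) ≤ M * (q * (q' * (s₂ + N))) := by gcongr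
  have hMA := mul_nonneg hM hA₂
  have hMq := mul_nonneg hM (mul_nonneg hq hq')
  nlinarith [mul_nonneg hA h₂, mul_nonneg hMA h₁, mul_nonneg hMA h₂, mul_nonneg hMq h₁,
    mul_nonneg (mul_nonneg hMq hN) h₁, mul_nonneg (mul_nonneg hMq hN) h₂]

set_option maxHeartbeats 800000 in
/-- Smooth approximations `W` of `e^{φ} w` for which the adjoint stays bounded. They are obtained
by dividing `w` by mollifications of `e^{-φ}`. -/
theorem exists_approximation (hφ : Continuous φ) {y₀ : Cn n} {r₀ r₁ r₂ : ℝ} (h0 : 0 < r₀)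
    (h01 : r₀ < r₁) (h12 : r₁ < r₂)
    (hr : Metric.closedBall y₀ r₂ ⊆ (chartAt (Cn n) p).target)
    (ha : ∀ i, ContDiffOn ℝ ∞ (a i) (chartAt (Cn n) p).target)
    (hb : ContDiffOn ℝ ∞ b (chartAt (Cn n) p).target)
    {B : Finset (Fin (2 * n)) → Cn n → Coef n}
    (hB : ∀ k, MemLp (B k) 2 (volume.restrict (Metric.closedBall y₀ r₁)))
    (hweak : ∀ k, ∀ v : Cn n → Coef n, IsCutoff (Metric.ball y₀ r₁) v → ContDiff ℝ ∞ v →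
      ∫ y, inner ℂ (B k y) (v y) =
        ∫ y, (chartExp φ p y : ℂ) * inner ℂ (EuclideanSpace.single k (1 : ℂ)) (diffOp a b v y))
    {w : Cn n → Coef n} (hw : IsCutoff (Metric.ball y₀ r₀) w) (hws : ContDiff ℝ ∞ w) :
    ∃ W : ℕ → Cn n → Coef n,
      (∀ j, IsCutoff (Metric.ball y₀ r₀) (W j) ∧ ContDiff ℝ ∞ (W j)) ∧
      (∃ D, ∀ j, ∫ y in Metric.closedBall y₀ r₁, ‖adjointRep φ p a B (W j) y‖ ^ 2 ≤ D) ∧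
      (∃ D, ∀ j y, ‖chartExp φ p y • W j y‖ ≤ D * ‖w y‖) ∧
      ∀ y, Tendsto (fun j => chartExp φ p y • W j y) atTop (𝓝 (w y)) := by
  set K := Metric.closedBall y₀ r₁ with hKdef
  have ht := (chartAt (Cn n) p).open_target
  have hK : IsCompact K := isCompact_closedBall _ _
  have hKt : K ⊆ (chartAt (Cn n) p).target := (Metric.closedBall_subset_closedBall h12.le).trans hr
  have hb0K : Metric.ball y₀ r₀ ⊆ K :=
    Metric.ball_subset_closedBall.trans (Metric.closedBall_subset_closedBall h01.le)
  have hb1K : Metric.ball y₀ r₁ ⊆ K := Metric.ball_subset_closedBall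
  -- a continuous function on the whole space that agrees with the weight on `K`
  let χ : ContDiffBump y₀ := ⟨r₁, r₂, h0.trans h01, h12⟩
  have hχ : IsCutoff (chartAt (Cn n) p).target χ :=
    ⟨χ.continuous, χ.hasCompactSupport, by rw [χ.tsupport_eq]; exact hr⟩
  let κ : Cn n → ℝ := fun y => χ y * chartExp φ p y
  have hκcut : IsCutoff (chartAt (Cn n) p).target κ :=
    hχ.of_eq_zero ht (χ.continuous.continuousOn.mul (continuousOn_chartExp hφ p)) fun y hy => by
      simp only [κ, image_eq_zero_of_notMem_tsupport hy, zero_mul]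
  have hκ := hκcut.continuous
  have hκE : ∀ y ∈ K, κ y = chartExp φ p y := fun y hy => by
    simp only [κ, χ.one_of_mem_closedBall hy, one_mul]
  have hEK := (continuousOn_chartExp hφ p).mono hKt
  obtain ⟨M, hM0, hM⟩ := exists_norm_clm_le hK hEK
  obtain ⟨M', hM'0, hM'⟩ := exists_norm_clm_le hK (hEK.inv₀ fun y _ => (chartExp_pos φ p y).ne')
  have hEM : ∀ y ∈ K, chartExp φ p y ≤ M := fun y hy => (le_abs_self _).trans (hM y hy)
  set m := M'⁻¹ with hmdef
  have hm : 0 < m := inv_pos.2 hM'0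
  have hEm : ∀ y ∈ K, m ≤ chartExp φ p y := fun y hy => by
    have h1 := hM' y hy
    rw [Pi.inv_apply, norm_inv, Real.norm_of_nonneg (chartExp_pos φ p y).le] at h1
    rw [hmdef]
    exact inv_le_of_inv_le₀ (chartExp_pos φ p y) h1
  -- bounds for the coefficients
  choose Li hLi0 hLi using fun i => exists_lipschitz_of_contDiffOn ht hK hKt
    (convex_closedBall y₀ r₁) (ha i)
  choose Cai hCai0 hCai using fun i => exists_norm_clm_le hK ((ha i).continuousOn.mono hKt)
  obtain ⟨Mb, hMb0, hMb⟩ := exists_norm_clm_le hK (hb.continuousOn.mono hKt)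
  obtain ⟨Cw, hCw0, hCw⟩ := exists_norm_clm_le hK hws.continuous.continuousOn
  choose Cdi hCdi0 hCdi using fun i : Fin (2 * n) => exists_norm_clm_le hK
    (((hws.continuous_fderiv (by simp)).clm_apply
      (continuous_const (y := stdBasis n i))).continuousOn)
  have hsum : ∀ (c : Fin (2 * n) → ℝ) (i : Fin (2 * n)), (∀ i, 0 < c i) → c i ≤ ∑ i, c i :=
    fun c i hc => Finset.single_le_sum (fun i _ => (hc i).le) (Finset.mem_univ i)
  -- the mollifiers
  obtain ⟨C, hC0, hmoll⟩ := exists_mollifier n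
  let ε : ℕ → ℝ := fun j => (r₁ - r₀) / 2 * (1 / ((j : ℝ) + 1))
  have hε : ∀ j, 0 < ε j := fun j => mul_pos (by linarith) (by positivity)
  have hεle : ∀ j, ε j ≤ (r₁ - r₀) / 2 := fun j => by
    refine mul_le_of_le_one_right (by linarith) ?_
    rw [div_le_one (by positivity)]
    have : (0 : ℝ) ≤ j := j.cast_nonneg
    linarith
  have hεt : Tendsto ε atTop (𝓝 0) := by
    have := (tendsto_one_div_add_atTop_nhds_zero_nat (𝕜 := ℝ)).const_mul ((r₁ - r₀) / 2)
    rwa [mul_zero] at this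
  choose ρ hρs hρ0 hρsupp hρ1 hρC using fun j => hmoll (ε j) (hε j)
  let κj : ℕ → Cn n → ℝ := fun j => mollify (ρ j) κ
  have hκjs : ∀ j, ContDiff ℝ ∞ (κj j) := fun j =>
    contDiff_mollify (hρs j) (hasCompactSupport_of_radius (hρsupp j)).2 hκ
  have hnear : ∀ j, ∀ x ∈ Metric.ball y₀ r₀, dist x y₀ + ε j < r₁ := fun j x hx => by
    have h1 := Metric.mem_ball.1 hx
    have h2 := hεle j
    linarith
  have hmemK : ∀ j, ∀ x ∈ Metric.ball y₀ r₀, ∀ y, dist x y ≤ ε j → y ∈ K := fun j x hx y hy => by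
    have h1 := hnear j x hx
    have h2 := dist_triangle y x y₀
    rw [dist_comm y x] at h2
    rw [hKdef, Metric.mem_closedBall]
    linarith
  have hκjm : ∀ j, ∀ x ∈ Metric.ball y₀ r₀, m ≤ κj j x := fun j x hx =>
    (abs_mollify_sub_le (hρs j) (hρ0 j) (hρsupp j) (hρ1 j) hκ (M := M) fun y hy => by
      have h1 := hmemK j x hx y hy
      rw [hκE y h1]
      exact ⟨hEm y h1, hEM y h1⟩).1
  let W : ℕ → Cn n → Coef n := fun j y => (κj j y)⁻¹ • w y
  have hW0 : ∀ j y, y ∉ tsupport w → W j y = 0 := fun j y hy => by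
    simp only [W, image_eq_zero_of_notMem_tsupport hy, smul_zero]
  have hWon : ∀ j, ContDiffOn ℝ ∞ (W j) (Metric.ball y₀ r₀) := fun j =>
    ((hκjs j).contDiffOn.inv fun x hx => (hm.trans_le (hκjm j x hx)).ne').smul hws.contDiffOn
  have hWc : ∀ j, IsCutoff (Metric.ball y₀ r₀) (W j) := fun j =>
    hw.of_eq_zero Metric.isOpen_ball (hWon j).continuousOn (hW0 j)
  have hWs : ∀ j, ContDiff ℝ ∞ (W j) := fun j =>
    hw.contDiff_of_eq_zero Metric.isOpen_ball (hWon j) (hW0 j)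
  refine ⟨W, fun j => ⟨hWc j, hWs j⟩, ?_, ⟨M * m⁻¹, fun j y => ?_⟩, fun y => ?_⟩
  · -- the averages of `‖B k‖`, cut off outside `K`
    let β : Finset (Fin (2 * n)) → Cn n → ℝ := fun k => K.indicator fun y => ‖B k y‖
    have hfin : IsFiniteMeasure (volume.restrict K) := ⟨by
      rw [Measure.restrict_apply_univ]
      exact hK.measure_lt_top⟩
    have hBi : ∀ k, IntegrableOn (B k) K := fun k => (hB k).integrable one_le_two
    have hβi : ∀ k, Integrable (β k) := fun k =>
      (integrable_indicator_iff hK.measurableSet).2 (hBi k).norm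
    have hβ2 : ∀ k, (fun y => β k y ^ 2) = K.indicator fun y => ‖B k y‖ ^ 2 := fun k => by
      ext y
      by_cases hy : y ∈ K
      · simp only [β, indicator_of_mem hy]
      · simp only [β, indicator_of_notMem hy, zero_pow two_ne_zero]
    have hB2 : ∀ k, IntegrableOn (fun y => ‖B k y‖ ^ 2) K := fun k =>
      (hB k).integrable_norm_pow two_ne_zero
    have hβ2i : ∀ k, Integrable fun y => β k y ^ 2 := fun k => by
      rw [hβ2 k]
      exact (integrable_indicator_iff hK.measurableSet).2 (hB2 k)
    have hβint : ∀ k, ∫ y, β k y ^ 2 = ∫ y in K, ‖B k y‖ ^ 2 := fun k => by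
      rw [hβ2 k, integral_indicator hK.measurableSet]
    let g : ℕ → Finset (Fin (2 * n)) → Cn n → ℝ := fun j k x => ∫ y, ρ j (x - y) * β k y
    have hyoung := fun j k => integral_sq_convolution_le (hρs j).continuous
      (hasCompactSupport_of_radius (hρsupp j)).2 (hρ0 j) (hρ1 j) (hβi k) (hβ2i k)
    have hg : ∀ j k, ∀ x ∈ Metric.ball y₀ r₀, ∫ y, ρ j (x - y) * ‖B k y‖ = g j k x := by
      intro j k x hx
      refine integral_congr_ae (Eventually.of_forall fun y => ?_)
      simp only
      rcases le_or_gt (ε j) ‖x - y‖ with h | h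
      · rw [hρsupp j _ h, zero_mul, zero_mul]
      · have hyK := hmemK j x hx y (by rw [dist_eq_norm]; exact h.le)
        simp only [β, indicator_of_mem hyK]
    set D₀ := M * 1 * (Mb + (2 * n : ℕ) * ((∑ i, Li i) * C)) with hD₀
    have hgrad : ∀ j k, ∀ x ∈ Metric.ball y₀ r₀,
        ‖∑ i, fderiv ℝ (κj j) x (stdBasis n i) • ContinuousLinearMap.adjoint (a i x)
          (EuclideanSpace.single k (1 : ℂ))‖ ≤ g j k x + D₀ := by
      intro j k x hx
      have h1 := norm_gradient_mollify_le (y₀ := y₀) (r := r₁) (ε := ε j) (M := M) (Mb := Mb)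
        (L := ∑ i, Li i) (C := C) (a := a) (b := b) (B := B k)
        (e := EuclideanSpace.single k (1 : ℂ)) hκ (fun y hy => by rw [hκE y hy]; exact hM y hy) hMb
        (fun i => (ha i).continuousOn.mono hKt) (hb.continuousOn.mono hKt)
        (Finset.sum_nonneg fun i _ => (hLi0 i).le)
        (fun i x hx y hy => (hLi i x hx y hy).trans
          (mul_le_mul_of_nonneg_right (hsum Li i hLi0) (norm_nonneg _))) (hBi k)
        (fun v hv hvs => by
          rw [hweak k v hv hvs]
          refine integral_congr_ae (Eventually.of_forall fun y => ?_)
          simp only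
          by_cases hy : y ∈ tsupport v
          · rw [hκE y (hb1K (hv.subset hy))]
          · rw [diffOp_eq_zero hy, inner_zero_right, mul_zero, mul_zero])
        (hρs j) (hρ0 j) (hρsupp j) (hρ1 j) (hρC j) (hε j) (hnear j x hx)
      rwa [hg j k x hx, EuclideanSpace.single, PiLp.norm_single, norm_one] at h1
    have hD₀0 : 0 ≤ D₀ := by
      have := Finset.sum_nonneg fun i (_ : i ∈ Finset.univ) => (hLi0 i).le
      positivity
    have hg0 : ∀ j k x, 0 ≤ g j k x := fun j k x => integral_nonneg fun y =>
      mul_nonneg (hρ0 j _) (indicator_nonneg (fun _ _ => norm_nonneg _) _)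
    set N : ℝ := ((Fintype.card (Finset (Fin (2 * n))) : ℕ) : ℝ) with hN
    have hN0 : 0 ≤ N := Nat.cast_nonneg _
    set D₁ := m⁻¹ * Cw + M * (m⁻¹ * ((2 * n : ℕ) * ((∑ i, Cai i) * ∑ i, Cdi i))) +
      M * ((m⁻¹) ^ 2 * Cw) * (1 + N * D₀) with hD₁
    have hca := Finset.sum_nonneg fun i (_ : i ∈ Finset.univ) => (hCai0 i).le
    have hcd := Finset.sum_nonneg fun i (_ : i ∈ Finset.univ) => (hCdi0 i).le
    have hD₁0 : 0 ≤ D₁ := by positivity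
    obtain ⟨E, hE⟩ : ∃ E, ∀ k, ∫ y in K, ‖B k y‖ ^ 2 ≤ E :=
      ⟨∑ k, ∫ y in K, ‖B k y‖ ^ 2, fun k => Finset.single_le_sum
        (f := fun k => ∫ y in K, ‖B k y‖ ^ 2) (fun k _ => integral_nonneg fun y => by positivity)
        (Finset.mem_univ k)⟩
    refine ⟨_, fun j => setIntegral_sq_le_of_norm_le hK (D := D₁)
      (f := fun k y => ‖B k y‖)
      (g := fun k y => g j k y) hB2 (fun k => (hyoung j k).1.integrableOn) hE (fun k => ?_)
      fun y hy => ?_⟩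
    · refine (setIntegral_le_integral (hyoung j k).1 (Eventually.of_forall fun y =>
        sq_nonneg _)).trans ((hyoung j k).2.trans ?_)
      rw [hβint]
      exact hE k
    · have hs1 : 0 ≤ ∑ k, ‖B k y‖ := Finset.sum_nonneg fun k _ => norm_nonneg _
      have hs2 : 0 ≤ ∑ k, g j k y := Finset.sum_nonneg fun k _ => hg0 j k y
      by_cases hyw : y ∈ tsupport w
      · have hyb := hw.subset hyw
        refine (norm_adjointRep_div_le (p := p) (φ := φ) (κ := κj j) (w := w) (Cw := Cw)
          (Ca := ∑ i, Cai i) (Cd := ∑ i, Cdi i) (B := B) hm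
          ((hκjs j).differentiable (by simp) y) (hκjm j y hyb)
          (hEM y hy) (hws.differentiable (by simp) y) (hCw y hy)
          (fun i => (hCai i y hy).trans (hsum Cai i hCai0))
          (fun i => (hCdi i y hy).trans (hsum Cdi i hCdi0))).trans ?_
        have h2 : ∑ k, ‖∑ i, fderiv ℝ (κj j) y (stdBasis n i) • ContinuousLinearMap.adjoint (a i y)
            (EuclideanSpace.single k (1 : ℂ))‖ ≤ ∑ k, g j k y + N * D₀ := by
          refine (Finset.sum_le_sum fun k _ => hgrad j k y hyb).trans_eq ?_
          rw [Finset.sum_add_distrib, Finset.sum_const, Finset.card_univ, nsmul_eq_mul]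
        have hND : 0 ≤ N * D₀ := mul_nonneg hN0 hD₀0
        have hA10 : 0 ≤ m⁻¹ * Cw := by positivity
        have hA20 : 0 ≤ m⁻¹ * ((2 * n : ℕ) * ((∑ i, Cai i) * ∑ i, Cdi i)) := by positivity
        have hA30 : 0 ≤ m⁻¹ ^ 2 := by positivity
        exact add_mul_add_mul_le hA10 hM0.le hA20 hA30 hCw0.le hs1 hs2 hND h2
      · have hsub : tsupport (W j) ⊆ tsupport w := by
          refine closure_minimal (fun z hz => ?_) (isClosed_tsupport w)
          by_contra h
          exact hz (hW0 j z h)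
        have h3 : adjointRep φ p a B (W j) y = 0 := by
          rw [adjointRep, hW0 j y hyw,
            fderiv_eq_zero_of_notMem_tsupport fun h => hyw (hsub h)]
          simp
        rw [h3, norm_zero]
        positivity
  · by_cases hy : y ∈ tsupport w
    · have hyb := hw.subset hy
      have h1 := hκjm j y hyb
      simp only [W]
      rw [norm_smul, norm_smul, norm_inv, Real.norm_of_nonneg (chartExp_pos φ p y).le,
        Real.norm_of_nonneg (hm.trans_le h1).le, ← mul_assoc]
      have h2 := hEM y (hb0K hyb)
      have h3 : (κj j y)⁻¹ ≤ m⁻¹ := inv_anti₀ hm h1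
      have h4 : 0 ≤ (κj j y)⁻¹ := inv_nonneg.2 (hm.trans_le h1).le
      gcongr
    · rw [hW0 j y hy, image_eq_zero_of_notMem_tsupport hy]
      simp
  · by_cases hy : y ∈ tsupport w
    · have hyK := hb0K (hw.subset hy)
      have h1 := tendsto_mollify hκ hεt hρs hρ0 hρsupp hρ1 y
      rw [hκE y hyK] at h1
      have hpos := chartExp_pos φ p y
      have h2 := ((h1.inv₀ hpos.ne').const_mul (chartExp φ p y)).smul_const (w y)
      rw [mul_inv_cancel₀ hpos.ne', one_smul] at h2
      refine h2.congr fun j => ?_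
      simp only [W, κj, smul_smul]
    · simp only [hW0 _ y hy, smul_zero, image_eq_zero_of_notMem_tsupport hy]
      exact tendsto_const_nhds

end WeakEquation

/-- Weak convergence of a bounded sequence can be tested on a dense set. -/
theorem tendsto_inner_of_dense {H : Type*} [NormedAddCommGroup H] [InnerProductSpace ℂ H]
    {S : Set H} (hS : Dense S) {h : ℕ → H} {h₀ : H} {M : ℝ} (hM : ∀ j, ‖h j‖ ≤ M)
    (ht : ∀ x ∈ S, Tendsto (fun j => (inner ℂ x (h j) : ℂ)) atTop (𝓝 (inner ℂ x h₀))) (x : H) :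
    Tendsto (fun j => (inner ℂ x (h j) : ℂ)) atTop (𝓝 (inner ℂ x h₀)) := by
  have hM0 : 0 ≤ M := (norm_nonneg _).trans (hM 0)
  rw [Metric.tendsto_atTop]
  intro ε hε
  set c := M + ‖h₀‖ + 1 with hc
  have hc0 : 0 < c := by positivity
  obtain ⟨y, hyS, hy⟩ := Metric.dense_iff.1 hS x (ε / (2 * c)) (by positivity)
  · obtain ⟨N, hN⟩ := Metric.tendsto_atTop.1 (ht _ hy) (ε / 2) (by positivity)
    refine ⟨N, fun j hj => ?_⟩
    have h1 := hN j hj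
    rw [dist_eq_norm] at h1 ⊢
    have h2 : (inner ℂ x (h j) - inner ℂ x h₀ : ℂ) =
        inner ℂ (x - y) (h j - h₀) + (inner ℂ y (h j) - inner ℂ y h₀) := by
      rw [inner_sub_left, inner_sub_right, inner_sub_right]
      ring
    have h3 : ‖x - y‖ * ‖h j - h₀‖ ≤ ε / (2 * c) * c := by
      have h4 : ‖x - y‖ ≤ ε / (2 * c) := by
        rw [← dist_eq_norm, dist_comm]
        exact (Metric.mem_ball.1 hyS).le
      have h5 : ‖h j - h₀‖ ≤ c := (norm_sub_le _ _).trans (by linarith [hM j])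
      gcongr
    have h6 : ε / (2 * c) * c = ε / 2 := by field_simp
    rw [h2]
    calc _ ≤ ‖(inner ℂ (x - y) (h j - h₀) : ℂ)‖ + ‖(inner ℂ y (h j) - inner ℂ y h₀ : ℂ)‖ :=
          norm_add_le _ _
      _ < ε := by linarith [norm_inner_le_norm (𝕜 := ℂ) (x - y) (h j - h₀)]

variable {n : ℕ} {X : Type*} [TopologicalSpace X] [ChartedSpace (Cn n) X]
  [IsManifold 𝓘(ℂ, Cn n) ω X]
  [RiemannianBundle (fun x : X => TangentSpace 𝓘(ℝ, Cn n) x)]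
  [IsContMDiffRiemannianBundle 𝓘(ℝ, Cn n) ∞ (Cn n) (fun x : X => TangentSpace 𝓘(ℝ, Cn n) x)]
  [MeasurableSpace X] [BorelSpace X] [SecondCountableTopology X] {φ : X → ℝ}
  {T : L2Forms n φ →ₗ.[ℂ] L2Forms n φ} {p : X}
  {a : Fin (2 * n) → Cn n → Coef n →L[ℂ] Coef n} {b : Cn n → Coef n →L[ℂ] Coef n}

theorem isCutoff_formMetricInv {W : Cn n → Coef n}
    (hW : IsCutoff (chartAt (Cn n) p).target W) :
    IsCutoff (chartAt (Cn n) p).target fun y => formMetricInv p y (W y) :=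
  hW.of_eq_zero (chartAt (Cn n) p).open_target
    ((contDiffOn_formMetricInv p).continuousOn.clm_apply hW.continuous.continuousOn) fun y hy => by
      rw [image_eq_zero_of_notMem_tsupport hy, map_zero]

/-- In a chart, `T` acts on its whole domain as a differential operator, in the weak sense. The
pairing is Euclidean, so that the test form which corresponds to `w` contains the factor `e^{φ}`,
which need not be differentiable: it is replaced by smooth approximations on which the adjoint is
bounded. -/
theorem integral_inner_chartRep [T2Space X] (hφ : Continuous φ) (hT : IsClosedDiffOperator T)
    (hsym : IsLocalSymbol T p a b) {y₀ : Cn n} {r₀ r₂ : ℝ} (h0 : 0 < r₀) (h02 : r₀ < r₂)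
    (hr : Metric.closedBall y₀ r₂ ⊆ (chartAt (Cn n) p).target)
    {w : Cn n → Coef n} (hw : IsCutoff (Metric.ball y₀ r₀) w) (hws : ContDiff ℝ ∞ w)
    {u f : L2Forms n φ} (huf : (u, f) ∈ T.graph) :
    ∫ y, inner ℂ (chartRep p f y) (w y) = ∫ y, inner ℂ (chartRep p u y) (transposeOp a b w y) := by
  obtain ⟨r₁, h01, h12⟩ := exists_between h02
  have ht := (chartAt (Cn n) p).open_target
  set K := Metric.closedBall y₀ r₁ with hKdef
  have hK : IsCompact K := isCompact_closedBall _ _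
  have hKt : K ⊆ (chartAt (Cn n) p).target := (Metric.closedBall_subset_closedBall h12.le).trans hr
  have hb0t : Metric.ball y₀ r₀ ⊆ (chartAt (Cn n) p).target :=
    (Metric.ball_subset_closedBall.trans (Metric.closedBall_subset_closedBall h02.le)).trans hr
  have hb0K : Metric.ball y₀ r₀ ⊆ K :=
    Metric.ball_subset_closedBall.trans (Metric.closedBall_subset_closedBall h01.le)
  obtain ⟨h, hweak⟩ := exists_weak_weight hφ hT hsym (h0.trans h01) h12 hr
  obtain ⟨C₁, -, hlow⟩ := exists_lowerRep_le hφ p hK hKt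
  obtain ⟨C₂, -, hrep⟩ := exists_lintegral_chartRep_le hφ p hK hKt
  obtain ⟨W, hW, ⟨D, hD⟩, ⟨D', hD'⟩, hlim⟩ := exists_approximation hφ h0 h01 h12 hr
    hsym.contDiffOn_a hsym.contDiffOn_b (fun k => (hlow (h k)).1) hweak hw hws
  obtain ⟨C, hC, hadj⟩ := exists_norm_adjoint_le hφ hT hsym hKt (fun k => (hlow (h k)).1) hweak
  choose g hg hgC using fun j => hadj (W j)
    ((hW j).1.mono (Metric.ball_subset_ball h01.le)) (hW j).2
  have hgM : ∀ j, ‖g j‖ ≤ Real.sqrt (C * D) := fun j =>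
    Real.le_sqrt_of_sq_le ((hgC j).trans (mul_le_mul_of_nonneg_left (hD j) hC.le))
  have hwt := hw.mono hb0t
  -- the pairings with `g j` converge on the domain of `T`
  have hconv : ∀ {v k : L2Forms n φ}, (v, k) ∈ T.graph →
      Tendsto (fun j => (inner ℂ v (g j) : ℂ)) atTop
        (𝓝 (∫ y, inner ℂ (chartRep p k y) (w y))) := by
    intro v k hvk
    have h1 : ∀ j, (inner ℂ v (g j) : ℂ) =
        ∫ y, inner ℂ (chartRep p k y) (chartExp φ p y • W j y) := by
      intro j
      have h2 : (inner ℂ v (g j) : ℂ) =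
          inner ℂ k (chartClass φ p fun y => formMetricInv p y (W j y)) := by
        rw [← inner_conj_symm, inner_adjoint_graph hT.dense hvk (hg j), inner_conj_symm]
      rw [h2, inner_chartClass hφ p (isCutoff_formMetricInv ((hW j).1.mono hb0t))]
      refine integral_congr_ae (Eventually.of_forall fun y => ?_)
      simp only
      by_cases hy : y ∈ (chartAt (Cn n) p).target
      · rw [formMetric_inv_apply hy]
      · rw [((hW j).1.mono hb0t).eq_zero hy, map_zero, map_zero]
    have hset : ∀ F : Cn n → Coef n, (∀ y ∉ K, F y = 0) →
        ∫ y, inner ℂ (chartRep p k y) (F y) = ∫ y in K, inner ℂ (chartRep p k y) (F y) := by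
      intro F hF
      refine (setIntegral_eq_integral_of_forall_compl_eq_zero fun y hy => ?_).symm
      rw [hF y hy, inner_zero_right]
    have hW0 : ∀ j, ∀ y ∉ K, chartExp φ p y • W j y = 0 := fun j y hy => by
      rw [(hW j).1.eq_zero fun h => hy (hb0K h), smul_zero]
    rw [hset w fun y hy => hw.eq_zero fun h => hy (hb0K h)]
    simp only [h1]
    simp only [hset _ (hW0 _)]
    have hcW : ∀ j, ContinuousOn (fun y => chartExp φ p y • W j y) K := fun j =>
      ((continuousOn_chartExp hφ p).mono hKt).smul (hW j).1.continuous.continuousOn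
    have hmk := (hrep k).1
    refine tendsto_integral_of_dominated_convergence
      (fun y => ‖chartRep p k y‖ * (D' * ‖w y‖)) (fun j => ?_) ?_ (fun j => ?_) ?_
    · exact hmk.aestronglyMeasurable.inner ((hcW j).aestronglyMeasurable hK.measurableSet)
    · have h3 : MemLp (fun y => D' * ‖w y‖) 2 (volume.restrict K) :=
        memLp_of_continuousOn hK (continuous_const.mul hw.continuous.norm).continuousOn
      exact hmk.norm.integrable_mul h3
    · exact Eventually.of_forall fun y => (norm_inner_le_norm _ _).trans
        (mul_le_mul_of_nonneg_left (hD' j y) (norm_nonneg _))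
    · exact Eventually.of_forall fun y => tendsto_const_nhds.inner (hlim y)
  have hTw := isCutoff_transposeOp ht hsym.contDiffOn_a hsym.contDiffOn_b hwt hws
  rw [← inner_chartClass_raise hφ hTw u]
  refine tendsto_nhds_unique (hconv huf)
    (tendsto_inner_of_dense (dense_testForms hφ) hgM (fun v hv => ?_) u)
  obtain ⟨η, hη, hvη⟩ := hv
  obtain ⟨A, -, hA⟩ := hT.acts
  obtain ⟨k, hk, -⟩ := hA η hη v hvη
  have h1 := hconv hk
  have h2 : ∫ y, (inner ℂ (chartRep p k y) (w y) : ℂ) =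
      inner ℂ v (chartClass φ p (raise φ p (transposeOp a b w))) := by
    rw [inner_chartClass_raise hφ hTw v]
    have h3 : ∀ {F G : Cn n → Coef n} {q : Cn n → Coef n}, (∀ᵐ y ∂(volume.restrict
        (chartAt (Cn n) p).target), F y = G y) → IsCutoff (chartAt (Cn n) p).target q →
        ∫ y, (inner ℂ (F y) (q y) : ℂ) = ∫ y, inner ℂ (G y) (q y) := by
      intro F G q hFG hq
      refine integral_congr_ae ?_
      filter_upwards [(ae_restrict_iff' ht.measurableSet).1 hFG] with y hy
      by_cases hyt : y ∈ (chartAt (Cn n) p).target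
      · rw [hy hyt]
      · rw [hq.eq_zero hyt, inner_zero_right, inner_zero_right]
    have h4 := h3 (hsym.acts η hη v k hvη hk) hwt
    have h5 := h3 (chartRep_of_isClassOf hφ p hvη) hTw
    rw [h4, h5]
    exact integral_inner_diffOp ht hsym.contDiffOn_a hsym.contDiffOn_b
      (contDiffOn_formRep hη.1 p) hwt hws
  rwa [h2] at h1

/-- In a chart, the adjoint of `T` acts on its whole domain as a differential operator, in the weak
sense. This only tests against smooth forms, which lie in the domain of `T`. -/
theorem integral_inner_lowerRep (hφ : Continuous φ) (hd : Dense (T.domain : Set (L2Forms n φ)))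
    (hsym : IsLocalSymbol T p a b) {w : Cn n → Coef n}
    (hw : IsCutoff (chartAt (Cn n) p).target w) (hws : ContDiff ℝ ∞ w)
    {u g : L2Forms n φ} (hug : (u, g) ∈ (LinearPMap.adjoint T).graph) :
    ∫ y, inner ℂ (lowerRep φ p g y) (w y) = ∫ y, inner ℂ (lowerRep φ p u y) (diffOp a b w y) := by
  rw [← inner_chartClass_eq_lowerRep hφ hw, ← inner_chartClass_eq_lowerRep hφ
    (isCutoff_diffOp (chartAt (Cn n) p).open_target (fun i => (hsym.contDiffOn_a i).continuousOn)
      hsym.contDiffOn_b.continuousOn hw hws)]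
  exact inner_adjoint_graph hd (hsym.mem_graph w hw hws) hug

/-! ### The Gårding inequality in a chart -/

section Symbol

variable {n : ℕ} {X : Type*} [TopologicalSpace X] [ChartedSpace (Cn n) X]
  [IsManifold 𝓘(ℂ, Cn n) ω X]
  [RiemannianBundle (fun x : X => TangentSpace 𝓘(ℝ, Cn n) x)]
  [IsContMDiffRiemannianBundle 𝓘(ℝ, Cn n) ∞ (Cn n) (fun x : X => TangentSpace 𝓘(ℝ, Cn n) x)]
  [MeasurableSpace X] [BorelSpace X] [SecondCountableTopology X] {φ : X → ℝ}
  {T : L2Forms n φ →ₗ.[ℂ] L2Forms n φ} {p : X}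
  {a : Fin (2 * n) → Cn n → Coef n →L[ℂ] Coef n} {b : Cn n → Coef n →L[ℂ] Coef n}

theorem integrable_norm_sq (u : L2Forms n φ) :
    Integrable (fun x => ‖u x‖ ^ 2) (weightedVolume n φ) :=
  (memLp_two_iff_integrable_sq_norm (Lp.aestronglyMeasurable u)).1 (Lp.memLp u)

theorem normOn_sq (S : Set X) (u : L2Forms n φ) :
    normOn S u ^ 2 = ∫ x in S, ‖u x‖ ^ 2 ∂weightedVolume n φ := by
  rw [normOn, Real.sq_sqrt (integral_nonneg fun x => by positivity)]

theorem normOn_sq_le (S : Set X) (u : L2Forms n φ) : normOn S u ^ 2 ≤ ‖u‖ ^ 2 := by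
  rw [normOn_sq, norm_sq_eq_integral]
  exact setIntegral_le_integral (integrable_norm_sq u) (Eventually.of_forall fun x => sq_nonneg _)

theorem fderiv_formRep_chartForm {g : Cn n → Coef n} {y : Cn n}
    (hy : y ∈ (chartAt (Cn n) p).target) :
    fderiv ℝ (formRep (chartForm p g) p) y = fderiv ℝ g y := by
  refine Filter.EventuallyEq.fderiv_eq ?_
  filter_upwards [(chartAt (Cn n) p).open_target.mem_nhds hy] with z hz
  exact formRep_chartForm hz

theorem sum_chartCoeff_chartForm [T2Space X] {g : Cn n → Coef n}
    (hg : IsCutoff (chartAt (Cn n) p).target g) (hs : ContDiff ℝ ∞ g) {y : Cn n}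
    (hy : y ∈ (chartAt (Cn n) p).target) :
    ∑ s, (‖chartCoeff (chartForm p g) p s y‖ ^ 2 +
      ∑ i, ‖chartDeriv (chartForm p g) p i s y‖ ^ 2) =
      ‖g y‖ ^ 2 + ∑ i, ‖fderiv ℝ g y (stdBasis n i)‖ ^ 2 := by
  have hη := (isTestForm_chartForm hg hs (subset_univ _)).1
  rw [Finset.sum_add_distrib, Finset.sum_comm, EuclideanSpace.norm_sq_eq]
  congr 1
  · refine Finset.sum_congr rfl fun s _ => ?_
    have h1 : chartCoeff (chartForm p g) p s y = formRep (chartForm p g) p y s := rfl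
    rw [h1, formRep_chartForm hy]
  · refine Finset.sum_congr rfl fun i _ => ?_
    rw [EuclideanSpace.norm_sq_eq]
    refine Finset.sum_congr rfl fun s _ => ?_
    rw [← fderiv_formRep hη p hy i s, fderiv_formRep_chartForm hy]

/-- For forms with support in a coordinate ball, the Sobolev norm defined by that chart alone
dominates the Euclidean norm of the derivatives. -/
theorem exists_sobolev_lower_bound [T2Space X] (hφ : Continuous φ) {y₀ : Cn n} {r₁ : ℝ}
    (hr : Metric.closedBall y₀ r₁ ⊆ (chartAt (Cn n) p).target) :
    ∃ m : ℝ, 0 < m ∧ ∀ g : Cn n → Coef n, IsCutoff (Metric.ball y₀ r₁) g → ContDiff ℝ ∞ g →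
      m * ∫ y in Metric.closedBall y₀ r₁, ∑ i, ‖fderiv ℝ g y (stdBasis n i)‖ ^ 2 ≤
        sobolevSq φ (fun _ : Fin 1 => p)
          (fun _ => (chartAt (Cn n) p).symm '' Metric.closedBall y₀ r₁)
          ((chartAt (Cn n) p).symm '' Metric.ball y₀ r₁) (chartForm p g) := by
  set e := chartAt (Cn n) p with he
  have ht := e.open_target
  set K := Metric.closedBall y₀ r₁ with hKdef
  have hK : IsCompact K := isCompact_closedBall _ _
  have hbK : Metric.ball y₀ r₁ ⊆ K := Metric.ball_subset_closedBall
  set Ω := e.symm '' Metric.ball y₀ r₁ with hΩ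
  have hΩo : IsOpen Ω := e.isOpen_image_symm_of_subset_target Metric.isOpen_ball (hbK.trans hr)
  have hΩs : Ω ⊆ e.source := by
    rintro _ ⟨y, hy, rfl⟩
    exact e.map_target (hr (hbK hy))
  have hwc := continuousOn_chartWeight (n := n) hφ p
  obtain ⟨M, hM0, hM⟩ := exists_norm_clm_le hK ((hwc.mono hr).inv₀ fun y hy =>
    (chartWeight_pos φ (hr hy)).ne')
  have hm : ∀ y ∈ K, M⁻¹ ≤ chartWeight φ p y := fun y hy => by
    have h1 := hM y hy
    have h2 := chartWeight_pos φ (hr hy)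
    rw [Pi.inv_apply, norm_inv, Real.norm_of_nonneg h2.le] at h1
    exact inv_le_of_inv_le₀ h2 h1
  refine ⟨M⁻¹, inv_pos.2 hM0, fun g hg hs => ?_⟩
  have hgt := hg.mono (hbK.trans hr)
  let G : Cn n → ℝ := fun y => ∑ i, ‖fderiv ℝ g y (stdBasis n i)‖ ^ 2
  let H : Cn n → ℝ := fun y => ‖g y‖ ^ 2 + G y
  have hGc : Continuous G := continuous_finsetSum _ fun i _ =>
    (((hs.continuous_fderiv (by simp)).clm_apply continuous_const).norm.pow 2)
  have hHc : Continuous H := (hg.continuous.norm.pow 2).add hGc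
  have hH0 : ∀ y ∉ Metric.ball y₀ r₁, H y = 0 := fun y hy => by
    have h1 : y ∉ tsupport g := fun h => hy (hg.subset h)
    simp [H, G, image_eq_zero_of_notMem_tsupport h1, fderiv_eq_zero_of_notMem_tsupport h1]
  have hGH : ∀ y, G y ≤ H y := fun y => le_add_of_nonneg_left (by positivity)
  have hG0 : ∀ y, 0 ≤ G y := fun y => Finset.sum_nonneg fun i _ => by positivity
  have hsob : sobolevSq φ (fun _ : Fin 1 => p) (fun _ => e.symm '' K) Ω (chartForm p g) =
      ∫ x in e.source, Ω.indicator (fun x => H (e x)) x ∂weightedVolume n φ := by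
    rw [sobolevSq, Fin.sum_univ_one, setIntegral_indicator hΩo.measurableSet,
      inter_eq_right.2 hΩs, inter_eq_right.2 (image_mono hbK)]
    refine setIntegral_congr_fun hΩo.measurableSet fun x hx => ?_
    exact sum_chartCoeff_chartForm hgt hs (e.map_source (hΩs hx))
  have hmeas : AEStronglyMeasurable (Ω.indicator fun x => H (e x))
      ((weightedVolume n φ).restrict e.source) := by
    refine AEStronglyMeasurable.indicator ?_ hΩo.measurableSet
    exact (hHc.comp_continuousOn e.continuousOn).aestronglyMeasurable e.open_source.measurableSet
  rw [hsob, integral_source hφ p hmeas]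
  have h1 : ∀ y ∈ e.target, chartWeight φ p y • Ω.indicator (fun x => H (e x)) (e.symm y) =
      chartWeight φ p y * H y := by
    intro y hy
    rw [smul_eq_mul]
    congr 1
    by_cases hyb : y ∈ Metric.ball y₀ r₁
    · rw [indicator_of_mem (mem_image_of_mem _ hyb), e.right_inv hy]
    · rw [hH0 y hyb, indicator_of_notMem]
      rintro ⟨z, hz, hzy⟩
      exact hyb (e.symm.injOn (hr (hbK hz)) hy hzy ▸ hz)
  rw [setIntegral_congr_fun ht.measurableSet h1, ← integral_const_mul,
    setIntegral_eq_of_subset_of_forall_sdiff_eq_zero ht.measurableSet hr fun y hy => by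
      rw [hH0 y fun h => hy.2 (hbK h), mul_zero]]
  refine setIntegral_mono_on ?_ ?_ hK.measurableSet fun y hy => ?_
  · exact ((hGc.continuousOn).integrableOn_compact hK).const_mul _
  · exact ((hwc.mono hr).mul hHc.continuousOn).integrableOn_compact hK
  · exact mul_le_mul (hm y hy) (hGH y) (hG0 y) (chartWeight_pos φ (hr hy)).le

/-- The Gårding inequality in a chart, for the Euclidean norms. -/
theorem exists_local_garding [T2Space X] (hφ : Continuous φ) (hT : IsClosedDiffOperator T)
    (hG : GardingInequality T) (hsym : IsLocalSymbol T p a b) {y₀ : Cn n} {r₁ : ℝ}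
    (hr : Metric.closedBall y₀ r₁ ⊆ (chartAt (Cn n) p).target)
    {B : Finset (Fin (2 * n)) → Cn n → Coef n}
    (hB : ∀ k, MemLp (B k) 2 (volume.restrict (Metric.closedBall y₀ r₁)))
    (hweak : ∀ k, ∀ v : Cn n → Coef n, IsCutoff (Metric.ball y₀ r₁) v → ContDiff ℝ ∞ v →
      ∫ y, inner ℂ (B k y) (v y) =
        ∫ y, (chartExp φ p y : ℂ) * inner ℂ (EuclideanSpace.single k (1 : ℂ)) (diffOp a b v y)) :
    ∃ C : ℝ, 0 < C ∧ ∀ g : Cn n → Coef n, IsCutoff (Metric.ball y₀ r₁) g → ContDiff ℝ ∞ g →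
      ∫ y in Metric.closedBall y₀ r₁, ∑ i, ‖fderiv ℝ g y (stdBasis n i)‖ ^ 2 ≤
        C * ((∫ y in Metric.closedBall y₀ r₁, ‖g y‖ ^ 2) +
          (∫ y in Metric.closedBall y₀ r₁, ‖diffOp a b g y‖ ^ 2) +
          ∫ y in Metric.closedBall y₀ r₁,
            ‖adjointRep φ p a B (fun y => formMetric p y (g y)) y‖ ^ 2) := by
  set e := chartAt (Cn n) p with he
  have ht := e.open_target
  set K := Metric.closedBall y₀ r₁ with hKdef
  have hK : IsCompact K := isCompact_closedBall _ _
  have hbK : Metric.ball y₀ r₁ ⊆ K := Metric.ball_subset_closedBall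
  set Ω := e.symm '' Metric.ball y₀ r₁ with hΩ
  have hΩo : IsOpen Ω := e.isOpen_image_symm_of_subset_target Metric.isOpen_ball (hbK.trans hr)
  have hKX : IsCompact (e.symm '' K) := hK.image_of_continuousOn (e.continuousOn_symm.mono hr)
  have hcl : closure Ω ⊆ e.symm '' K := closure_minimal (image_mono hbK) hKX.isClosed
  obtain ⟨m, hm, hlow⟩ := exists_sobolev_lower_bound hφ hr
  obtain ⟨C₁, hC₁, hGar⟩ := hG Ω hΩo (hKX.of_isClosed_subset isClosed_closure hcl) 1 (fun _ => p)
    (fun _ => e.symm '' K) (fun _ => ⟨hKX, by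
      rintro _ ⟨y, hy, rfl⟩
      exact e.map_target (hr hy)⟩) (hcl.trans (subset_iUnion_of_subset 0 subset_rfl))
  obtain ⟨C₂, hC₂, hnorm⟩ := exists_normOn_le hφ p hK hr
  obtain ⟨C₃, hC₃, hadj⟩ := exists_norm_adjoint_le hφ hT hsym hr hB hweak
  refine ⟨m⁻¹ * (C₁ * (C₂ + C₃)), by positivity, fun g hg hs => ?_⟩
  have hgt := hg.mono (hbK.trans hr)
  have hDg := isCutoff_diffOp ht (fun i => (hsym.contDiffOn_a i).continuousOn)
    hsym.contDiffOn_b.continuousOn hgt hs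
  have hWon : ContDiffOn ℝ ∞ (fun y => formMetric p y (g y)) e.target :=
    contDiffOn_clm_apply_real (contDiffOn_formMetric p) hs.contDiffOn
  have hW0 : ∀ y, y ∉ tsupport g → formMetric p y (g y) = 0 := fun y hy => by
    rw [image_eq_zero_of_notMem_tsupport hy, map_zero]
  obtain ⟨h, hh, hhC⟩ := hadj (fun y => formMetric p y (g y))
    (hg.of_eq_zero Metric.isOpen_ball (hWon.continuousOn.mono (hbK.trans hr)) hW0)
    (hgt.contDiff_of_eq_zero ht hWon hW0)
  have hinv : (fun y => formMetricInv p y (formMetric p y (g y))) = g := by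
    ext1 y
    by_cases hy : y ∈ e.target
    · exact formMetricInv_apply hy _
    · rw [hgt.eq_zero hy, map_zero, map_zero]
  rw [hinv] at hh
  have h1 := hGar _ (isTestForm_chartForm hgt hs (image_mono hg.subset)) _ _ _
    (isClassOf_chartClass hφ hgt) (hsym.mem_graph g hgt hs) hh
  have hrep : ∀ {q : Cn n → Coef n}, IsCutoff e.target q →
      normOn Ω (chartClass φ p q) ^ 2 ≤ C₂ * ∫ y in K, ‖q y‖ ^ 2 := by
    intro q hq
    refine (hnorm _ Ω hΩo.measurableSet (image_mono hbK)).trans_eq ?_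
    congr 1
    refine integral_congr_ae ?_
    filter_upwards [ae_restrict_of_ae_restrict_of_subset hr (chartRep_chartClass hφ p hq)] with y hy
    rw [hy]
  have h2 := hrep hgt
  have h3 := hrep hDg
  have h4 := (normOn_sq_le Ω h).trans hhC
  have h5 := (hlow g hg hs).trans h1
  have i1 : 0 ≤ ∫ y in K, ‖g y‖ ^ 2 := integral_nonneg fun _ => by positivity
  have i2 : 0 ≤ ∫ y in K, ‖diffOp a b g y‖ ^ 2 := integral_nonneg fun _ => by positivity
  have i3 : 0 ≤ ∫ y in K, ‖adjointRep φ p a B (fun y => formMetric p y (g y)) y‖ ^ 2 :=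
    integral_nonneg fun _ => by positivity
  rw [mul_assoc, ← div_eq_inv_mul, le_div_iff₀ hm, mul_comm _ m]
  refine h5.trans ?_
  rw [mul_assoc]
  refine mul_le_mul_of_nonneg_left ?_ hC₁.le
  refine (add_le_add (add_le_add h2 h3) h4).trans ?_
  generalize (∫ y in K, ‖g y‖ ^ 2) = I₁ at i1 ⊢
  generalize (∫ y in K, ‖diffOp a b g y‖ ^ 2) = I₂ at i2 ⊢
  generalize (∫ y in K, ‖adjointRep φ p a B (fun y => formMetric p y (g y)) y‖ ^ 2) = I₃ at i3 ⊢
  nlinarith [mul_nonneg hC₃.le i1, mul_nonneg hC₃.le i2, mul_nonneg hC₂.le i3]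

end Symbol

/-! ### Oscillating forms and ellipticity of the symbol -/

theorem integral_norm_add_sq_le {α F : Type*} [MeasurableSpace α] {μ : Measure α}
    [NormedAddCommGroup F] {P Q : α → F} (hP : MemLp P 2 μ) (hQ : MemLp Q 2 μ) :
    ∫ y, ‖P y + Q y‖ ^ 2 ∂μ ≤ 2 * (∫ y, ‖P y‖ ^ 2 ∂μ) + 2 * ∫ y, ‖Q y‖ ^ 2 ∂μ := by
  have h1 := hP.integrable_norm_pow two_ne_zero
  have h2 := hQ.integrable_norm_pow two_ne_zero
  rw [← integral_const_mul, ← integral_const_mul, ← integral_add (h1.const_mul 2) (h2.const_mul 2)]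
  refine integral_mono ((hP.add hQ).integrable_norm_pow two_ne_zero)
    ((h1.const_mul 2).add (h2.const_mul 2)) fun y => ?_
  have h3 := norm_add_le (P y) (Q y)
  have h4 : ‖P y + Q y‖ ^ 2 ≤ (‖P y‖ + ‖Q y‖) ^ 2 := by gcongr
  nlinarith [sq_nonneg (‖P y‖ - ‖Q y‖)]

/-- Comparison of the leading terms of two quadratic polynomials in `s`. -/
theorem le_of_forall_sq_mul_le {A D G : ℝ}
    (h : ∀ s : ℝ, (2 * Real.pi * s) ^ 2 * A ≤ D + (2 * Real.pi * s) ^ 2 * G) : A ≤ G := by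
  by_contra hcon
  have hAG : 0 < A - G := sub_pos.2 (not_le.1 hcon)
  have h1 := h (Real.sqrt ((|D| + 1) / (A - G)) / (2 * Real.pi))
  have h2 : (2 * Real.pi * (Real.sqrt ((|D| + 1) / (A - G)) / (2 * Real.pi))) ^ 2 =
      (|D| + 1) / (A - G) := by
    rw [mul_div_cancel₀ _ (by positivity), Real.sq_sqrt (by positivity)]
  rw [h2] at h1
  have h3 : (|D| + 1) / (A - G) * (A - G) = |D| + 1 := div_mul_cancel₀ _ hAG.ne'
  have h4 := le_abs_self D
  linarith

/-- The plane wave `e^{2πi⟨y, ξ⟩}`. -/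
def planeWave {n : ℕ} (ξ y : Cn n) : ℂ :=
  Complex.exp (((2 * Real.pi * inner ℝ y ξ : ℝ) : ℂ) * Complex.I)

/-- The principal symbol `∑ ξᵢ aᵢ(y)` of `∑ aᵢ ∂ᵢ`, without the factor `2πi`. -/
def symbolAt {n : ℕ} (a : Fin (2 * n) → Cn n → Coef n →L[ℂ] Coef n) (y ξ : Cn n) :
    Coef n →L[ℂ] Coef n :=
  ∑ i, (inner ℝ (stdBasis n i) ξ : ℝ) • a i y

section PlaneWave

variable {n : ℕ}

theorem norm_planeWave (ξ y : Cn n) : ‖planeWave ξ y‖ = 1 := Complex.norm_exp_ofReal_mul_I _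

theorem contDiff_planeWave (ξ : Cn n) : ContDiff ℝ ∞ (planeWave ξ) := by
  refine ContDiff.cexp (ContDiff.mul (Complex.ofRealCLM.contDiff.comp ?_) contDiff_const)
  exact contDiff_const.mul (contDiff_id.inner ℝ contDiff_const)

theorem hasFDerivAt_planeWave (ξ y : Cn n) : ∃ L : Cn n →L[ℝ] ℂ, HasFDerivAt (planeWave ξ) L y ∧
    ∀ v, L v = (2 * Real.pi * Complex.I) * (inner ℝ v ξ : ℝ) * planeWave ξ y := by
  have h1 : HasFDerivAt (fun y : Cn n => (inner ℝ y ξ : ℝ)) (innerSL ℝ ξ) y := by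
    have h2 := (innerSL ℝ ξ).hasFDerivAt (x := y)
    refine h2.congr_of_eventuallyEq (Eventually.of_forall fun z => ?_)
    simp only [innerSL_apply_apply]
    exact real_inner_comm _ _
  have h3 := ((Complex.ofRealCLM.hasFDerivAt.comp y (h1.const_mul (2 * Real.pi))).mul_const
    Complex.I).cexp
  refine ⟨_, h3, fun v => ?_⟩
  simp only [_root_.smul_apply, ContinuousLinearMap.comp_apply, innerSL_apply_apply,
    Complex.ofRealCLM_apply, smul_eq_mul, Function.comp, planeWave, real_inner_comm v ξ]
  push_cast
  ring

theorem fderiv_planeWave_smul {v : Cn n → Coef n} {y : Cn n} (hv : DifferentiableAt ℝ v y)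
    (ξ e : Cn n) : fderiv ℝ (fun y => planeWave ξ y • v y) y e =
      planeWave ξ y • (fderiv ℝ v y e + (2 * Real.pi * Complex.I * (inner ℝ e ξ : ℝ)) • v y) := by
  obtain ⟨L, hL, hLe⟩ := hasFDerivAt_planeWave ξ y
  have h1 := hL.smul hv.hasFDerivAt
  rw [show (fun y => planeWave ξ y • v y) = planeWave ξ • v from rfl, h1.fderiv]
  simp only [_root_.add_apply, _root_.smul_apply, ContinuousLinearMap.smulRight_apply, hLe,
    smul_add, smul_smul]
  congr 2
  ring

theorem diffOp_planeWave_smul {a : Fin (2 * n) → Cn n → Coef n →L[ℂ] Coef n}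
    {b : Cn n → Coef n →L[ℂ] Coef n} {v : Cn n → Coef n} {y : Cn n}
    (hv : DifferentiableAt ℝ v y) (ξ : Cn n) :
    diffOp a b (fun y => planeWave ξ y • v y) y =
      planeWave ξ y • (diffOp a b v y + (2 * Real.pi * Complex.I) • symbolAt a y ξ (v y)) := by
  simp only [diffOp, fderiv_planeWave_smul hv, map_smul, map_add, symbolAt, smul_add,
    Finset.sum_add_distrib, _root_.sum_apply, _root_.smul_apply, Finset.smul_sum, add_assoc,
    mul_smul, RCLike.real_smul_eq_coe_smul (K := ℂ)]
  rfl

theorem symbolAt_smul (a : Fin (2 * n) → Cn n → Coef n →L[ℂ] Coef n) (y ξ : Cn n) (t : ℝ) :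
    symbolAt a y (t • ξ) = t • symbolAt a y ξ := by
  simp only [symbolAt, inner_smul_right, Finset.smul_sum, smul_smul]

theorem continuousOn_symbolAt {a : Fin (2 * n) → Cn n → Coef n →L[ℂ] Coef n} {U : Set (Cn n)}
    (ha : ∀ i, ContinuousOn (a i) U) (ξ : Cn n) : ContinuousOn (fun y => symbolAt a y ξ) U :=
  continuousOn_finsetSum _ fun i _ =>
    (continuousOn_const (c := (inner ℝ (stdBasis n i) ξ : ℝ))).smul (ha i)

theorem sum_inner_stdBasis_sq (ξ : Cn n) :
    ∑ i, (inner ℝ (stdBasis n i) ξ : ℝ) ^ 2 = ‖ξ‖ ^ 2 := by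
  have := (stdBasis n).sum_sq_norm_inner_right ξ
  simpa using this

end PlaneWave

section Symbol

variable {n : ℕ} {X : Type*} [TopologicalSpace X] [ChartedSpace (Cn n) X]
  [IsManifold 𝓘(ℂ, Cn n) ω X]
  [RiemannianBundle (fun x : X => TangentSpace 𝓘(ℝ, Cn n) x)]
  [IsContMDiffRiemannianBundle 𝓘(ℝ, Cn n) ∞ (Cn n) (fun x : X => TangentSpace 𝓘(ℝ, Cn n) x)]
  [MeasurableSpace X] [BorelSpace X] [SecondCountableTopology X] {φ : X → ℝ}
  {T : L2Forms n φ →ₗ.[ℂ] L2Forms n φ} {p : X}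
  {a : Fin (2 * n) → Cn n → Coef n →L[ℂ] Coef n} {b : Cn n → Coef n →L[ℂ] Coef n}

/-- The coefficients of the adjoint of the principal part. -/
abbrev adjointCoeff (a : Fin (2 * n) → Cn n → Coef n →L[ℂ] Coef n) (i : Fin (2 * n)) (y : Cn n) :
    Coef n →L[ℂ] Coef n :=
  ContinuousLinearMap.adjoint (a i y)

theorem adjointRep_planeWave_smul {B : Finset (Fin (2 * n)) → Cn n → Coef n} {v : Cn n → Coef n}
    {y : Cn n} (hv : DifferentiableAt ℝ v y) (ξ : Cn n) :
    adjointRep φ p a B (fun y => planeWave ξ y • v y) y =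
      planeWave ξ y • (adjointRep φ p a B v y + -(2 * Real.pi * Complex.I) •
        chartExp φ p y • symbolAt (adjointCoeff a) y ξ (v y)) := by
  have h1 : ∑ i, ContinuousLinearMap.adjoint (a i y)
      (fderiv ℝ (fun y => planeWave ξ y • v y) y (stdBasis n i)) =
      planeWave ξ y • (∑ i, ContinuousLinearMap.adjoint (a i y) (fderiv ℝ v y (stdBasis n i)) +
        (2 * Real.pi * Complex.I) • symbolAt (adjointCoeff a) y ξ (v y)) := by
    simp only [fderiv_planeWave_smul hv, map_smul, map_add, symbolAt, smul_add,
      Finset.sum_add_distrib, _root_.sum_apply, _root_.smul_apply, Finset.smul_sum,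
      mul_smul, RCLike.real_smul_eq_coe_smul (K := ℂ)]
    rfl
  have h2 : ∑ k, (planeWave ξ y • v y) k • B k y = planeWave ξ y • ∑ k, v y k • B k y := by
    simp only [PiLp.smul_apply, smul_eq_mul, mul_smul, Finset.smul_sum]
  rw [adjointRep, adjointRep, h1, h2]
  simp only [RCLike.real_smul_eq_coe_smul (K := ℂ)]
  module

set_option maxHeartbeats 800000 in
/-- The consequence of the Gårding inequality for oscillating forms of high frequency. -/
theorem exists_integral_symbol_le [T2Space X] (hφ : Continuous φ) (hT : IsClosedDiffOperator T)
    (hG : GardingInequality T) (hsym : IsLocalSymbol T p a b) {y₀ : Cn n} {r₁ r₂ : ℝ}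
    (h0 : 0 < r₁) (h12 : r₁ < r₂) (hr : Metric.closedBall y₀ r₂ ⊆ (chartAt (Cn n) p).target) :
    ∃ C : ℝ, 0 < C ∧ ∀ χ : Cn n → ℝ, IsCutoff (Metric.ball y₀ r₁) χ → ContDiff ℝ ∞ χ →
      ∀ (ξ : Cn n) (c : Coef n) (i : Fin (2 * n)),
      ∫ y in Metric.closedBall y₀ r₁, ‖χ y • (inner ℝ (stdBasis n i) ξ : ℝ) • c‖ ^ 2 ≤
        C * ((∫ y in Metric.closedBall y₀ r₁, ‖χ y • symbolAt a y ξ c‖ ^ 2) +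
          ∫ y in Metric.closedBall y₀ r₁, ‖χ y • chartExp φ p y •
            symbolAt (adjointCoeff a) y ξ (formMetric p y c)‖ ^ 2) := by
  set K := Metric.closedBall y₀ r₁ with hKdef
  have ht := (chartAt (Cn n) p).open_target
  have hK : IsCompact K := isCompact_closedBall _ _
  have hKt : K ⊆ (chartAt (Cn n) p).target := (Metric.closedBall_subset_closedBall h12.le).trans hr
  have hbt : Metric.ball y₀ r₁ ⊆ (chartAt (Cn n) p).target :=
    Metric.ball_subset_closedBall.trans hKt
  obtain ⟨h, hweak⟩ := exists_weak_weight hφ hT hsym h0 h12 hr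
  obtain ⟨C₁, -, hlow⟩ := exists_lowerRep_le hφ p hK hKt
  have hB := fun k => (hlow (h k)).1
  set B : Finset (Fin (2 * n)) → Cn n → Coef n := fun k => lowerRep φ p (h k) with hBdef
  obtain ⟨C, hC, hgard⟩ := exists_local_garding (B := B) hφ hT hG hsym hKt hB hweak
  refine ⟨4 * C, by positivity, fun χ hχ hχs ξ c i => ?_⟩
  let v : Cn n → Coef n := fun y => χ y • c
  have hv0 : ∀ y, y ∉ tsupport χ → v y = 0 := fun y hy => by
    simp only [v, image_eq_zero_of_notMem_tsupport hy, zero_smul]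
  have hvs : ContDiff ℝ ∞ v := hχs.smul contDiff_const
  have hvc : IsCutoff (Metric.ball y₀ r₁) v :=
    hχ.of_eq_zero Metric.isOpen_ball hvs.continuous.continuousOn hv0
  let V : Cn n → Coef n := fun y => formMetric p y (v y)
  have hVon : ContDiffOn ℝ ∞ V (chartAt (Cn n) p).target :=
    contDiffOn_clm_apply_real (contDiffOn_formMetric p) hvs.contDiffOn
  have hVs : ContDiff ℝ ∞ V := (hvc.mono hbt).contDiff_of_eq_zero ht hVon fun y hy => by
    simp only [V, image_eq_zero_of_notMem_tsupport hy, map_zero]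
  have ha := fun i => (hsym.contDiffOn_a i).continuousOn.mono hKt
  -- the parts of order one in the frequency
  let Q₀ : Cn n → Coef n := fun y => χ y • (inner ℝ (stdBasis n i) ξ : ℝ) • c
  let Q₁ : Cn n → Coef n := fun y => χ y • symbolAt a y ξ c
  let Q₂ : Cn n → Coef n := fun y => χ y • chartExp φ p y •
    symbolAt (adjointCoeff a) y ξ (formMetric p y c)
  have hχc := hχ.continuous.continuousOn (s := K)
  have hQ₀ : MemLp Q₀ 2 (volume.restrict K) := memLp_of_continuousOn hK (hχc.smul continuousOn_const)
  have hQ₁ : MemLp Q₁ 2 (volume.restrict K) := memLp_of_continuousOn hK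
    (hχc.smul ((continuousOn_symbolAt ha ξ).clm_apply continuousOn_const))
  have hQ₂ : MemLp Q₂ 2 (volume.restrict K) := memLp_of_continuousOn hK
    (hχc.smul (((continuousOn_chartExp hφ p).mono hKt).smul ((continuousOn_symbolAt
      (fun i => continuousOn_adjoint (ha i)) ξ).clm_apply
        (((contDiffOn_formMetric p).continuousOn.mono hKt).clm_apply continuousOn_const))))
  let P₀ : Cn n → Coef n := fun y => fderiv ℝ v y (stdBasis n i)
  have hP₀ : MemLp P₀ 2 (volume.restrict K) := memLp_of_continuousOn hK
    ((hvs.continuous_fderiv (by simp)).clm_apply continuous_const).continuousOn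
  have hP₁ : MemLp (diffOp a b v) 2 (volume.restrict K) := memLp_of_continuousOn hK
    ((continuousOn_diffOp ht (fun i => (hsym.contDiffOn_a i).continuousOn)
      hsym.contDiffOn_b.continuousOn hvs.contDiffOn).mono hKt)
  have hP₂ : MemLp (adjointRep φ p a B V) 2 (volume.restrict K) :=
    memLp_adjointRep hφ hK hKt (fun i => (hsym.contDiffOn_a i).continuousOn) hB hVs
  -- the inequality at the frequency `s ξ`
  have key : ∀ s : ℝ, (2 * Real.pi * s) ^ 2 * (∫ y in K, ‖Q₀ y‖ ^ 2) ≤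
      (2 * (∫ y in K, ‖P₀ y‖ ^ 2) + 2 * (C * ((∫ y in K, ‖v y‖ ^ 2) +
        2 * (∫ y in K, ‖diffOp a b v y‖ ^ 2) + 2 * ∫ y in K, ‖adjointRep φ p a B V y‖ ^ 2))) +
      (2 * Real.pi * s) ^ 2 * (4 * C * ((∫ y in K, ‖Q₁ y‖ ^ 2) + ∫ y in K, ‖Q₂ y‖ ^ 2)) := by
    intro s
    let z : ℂ := 2 * Real.pi * Complex.I * s
    have hz : ‖z‖ ^ 2 = (2 * Real.pi * s) ^ 2 := by
      simp only [z, norm_mul, Complex.norm_I, Complex.norm_real, mul_one, mul_pow,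
        Real.norm_eq_abs, sq_abs]
      norm_num
    have hzQ : ∀ Q : Cn n → Coef n, ∫ y in K, ‖z • Q y‖ ^ 2 =
        (2 * Real.pi * s) ^ 2 * ∫ y in K, ‖Q y‖ ^ 2 := fun Q => by
      rw [← hz, ← integral_const_mul]
      simp only [norm_smul, mul_pow]
    let g : Cn n → Coef n := fun y => planeWave (s • ξ) y • v y
    have hgs : ContDiff ℝ ∞ g := (contDiff_planeWave _).smul hvs
    have hgc : IsCutoff (Metric.ball y₀ r₁) g :=
      hvc.of_eq_zero Metric.isOpen_ball hgs.continuous.continuousOn fun y hy => by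
        simp only [g, image_eq_zero_of_notMem_tsupport hy, smul_zero]
    have hd : ∀ y, DifferentiableAt ℝ v y := fun y => hvs.differentiable (by simp) y
    have hdV : ∀ y, DifferentiableAt ℝ V y := fun y => hVs.differentiable (by simp) y
    have e0 : ∀ y, ‖fderiv ℝ g y (stdBasis n i)‖ = ‖P₀ y + z • Q₀ y‖ := fun y => by
      rw [fderiv_planeWave_smul (hd y), norm_smul, norm_planeWave, one_mul, inner_smul_right]
      congr 2
      simp only [z, Q₀, v, RCLike.real_smul_eq_coe_smul (K := ℂ), smul_smul]
      congr 1
      push_cast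
      simp only [Complex.coe_algebraMap]
      ring
    have e1 : ∀ y, ‖diffOp a b g y‖ = ‖diffOp a b v y + z • Q₁ y‖ := fun y => by
      rw [diffOp_planeWave_smul (hd y), norm_smul, norm_planeWave, one_mul, symbolAt_smul]
      congr 2
      simp only [z, Q₁, v, RCLike.real_smul_eq_coe_smul (K := ℂ), smul_smul, _root_.smul_apply,
        map_smul]
      congr 1
      simp only [RCLike.ofReal_eq_complex_ofReal]
      ring
    have e2 : ∀ y, ‖adjointRep φ p a B (fun y => formMetric p y (g y)) y‖ =
        ‖adjointRep φ p a B V y + -z • Q₂ y‖ := fun y => by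
      have h1 : (fun y => formMetric p y (g y)) = fun y => planeWave (s • ξ) y • V y := by
        ext1 y
        simp only [g, V, map_smul]
      rw [h1, adjointRep_planeWave_smul (hdV y), norm_smul, norm_planeWave, one_mul, symbolAt_smul]
      congr 2
      simp only [z, Q₂, V, v, RCLike.real_smul_eq_coe_smul (K := ℂ), smul_smul, _root_.smul_apply,
        map_smul]
      congr 1
      simp only [RCLike.ofReal_eq_complex_ofReal]
      ring
    have h1 := hgard g hgc hgs
    simp only [e1, e2] at h1
    have h2 : ∫ y in K, ‖P₀ y + z • Q₀ y‖ ^ 2 ≤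
        ∫ y in K, ∑ i, ‖fderiv ℝ g y (stdBasis n i)‖ ^ 2 := by
      refine integral_mono ((hP₀.add (hQ₀.const_smul z)).integrable_norm_pow two_ne_zero) ?_
        fun y => ?_
      · exact integrable_finsetSum _ fun i _ => (memLp_of_continuousOn hK
          (((hgs.continuous_fderiv (by simp)).clm_apply
            (continuous_const (y := stdBasis n i))).continuousOn)).integrable_norm_pow two_ne_zero
      · simp only [← e0]
        exact Finset.single_le_sum (f := fun i => ‖fderiv ℝ g y (stdBasis n i)‖ ^ 2)
          (fun i _ => by positivity) (Finset.mem_univ i)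
    have h3 : ∫ y in K, ‖z • Q₀ y‖ ^ 2 ≤
        2 * (∫ y in K, ‖P₀ y + z • Q₀ y‖ ^ 2) + 2 * ∫ y in K, ‖P₀ y‖ ^ 2 := by
      have := integral_norm_add_sq_le (hP₀.add (hQ₀.const_smul z)) hP₀.neg
      simpa using this
    have h4 := integral_norm_add_sq_le hP₁ (hQ₁.const_smul z)
    have h5 := integral_norm_add_sq_le hP₂ (hQ₂.const_smul (-z))
    simp only [Pi.smul_apply] at h4 h5
    have h6 : ∫ y in K, ‖g y‖ ^ 2 = ∫ y in K, ‖v y‖ ^ 2 := by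
      simp only [g, norm_smul, norm_planeWave, one_mul]
    have h7 : ∫ y in K, ‖-z • Q₂ y‖ ^ 2 = ∫ y in K, ‖z • Q₂ y‖ ^ 2 := by
      simp only [neg_smul, norm_neg]
    rw [h7] at h5
    rw [h6] at h1
    rw [hzQ] at h3 h4 h5
    have h8 := h2.trans (h1.trans (mul_le_mul_of_nonneg_left (add_le_add (add_le_add le_rfl h4) h5)
      hC.le))
    linarith
  refine (le_of_forall_sq_mul_le key).trans_eq ?_
  ring

end Symbol

/-- Localization at `y₀` of an inequality between integrals, by bump functions that shrink to `y₀`. -/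
theorem le_of_forall_bump {n : ℕ} {F : Cn n → ℝ} {A : ℝ} {y₀ : Cn n} {r : ℝ} (hr : 0 < r)
    (hF : ContinuousOn F (Metric.closedBall y₀ r))
    (h : ∀ χ : Cn n → ℝ, IsCutoff (Metric.ball y₀ r) χ → ContDiff ℝ ∞ χ →
      ∫ y in Metric.closedBall y₀ r, χ y ^ 2 * A ≤
        ∫ y in Metric.closedBall y₀ r, χ y ^ 2 * F y) : A ≤ F y₀ := by
  by_contra hcon
  rw [not_le] at hcon
  obtain ⟨m, hFm, hmA⟩ := exists_between hcon
  have hK : IsCompact (Metric.closedBall y₀ r) := isCompact_closedBall _ _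
  have hnhds : ∀ᶠ y in 𝓝 y₀, F y < m :=
    (hF.continuousAt (Metric.closedBall_mem_nhds y₀ hr)).eventually (Iio_mem_nhds hFm)
  obtain ⟨ρ, hρ, hρF⟩ := Metric.eventually_nhds_iff.1 hnhds
  set s := min ρ r / 2 with hs
  have hs0 : 0 < s := by positivity
  have hsρ : s < ρ := by
    have := min_le_left ρ r
    linarith
  have hsr : s < r := by
    have := min_le_right ρ r
    linarith
  let χ : ContDiffBump y₀ := ⟨s / 2, s, by positivity, by linarith⟩
  have hχ : IsCutoff (Metric.ball y₀ r) χ := ⟨χ.continuous, χ.hasCompactSupport, by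
    rw [χ.tsupport_eq]
    exact Metric.closedBall_subset_ball hsr⟩
  have h1 := h χ hχ χ.contDiff
  have hχ0 : ∀ y ∉ Metric.closedBall y₀ r, χ y ^ 2 = 0 := fun y hy => by
    rw [hχ.eq_zero fun h => hy (Metric.ball_subset_closedBall h), zero_pow two_ne_zero]
  have h2 : ∫ y in Metric.closedBall y₀ r, χ y ^ 2 * F y ≤
      ∫ y in Metric.closedBall y₀ r, χ y ^ 2 * m := by
    refine setIntegral_mono_on ((χ.continuous.continuousOn.pow 2).mul hF
      |>.integrableOn_compact hK) (((χ.continuous.pow 2).mul continuous_const).continuousOn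
      |>.integrableOn_compact hK) hK.measurableSet fun y _ => ?_
    by_cases hy : dist y y₀ < ρ
    · exact mul_le_mul_of_nonneg_left (hρF hy).le (sq_nonneg _)
    · rw [χ.zero_of_le_dist (hsρ.le.trans (not_lt.1 hy)), zero_pow two_ne_zero, zero_mul, zero_mul]
  have h3 : 0 < ∫ y in Metric.closedBall y₀ r, χ y ^ 2 := by
    rw [setIntegral_eq_integral_of_forall_compl_eq_zero hχ0]
    refine Continuous.integral_pos_of_hasCompactSupport_nonneg_nonzero (x := y₀)
      (χ.continuous.pow 2) ?_ (fun y => sq_nonneg _) ?_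
    · exact χ.hasCompactSupport.mono fun y hy h0 => hy (by simp [h0])
    · rw [χ.one_of_mem_closedBall (Metric.mem_closedBall_self (by positivity))]
      norm_num
  have h4 := h1.trans h2
  rw [integral_mul_const, integral_mul_const] at h4
  nlinarith

section Symbol

variable {n : ℕ} {X : Type*} [TopologicalSpace X] [ChartedSpace (Cn n) X]
  [IsManifold 𝓘(ℂ, Cn n) ω X]
  [RiemannianBundle (fun x : X => TangentSpace 𝓘(ℝ, Cn n) x)]
  [IsContMDiffRiemannianBundle 𝓘(ℝ, Cn n) ∞ (Cn n) (fun x : X => TangentSpace 𝓘(ℝ, Cn n) x)]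
  [MeasurableSpace X] [BorelSpace X] [SecondCountableTopology X] {φ : X → ℝ}
  {T : L2Forms n φ →ₗ.[ℂ] L2Forms n φ} {p : X}
  {a : Fin (2 * n) → Cn n → Coef n →L[ℂ] Coef n} {b : Cn n → Coef n →L[ℂ] Coef n}

/-- The principal symbols of `T` and of its adjoint are jointly injective: this is the ellipticity
of `T` in the sense of symbols. -/
theorem exists_norm_le_symbolAt [T2Space X] (hφ : Continuous φ) (hT : IsClosedDiffOperator T)
    (hG : GardingInequality T) (hsym : IsLocalSymbol T p a b) {y₀ : Cn n}
    (hy₀ : y₀ ∈ (chartAt (Cn n) p).target) :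
    ∃ C : ℝ, 0 < C ∧ ∀ (ξ : Cn n) (c : Coef n), ‖ξ‖ ^ 2 * ‖c‖ ^ 2 ≤
      C * (‖symbolAt a y₀ ξ c‖ ^ 2 +
        ‖symbolAt (adjointCoeff a) y₀ ξ (chartExp φ p y₀ • formMetric p y₀ c)‖ ^ 2) := by
  have ht := (chartAt (Cn n) p).open_target
  obtain ⟨r₂, hr₂, hr⟩ := Metric.nhds_basis_closedBall.mem_iff.1 (ht.mem_nhds hy₀)
  obtain ⟨r₁, h0, h12⟩ := exists_between hr₂
  obtain ⟨C, hC, hle⟩ := exists_integral_symbol_le hφ hT hG hsym h0 h12 hr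
  refine ⟨(2 * n : ℕ) * C + 1, by positivity, fun ξ c => ?_⟩
  have hKt : Metric.closedBall y₀ r₁ ⊆ (chartAt (Cn n) p).target :=
    (Metric.closedBall_subset_closedBall h12.le).trans hr
  have ha := fun i => (hsym.contDiffOn_a i).continuousOn.mono hKt
  let F₁ : Cn n → Coef n := fun y => symbolAt a y ξ c
  let F₂ : Cn n → Coef n := fun y =>
    chartExp φ p y • symbolAt (adjointCoeff a) y ξ (formMetric p y c)
  have hF₁ : ContinuousOn F₁ (Metric.closedBall y₀ r₁) :=
    (continuousOn_symbolAt ha ξ).clm_apply continuousOn_const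
  have hF₂ : ContinuousOn F₂ (Metric.closedBall y₀ r₁) :=
    ((continuousOn_chartExp hφ p).mono hKt).smul ((continuousOn_symbolAt
      (fun i => continuousOn_adjoint (ha i)) ξ).clm_apply
        (((contDiffOn_formMetric p).continuousOn.mono hKt).clm_apply continuousOn_const))
  have hi : ∀ i, (inner ℝ (stdBasis n i) ξ : ℝ) ^ 2 * ‖c‖ ^ 2 ≤
      C * (‖F₁ y₀‖ ^ 2 + ‖F₂ y₀‖ ^ 2) := by
    intro i
    refine le_of_forall_bump (F := fun y => C * (‖F₁ y‖ ^ 2 + ‖F₂ y‖ ^ 2)) h0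
      (continuousOn_const.mul ((hF₁.norm.pow 2).add (hF₂.norm.pow 2))) fun χ hχ hχs => ?_
    have h1 := hle χ hχ hχs ξ c i
    have hK : IsCompact (Metric.closedBall y₀ r₁) := isCompact_closedBall _ _
    have hχc := hχ.continuous.continuousOn (s := Metric.closedBall y₀ r₁)
    rw [← integral_add, ← integral_const_mul] at h1
    · refine (Eq.le ?_).trans (h1.trans (Eq.le ?_))
      · refine integral_congr_ae (Eventually.of_forall fun y => ?_)
        simp only [norm_smul, mul_pow, Real.norm_eq_abs, sq_abs]
      · refine integral_congr_ae (Eventually.of_forall fun y => ?_)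
        simp only [F₁, F₂, norm_smul, mul_pow, Real.norm_eq_abs, sq_abs]
        ring
    · exact ((hχc.smul hF₁).norm.pow 2).integrableOn_compact hK
    · exact ((hχc.smul hF₂).norm.pow 2).integrableOn_compact hK
  have hF₂' : symbolAt (adjointCoeff a) y₀ ξ (chartExp φ p y₀ • formMetric p y₀ c) = F₂ y₀ :=
    ContinuousLinearMap.map_smul_of_tower _ _ _
  rw [hF₂']
  calc ‖ξ‖ ^ 2 * ‖c‖ ^ 2 = ∑ i, (inner ℝ (stdBasis n i) ξ : ℝ) ^ 2 * ‖c‖ ^ 2 := by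
        rw [← Finset.sum_mul, sum_inner_stdBasis_sq]
    _ ≤ ∑ _i : Fin (2 * n), C * (‖F₁ y₀‖ ^ 2 + ‖F₂ y₀‖ ^ 2) := Finset.sum_le_sum fun i _ => hi i
    _ = (2 * n : ℕ) * C * (‖F₁ y₀‖ ^ 2 + ‖F₂ y₀‖ ^ 2) := by
        rw [Finset.sum_const, Finset.card_univ, Fintype.card_fin, nsmul_eq_mul, mul_assoc]
    _ ≤ _ := by
        refine mul_le_mul_of_nonneg_right ?_ (by positivity)
        linarith

end Symbol

/-! ### The Fourier transform of square integrable functions -/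

section Fourier

open scoped FourierTransform SchwartzMap

section General

variable {E F : Type*} [NormedAddCommGroup E] [InnerProductSpace ℝ E] [FiniteDimensional ℝ E]
  [MeasurableSpace E] [BorelSpace E] [NormedAddCommGroup F] [InnerProductSpace ℂ F]
  [CompleteSpace F]

theorem continuous_fourier {f : E → F} (h : Integrable f) : Continuous (𝓕 f) :=
  VectorFourier.fourierIntegral_continuous Real.continuous_fourierChar
    (by simpa using continuous_inner (𝕜 := ℝ) (E := E)) h

/-- The Fourier transform on `L²` is given by the Fourier integral for integrable functions. -/
theorem fourier_toLp_ae {f : E → F} (h1 : Integrable f) (h2 : MemLp f 2 (volume : Measure E)) :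
    ⇑(𝓕 (h2.toLp f) : Lp F 2 (volume : Measure E)) =ᵐ[volume] 𝓕 f := by
  have hloc : LocallyIntegrable (⇑(𝓕 (h2.toLp f) : Lp F 2 (volume : Measure E))) (volume : Measure E) :=
    (Lp.memLp _).locallyIntegrable one_le_two
  refine ae_eq_of_integral_contDiff_smul_eq hloc (continuous_fourier h1).locallyIntegrable
    fun g hg hgc => ?_
  let g' : E → ℂ := fun x => (g x : ℂ)
  have hg' : ContDiff ℝ ∞ g' := Complex.ofRealCLM.contDiff.comp hg
  have hgc' : HasCompactSupport g' := hgc.comp_left (g := fun t : ℝ => (t : ℂ)) rfl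
  let G : 𝓢(E, ℂ) := hgc'.toSchwartzMap hg'
  have e1 := congrArg (fun D => D G) (Lp.fourier_toTemperedDistribution_eq (h2.toLp f))
  simp only [TemperedDistribution.fourier_apply, Lp.toTemperedDistribution_apply] at e1
  have hGg : ∀ x, G x = (g x : ℂ) := fun x => rfl
  simp only [hGg] at e1
  have e2 : ∫ x, 𝓕 G x • (h2.toLp f) x = ∫ x, 𝓕 G x • f x := by
    refine integral_congr_ae ?_
    filter_upwards [h2.coeFn_toLp] with x hx
    rw [hx]
  have e3 : ∫ x, 𝓕 (G : E → ℂ) x • f x = ∫ x, G x • 𝓕 f x := by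
    have h3 := VectorFourier.integral_fourierIntegral_smul_eq_flip (μ := volume) (ν := volume)
      (L := innerₗ E) Real.continuous_fourierChar
      (by simpa using continuous_inner (𝕜 := ℝ) (E := E)) G.integrable h1
    rw [flip_innerₗ] at h3
    exact h3
  rw [e2, SchwartzMap.fourier_coe, e3] at e1
  simp only [hGg, Complex.coe_smul] at e1
  exact e1.symm

theorem memLp_fourier {f : E → F} (h1 : Integrable f) (h2 : MemLp f 2 (volume : Measure E)) :
    MemLp (𝓕 f) 2 (volume : Measure E) :=
  (Lp.memLp (𝓕 (h2.toLp f) : Lp F 2 (volume : Measure E))).ae_eq (fourier_toLp_ae h1 h2)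

theorem integral_norm_sq_fourier {f : E → F} (h1 : Integrable f)
    (h2 : MemLp f 2 (volume : Measure E)) : ∫ ξ, ‖𝓕 f ξ‖ ^ 2 = ∫ x, ‖f x‖ ^ 2 := by
  have h3 : ∀ {u : E → F} (hu : MemLp u 2 (volume : Measure E)),
      ‖hu.toLp u‖ ^ 2 = ∫ x, ‖u x‖ ^ 2 := by
    intro u hu
    have h4 := inner_self_eq_norm_sq_to_K (𝕜 := ℂ) (hu.toLp u)
    rw [L2.inner_def] at h4
    have h5 : ∫ x, (inner ℂ (hu.toLp u x) (hu.toLp u x) : ℂ) = ∫ x, ((‖u x‖ ^ 2 : ℝ) : ℂ) := by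
      refine integral_congr_ae ?_
      filter_upwards [hu.coeFn_toLp] with x hx
      rw [hx, inner_self_eq_norm_sq_to_K]
      push_cast
      rfl
    rw [h5, integral_complex_ofReal] at h4
    have h6 : ((∫ x, ‖u x‖ ^ 2 : ℝ) : ℂ) = ((‖hu.toLp u‖ ^ 2 : ℝ) : ℂ) := by
      rw [h4]
      push_cast
      rfl
    exact (Complex.ofReal_injective h6).symm
  rw [← h3 h2, ← h3 (memLp_fourier h1 h2), ← Lp.norm_fourier_eq (h2.toLp f)]
  congr 2
  ext1
  exact ((memLp_fourier h1 h2).coeFn_toLp).trans (fourier_toLp_ae h1 h2).symm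

end General

variable {n : ℕ}

theorem inner_fourier {h : Cn n → Coef n} (hh : Integrable h) (ξ : Cn n) (c : Coef n) :
    inner ℂ (𝓕 h ξ) c = ∫ y, inner ℂ (h y) (planeWave ξ y • c) := by
  have h1 : Integrable fun y => 𝐞 (-inner ℝ y ξ) • h y := by
    refine hh.mono ?_ (Eventually.of_forall fun y => (Circle.norm_smul _ _).le)
    have h2 : Continuous fun y : Cn n => 𝐞 (-inner ℝ y ξ) :=
      Real.continuous_fourierChar.comp (continuous_id.inner continuous_const).neg
    exact h2.aestronglyMeasurable.smul hh.aestronglyMeasurable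
  rw [Real.fourier_eq, ← inner_conj_symm, ← integral_inner h1, ← integral_conj]
  refine integral_congr_ae (Eventually.of_forall fun y => ?_)
  simp only [inner_conj_symm]
  rw [Circle.smul_def, inner_smul_left, inner_smul_right, Real.fourierChar_apply, planeWave,
    ← Complex.exp_conj]
  congr 2
  simp [Complex.conj_ofNat]

end Fourier

/-! ### Low and high frequencies -/

section Fourier

open scoped FourierTransform

variable {n : ℕ}

theorem continuous_planeWave (ξ : Cn n) : Continuous (planeWave ξ) :=
  (contDiff_planeWave ξ).continuous

theorem integrable_inner_planeWave {h : Cn n → Coef n} (hh : Integrable h) (ξ : Cn n)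
    (c : Coef n) : Integrable fun y => (inner ℂ (h y) (planeWave ξ y • c) : ℂ) := by
  refine (hh.norm.mul_const ‖c‖).mono' (hh.aestronglyMeasurable.inner
    ((continuous_planeWave ξ).smul continuous_const).aestronglyMeasurable)
    (Eventually.of_forall fun y => (norm_inner_le_norm _ _).trans ?_)
  rw [norm_smul, norm_planeWave, one_mul]

theorem norm_two_pi_I_ge : (1 : ℝ) ≤ ‖(2 * Real.pi * Complex.I : ℂ)‖ := by
  rw [norm_mul, norm_mul, Complex.norm_I, mul_one, Complex.norm_real, Complex.norm_ofNat,
    Real.norm_of_nonneg Real.pi_pos.le]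
  linarith [Real.pi_gt_three]

/-- If `h` is the image of `v` under a first order operator with principal coefficients `A i`,
then freezing these coefficients costs only the Fourier transforms of the differences. -/
theorem norm_symbol_fourier_le {h v : Cn n → Coef n}
    {A : Fin (2 * n) → Cn n → Coef n →L[ℂ] Coef n} {A₀ : Fin (2 * n) → Coef n →L[ℂ] Coef n}
    (hh : Integrable h) (hv : Integrable v)
    (hA : ∀ i, Integrable fun y => A i y (v y) - A₀ i (v y)) {ξ : Cn n}
    (hrel : ∀ c, ∫ y, inner ℂ (h y) (planeWave ξ y • c) =
      2 * Real.pi * Complex.I * ∫ y, inner ℂ (symbolAt A y ξ (v y)) (planeWave ξ y • c)) :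
    ‖∑ i, (inner ℝ (stdBasis n i) ξ : ℝ) • A₀ i (𝓕 v ξ)‖ ≤
      ‖𝓕 h ξ‖ + ‖ξ‖ * ∑ i, ‖𝓕 (fun y => A i y (v y) - A₀ i (v y)) ξ‖ := by
  set z : ℂ := 2 * Real.pi * Complex.I with hz
  set w : Fin (2 * n) → Cn n → Coef n := fun i y => A i y (v y) - A₀ i (v y) with hw
  set S := ∑ i, (inner ℝ (stdBasis n i) ξ : ℝ) • A₀ i (𝓕 v ξ) with hS
  set S' := ∑ i, (inner ℝ (stdBasis n i) ξ : ℝ) • 𝓕 (w i) ξ with hS'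
  have hz1 : 1 ≤ ‖z‖ := norm_two_pi_I_ge
  have hpt : ∀ c y, (inner ℂ (symbolAt A y ξ (v y)) (planeWave ξ y • c) : ℂ) =
      ∑ i, ((inner ℝ (stdBasis n i) ξ : ℝ) : ℂ) * (inner ℂ (w i y) (planeWave ξ y • c) +
        inner ℂ (v y) (planeWave ξ y • ContinuousLinearMap.adjoint (A₀ i) c)) := by
    intro c y
    simp only [symbolAt, _root_.sum_apply, _root_.smul_apply, sum_inner,
      RCLike.real_smul_eq_coe_smul (K := ℂ), inner_smul_left, RCLike.conj_ofReal]
    refine Finset.sum_congr rfl fun i _ => ?_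
    rw [← map_smul, ContinuousLinearMap.adjoint_inner_right, ← inner_add_left, hw]
    simp only [sub_add_cancel]
    rfl
  have hid : 𝓕 h ξ = (starRingEnd ℂ) z • (S' + S) := by
    refine ext_inner_right ℂ fun c => ?_
    rw [inner_fourier hh, hrel c, inner_smul_left, Complex.conj_conj]
    congr 1
    simp only [hpt]
    have hint : ∀ i, Integrable fun y => ((inner ℝ (stdBasis n i) ξ : ℝ) : ℂ) *
        (inner ℂ (w i y) (planeWave ξ y • c) +
          inner ℂ (v y) (planeWave ξ y • ContinuousLinearMap.adjoint (A₀ i) c)) := fun i =>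
      ((integrable_inner_planeWave (hA i) ξ c).add
        (integrable_inner_planeWave hv ξ _)).const_mul _
    rw [integral_finsetSum _ fun i _ => hint i, inner_add_left, hS, hS', sum_inner,
      sum_inner, ← Finset.sum_add_distrib]
    refine Finset.sum_congr rfl fun i _ => ?_
    rw [integral_const_mul, integral_add (integrable_inner_planeWave (hA i) ξ c)
      (integrable_inner_planeWave hv ξ _), ← inner_fourier (hA i), ← inner_fourier hv,
      ContinuousLinearMap.adjoint_inner_right, RCLike.real_smul_eq_coe_smul (K := ℂ),
      RCLike.real_smul_eq_coe_smul (K := ℂ), inner_smul_left, inner_smul_left, RCLike.conj_ofReal,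
      mul_add]
    rfl
  have h1 : ‖S' + S‖ ≤ ‖𝓕 h ξ‖ := by
    rw [hid, norm_smul, RCLike.norm_conj]
    exact le_mul_of_one_le_left (norm_nonneg _) hz1
  have h2 : ‖S'‖ ≤ ‖ξ‖ * ∑ i, ‖𝓕 (w i) ξ‖ := by
    rw [Finset.mul_sum]
    refine (norm_sum_le _ _).trans (Finset.sum_le_sum fun i _ => ?_)
    rw [norm_smul]
    refine mul_le_mul_of_nonneg_right ((norm_inner_le_norm _ _).trans ?_) (norm_nonneg _)
    rw [(stdBasis n).norm_eq_one, one_mul]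
  calc ‖S‖ = ‖(S' + S) - S'‖ := by rw [add_sub_cancel_left]
    _ ≤ ‖S' + S‖ + ‖S'‖ := norm_sub_le _ _
    _ ≤ _ := add_le_add h1 h2

/-- If the constant coefficients `A₀` are elliptic, the part of `v` of frequency at least `R` is
bounded by `R⁻¹` times the images `h k` of `v` under the operators and by the errors `w k i` made in
freezing their coefficients. -/
theorem integral_norm_sq_le_of_symbol {v : Cn n → Coef n} (hv : Integrable v)
    (hv2 : MemLp v 2 volume) {h : Fin 2 → Cn n → Coef n} (hh : ∀ k, Integrable (h k))
    (hh2 : ∀ k, MemLp (h k) 2 volume) {w : Fin 2 → Fin (2 * n) → Cn n → Coef n}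
    (hw : ∀ k i, Integrable (w k i)) (hw2 : ∀ k i, MemLp (w k i) 2 volume)
    {A₀ : Fin 2 → Fin (2 * n) → Coef n →L[ℂ] Coef n} {C δ R : ℝ} (hC : 0 ≤ C) (hR : 0 < R)
    (hell : ∀ (ξ : Cn n) (c : Coef n), ‖ξ‖ ^ 2 * ‖c‖ ^ 2 ≤
      C * ∑ k, ‖∑ i, (inner ℝ (stdBasis n i) ξ : ℝ) • A₀ k i c‖ ^ 2)
    (hrel : ∀ k ξ, ‖∑ i, (inner ℝ (stdBasis n i) ξ : ℝ) • A₀ k i (𝓕 v ξ)‖ ≤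
      ‖𝓕 (h k) ξ‖ + ‖ξ‖ * ∑ i, ‖𝓕 (w k i) ξ‖)
    (hδ : ∀ k i, ∫ y, ‖w k i y‖ ^ 2 ≤ δ * ∫ y, ‖v y‖ ^ 2) :
    ∫ y, ‖v y‖ ^ 2 ≤ (∫ ξ in Metric.ball 0 R, ‖𝓕 v ξ‖ ^ 2) +
      C * (2 * (R ^ 2)⁻¹ * (∑ k, ∫ y, ‖h k y‖ ^ 2) +
        2 * (2 * n : ℕ) * (2 * ((2 * n : ℕ) * (δ * ∫ y, ‖v y‖ ^ 2)))) := by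
  let Φ : Cn n → ℝ := fun ξ => C * (2 * (R ^ 2)⁻¹ * (∑ k, ‖𝓕 (h k) ξ‖ ^ 2) +
    2 * (2 * n : ℕ) * ∑ k, ∑ i, ‖𝓕 (w k i) ξ‖ ^ 2)
  have hF := (memLp_fourier hv hv2).integrable_norm_pow two_ne_zero
  have hFh := fun k => (memLp_fourier (hh k) (hh2 k)).integrable_norm_pow two_ne_zero
  have hFw := fun k i => (memLp_fourier (hw k i) (hw2 k i)).integrable_norm_pow two_ne_zero
  have i1 : Integrable fun ξ => 2 * (R ^ 2)⁻¹ * (∑ k, ‖𝓕 (h k) ξ‖ ^ 2) :=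
    (integrable_finsetSum _ fun k _ => hFh k).const_mul _
  have i2 : Integrable fun ξ => 2 * ((2 * n : ℕ) : ℝ) * ∑ k, ∑ i, ‖𝓕 (w k i) ξ‖ ^ 2 :=
    (integrable_finsetSum _ fun k _ => integrable_finsetSum _ fun i _ => hFw k i).const_mul _
  have hΦ : Integrable Φ := (i1.add i2).const_mul C
  have hΦ0 : ∀ ξ, 0 ≤ Φ ξ := fun ξ => by positivity
  have hpt : ∀ ξ ∈ (Metric.ball (0 : Cn n) R)ᶜ, ‖𝓕 v ξ‖ ^ 2 ≤ Φ ξ := by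
    intro ξ hξ
    have hξR : R ≤ ‖ξ‖ := by simpa using hξ
    have hξ0 : 0 < ‖ξ‖ ^ 2 := pow_pos (hR.trans_le hξR) 2
    have h1 : ∀ k, ‖∑ i, (inner ℝ (stdBasis n i) ξ : ℝ) • A₀ k i (𝓕 v ξ)‖ ^ 2 ≤
        ‖ξ‖ ^ 2 * (2 * (R ^ 2)⁻¹ * ‖𝓕 (h k) ξ‖ ^ 2 +
          2 * (2 * n : ℕ) * ∑ i, ‖𝓕 (w k i) ξ‖ ^ 2) := by
      intro k
      have h2 : (∑ i, ‖𝓕 (w k i) ξ‖) ^ 2 ≤ (2 * n : ℕ) * ∑ i, ‖𝓕 (w k i) ξ‖ ^ 2 := by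
        have := sq_sum_le_card_mul_sum_sq (s := Finset.univ) (f := fun i => ‖𝓕 (w k i) ξ‖)
        rwa [Finset.card_univ, Fintype.card_fin] at this
      have h3 : (1 : ℝ) ≤ ‖ξ‖ ^ 2 * (R ^ 2)⁻¹ := by
        rw [← div_eq_mul_inv, one_le_div (by positivity)]
        gcongr
      set x := ‖𝓕 (h k) ξ‖
      set s := ∑ i, ‖𝓕 (w k i) ξ‖
      calc _ ≤ (x + ‖ξ‖ * s) ^ 2 := by
            gcongr
            exact hrel k ξ
        _ ≤ 2 * x ^ 2 + 2 * (‖ξ‖ ^ 2 * s ^ 2) := by nlinarith [sq_nonneg (x - ‖ξ‖ * s)]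
        _ ≤ 2 * (‖ξ‖ ^ 2 * (R ^ 2)⁻¹ * x ^ 2) +
            2 * (‖ξ‖ ^ 2 * ((2 * n : ℕ) * ∑ i, ‖𝓕 (w k i) ξ‖ ^ 2)) := by
            gcongr
            exact le_mul_of_one_le_left (by positivity) h3
        _ = _ := by ring
    refine le_of_mul_le_mul_left ((hell ξ (𝓕 v ξ)).trans ?_) hξ0
    calc C * ∑ k, ‖∑ i, (inner ℝ (stdBasis n i) ξ : ℝ) • A₀ k i (𝓕 v ξ)‖ ^ 2 ≤
        C * ∑ k, ‖ξ‖ ^ 2 * (2 * (R ^ 2)⁻¹ * ‖𝓕 (h k) ξ‖ ^ 2 +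
          2 * (2 * n : ℕ) * ∑ i, ‖𝓕 (w k i) ξ‖ ^ 2) :=
          mul_le_mul_of_nonneg_left (Finset.sum_le_sum fun k _ => h1 k) hC
      _ = ‖ξ‖ ^ 2 * Φ ξ := by
          simp only [Φ]
          rw [← Finset.mul_sum, Finset.sum_add_distrib, ← Finset.mul_sum, ← Finset.mul_sum]
          ring
  have h4 : ∫ ξ in (Metric.ball (0 : Cn n) R)ᶜ, ‖𝓕 v ξ‖ ^ 2 ≤ ∫ ξ, Φ ξ :=
    (setIntegral_mono_on hF.integrableOn hΦ.integrableOn Metric.isOpen_ball.measurableSet.compl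
      hpt).trans (setIntegral_le_integral hΦ (Eventually.of_forall hΦ0))
  have h5 : ∫ ξ, Φ ξ = C * (2 * (R ^ 2)⁻¹ * (∑ k, ∫ y, ‖h k y‖ ^ 2) +
      2 * (2 * n : ℕ) * ∑ k, ∑ i, ∫ y, ‖w k i y‖ ^ 2) := by
    simp only [Φ]
    rw [integral_const_mul, integral_add i1 i2, integral_const_mul, integral_const_mul,
      integral_finsetSum _ fun k _ => hFh k,
      integral_finsetSum _ fun k _ => integrable_finsetSum _ fun i _ => hFw k i]
    simp only [integral_norm_sq_fourier (hh _) (hh2 _)]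
    congr 3
    refine Finset.sum_congr rfl fun k _ => ?_
    rw [integral_finsetSum _ fun i _ => hFw k i]
    simp only [integral_norm_sq_fourier (hw _ _) (hw2 _ _)]
  have h6 : ∑ k, ∑ i, ∫ y, ‖w k i y‖ ^ 2 ≤ 2 * ((2 * n : ℕ) * (δ * ∫ y, ‖v y‖ ^ 2)) := by
    calc _ ≤ ∑ _k : Fin 2, ∑ _i : Fin (2 * n), δ * ∫ y, ‖v y‖ ^ 2 :=
          Finset.sum_le_sum fun k _ => Finset.sum_le_sum fun i _ => hδ k i
      _ = _ := by simp
  have h7 : ∫ y, ‖v y‖ ^ 2 = (∫ ξ in Metric.ball 0 R, ‖𝓕 v ξ‖ ^ 2) +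
      ∫ ξ in (Metric.ball 0 R)ᶜ, ‖𝓕 v ξ‖ ^ 2 := by
    rw [← integral_norm_sq_fourier hv hv2, integral_add_compl
      (Metric.isOpen_ball (x := (0 : Cn n)) (ε := R)).measurableSet hF]
  refine h7.le.trans (add_le_add_right ?_ _)
  refine (h4.trans_eq h5).trans ?_
  gcongr

theorem norm_planeWave_sub_le (ξ ξ' y : Cn n) :
    ‖planeWave ξ y - planeWave ξ' y‖ ≤ 2 * Real.pi * ‖y‖ * ‖ξ - ξ'‖ := by
  have h1 : planeWave ξ y = planeWave ξ' y * planeWave (ξ - ξ') y := by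
    rw [planeWave, planeWave, planeWave, ← Complex.exp_add, inner_sub_right]
    congr 1
    push_cast
    ring
  have h2 : planeWave ξ y - planeWave ξ' y = planeWave ξ' y * (planeWave (ξ - ξ') y - 1) := by
    rw [h1]
    ring
  rw [h2, norm_mul, norm_planeWave, one_mul, planeWave, mul_comm]
  refine Real.norm_exp_I_mul_ofReal_sub_one_le.trans ?_
  rw [norm_mul, Real.norm_of_nonneg Real.two_pi_pos.le, mul_assoc (2 * Real.pi) ‖y‖]
  exact mul_le_mul_of_nonneg_left (norm_inner_le_norm (𝕜 := ℝ) y (ξ - ξ')) Real.two_pi_pos.le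

theorem norm_fourier_sub_le {v : Cn n → Coef n} (hv : Integrable v) {M : ℝ}
    (hM0 : 0 ≤ M) (hM : ∀ y, M < ‖y‖ → v y = 0) (ξ ξ' : Cn n) :
    ‖𝓕 v ξ - 𝓕 v ξ'‖ ≤ 2 * Real.pi * M * ‖ξ - ξ'‖ * ∫ y, ‖v y‖ := by
  set c := 𝓕 v ξ - 𝓕 v ξ' with hc
  have h1 : (inner ℂ c c : ℂ) =
      ∫ y, inner ℂ (v y) ((planeWave ξ y - planeWave ξ' y) • c) := by
    conv_lhs => rw [hc, inner_sub_left, ← hc]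
    rw [inner_fourier hv, inner_fourier hv, ← integral_sub (integrable_inner_planeWave hv _ _)
      (integrable_inner_planeWave hv _ _)]
    simp only [sub_smul, inner_sub_right]
  have h2 : ‖c‖ * ‖c‖ ≤ (2 * Real.pi * M * ‖ξ - ξ'‖ * ∫ y, ‖v y‖) * ‖c‖ := by
    have h3 : ‖c‖ * ‖c‖ = ‖(inner ℂ c c : ℂ)‖ := by
      rw [inner_self_eq_norm_sq_to_K, norm_pow, RCLike.norm_ofReal, abs_norm, sq]
    rw [h3, h1]
    refine (norm_integral_le_of_norm_le (g := fun y => (2 * Real.pi * M * ‖ξ - ξ'‖ * ‖c‖) * ‖v y‖)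
      (hv.norm.const_mul _) (Eventually.of_forall fun y => ?_)).trans_eq ?_
    · rcases lt_or_ge M ‖y‖ with h | h
      · simp [hM y h]
      · refine (norm_inner_le_norm _ _).trans ?_
        rw [norm_smul, mul_comm]
        refine mul_le_mul_of_nonneg_right ?_ (norm_nonneg _)
        refine mul_le_mul_of_nonneg_right ((norm_planeWave_sub_le ξ ξ' y).trans ?_) (norm_nonneg _)
        gcongr
    · rw [integral_const_mul]
      ring
  rcases (norm_nonneg c).eq_or_lt with h | h
  · rw [← h]
    have h4 : 0 ≤ ∫ y, ‖v y‖ := integral_nonneg fun y => norm_nonneg (v y)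
    have h5 := Real.pi_pos.le
    exact mul_nonneg (by positivity) h4
  · exact le_of_mul_le_mul_right h2 h

/-- The low frequencies of functions with support in a fixed ball are controlled by finitely many
values of the Fourier transform. -/
theorem exists_low_frequency (R : ℝ) {M ε : ℝ} (hM0 : 0 ≤ M) (hε : 0 < ε) :
    ∃ (N : Finset (Cn n)) (C : ℝ), 0 ≤ C ∧ ∀ v : Cn n → Coef n, Integrable v →
      (∀ y, M < ‖y‖ → v y = 0) → ∫ ξ in Metric.ball 0 R, ‖𝓕 v ξ‖ ^ 2 ≤
        C * (∑ ξ ∈ N, ‖𝓕 v ξ‖ ^ 2) + ε * (∫ y, ‖v y‖) ^ 2 := by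
  set V := volume.real (Metric.ball (0 : Cn n) R) with hV
  have hV0 : 0 ≤ V := measureReal_nonneg
  set Q := V * (2 * (2 * Real.pi * M) ^ 2) with hQ
  have hQ0 : 0 ≤ Q := by positivity
  set s := Real.sqrt (ε / (Q + 1)) with hs
  have hs0 : 0 < s := Real.sqrt_pos.2 (by positivity)
  have hs2 : Q * s ^ 2 ≤ ε := by
    rw [hs, Real.sq_sqrt (by positivity), mul_div_assoc', div_le_iff₀ (by positivity)]
    nlinarith
  obtain ⟨t, ht, htb⟩ := Metric.totallyBounded_iff.1
    (isCompact_closedBall (0 : Cn n) R).totallyBounded s hs0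
  refine ⟨ht.toFinset, 2 * V, by positivity, fun v hv hM => ?_⟩
  have hpt : ∀ ξ ∈ Metric.ball (0 : Cn n) R, ‖𝓕 v ξ‖ ^ 2 ≤
      2 * (∑ ξ ∈ ht.toFinset, ‖𝓕 v ξ‖ ^ 2) + 2 * (2 * Real.pi * M) ^ 2 * s ^ 2 *
        (∫ y, ‖v y‖) ^ 2 := by
    intro ξ hξ
    obtain ⟨ξ', hξ', hd⟩ := mem_iUnion₂.1 (htb (Metric.ball_subset_closedBall hξ))
    have h1 := norm_fourier_sub_le hv hM0 hM ξ ξ'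
    have h2 : ‖ξ - ξ'‖ ^ 2 ≤ s ^ 2 := by
      have h3 : ‖ξ - ξ'‖ ≤ s := by
        rw [← dist_eq_norm]
        exact (Metric.mem_ball.1 hd).le
      gcongr
    have h3 : ‖𝓕 v ξ‖ ≤ ‖𝓕 v ξ'‖ + ‖𝓕 v ξ - 𝓕 v ξ'‖ := by
      rw [← sub_add_cancel (𝓕 v ξ) (𝓕 v ξ')]
      refine (norm_add_le _ _).trans_eq ?_
      rw [sub_add_cancel, add_comm]
    have h4 : ‖𝓕 v ξ'‖ ^ 2 ≤ ∑ ξ ∈ ht.toFinset, ‖𝓕 v ξ‖ ^ 2 :=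
      Finset.single_le_sum (f := fun ξ => ‖𝓕 v ξ‖ ^ 2) (fun _ _ => by positivity)
        (ht.mem_toFinset.2 hξ')
    have h5 : ‖𝓕 v ξ - 𝓕 v ξ'‖ ^ 2 ≤ (2 * Real.pi * M) ^ 2 * s ^ 2 * (∫ y, ‖v y‖) ^ 2 := by
      calc _ ≤ (2 * Real.pi * M * ‖ξ - ξ'‖ * ∫ y, ‖v y‖) ^ 2 := by gcongr
        _ = (2 * Real.pi * M) ^ 2 * ‖ξ - ξ'‖ ^ 2 * (∫ y, ‖v y‖) ^ 2 := by ring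
        _ ≤ _ := by gcongr
    calc ‖𝓕 v ξ‖ ^ 2 ≤ (‖𝓕 v ξ'‖ + ‖𝓕 v ξ - 𝓕 v ξ'‖) ^ 2 := by gcongr
      _ ≤ 2 * ‖𝓕 v ξ'‖ ^ 2 + 2 * ‖𝓕 v ξ - 𝓕 v ξ'‖ ^ 2 := by
          nlinarith [sq_nonneg (‖𝓕 v ξ'‖ - ‖𝓕 v ξ - 𝓕 v ξ'‖)]
      _ ≤ _ := by linarith
  have hfin : volume (Metric.ball (0 : Cn n) R) ≠ ⊤ := measure_ball_lt_top.ne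
  have hint : IntegrableOn (fun ξ => ‖𝓕 v ξ‖ ^ 2) (Metric.ball (0 : Cn n) R) :=
    (((continuous_fourier hv).norm.pow 2).continuousOn.integrableOn_compact
      (isCompact_closedBall 0 R)).mono_set Metric.ball_subset_closedBall
  refine (setIntegral_mono_on hint (integrableOn_const hfin)
    Metric.isOpen_ball.measurableSet hpt).trans ?_
  rw [setIntegral_const, smul_eq_mul, ← hV]
  have h6 : V * (2 * (2 * Real.pi * M) ^ 2 * s ^ 2 * (∫ y, ‖v y‖) ^ 2) ≤ ε * (∫ y, ‖v y‖) ^ 2 := by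
    calc _ = (Q * s ^ 2) * (∫ y, ‖v y‖) ^ 2 := by
          rw [hQ]
          ring
      _ ≤ _ := by gcongr
  linarith

end Fourier

/-! ### Localization of the weak equations -/

section Remainder

variable {n : ℕ}

theorem exists_memLp_clm_apply {K : Set (Cn n)} (hK : IsCompact K)
    {A : Cn n → Coef n →L[ℂ] Coef n} (hA : ContinuousOn A K) (hA0 : ∀ y ∉ K, A y = 0) :
    ∃ C : ℝ, 0 < C ∧ ∀ U : Cn n → Coef n, MemLp U 2 (volume.restrict K) →
      Integrable (fun y => A y (U y)) ∧ MemLp (fun y => A y (U y)) 2 volume ∧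
        ∫ y, ‖A y (U y)‖ ^ 2 ≤ C * ∫ y in K, ‖U y‖ ^ 2 := by
  obtain ⟨C, hC, hle⟩ := exists_norm_clm_le hK hA
  refine ⟨C ^ 2, by positivity, fun U hU => ?_⟩
  have hfin : IsFiniteMeasure (volume.restrict K) := ⟨by
    rw [Measure.restrict_apply_univ]
    exact hK.measure_lt_top⟩
  have happ : Continuous fun q : (Coef n →L[ℂ] Coef n) × Coef n => q.1 q.2 :=
    isBoundedBilinearMap_apply.continuous
  have hm : MemLp (fun y => A y (U y)) 2 (volume.restrict K) := by
    refine hU.of_le_mul (c := C) (happ.comp_aestronglyMeasurable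
      ((hA.aestronglyMeasurable hK.measurableSet).prodMk hU.aestronglyMeasurable)) ?_
    filter_upwards [ae_restrict_mem hK.measurableSet] with y hy
    exact (A y).le_of_opNorm_le (hle y hy) _
  have hind : (fun y => A y (U y)) = K.indicator fun y => A y (U y) := by
    ext1 y
    by_cases hy : y ∈ K
    · rw [indicator_of_mem hy]
    · rw [indicator_of_notMem hy, hA0 y hy, _root_.zero_apply]
  refine ⟨?_, ?_, ?_⟩
  · rw [hind, integrable_indicator_iff hK.measurableSet]
    exact hm.integrable one_le_two
  · rw [hind, memLp_indicator_iff_restrict hK.measurableSet]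
    exact hm
  · rw [← integral_const_mul, ← setIntegral_eq_integral_of_forall_compl_eq_zero (s := K)
      fun y hy => by rw [hA0 y hy, _root_.zero_apply, norm_zero, zero_pow two_ne_zero]]
    refine setIntegral_mono_on (hm.integrable_norm_pow two_ne_zero)
      ((hU.integrable_norm_pow two_ne_zero).const_mul _) hK.measurableSet fun y hy => ?_
    rw [← mul_pow]
    have := (A y).le_of_opNorm_le (hle y hy) (U y)
    gcongr

/-- The zeroth order operator `v ↦ χ β v + [∑ αᵢ ∂ᵢ, χ] v`. -/
def cutoffCoeff (α : Fin (2 * n) → Cn n → Coef n →L[ℂ] Coef n) (β : Cn n → Coef n →L[ℂ] Coef n)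
    (χ : Cn n → ℝ) (y : Cn n) : Coef n →L[ℂ] Coef n :=
  χ y • β y + ∑ i, fderiv ℝ χ y (stdBasis n i) • α i y

variable {α : Fin (2 * n) → Cn n → Coef n →L[ℂ] Coef n} {β : Cn n → Coef n →L[ℂ] Coef n}
  {χ : Cn n → ℝ}

theorem diffOp_smul_const (hχ : ContDiff ℝ ∞ χ) (c : Coef n) (y : Cn n) :
    diffOp α β (fun y => χ y • c) y = cutoffCoeff α β χ y c := by
  have h1 : ∀ e, fderiv ℝ (fun y => χ y • c) y e = fderiv ℝ χ y e • c := fun e => by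
    have h2 := (hχ.differentiable (by simp) y).hasFDerivAt.smul_const c
    rw [h2.fderiv]
    rfl
  simp only [diffOp, cutoffCoeff, h1, _root_.add_apply, _root_.smul_apply, _root_.sum_apply,
    ContinuousLinearMap.map_smul_of_tower]

theorem continuousOn_cutoffCoeff {K : Set (Cn n)} (hα : ∀ i, ContinuousOn (α i) K)
    (hβ : ContinuousOn β K) (hχ : ContDiff ℝ ∞ χ) : ContinuousOn (cutoffCoeff α β χ) K :=
  (hχ.continuous.continuousOn.smul hβ).add (continuousOn_finsetSum _ fun i _ =>
    (((hχ.continuous_fderiv (by simp)).clm_apply (continuous_const (y := stdBasis n i))).continuousOn).smul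
      (hα i))

theorem cutoffCoeff_eq_zero {y : Cn n} (hy : y ∉ tsupport χ) : cutoffCoeff α β χ y = 0 := by
  ext1 c
  simp [cutoffCoeff, image_eq_zero_of_notMem_tsupport hy, fderiv_eq_zero_of_notMem_tsupport hy,
    _root_.add_apply, _root_.sum_apply, _root_.smul_apply]

/-- If `F` is weakly the image of `U` under the formal adjoint of `∑ αᵢ ∂ᵢ + β`, then the principal
part of this operator, applied to `χ U`, is square integrable, in the sense of frequencies. -/
theorem exists_remainder {y₀ : Cn n} {r₀ : ℝ}
    (hα : ∀ i, ContinuousOn (α i) (Metric.closedBall y₀ r₀))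
    (hβ : ContinuousOn β (Metric.closedBall y₀ r₀)) (hχ : IsCutoff (Metric.ball y₀ r₀) χ)
    (hχs : ContDiff ℝ ∞ χ) : ∃ C : ℝ, 0 < C ∧ ∀ F U : Cn n → Coef n,
      MemLp F 2 (volume.restrict (Metric.closedBall y₀ r₀)) →
      MemLp U 2 (volume.restrict (Metric.closedBall y₀ r₀)) →
      (∀ w, IsCutoff (Metric.ball y₀ r₀) w → ContDiff ℝ ∞ w →
        ∫ y, inner ℂ (F y) (w y) = ∫ y, inner ℂ (U y) (diffOp α β w y)) →
      ∃ h : Cn n → Coef n, Integrable h ∧ MemLp h 2 volume ∧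
        ∫ y, ‖h y‖ ^ 2 ≤ C * ((∫ y in Metric.closedBall y₀ r₀, ‖F y‖ ^ 2) +
          ∫ y in Metric.closedBall y₀ r₀, ‖U y‖ ^ 2) ∧
        ∀ ξ c, ∫ y, inner ℂ (h y) (planeWave ξ y • c) = 2 * Real.pi * Complex.I *
          ∫ y, inner ℂ (symbolAt (adjointCoeff α) y ξ (χ y • U y)) (planeWave ξ y • c) := by
  set K := Metric.closedBall y₀ r₀ with hKdef
  have hK : IsCompact K := isCompact_closedBall _ _
  have hKs : ∀ y ∉ K, y ∉ tsupport χ := fun y hy h =>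
    hy (Metric.ball_subset_closedBall (hχ.subset h))
  let A₁ : Cn n → Coef n →L[ℂ] Coef n := fun y => χ y • ContinuousLinearMap.id ℂ (Coef n)
  have hA₁ : ContinuousOn A₁ K := hχ.continuous.continuousOn.smul continuousOn_const
  have hA₁0 : ∀ y ∉ K, A₁ y = 0 := fun y hy => by
    ext1 c
    simp only [A₁, image_eq_zero_of_notMem_tsupport (hKs y hy), _root_.smul_apply, zero_smul,
      _root_.zero_apply]
  let A₂ : Cn n → Coef n →L[ℂ] Coef n := fun y =>
    ContinuousLinearMap.adjoint (cutoffCoeff α β χ y)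
  have hA₂ : ContinuousOn A₂ K := continuousOn_adjoint (continuousOn_cutoffCoeff hα hβ hχs)
  have hA₂0 : ∀ y ∉ K, A₂ y = 0 := fun y hy => by
    simp only [A₂, cutoffCoeff_eq_zero (hKs y hy), map_zero]
  obtain ⟨C₁, hC₁, hm₁⟩ := exists_memLp_clm_apply hK hA₁ hA₁0
  obtain ⟨C₂, hC₂, hm₂⟩ := exists_memLp_clm_apply hK hA₂ hA₂0
  refine ⟨2 * C₁ + 2 * C₂, by positivity, fun F U hF hU hFU => ?_⟩
  obtain ⟨i1, j1, k1⟩ := hm₁ F hF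
  obtain ⟨i2, j2, k2⟩ := hm₂ U hU
  refine ⟨fun y => A₁ y (F y) - A₂ y (U y), i1.sub i2, j1.sub j2, ?_, fun ξ c => ?_⟩
  · have h1 := integral_norm_add_sq_le j1 j2.neg
    simp only [Pi.neg_apply, norm_neg, ← sub_eq_add_neg] at h1
    have h2 : 0 ≤ ∫ y in K, ‖F y‖ ^ 2 := integral_nonneg fun _ => by positivity
    have h3 : 0 ≤ ∫ y in K, ‖U y‖ ^ 2 := integral_nonneg fun _ => by positivity
    nlinarith [mul_nonneg hC₂.le h2, mul_nonneg hC₁.le h3]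
  · set z : ℂ := 2 * Real.pi * Complex.I with hz
    let A₃ : Cn n → Coef n →L[ℂ] Coef n := fun y => χ y • symbolAt (adjointCoeff α) y ξ
    have hA₃ : ContinuousOn A₃ K := hχ.continuous.continuousOn.smul
      (continuousOn_symbolAt (fun i => continuousOn_adjoint (hα i)) ξ)
    have hA₃0 : ∀ y ∉ K, A₃ y = 0 := fun y hy => by
      ext1 c
      simp only [A₃, image_eq_zero_of_notMem_tsupport (hKs y hy), _root_.smul_apply, zero_smul,
        _root_.zero_apply]
    obtain ⟨_, _, hm₃⟩ := exists_memLp_clm_apply hK hA₃ hA₃0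
    have i3 := (hm₃ U hU).1
    let v : Cn n → Coef n := fun y => χ y • c
    have hvs : ContDiff ℝ ∞ v := hχs.smul contDiff_const
    let w : Cn n → Coef n := fun y => planeWave ξ y • v y
    have hws : ContDiff ℝ ∞ w := (contDiff_planeWave ξ).smul hvs
    have hwc : IsCutoff (Metric.ball y₀ r₀) w :=
      hχ.of_eq_zero Metric.isOpen_ball hws.continuous.continuousOn fun y hy => by
        simp only [w, v, image_eq_zero_of_notMem_tsupport hy, zero_smul, smul_zero]
    have e1 := hFU w hwc hws
    have e2 : ∀ y, (inner ℂ (F y) (w y) : ℂ) = inner ℂ (A₁ y (F y)) (planeWave ξ y • c) := by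
      intro y
      simp only [w, v, A₁, _root_.smul_apply, ContinuousLinearMap.id_apply,
        RCLike.real_smul_eq_coe_smul (K := ℂ), inner_smul_left, inner_smul_right, RCLike.conj_ofReal]
    have e3 : ∀ y, (inner ℂ (U y) (diffOp α β w y) : ℂ) =
        inner ℂ (A₂ y (U y)) (planeWave ξ y • c) +
          z * inner ℂ (A₃ y (U y)) (planeWave ξ y • c) := by
      intro y
      have h1 : diffOp α β w y = planeWave ξ y • (cutoffCoeff α β χ y c +
          z • (χ y : ℂ) • symbolAt α y ξ c) := by
        rw [diffOp_planeWave_smul (hvs.differentiable (by simp) y), diffOp_smul_const hχs,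
          ← map_smul (symbolAt α y ξ) (χ y : ℂ) c]
        rfl
      have h2 : ∀ d d' : Coef n, (inner ℂ (symbolAt (adjointCoeff α) y ξ d) d' : ℂ) =
          inner ℂ d (symbolAt α y ξ d') := by
        intro d d'
        simp only [symbolAt, _root_.sum_apply, _root_.smul_apply, sum_inner, inner_sum,
          RCLike.real_smul_eq_coe_smul (K := ℂ), inner_smul_left, inner_smul_right,
          RCLike.conj_ofReal, ContinuousLinearMap.adjoint_inner_left]
      simp only [A₂, A₃, _root_.smul_apply, RCLike.real_smul_eq_coe_smul (K := ℂ)]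
      simp only [h1, inner_smul_right, inner_add_right, inner_smul_left, h2,
        ContinuousLinearMap.adjoint_inner_left, RCLike.conj_ofReal]
      simp only [RCLike.ofReal_eq_complex_ofReal]
      ring
    simp only [e2, e3] at e1
    rw [integral_add (integrable_inner_planeWave i2 ξ c)
      ((integrable_inner_planeWave i3 ξ c).const_mul z), integral_const_mul] at e1
    simp only [inner_sub_left]
    rw [integral_sub (integrable_inner_planeWave i1 ξ c) (integrable_inner_planeWave i2 ξ c), e1,
      add_sub_cancel_left]
    congr 1
    refine integral_congr_ae (Eventually.of_forall fun y => ?_)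
    simp only [A₃, _root_.smul_apply, RCLike.real_smul_eq_coe_smul (K := ℂ), map_smul]

end Remainder

section Local

variable {n : ℕ} {X : Type*} [TopologicalSpace X] [ChartedSpace (Cn n) X]
  [IsManifold 𝓘(ℂ, Cn n) ω X]
  [RiemannianBundle (fun x : X => TangentSpace 𝓘(ℝ, Cn n) x)]
  [IsContMDiffRiemannianBundle 𝓘(ℝ, Cn n) ∞ (Cn n) (fun x : X => TangentSpace 𝓘(ℝ, Cn n) x)]
  [MeasurableSpace X] [BorelSpace X] [SecondCountableTopology X] {φ : X → ℝ}
  {T : L2Forms n φ →ₗ.[ℂ] L2Forms n φ} {p : X}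
  {a : Fin (2 * n) → Cn n → Coef n →L[ℂ] Coef n} {b : Cn n → Coef n →L[ℂ] Coef n}

/-- The principal coefficients of `T` (up to the sign) and of its adjoint (up to the metric), with
respect to the coefficients of forms in the chart at `p`. The double adjoint in the first case is
`-a i`, in the form in which `exists_remainder` yields it for the formal transpose. -/
def pairCoeff (φ : X → ℝ) (p : X) (a : Fin (2 * n) → Cn n → Coef n →L[ℂ] Coef n) (k : Fin 2)
    (i : Fin (2 * n)) (y : Cn n) : Coef n →L[ℂ] Coef n :=
  if k = 0 then ContinuousLinearMap.adjoint (-ContinuousLinearMap.adjoint (a i y))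
  else (ContinuousLinearMap.adjoint (a i y)).comp (chartExp φ p y • formMetric p y)

theorem continuousOn_pairCoeff (hφ : Continuous φ)
    (ha : ∀ i, ContinuousOn (a i) (chartAt (Cn n) p).target) (k : Fin 2) (i : Fin (2 * n)) :
    ContinuousOn (pairCoeff φ p a k i) (chartAt (Cn n) p).target := by
  by_cases hk : k = 0
  · have h1 : pairCoeff φ p a k i = fun y =>
        ContinuousLinearMap.adjoint (-ContinuousLinearMap.adjoint (a i y)) :=
      funext fun y => if_pos hk
    rw [h1]
    exact continuousOn_adjoint (continuousOn_adjoint (ha i)).neg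
  · have h1 : pairCoeff φ p a k i = fun y =>
        (ContinuousLinearMap.adjoint (a i y)).comp (chartExp φ p y • formMetric p y) :=
      funext fun y => if_neg hk
    rw [h1]
    exact (continuousOn_adjoint (ha i)).clm_comp ((continuousOn_chartExp hφ p).smul
      (contDiffOn_formMetric p).continuousOn)

theorem sum_norm_pairCoeff (y ξ : Cn n) (c : Coef n) :
    ∑ k, ‖∑ i, (inner ℝ (stdBasis n i) ξ : ℝ) • pairCoeff φ p a k i y c‖ ^ 2 =
      ‖symbolAt a y ξ c‖ ^ 2 +
        ‖symbolAt (adjointCoeff a) y ξ (chartExp φ p y • formMetric p y c)‖ ^ 2 := by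
  rw [Fin.sum_univ_two]
  congr 2
  · simp [pairCoeff, symbolAt, _root_.neg_apply]
  · simp [pairCoeff, symbolAt]

/-- The principal parts of `T` and of its adjoint, applied to the cutoff `χ u`, are weakly equal to
functions `h k` whose norms are bounded by the graph norm of `u`. -/
theorem exists_pair_remainder [T2Space X] (hφ : Continuous φ) (hT : IsClosedDiffOperator T)
    (hsym : IsLocalSymbol T p a b) {y₀ : Cn n} {r₀ r₂ : ℝ} (h0 : 0 < r₀) (h02 : r₀ < r₂)
    (hr : Metric.closedBall y₀ r₂ ⊆ (chartAt (Cn n) p).target) {χ : Cn n → ℝ}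
    (hχ : IsCutoff (Metric.ball y₀ r₀) χ) (hχs : ContDiff ℝ ∞ χ) :
    ∃ C : ℝ, 0 < C ∧ ∀ u f g : L2Forms n φ, (u, f) ∈ T.graph →
      (u, g) ∈ (LinearPMap.adjoint T).graph → ∃ h : Fin 2 → Cn n → Coef n,
        ∀ k, Integrable (h k) ∧ MemLp (h k) 2 volume ∧
          ∫ y, ‖h k y‖ ^ 2 ≤ C * (‖u‖ ^ 2 + ‖f‖ ^ 2 + ‖g‖ ^ 2) ∧
          ∀ ξ c, ∫ y, inner ℂ (h k y) (planeWave ξ y • c) = 2 * Real.pi * Complex.I *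
            ∫ y, inner ℂ (symbolAt (pairCoeff φ p a k) y ξ (χ y • chartRep p u y))
              (planeWave ξ y • c) := by
  have ht := (chartAt (Cn n) p).open_target
  set K := Metric.closedBall y₀ r₀ with hKdef
  have hK : IsCompact K := isCompact_closedBall _ _
  have hKt : K ⊆ (chartAt (Cn n) p).target := (Metric.closedBall_subset_closedBall h02.le).trans hr
  have hbt : Metric.ball y₀ r₀ ⊆ (chartAt (Cn n) p).target :=
    Metric.ball_subset_closedBall.trans hKt
  have ha := fun i => (hsym.contDiffOn_a i).continuousOn.mono hKt
  obtain ⟨C₁, hC₁, hrem₁⟩ := exists_remainder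
    (α := fun i y => -ContinuousLinearMap.adjoint (a i y)) (β := transposeB a b)
    (fun i => (continuousOn_adjoint (ha i)).neg)
    ((continuousOn_transposeB ht hsym.contDiffOn_a hsym.contDiffOn_b).mono hKt) hχ hχs
  obtain ⟨C₂, hC₂, hrem₂⟩ := exists_remainder (α := a) (β := b) ha
    (hsym.contDiffOn_b.continuousOn.mono hKt) hχ hχs
  obtain ⟨C₃, hC₃, hrep⟩ := exists_lintegral_chartRep_le hφ p hK hKt
  obtain ⟨C₄, hC₄, hlow⟩ := exists_lowerRep_le hφ p hK hKt
  refine ⟨C₁ * C₃ + C₂ * C₄, by positivity, fun u f g huf hug => ?_⟩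
  obtain ⟨h₁, i1, j1, k1, l1⟩ := hrem₁ _ _ (hrep f).1 (hrep u).1 fun w hw hws =>
    integral_inner_chartRep hφ hT hsym h0 h02 hr hw hws huf
  obtain ⟨h₂, i2, j2, k2, l2⟩ := hrem₂ _ _ (hlow g).1 (hlow u).1 fun w hw hws =>
    integral_inner_lowerRep hφ hT.dense hsym (hw.mono hbt) hws hug
  have m1 : ∫ y, ‖h₁ y‖ ^ 2 ≤ (C₁ * C₃ + C₂ * C₄) * (‖u‖ ^ 2 + ‖f‖ ^ 2 + ‖g‖ ^ 2) := by
    calc _ ≤ C₁ * (C₃ * ‖f‖ ^ 2 + C₃ * ‖u‖ ^ 2) := k1.trans (mul_le_mul_of_nonneg_left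
          (add_le_add (hrep f).2 (hrep u).2) hC₁.le)
      _ = C₁ * C₃ * (‖u‖ ^ 2 + ‖f‖ ^ 2 + 0) := by ring
      _ ≤ _ := by
          gcongr
          · exact le_add_of_nonneg_right (by positivity)
          · positivity
  have m2 : ∫ y, ‖h₂ y‖ ^ 2 ≤ (C₁ * C₃ + C₂ * C₄) * (‖u‖ ^ 2 + ‖f‖ ^ 2 + ‖g‖ ^ 2) := by
    calc _ ≤ C₂ * (C₄ * ‖g‖ ^ 2 + C₄ * ‖u‖ ^ 2) := k2.trans (mul_le_mul_of_nonneg_left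
          (add_le_add (hlow g).2 (hlow u).2) hC₂.le)
      _ = C₂ * C₄ * (‖u‖ ^ 2 + 0 + ‖g‖ ^ 2) := by ring
      _ ≤ _ := by
          gcongr
          · exact le_add_of_nonneg_left (by positivity)
          · positivity
  refine ⟨fun k => if k = 0 then h₁ else h₂, fun k => ?_⟩
  by_cases hk : k = 0
  · subst hk
    exact ⟨i1, j1, m1, l1⟩
  · simp only [hk, if_false]
    refine ⟨i2, j2, m2, fun ξ c => (l2 ξ c).trans ?_⟩
    congr 1
    refine integral_congr_ae (Eventually.of_forall fun y => ?_)
    simp only [symbolAt, pairCoeff, hk, if_false, _root_.sum_apply, _root_.smul_apply, lowerRep,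
      ContinuousLinearMap.comp_apply, ContinuousLinearMap.map_smul_of_tower, adjointCoeff]
    congr 1
    refine Finset.sum_congr rfl fun i _ => ?_
    rw [smul_comm (χ y) (chartExp φ p y)]

end Local

/-! ### Local compactness -/

section Local

open scoped FourierTransform

variable {n : ℕ} {X : Type*} [TopologicalSpace X] [ChartedSpace (Cn n) X]
  [IsManifold 𝓘(ℂ, Cn n) ω X]
  [RiemannianBundle (fun x : X => TangentSpace 𝓘(ℝ, Cn n) x)]
  [IsContMDiffRiemannianBundle 𝓘(ℝ, Cn n) ∞ (Cn n) (fun x : X => TangentSpace 𝓘(ℝ, Cn n) x)]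
  [MeasurableSpace X] [BorelSpace X] [SecondCountableTopology X] {φ : X → ℝ}
  {T : L2Forms n φ →ₗ.[ℂ] L2Forms n φ} {p : X}
  {a : Fin (2 * n) → Cn n → Coef n →L[ℂ] Coef n} {b : Cn n → Coef n →L[ℂ] Coef n}

open scoped Classical in
/-- The values at finitely many frequencies of the Fourier transform of `χ u` are controlled by
finitely many continuous functionals of `u`. -/
theorem exists_finset_fourier_le (hφ : Continuous φ) {χ : Cn n → ℝ}
    (hχ : IsCutoff (chartAt (Cn n) p).target χ) (N : Finset (Cn n)) :
    ∃ (S : Finset (L2Forms n φ)) (C : ℝ), 0 ≤ C ∧ ∀ u : L2Forms n φ,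
      Integrable (fun y => χ y • chartRep p u y) →
      ∑ ξ ∈ N, ‖𝓕 (fun y => χ y • chartRep p u y) ξ‖ ^ 2 ≤
        C * ∑ v ∈ S, ‖(inner ℂ v u : ℂ)‖ ^ 2 := by
  let w : Cn n → Finset (Fin (2 * n)) → Cn n → Coef n := fun ξ s y =>
    χ y • planeWave ξ y • EuclideanSpace.single s (1 : ℂ)
  have hw : ∀ ξ s, IsCutoff (chartAt (Cn n) p).target (w ξ s) := fun ξ s =>
    hχ.of_eq_zero (chartAt (Cn n) p).open_target
      (hχ.continuous.smul ((continuous_planeWave ξ).smul continuous_const)).continuousOn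
      fun y hy => by simp only [w, image_eq_zero_of_notMem_tsupport hy, zero_smul]
  let e : Cn n × Finset (Fin (2 * n)) → L2Forms n φ := fun q =>
    chartClass φ p (raise φ p (w q.1 q.2))
  refine ⟨(N ×ˢ Finset.univ).image e, ((N ×ˢ (Finset.univ : Finset (Finset (Fin (2 * n))))).card : ℕ),
    Nat.cast_nonneg _, fun u hu => ?_⟩
  have h1 : ∀ ξ s, ‖𝓕 (fun y => χ y • chartRep p u y) ξ s‖ = ‖(inner ℂ (e (ξ, s)) u : ℂ)‖ := by
    intro ξ s
    have h2 : 𝓕 (fun y => χ y • chartRep p u y) ξ s = (starRingEnd ℂ) (inner ℂ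
        (𝓕 (fun y => χ y • chartRep p u y) ξ) (EuclideanSpace.single s (1 : ℂ))) := by
      rw [EuclideanSpace.inner_single_right]
      simp
    rw [h2, RCLike.norm_conj, inner_fourier hu, norm_inner_symm,
      inner_chartClass_raise hφ (hw ξ s)]
    congr 1
    refine integral_congr_ae (Eventually.of_forall fun y => ?_)
    simp only [w, RCLike.real_smul_eq_coe_smul (K := ℂ), inner_smul_left, inner_smul_right,
      RCLike.conj_ofReal]
    ring
  have h3 : ∑ ξ ∈ N, ‖𝓕 (fun y => χ y • chartRep p u y) ξ‖ ^ 2 =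
      ∑ q ∈ N ×ˢ (Finset.univ : Finset (Finset (Fin (2 * n)))), ‖(inner ℂ (e q) u : ℂ)‖ ^ 2 := by
    rw [Finset.sum_product]
    refine Finset.sum_congr rfl fun ξ _ => ?_
    rw [EuclideanSpace.norm_sq_eq]
    exact Finset.sum_congr rfl fun s _ => by rw [h1]
  rw [h3, ← nsmul_eq_mul]
  refine Finset.sum_le_card_nsmul _ _ _ fun q hq => ?_
  exact Finset.single_le_sum (f := fun v => ‖(inner ℂ v u : ℂ)‖ ^ 2) (fun _ _ => by positivity)
    (Finset.mem_image_of_mem e hq)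

/-- The principal coefficients are nearly constant near a point. -/
theorem exists_freezing_radius (hφ : Continuous φ)
    (ha : ∀ i, ContinuousOn (a i) (chartAt (Cn n) p).target) {y₀ : Cn n}
    (hy₀ : y₀ ∈ (chartAt (Cn n) p).target) {δ : ℝ} (hδ : 0 < δ) :
    ∃ r > 0, Metric.closedBall y₀ r ⊆ (chartAt (Cn n) p).target ∧
      ∀ k i, ∀ y ∈ Metric.closedBall y₀ r,
        ‖pairCoeff φ p a k i y - pairCoeff φ p a k i y₀‖ ^ 2 ≤ δ := by
  have ht := (chartAt (Cn n) p).open_target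
  have h1 : ∀ᶠ y in 𝓝 y₀, ∀ k i,
      ‖pairCoeff φ p a k i y - pairCoeff φ p a k i y₀‖ ^ 2 < δ := by
    refine eventually_all.2 fun k => eventually_all.2 fun i => ?_
    have h2 : ContinuousAt (fun y => ‖pairCoeff φ p a k i y - pairCoeff φ p a k i y₀‖ ^ 2) y₀ :=
      (((continuousOn_pairCoeff hφ ha k i).continuousAt (ht.mem_nhds hy₀)).sub
        continuousAt_const).norm.pow 2
    refine h2.eventually (Iio_mem_nhds ?_)
    simpa using hδ
  obtain ⟨r, hr, hsub⟩ := Metric.nhds_basis_closedBall.mem_iff.1 (h1.and (ht.mem_nhds hy₀))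
  exact ⟨r, hr, fun y hy => (hsub hy).2, fun k i y hy => ((hsub hy).1 k i).le⟩

/-- Local compactness: near each point, the `L²` norm of a form in the domains of `T` and of its
adjoint is controlled by finitely many functionals and a small multiple of the graph norm. -/
theorem exists_local_compactness [T2Space X] (hφ : Continuous φ) (hT : IsClosedDiffOperator T)
    (hG : GardingInequality T) (x₀ : X) : ∃ O : Set X, IsOpen O ∧ x₀ ∈ O ∧ ∀ ε > 0,
      ∃ (S : Finset (L2Forms n φ)) (C : ℝ), 0 ≤ C ∧ ∀ u f g : L2Forms n φ, (u, f) ∈ T.graph →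
        (u, g) ∈ (LinearPMap.adjoint T).graph →
        normOn O u ^ 2 ≤ C * ∑ v ∈ S, ‖(inner ℂ v u : ℂ)‖ ^ 2 +
          ε * (‖u‖ ^ 2 + ‖f‖ ^ 2 + ‖g‖ ^ 2) := by
  obtain ⟨a, b, hsym⟩ := exists_isLocalSymbol hφ hT x₀
  set e := chartAt (Cn n) x₀ with he
  have ht := e.open_target
  set y₀ := e x₀ with hy₀def
  have hy₀ : y₀ ∈ e.target := mem_chart_target _ _
  have ha := fun i => (hsym.contDiffOn_a i).continuousOn
  obtain ⟨Ce, hCe, hell⟩ := exists_norm_le_symbolAt hφ hT hG hsym hy₀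
  set Q := Ce * (2 * (2 * n : ℕ) * (2 * (2 * n : ℕ))) with hQ
  have hQ0 : 0 ≤ Q := by positivity
  set δ := (2 * (Q + 1))⁻¹ with hδ
  have hδ0 : 0 < δ := by positivity
  have hQδ : Q * δ ≤ 1 / 2 := by
    rw [hδ, ← div_eq_mul_inv, div_le_div_iff₀ (by positivity) (by positivity)]
    linarith
  obtain ⟨r₂, hr₂, hrt, hfreeze⟩ := exists_freezing_radius hφ ha hy₀ hδ0
  obtain ⟨r₀, h0, h02⟩ := exists_between hr₂
  let χ : ContDiffBump y₀ := ⟨r₀ / 4, r₀ / 2, by positivity, by linarith⟩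
  have hχ : IsCutoff (Metric.ball y₀ r₀) χ := ⟨χ.continuous, χ.hasCompactSupport, by
    rw [χ.tsupport_eq]
    exact Metric.closedBall_subset_ball (half_lt_self h0)⟩
  set K := Metric.closedBall y₀ r₀ with hKdef
  have hK : IsCompact K := isCompact_closedBall _ _
  have hK2 : K ⊆ Metric.closedBall y₀ r₂ := Metric.closedBall_subset_closedBall h02.le
  have hKt : K ⊆ e.target := hK2.trans hrt
  have hbK : Metric.ball y₀ r₀ ⊆ K := Metric.ball_subset_closedBall
  have hχK : ∀ y ∉ K, χ y = 0 := fun y hy => hχ.eq_zero fun h => hy (hbK h)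
  obtain ⟨Ch, hCh, hrem⟩ := exists_pair_remainder hφ hT hsym h0 h02 hrt hχ χ.contDiff
  obtain ⟨C₃, hC₃, hrep⟩ := exists_lintegral_chartRep_le hφ x₀ hK hKt
  -- the cutoff and the differences of the coefficients as matrix valued functions
  have hχc : ContinuousOn (fun y => χ y • ContinuousLinearMap.id ℂ (Coef n)) K :=
    χ.continuous.continuousOn.smul continuousOn_const
  obtain ⟨C₄, hC₄, hmv⟩ := exists_memLp_clm_apply hK hχc fun y hy => by
    ext1 c
    simp only [hχK y hy, _root_.smul_apply, zero_smul, _root_.zero_apply]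
  have hwc : ∀ k i, ContinuousOn (fun y => χ y • (pairCoeff φ x₀ a k i y -
      pairCoeff φ x₀ a k i y₀)) K := fun k i => χ.continuous.continuousOn.smul
    (((continuousOn_pairCoeff hφ ha k i).mono hKt).sub continuousOn_const)
  choose C₅ hC₅ hmw using fun k i => exists_memLp_clm_apply hK (hwc k i) fun y hy => by
    ext1 c
    simp only [hχK y hy, _root_.smul_apply, zero_smul, _root_.zero_apply]
  have hK4 : Metric.closedBall y₀ (r₀ / 4) ⊆ K :=
    Metric.closedBall_subset_closedBall (by linarith)
  obtain ⟨C₆, hC₆, hnorm⟩ := exists_normOn_le hφ x₀ (isCompact_closedBall y₀ (r₀ / 4))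
    (hK4.trans hKt)
  have hb4 : Metric.ball y₀ (r₀ / 4) ⊆ e.target :=
    Metric.ball_subset_closedBall.trans (hK4.trans hKt)
  have hOo : IsOpen (e.symm '' Metric.ball y₀ (r₀ / 4)) :=
    e.isOpen_image_symm_of_subset_target Metric.isOpen_ball hb4
  refine ⟨e.symm '' Metric.ball y₀ (r₀ / 4), hOo, ⟨y₀, Metric.mem_ball_self (by positivity),
    e.left_inv (mem_chart_source _ _)⟩, fun ε hε => ?_⟩
  -- the frequency that separates low from high frequencies
  set R := Real.sqrt (16 * C₆ * Ce * Ch / ε) with hR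
  have hR0 : 0 < R := Real.sqrt_pos.2 (by positivity)
  have hR2 : R ^ 2 = 16 * C₆ * Ce * Ch / ε := Real.sq_sqrt (by positivity)
  set V := volume.real K with hV
  have hV0 : 0 ≤ V := measureReal_nonneg
  set ε' := ε / (4 * C₆ * (V * (C₄ * C₃) + 1)) with hε'
  have hε'0 : 0 < ε' := by positivity
  obtain ⟨N, CN, hCN, hlow⟩ := exists_low_frequency (n := n) R (M := ‖y₀‖ + r₀) (by positivity) hε'0
  obtain ⟨S, CS, hCS, hS⟩ := exists_finset_fourier_le (p := x₀) hφ (hχ.mono (hbK.trans hKt)) N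
  refine ⟨S, C₆ * (2 * (CN * CS)), by positivity, fun u f g huf hug => ?_⟩
  obtain ⟨h, hh⟩ := hrem u f g huf hug
  obtain ⟨hu, huC⟩ := hrep u
  set v : Cn n → Coef n := fun y => χ y • chartRep x₀ u y with hv
  obtain ⟨hv1, hv2, hv3⟩ : Integrable v volume ∧ MemLp v 2 volume ∧ ∫ y, ‖v y‖ ^ 2 ≤
      C₄ * ∫ y in K, ‖chartRep x₀ u y‖ ^ 2 := hmv _ hu
  have hw := fun k i => hmw k i _ hu
  have hweq : ∀ k i y, (χ y • (pairCoeff φ x₀ a k i y - pairCoeff φ x₀ a k i y₀))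
      (chartRep x₀ u y) = pairCoeff φ x₀ a k i y (v y) - pairCoeff φ x₀ a k i y₀ (v y) := by
    intro k i y
    simp only [hv, _root_.smul_apply, _root_.sub_apply, ContinuousLinearMap.map_smul_of_tower,
      smul_sub]
  simp only [hweq] at hw
  set J := ∫ y, ‖v y‖ ^ 2 with hJ
  have hJ0 : 0 ≤ J := integral_nonneg fun _ => by positivity
  set G := ‖u‖ ^ 2 + ‖f‖ ^ 2 + ‖g‖ ^ 2 with hGdef
  have hG0 : 0 ≤ G := by positivity
  have hδle : ∀ k i, ∫ y, ‖pairCoeff φ x₀ a k i y (v y) - pairCoeff φ x₀ a k i y₀ (v y)‖ ^ 2 ≤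
      δ * J := by
    intro k i
    rw [hJ, ← integral_const_mul]
    refine integral_mono ((hw k i).2.1.integrable_norm_pow two_ne_zero)
      ((hv2.integrable_norm_pow two_ne_zero).const_mul _) fun y => ?_
    simp only
    by_cases hy : y ∈ K
    · rw [← _root_.sub_apply]
      calc _ ≤ (‖pairCoeff φ x₀ a k i y - pairCoeff φ x₀ a k i y₀‖ * ‖v y‖) ^ 2 := by
            gcongr
            exact ContinuousLinearMap.le_opNorm _ _
        _ = ‖pairCoeff φ x₀ a k i y - pairCoeff φ x₀ a k i y₀‖ ^ 2 * ‖v y‖ ^ 2 := by ring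
        _ ≤ _ := by
            gcongr
            exact hfreeze k i y (hK2 hy)
    · simp [hv, hχK y hy]
  have hmain := integral_norm_sq_le_of_symbol hv1 hv2 (fun k => (hh k).1) (fun k => (hh k).2.1)
    (fun k i => (hw k i).1) (fun k i => (hw k i).2.1)
    (A₀ := fun k i => pairCoeff φ x₀ a k i y₀) hCe.le hR0
    (fun ξ c => by
      rw [sum_norm_pairCoeff]
      exact hell ξ c)
    (fun k ξ => norm_symbol_fourier_le (hh k).1 hv1 (fun i => (hw k i).1) ((hh k).2.2.2 ξ)) hδle
  have hvM : ∀ y, ‖y₀‖ + r₀ < ‖y‖ → v y = 0 := by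
    intro y hy
    have h1 : y ∉ K := fun h => by
      have h2 := norm_le_norm_add_norm_sub' y y₀
      rw [← dist_eq_norm] at h2
      linarith [Metric.mem_closedBall.1 h]
    simp [hv, hχK y h1]
  have hl := hlow v hv1 hvM
  have hs := hS u hv1
  have hvL1 : (∫ y, ‖v y‖) ^ 2 ≤ V * J := by
    have hfin : IsFiniteMeasure (volume.restrict K) := ⟨by
      rw [Measure.restrict_apply_univ]
      exact hK.measure_lt_top⟩
    have h0' : ∀ y ∉ K, v y = 0 := fun y hy => by simp [hv, hχK y hy]
    have h1 := integral_norm_mul_norm_le (μ := volume.restrict K) (f := fun _ => (1 : ℝ)) (g := v)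
      (memLp_const _) (hv2.restrict K)
    simp only [norm_one, one_mul, one_pow, integral_const, smul_eq_mul, mul_one] at h1
    rw [setIntegral_eq_integral_of_forall_compl_eq_zero fun y hy => by rw [h0' y hy, norm_zero],
      setIntegral_eq_integral_of_forall_compl_eq_zero fun y hy => by
        rw [h0' y hy, norm_zero, zero_pow two_ne_zero], measureReal_restrict_apply_univ] at h1
    calc (∫ y, ‖v y‖) ^ 2 ≤ (Real.sqrt V * Real.sqrt J) ^ 2 := by
          have : 0 ≤ ∫ y, ‖v y‖ := integral_nonneg fun y => norm_nonneg _
          gcongr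
      _ = V * J := by rw [mul_pow, Real.sq_sqrt hV0, Real.sq_sqrt hJ0]
  have hJu : J ≤ C₄ * C₃ * G := by
    calc J ≤ C₄ * (C₃ * ‖u‖ ^ 2) := hv3.trans (mul_le_mul_of_nonneg_left huC hC₄.le)
      _ ≤ C₄ * (C₃ * G) := by
          gcongr
          rw [hGdef, add_assoc]
          exact le_add_of_nonneg_right (by positivity)
      _ = _ := by ring
  have hhs : ∑ k, ∫ y, ‖h k y‖ ^ 2 ≤ 2 * (Ch * G) := by
    calc _ ≤ ∑ _k : Fin 2, Ch * G := Finset.sum_le_sum fun k _ => (hh k).2.2.1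
      _ = _ := by simp
  have hOle : normOn (e.symm '' Metric.ball y₀ (r₀ / 4)) u ^ 2 ≤ C₆ * J := by
    refine (hnorm u _ hOo.measurableSet (image_mono Metric.ball_subset_closedBall)).trans ?_
    refine mul_le_mul_of_nonneg_left ?_ hC₆.le
    calc ∫ y in Metric.closedBall y₀ (r₀ / 4), ‖chartRep x₀ u y‖ ^ 2 =
        ∫ y in Metric.closedBall y₀ (r₀ / 4), ‖v y‖ ^ 2 := by
          refine setIntegral_congr_fun (isCompact_closedBall _ _).measurableSet fun y hy => ?_
          simp only [hv, χ.one_of_mem_closedBall hy, one_smul]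
      _ ≤ J := setIntegral_le_integral (hv2.integrable_norm_pow two_ne_zero)
          (Eventually.of_forall fun y => by positivity)
  set q₀ := ∑ v ∈ S, ‖(inner ℂ v u : ℂ)‖ ^ 2 with hq₀
  have hq₀0 : 0 ≤ q₀ := Finset.sum_nonneg fun _ _ => by positivity
  -- collect the terms; the frozen coefficients are absorbed into the left hand side
  have f1 : J ≤ 2 * (CN * CS * q₀ + ε' * (V * (C₄ * C₃ * G))) + 8 * (Ce * (R ^ 2)⁻¹ * (Ch * G)) := by
    have g1 : CN * ∑ ξ ∈ N, ‖𝓕 v ξ‖ ^ 2 ≤ CN * (CS * q₀) := mul_le_mul_of_nonneg_left hs hCN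
    have g2 : ε' * (∫ y, ‖v y‖) ^ 2 ≤ ε' * (V * (C₄ * C₃ * G)) := by
      refine mul_le_mul_of_nonneg_left (hvL1.trans ?_) hε'0.le
      gcongr
    have g3 : Ce * (2 * (R ^ 2)⁻¹ * ∑ k, ∫ y, ‖h k y‖ ^ 2) ≤
        Ce * (2 * (R ^ 2)⁻¹ * (2 * (Ch * G))) := by gcongr
    have g4 : Ce * (2 * (2 * n : ℕ) * (2 * ((2 * n : ℕ) * (δ * J)))) = (Q * δ) * J := by
      rw [hQ]
      ring
    have g5 : (Q * δ) * J ≤ 1 / 2 * J := mul_le_mul_of_nonneg_right hQδ hJ0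
    rw [mul_add, g4] at hmain
    linarith
  have f2 : C₆ * (8 * (Ce * (R ^ 2)⁻¹ * (Ch * G))) = ε / 2 * G := by
    rw [hR2]
    field_simp
    ring
  have f3 : C₆ * (2 * (ε' * (V * (C₄ * C₃ * G)))) ≤ ε / 2 * G := by
    have g1 : C₆ * (2 * (ε' * (V * (C₄ * C₃ * G)))) =
        (ε / 2 * G) * (V * (C₄ * C₃) / (V * (C₄ * C₃) + 1)) := by
      rw [hε']
      field_simp
      ring
    rw [g1]
    refine mul_le_of_le_one_right (by positivity) ?_
    rw [div_le_one (by positivity)]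
    linarith
  have f4 := hOle.trans (mul_le_mul_of_nonneg_left f1 hC₆.le)
  linarith

end Local

/-! ### Compact sets and tails -/

section Global

variable {n : ℕ} {X : Type*} [TopologicalSpace X] [ChartedSpace (Cn n) X]
  [IsManifold 𝓘(ℂ, Cn n) ω X]
  [RiemannianBundle (fun x : X => TangentSpace 𝓘(ℝ, Cn n) x)]
  [IsContMDiffRiemannianBundle 𝓘(ℝ, Cn n) ∞ (Cn n) (fun x : X => TangentSpace 𝓘(ℝ, Cn n) x)]
  [MeasurableSpace X] [BorelSpace X] [SecondCountableTopology X] {φ : X → ℝ}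
  {T : L2Forms n φ →ₗ.[ℂ] L2Forms n φ}

theorem normOn_nonneg (S : Set X) (u : L2Forms n φ) : 0 ≤ normOn S u := Real.sqrt_nonneg _

theorem normOn_sq_mono {S S' : Set X} (h : S ⊆ S') (u : L2Forms n φ) :
    normOn S u ^ 2 ≤ normOn S' u ^ 2 := by
  rw [normOn_sq, normOn_sq]
  exact setIntegral_mono_set (integrable_norm_sq u).integrableOn
    (Eventually.of_forall fun x => sq_nonneg _) h.eventuallyLE

theorem normOn_sq_union_le (S S' : Set X) (u : L2Forms n φ) :
    normOn (S ∪ S') u ^ 2 ≤ normOn S u ^ 2 + normOn S' u ^ 2 := by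
  have hi := integrable_norm_sq u
  simp only [normOn_sq]
  rw [← integral_add_measure hi.restrict hi.restrict]
  exact integral_mono_measure (Measure.restrict_union_le S S')
    (Eventually.of_forall fun x => sq_nonneg _) (hi.restrict.add_measure hi.restrict)

theorem norm_sq_le_normOn_add (S : Set X) (u : L2Forms n φ) :
    ‖u‖ ^ 2 ≤ normOn S u ^ 2 + normOn Sᶜ u ^ 2 := by
  refine le_trans (le_of_eq ?_) (normOn_sq_union_le S Sᶜ u)
  rw [union_compl_self, normOn_sq, norm_sq_eq_integral, Measure.restrict_univ]

theorem normOn_sub_sq_le (S : Set X) (u v : L2Forms n φ) :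
    normOn S (u - v) ^ 2 ≤ 2 * normOn S u ^ 2 + 2 * normOn S v ^ 2 := by
  simp only [normOn_sq]
  rw [← integral_const_mul, ← integral_const_mul, ← integral_add
    ((integrable_norm_sq u).restrict.const_mul _) ((integrable_norm_sq v).restrict.const_mul _)]
  refine integral_mono_ae (integrable_norm_sq _).restrict
    (((integrable_norm_sq u).restrict.const_mul _).add
      ((integrable_norm_sq v).restrict.const_mul _)) ?_
  filter_upwards [ae_restrict_of_ae (Lp.coeFn_sub u v)] with x hx
  rw [hx, Pi.sub_apply]
  have h1 := norm_sub_le (u x) (v x)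
  nlinarith [norm_nonneg (u x - v x), sq_nonneg (‖u x‖ - ‖v x‖)]

theorem normOn_smul (S : Set X) (c : ℂ) (u : L2Forms n φ) :
    normOn S (c • u) = ‖c‖ * normOn S u := by
  have h1 : normOn S (c • u) ^ 2 = (‖c‖ * normOn S u) ^ 2 := by
    rw [mul_pow, normOn_sq, normOn_sq, ← integral_const_mul]
    refine integral_congr_ae ?_
    filter_upwards [ae_restrict_of_ae (Lp.coeFn_smul c u)] with x hx
    rw [hx, Pi.smul_apply, norm_smul, mul_pow]
  exact (sq_eq_sq₀ (normOn_nonneg _ _) (mul_nonneg (norm_nonneg _) (normOn_nonneg _ _))).1 h1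

/-- The restriction of `u` to `S` pairs with `w` only through the values on `S`. -/
theorem exists_indicator {S : Set X} (hS : MeasurableSet S) (u : L2Forms n φ) :
    ∃ h : L2Forms n φ, (∀ w : L2Forms n φ, ‖(inner ℂ h w : ℂ)‖ ≤ normOn S u * normOn S w) ∧
      ‖(inner ℂ h u : ℂ)‖ = normOn S u ^ 2 := by
  have hm := (Lp.memLp u).indicator hS
  have h1 : ∀ w : L2Forms n φ, (inner ℂ hm.toLp w : ℂ) =
      ∫ x in S, inner ℂ (u x) (w x) ∂weightedVolume n φ := by
    intro w
    rw [L2.inner_def, ← integral_indicator hS]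
    refine integral_congr_ae ?_
    filter_upwards [hm.coeFn_toLp] with x hx
    rw [hx]
    by_cases hxS : x ∈ S
    · rw [indicator_of_mem hxS, indicator_of_mem hxS]
    · rw [indicator_of_notMem hxS, indicator_of_notMem hxS, inner_zero_left]
  refine ⟨hm.toLp, fun w => ?_, ?_⟩
  · rw [h1]
    calc _ ≤ ∫ x in S, ‖u x‖ * ‖w x‖ ∂weightedVolume n φ :=
          norm_integral_le_of_norm_le
            (((Lp.memLp u).restrict S).norm.integrable_mul ((Lp.memLp w).restrict S).norm)
            (Eventually.of_forall fun x => norm_inner_le_norm _ _)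
      _ ≤ _ := integral_norm_mul_norm_le ((Lp.memLp u).restrict S) ((Lp.memLp w).restrict S)
  · rw [h1, normOn_sq]
    simp only [inner_self_eq_norm_sq_to_K]
    have h2 : ∫ x in S, ((‖u x‖ : ℂ)) ^ 2 ∂weightedVolume n φ =
        ((∫ x in S, ‖u x‖ ^ 2 ∂weightedVolume n φ : ℝ) : ℂ) := by
      rw [← integral_complex_ofReal]
      simp only [Complex.ofReal_pow]
    refine (congrArg norm h2).trans ?_
    rw [Complex.norm_real, Real.norm_of_nonneg (integral_nonneg fun x => sq_nonneg _)]

/-- On a compact set the `L²` norm is controlled by finitely many functionals and a small multiple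
of the graph norm. -/
theorem exists_finset_normOn_le [T2Space X] (hφ : Continuous φ) (hT : IsClosedDiffOperator T)
    (hG : GardingInequality T) {K : Set X} (hK : IsCompact K) :
    ∀ ε > 0, ∃ (S : Finset (L2Forms n φ)) (C : ℝ), 0 ≤ C ∧ ∀ u f g : L2Forms n φ, (u, f) ∈ T.graph →
      (u, g) ∈ (LinearPMap.adjoint T).graph →
      normOn K u ^ 2 ≤ C * ∑ v ∈ S, ‖(inner ℂ v u : ℂ)‖ ^ 2 +
        ε * (‖u‖ ^ 2 + ‖f‖ ^ 2 + ‖g‖ ^ 2) := by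
  classical
  refine hK.induction_on ?_ ?_ ?_ ?_
  · refine fun ε hε => ⟨∅, 0, le_rfl, fun u f g _ _ => ?_⟩
    rw [normOn_sq, Measure.restrict_empty, integral_zero_measure]
    positivity
  · intro s t hst ih ε hε
    obtain ⟨S, C, hC, h⟩ := ih ε hε
    exact ⟨S, C, hC, fun u f g hf hg => (normOn_sq_mono hst u).trans (h u f g hf hg)⟩
  · intro s t ihs iht ε hε
    obtain ⟨S, C, hC, h⟩ := ihs _ (half_pos hε)
    obtain ⟨S', C', hC', h'⟩ := iht _ (half_pos hε)
    refine ⟨S ∪ S', C + C', by positivity, fun u f g hf hg => ?_⟩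
    have h1 : C * ∑ v ∈ S, ‖(inner ℂ v u : ℂ)‖ ^ 2 ≤
        C * ∑ v ∈ S ∪ S', ‖(inner ℂ v u : ℂ)‖ ^ 2 := mul_le_mul_of_nonneg_left
      (Finset.sum_le_sum_of_subset_of_nonneg Finset.subset_union_left
        fun _ _ _ => by positivity) hC
    have h2 : C' * ∑ v ∈ S', ‖(inner ℂ v u : ℂ)‖ ^ 2 ≤
        C' * ∑ v ∈ S ∪ S', ‖(inner ℂ v u : ℂ)‖ ^ 2 := mul_le_mul_of_nonneg_left
      (Finset.sum_le_sum_of_subset_of_nonneg Finset.subset_union_right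
        fun _ _ _ => by positivity) hC'
    linarith [normOn_sq_union_le s t u, h u f g hf hg, h' u f g hf hg]
  · intro x hx
    obtain ⟨O, hO, hxO, h⟩ := exists_local_compactness hφ hT hG x
    exact ⟨O, mem_nhdsWithin_of_mem_nhds (hO.mem_nhds hxO), h⟩

/-- Finitely many square integrable forms are uniformly small off a relatively compact open set. -/
theorem exists_normOn_compl_lt [T2Space X] {t : Set (L2Forms n φ)} (ht : t.Finite) {ε : ℝ}
    (hε : 0 < ε) : ∃ Ω : Set X, IsOpen Ω ∧ IsCompact (closure Ω) ∧
      ∀ v ∈ t, normOn Ωᶜ v ^ 2 < ε := by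
  have : LocallyCompactSpace X := ChartedSpace.locallyCompactSpace (Cn n) X
  let K : CompactExhaustion X := default
  have h1 : ∀ v : L2Forms n φ, Tendsto (fun j => normOn (K j)ᶜ v ^ 2) atTop (𝓝 0) := by
    intro v
    simp only [normOn_sq]
    have h2 := tendsto_setIntegral_of_antitone (μ := weightedVolume n φ)
      (s := fun j => (K j)ᶜ) (f := fun x => ‖v x‖ ^ 2)
      (fun j => (K.isCompact j).isClosed.measurableSet.compl)
      (fun i j hij => compl_subset_compl.2 (K.subset hij))
      ⟨0, (integrable_norm_sq v).integrableOn⟩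
    rwa [← compl_iUnion, K.iUnion_eq, compl_univ, Measure.restrict_empty,
      integral_zero_measure] at h2
  have h3 : ∀ᶠ j in atTop, ∀ v ∈ t, normOn (K j)ᶜ v ^ 2 < ε :=
    (Set.Finite.eventually_all ht).2 fun v _ => (h1 v).eventually (Iio_mem_nhds hε)
  obtain ⟨j, hj⟩ := h3.exists
  refine ⟨interior (K (j + 1)), isOpen_interior, (K.isCompact (j + 1)).of_isClosed_subset
    isClosed_closure (closure_minimal interior_subset (K.isCompact (j + 1)).isClosed),
    fun v hv => (normOn_sq_mono ?_ v).trans_lt (hj v hv)⟩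
  exact compl_subset_compl.2 (K.subset_interior_succ j)

end Global

/-! ### The energy space at infinity -/

section Equivalence

variable {n : ℕ} {X : Type*} [TopologicalSpace X] [ChartedSpace (Cn n) X]
  [IsManifold 𝓘(ℂ, Cn n) ω X]
  [RiemannianBundle (fun x : X => TangentSpace 𝓘(ℝ, Cn n) x)]
  [IsContMDiffRiemannianBundle 𝓘(ℝ, Cn n) ∞ (Cn n) (fun x : X => TangentSpace 𝓘(ℝ, Cn n) x)]
  [MeasurableSpace X] [BorelSpace X] [SecondCountableTopology X] {φ : X → ℝ}
  {T : L2Forms n φ →ₗ.[ℂ] L2Forms n φ}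
  {V₁ V₂ V₃ : Submodule ℂ (L2Forms n φ)}
  [CompleteSpace V₁] [CompleteSpace V₂] [CompleteSpace V₃]

theorem EnergySpace.exists_graph (u : EnergySpace T V₂) :
    ∃ f g, (EnergySpace.incl T V₂ u, f) ∈ T.graph ∧
      (EnergySpace.incl T V₂ u, g) ∈ (LinearPMap.adjoint T).graph ∧
      ‖u‖ ^ 2 = ‖f‖ ^ 2 + ‖g‖ ^ 2 := by
  have hu := u.2
  simp only [energySubmodule, Submodule.mem_inf] at hu
  obtain ⟨⟨h1, h2⟩, -⟩ := hu
  obtain ⟨a, ha⟩ := LinearPMap.mem_domain_iff.1 h1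
  obtain ⟨b, hb⟩ := LinearPMap.mem_domain_iff.1 h2
  exact ⟨a, b, ha, hb, EnergySpace.norm_sq T V₂ u a b ha hb⟩

theorem exists_tail_lt_of_totallyBounded [T2Space X]
    (h : TotallyBounded (EnergySpace.incl T V₂ '' Metric.ball 0 1)) {ε : ℝ} (hε : 0 < ε) :
    ∃ Ω : Set X, IsOpen Ω ∧ IsCompact (closure Ω) ∧
      ∀ u : EnergySpace T V₂, ‖u‖ < 1 → normOn Ωᶜ (EnergySpace.incl T V₂ u) < ε := by
  obtain ⟨t, ht, hcov⟩ := Metric.totallyBounded_iff.1 h (ε / 2) (by positivity)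
  obtain ⟨Ω, hΩ, hΩc, hΩt⟩ := exists_normOn_compl_lt ht (ε := ε ^ 2 / 4) (by positivity)
  refine ⟨Ω, hΩ, hΩc, fun u hu => ?_⟩
  have h1 := hcov (mem_image_of_mem _ (mem_ball_zero_iff.2 hu))
  simp only [mem_iUnion, Metric.mem_ball, dist_eq_norm] at h1
  obtain ⟨v, hv, huv⟩ := h1
  set w := EnergySpace.incl T V₂ u
  have h2 := normOn_sub_sq_le Ωᶜ v (v - w)
  rw [sub_sub_cancel] at h2
  have h3 : ‖v - w‖ ^ 2 < (ε / 2) ^ 2 := by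
    rw [norm_sub_rev]
    gcongr
  have h4 := normOn_sq_le Ωᶜ (v - w)
  refine lt_of_pow_lt_pow_left₀ 2 hε.le ?_
  linarith [hΩt v hv]

/-- The condition on the tails in homogeneous form. Elements of norm zero are covered because the
energy norm dominates the norm of the Hilbert space. -/
theorem exists_tail_sq_le (hT : T.IsClosed)
    (hTT : ∀ u f, (u, f) ∈ T.graph → (f, 0) ∈ T.graph)
    (h₁₂ : IsClosedRangePair T V₁ V₂) (h₂₃ : IsClosedRangePair T V₂ V₃)
    (h : ∀ ε > 0, ∃ Ω : Set X, IsOpen Ω ∧ IsCompact (closure Ω) ∧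
      ∀ u : EnergySpace T V₂, ‖u‖ < 1 → normOn Ωᶜ (EnergySpace.incl T V₂ u) < ε)
    {η : ℝ} (hη : 0 < η) : ∃ Ω : Set X, IsOpen Ω ∧ IsCompact (closure Ω) ∧
      ∀ u : EnergySpace T V₂, normOn Ωᶜ (EnergySpace.incl T V₂ u) ^ 2 ≤ η * ‖u‖ ^ 2 := by
  obtain ⟨Ω, hΩ, hΩc, hu⟩ := h (Real.sqrt η / 2) (by positivity)
  refine ⟨Ω, hΩ, hΩc, fun u => ?_⟩
  obtain ⟨C, hC, hCu⟩ := EnergySpace.exists_norm_le hT hTT h₁₂ h₂₃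
  rcases (norm_nonneg u).eq_or_lt with h0 | h0
  · have h1 := (normOn_sq_le Ωᶜ _).trans (hCu u)
    rw [← h0] at h1 ⊢
    simpa using h1
  · have h1 := hu (((2 * ‖u‖)⁻¹ : ℂ) • u) (by
      rw [norm_smul]
      simp only [norm_inv, norm_mul, Complex.norm_real, norm_norm, Complex.norm_ofNat]
      rw [mul_inv, mul_assoc, inv_mul_cancel₀ h0.ne']
      norm_num)
    rw [map_smul, normOn_smul] at h1
    simp only [norm_inv, norm_mul, Complex.norm_real, norm_norm, Complex.norm_ofNat] at h1
    have h2 : normOn Ωᶜ (EnergySpace.incl T V₂ u) ≤ Real.sqrt η * ‖u‖ := by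
      rw [inv_mul_lt_iff₀ (by positivity)] at h1
      linarith
    calc _ ≤ (Real.sqrt η * ‖u‖) ^ 2 := by
          have := normOn_nonneg Ωᶜ (EnergySpace.incl T V₂ u)
          gcongr
      _ = _ := by rw [mul_pow, Real.sq_sqrt hη.le]

/-- Rellich's argument: uniformly small tails and local compactness give compactness. -/
theorem totallyBounded_of_tail [T2Space X] (hφ : Continuous φ) (hT : IsClosedDiffOperator T)
    (hTT : ∀ u f, (u, f) ∈ T.graph → (f, 0) ∈ T.graph) (hG : GardingInequality T)
    (h₁₂ : IsClosedRangePair T V₁ V₂) (h₂₃ : IsClosedRangePair T V₂ V₃)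
    (h : ∀ ε > 0, ∃ Ω : Set X, IsOpen Ω ∧ IsCompact (closure Ω) ∧
      ∀ u : EnergySpace T V₂, ‖u‖ < 1 → normOn Ωᶜ (EnergySpace.incl T V₂ u) < ε) :
    TotallyBounded (EnergySpace.incl T V₂ '' Metric.ball 0 1) := by
  obtain ⟨C₀, hC₀, hC₀u⟩ := EnergySpace.exists_norm_le hT.closed hTT h₁₂ h₂₃
  refine totallyBounded_image_of_control (Y := L2Forms n φ) fun ε hε => ?_
  obtain ⟨Ω, hΩ, hΩc, hΩu⟩ := exists_tail_sq_le hT.closed hTT h₁₂ h₂₃ h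
    (η := ε ^ 2 / 4 / 4 / 2) (by positivity)
  obtain ⟨S, C, hC, hS⟩ := exists_finset_normOn_le hφ hT hG hΩc (ε ^ 2 / 4 / (4 * (C₀ + 1)))
    (by positivity)
  -- the functionals attached to `S` factor through the projection to its finite dimensional span
  set W := Submodule.span ℂ (S : Set (L2Forms n φ)) with hW
  set A := C * ∑ v ∈ S, ‖v‖ ^ 2 with hA
  have hA0 : 0 ≤ A := mul_nonneg hC (Finset.sum_nonneg fun _ _ => sq_nonneg _)
  refine ⟨fun u => W.starProjection (EnergySpace.incl T V₂ u), ε / (2 * (A + 1)), by positivity,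
    ?_, fun x hx y hy hxy => ?_⟩
  · have h1 : TotallyBounded
        ((fun u => W.orthogonalProjectionOnto (EnergySpace.incl T V₂ u)) '' Metric.ball 0 1) := by
      have h2 : Bornology.IsBounded
          ((fun u => W.orthogonalProjectionOnto (EnergySpace.incl T V₂ u)) '' Metric.ball 0 1) := by
        refine isBounded_iff_forall_norm_le.2 ⟨C₀ + 1, ?_⟩
        rintro _ ⟨u, hu, rfl⟩
        have hu1 : ‖u‖ < 1 := mem_ball_zero_iff.1 hu
        refine (W.norm_orthogonalProjectionOnto_apply_le _).trans ?_
        refine abs_le_of_sq_le_sq' ?_ (by positivity) |>.2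
        have h3 : ‖u‖ ^ 2 ≤ 1 := pow_le_one₀ (norm_nonneg u) hu1.le
        nlinarith [hC₀u u]
      have := FiniteDimensional.proper ℂ W
      exact h2.isCompact_closure.totallyBounded.subset subset_closure
    have h3 := h1.image (uniformContinuous_subtype_val (p := fun x => x ∈ W))
    rwa [image_image] at h3
  · rw [dist_eq_norm, ← map_sub, ← map_sub] at hxy
    rw [dist_eq_norm, ← map_sub]
    set w := x - y with hw
    set U := EnergySpace.incl T V₂ w with hU
    have hw2 : ‖w‖ ^ 2 ≤ 4 := by
      have h1 : ‖w‖ ≤ 2 := (norm_sub_le x y).trans (by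
        linarith [mem_ball_zero_iff.1 hx, mem_ball_zero_iff.1 hy])
      nlinarith [norm_nonneg w]
    obtain ⟨f, g, hf, hg, hfg⟩ := EnergySpace.exists_graph w
    have h1 := hS U f g hf hg
    have h2 : ∀ v ∈ S, ‖(inner ℂ v U : ℂ)‖ ^ 2 ≤ ‖v‖ ^ 2 * (ε / (2 * (A + 1))) ^ 2 := by
      intro v hv
      have hvW : v ∈ W := Submodule.subset_span hv
      rw [← Submodule.starProjection_eq_self_iff.2 hvW,
        Submodule.inner_starProjection_left_eq_right, ← mul_pow]
      rw [Submodule.starProjection_eq_self_iff.2 hvW]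
      have h3 := (norm_inner_le_norm (𝕜 := ℂ) v (W.starProjection U)).trans
        (mul_le_mul_of_nonneg_left hxy.le (norm_nonneg v))
      gcongr
    have h3 : C * ∑ v ∈ S, ‖(inner ℂ v U : ℂ)‖ ^ 2 ≤ ε ^ 2 / 4 := by
      calc _ ≤ C * ∑ v ∈ S, ‖v‖ ^ 2 * (ε / (2 * (A + 1))) ^ 2 :=
            mul_le_mul_of_nonneg_left (Finset.sum_le_sum h2) hC
        _ = ε ^ 2 / 4 * (A / (A + 1) ^ 2) := by
            rw [← Finset.sum_mul, ← mul_assoc, ← hA]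
            field_simp
            ring
        _ ≤ _ := by
            refine mul_le_of_le_one_right (by positivity) ?_
            rw [div_le_one (by positivity)]
            nlinarith
    have h4 : ε ^ 2 / 4 / (4 * (C₀ + 1)) * (‖U‖ ^ 2 + ‖f‖ ^ 2 + ‖g‖ ^ 2) ≤ ε ^ 2 / 4 := by
      rw [div_mul_eq_mul_div]
      refine div_le_of_le_mul₀ (by positivity) (by positivity)
        (mul_le_mul_of_nonneg_left ?_ (by positivity))
      rw [add_assoc, ← hfg]
      nlinarith [hC₀u w]
    have h5 := norm_sq_le_normOn_add (closure Ω) U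
    have h6 := (normOn_sq_mono (compl_subset_compl.2 subset_closure) U).trans (hΩu w)
    have h7 : ε ^ 2 / 4 / 4 / 2 * ‖w‖ ^ 2 ≤ ε ^ 2 / 4 / 2 := by
      have : ε ^ 2 / 4 / 4 / 2 * ‖w‖ ^ 2 ≤ ε ^ 2 / 4 / 4 / 2 * 4 := by gcongr
      linarith
    have h8 : 0 < ε ^ 2 := by positivity
    refine lt_of_pow_lt_pow_left₀ 2 hε.le ?_
    linarith

/-- If `θ j ≤ 1` vanishes off `S j`, then `∑ θ j` is integrable against `|u|²` as soon as the
squares of the norms of `u` on the sets `S j` are summable. -/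
theorem integral_tsum_mul_le {θ : ℕ → X → ℝ} (hθ : ∀ j, Continuous (θ j))
    (hs : ∀ x, Summable fun j => θ j x) (hc : Continuous fun x => ∑' j, θ j x)
    (h01 : ∀ j x, θ j x ∈ Icc (0 : ℝ) 1) {S : ℕ → Set X} (hS : ∀ j, MeasurableSet (S j))
    (h0 : ∀ j, ∀ x ∉ S j, θ j x = 0)
    {η : ℕ → ℝ} (hη : Summable η) {u : L2Forms n φ} (hu : ∀ j, normOn (S j) u ^ 2 ≤ η j) :
    Integrable (fun x => (∑' j, θ j x) * ‖u x‖ ^ 2) (weightedVolume n φ) ∧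
      ∫ x, (∑' j, θ j x) * ‖u x‖ ^ 2 ∂weightedVolume n φ ≤ ∑' j, η j := by
  have hi := integrable_norm_sq u
  have hle : ∀ j x, θ j x * ‖u x‖ ^ 2 ≤ (S j).indicator (fun x => ‖u x‖ ^ 2) x := by
    intro j x
    by_cases hx : x ∈ S j
    · rw [indicator_of_mem hx]
      exact mul_le_of_le_one_left (sq_nonneg _) (h01 j x).2
    · rw [indicator_of_notMem hx, h0 j x hx, zero_mul]
  have hF0 : ∀ j x, 0 ≤ θ j x * ‖u x‖ ^ 2 := fun j x => mul_nonneg (h01 j x).1 (sq_nonneg _)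
  have hFi : ∀ j, Integrable (fun x => θ j x * ‖u x‖ ^ 2) (weightedVolume n φ) := fun j =>
    (hi.indicator (hS j)).mono' ((hθ j).aestronglyMeasurable.mul hi.aestronglyMeasurable)
      (Eventually.of_forall fun x => by
        rw [Real.norm_of_nonneg (hF0 j x)]
        exact hle j x)
  have hη0 : ∀ j, 0 ≤ η j := fun j => (sq_nonneg _).trans (hu j)
  have hFη : ∀ j, ∫ x, θ j x * ‖u x‖ ^ 2 ∂weightedVolume n φ ≤ η j := fun j => by
    refine (integral_mono (hFi j) (hi.indicator (hS j)) (hle j)).trans ?_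
    rw [integral_indicator (hS j), ← normOn_sq]
    exact hu j
  have hm : AEStronglyMeasurable (fun x => (∑' j, θ j x) * ‖u x‖ ^ 2) (weightedVolume n φ) :=
    hc.aestronglyMeasurable.mul hi.aestronglyMeasurable
  have hpos : ∀ x, 0 ≤ (∑' j, θ j x) * ‖u x‖ ^ 2 := fun x =>
    mul_nonneg (tsum_nonneg fun j => (h01 j x).1) (sq_nonneg _)
  have hl : ∫⁻ x, ENNReal.ofReal ((∑' j, θ j x) * ‖u x‖ ^ 2) ∂weightedVolume n φ ≤
      ENNReal.ofReal (∑' j, η j) := by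
    calc _ = ∫⁻ x, ∑' j, ENNReal.ofReal (θ j x * ‖u x‖ ^ 2) ∂weightedVolume n φ := by
          refine lintegral_congr fun x => ?_
          rw [← tsum_mul_right, ENNReal.ofReal_tsum_of_nonneg (hF0 · x) ((hs x).mul_right _)]
      _ = ∑' j, ∫⁻ x, ENNReal.ofReal (θ j x * ‖u x‖ ^ 2) ∂weightedVolume n φ :=
          lintegral_tsum fun j => (hFi j).aestronglyMeasurable.aemeasurable.ennreal_ofReal
      _ ≤ ∑' j, ENNReal.ofReal (η j) := ENNReal.tsum_le_tsum fun j => by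
          rw [← ofReal_integral_eq_lintegral_ofReal (hFi j) (Eventually.of_forall (hF0 j))]
          exact ENNReal.ofReal_le_ofReal (hFη j)
      _ = _ := (ENNReal.ofReal_tsum_of_nonneg hη0 hη).symm
  have hI : Integrable (fun x => (∑' j, θ j x) * ‖u x‖ ^ 2) (weightedVolume n φ) :=
    ⟨hm, (hasFiniteIntegral_iff_ofReal (Eventually.of_forall hpos)).2
      (hl.trans_lt ENNReal.ofReal_lt_top)⟩
  refine ⟨hI, ?_⟩
  rw [← ofReal_integral_eq_lintegral_ofReal hI (Eventually.of_forall hpos)] at hl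
  exact (ENNReal.ofReal_le_ofReal_iff (tsum_nonneg hη0)).1 hl

/-- Uniformly small tails give a weight that tends to infinity: a series of smooth functions, each
equal to one off a compact set and vanishing where the tail is not yet small. -/
theorem exists_weight_of_tail [T2Space X] (hT : T.IsClosed)
    (hTT : ∀ u f, (u, f) ∈ T.graph → (f, 0) ∈ T.graph)
    (h₁₂ : IsClosedRangePair T V₁ V₂) (h₂₃ : IsClosedRangePair T V₂ V₃)
    (h : ∀ ε > 0, ∃ Ω : Set X, IsOpen Ω ∧ IsCompact (closure Ω) ∧
      ∀ u : EnergySpace T V₂, ‖u‖ < 1 → normOn Ωᶜ (EnergySpace.incl T V₂ u) < ε) :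
    ∃ ψ : X → ℝ, ContMDiff 𝓘(ℝ, Cn n) 𝓘(ℝ, ℝ) ∞ ψ ∧ (∀ x, 0 < ψ x) ∧
      Tendsto ψ (cocompact X) atTop ∧ ∀ u : EnergySpace T V₂,
        Integrable (fun x => ψ x * ‖EnergySpace.incl T V₂ u x‖ ^ 2) (weightedVolume n φ) ∧
          ∫ x, ψ x * ‖EnergySpace.incl T V₂ u x‖ ^ 2 ∂weightedVolume n φ ≤ ‖u‖ ^ 2 := by
  have : LocallyCompactSpace X := ChartedSpace.locallyCompactSpace (Cn n) X
  let K : CompactExhaustion X := default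
  obtain ⟨C, hC, hCu⟩ := EnergySpace.exists_norm_le hT hTT h₁₂ h₂₃
  choose Ω hΩ hΩc hΩu using fun j : ℕ => exists_tail_sq_le hT hTT h₁₂ h₂₃ h
    (η := 1 / 2 / 2 ^ j) (by positivity)
  choose m hm using fun j => K.exists_superset_of_isCompact ((K.isCompact j).union (hΩc j))
  have hL : ∀ j, IsClosed (K j ∪ closure (Ω j)) := fun j =>
    (K.isCompact j).isClosed.union isClosed_closure
  choose θ hθ0 hθ1 hθ using fun j => exists_contMDiffMap_zero_one_of_isClosed 𝓘(ℝ, Cn n) (n := ⊤)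
    (hL j) (isOpen_interior (s := K (m j + 1))).isClosed_compl
    (disjoint_compl_right_iff_subset.2 ((hm j).trans (K.subset_interior_succ _)))
  have hfin : LocallyFinite fun j => Function.support (θ j) := by
    intro x
    obtain ⟨k, hk⟩ := K.exists_mem_nhds x
    refine ⟨K k, hk, (finite_lt_nat k).subset ?_⟩
    rintro j ⟨y, hy, hyk⟩
    by_contra hj
    exact hy (hθ0 j (Or.inl (K.subset (not_lt.1 hj) hyk)))
  have hps : ∀ x, (Function.support fun j => θ j x).Finite := fun x => hfin.point_finite x
  have hsum : ∀ x, Summable fun j => θ j x := fun x => summable_of_hasFiniteSupport (hps x)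
  have hsm : ContMDiff 𝓘(ℝ, Cn n) 𝓘(ℝ, ℝ) ∞ fun x => ∑' j, θ j x := by
    have h1 : (fun x => ∑' j, θ j x) = fun x => ∑ᶠ j, θ j x :=
      funext fun x => tsum_eq_finsum (hps x)
    rw [h1]
    exact contMDiff_finsum (fun j => (θ j).contMDiff) hfin
  set c := (C + 1)⁻¹ with hc
  have hc0 : 0 < c := by positivity
  refine ⟨fun x => c * (1 + ∑' j, θ j x), contMDiff_const.mul (contMDiff_const.add hsm),
    fun x => ?_, ?_, fun u => ?_⟩
  · have : 0 ≤ ∑' j, θ j x := tsum_nonneg fun j => (hθ j x).1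
    positivity
  · refine Tendsto.const_mul_atTop hc0 (tendsto_atTop_add_const_left _ _
      (tendsto_atTop.2 fun b => ?_))
    obtain ⟨N, hN⟩ := exists_nat_ge b
    have h1 : ∀ᶠ x in cocompact X, ∀ j ∈ Finset.range N, θ j x = 1 :=
      (Finset.eventually_all _).2 fun j _ => by
        filter_upwards [(K.isCompact (m j + 1)).compl_mem_cocompact] with x hx
        exact hθ1 j fun h' => hx (interior_subset h')
    filter_upwards [h1] with x hx
    calc b ≤ N := hN
      _ = ∑ j ∈ Finset.range N, θ j x := by rw [Finset.sum_congr rfl hx]; simp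
      _ ≤ _ := (hsum x).sum_le_tsum _ fun j _ => (hθ j x).1
  · set v := EnergySpace.incl T V₂ u
    have hη : HasSum (fun j : ℕ => 1 / 2 / 2 ^ j * ‖u‖ ^ 2) (1 * ‖u‖ ^ 2) :=
      (hasSum_geometric_two' (1 : ℝ)).mul_right _
    obtain ⟨hi, hle⟩ := integral_tsum_mul_le (u := v) (fun j => (θ j).contMDiff.continuous) hsum
      hsm.continuous hθ (fun j => (hL j).measurableSet.compl)
      (fun j x hx => hθ0 j (not_notMem.1 hx)) hη.summable fun j =>
        (normOn_sq_mono (compl_subset_compl.2 (subset_closure.trans subset_union_right)) v).trans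
          (hΩu j u)
    rw [hη.tsum_eq, one_mul] at hle
    have hv := integrable_norm_sq v
    have h1 : ∀ x, c * (1 + ∑' j, θ j x) * ‖v x‖ ^ 2 =
        c * (‖v x‖ ^ 2 + (∑' j, θ j x) * ‖v x‖ ^ 2) := fun x => by ring
    simp only [h1]
    refine ⟨(hv.add hi).const_mul c, ?_⟩
    rw [integral_const_mul, integral_add hv hi, ← norm_sq_eq_integral, hc,
      inv_mul_le_iff₀ (by positivity)]
    linarith [hCu u]

/-- A weight that tends to infinity makes the tails of the energy space small. The hypothesis only
concerns the domain of `Q`; by duality, `v` is tested against the solution `w` of `Q w = f`, where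
`f` is the projection to the range of `Q` of the restriction of `v` to the tail. -/
theorem exists_tail_lt_of_weight [T2Space X] (hT : T.IsClosed)
    (hTT : ∀ u f, (u, f) ∈ T.graph → (f, 0) ∈ T.graph)
    (h₁₂ : IsClosedRangePair T V₁ V₂) (h₂₃ : IsClosedRangePair T V₂ V₃)
    {ψ : X → ℝ} (hψ : Continuous ψ) (hψ0 : ∀ x, 0 < ψ x) (hlim : Tendsto ψ (cocompact X) atTop)
    (h : ∀ u f, (u, f) ∈ (boxOp T V₂).graph → u ∈ range (boxOp T V₂) →
      Integrable (fun x => ψ x * ‖(u : L2Forms n φ) x‖ ^ 2) (weightedVolume n φ) ∧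
        ∫ x, ψ x * ‖(u : L2Forms n φ) x‖ ^ 2 ∂weightedVolume n φ ≤ (inner ℂ f u).re)
    {ε : ℝ} (hε : 0 < ε) : ∃ Ω : Set X, IsOpen Ω ∧ IsCompact (closure Ω) ∧
      ∀ u : EnergySpace T V₂, ‖u‖ < 1 → normOn Ωᶜ (EnergySpace.incl T V₂ u) < ε := by
  set c := (ε ^ 2)⁻¹ with hc
  have hc0 : 0 < c := by positivity
  obtain ⟨K, hK, hKc⟩ := mem_cocompact.1 (hlim.eventually (eventually_gt_atTop c))
  have hΩ : IsOpen {x | ψ x < c} := isOpen_lt hψ continuous_const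
  refine ⟨{x | ψ x < c}, hΩ, hK.of_isClosed_subset isClosed_closure
    (closure_minimal (fun x hx => ?_) hK.isClosed), fun u hu => ?_⟩
  · by_contra hxK
    exact lt_asymm (show c < ψ x from hKc hxK) (show ψ x < c from hx)
  set S := {x | ψ x < c}ᶜ
  have hS : MeasurableSet S := hΩ.measurableSet.compl
  have hQ := isHilbertLaplacian_boxOp hT hTT h₁₂ h₂₃
  obtain ⟨N, hN, -⟩ := hQ.existsUnique_green
  obtain ⟨v, hv, hvr, -⟩ := EnergySpace.exists_rep h₁₂ h₂₃ u
  rw [← hv]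
  obtain ⟨k, hk, hkv⟩ := exists_indicator hS (v : L2Forms n φ)
  have hcr : CompleteSpace (opRange (boxOp T V₂)) := by
    refine IsClosed.completeSpace_coe (hs := ?_)
    rw [coe_opRange]
    exact hQ.isClosed_range
  set f : V₂ := (opRange (boxOp T V₂)).starProjection (V₂.orthogonalProjectionOnto k) with hf
  have hfr : f ∈ range (boxOp T V₂) := by
    rw [← coe_opRange]
    exact Submodule.starProjection_apply_mem _ _
  have hfin : ∀ w ∈ range (boxOp T V₂), (inner ℂ f w : ℂ) = inner ℂ k (w : L2Forms n φ) := by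
    intro w hw
    rw [← coe_opRange] at hw
    rw [hf, Submodule.inner_starProjection_left_eq_right,
      Submodule.starProjection_eq_self_iff.2 hw, Submodule.inner_orthogonalProjectionOnto_eq_of_mem_right]
  obtain ⟨hwr, hwf⟩ := hN.1 f hfr
  obtain ⟨hq0, hq⟩ := EnergySpace.norm_inner_sq_le hT hTT h₁₂ h₂₃ hwf hv.symm
  obtain ⟨hint, hle⟩ := h _ _ hwf hwr
  set w := N f
  set q := (inner ℂ f w).re
  set M := normOn S (v : L2Forms n φ) with hM
  have hM0 : 0 ≤ M := normOn_nonneg _ _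
  have hW0 : 0 ≤ normOn S (w : L2Forms n φ) := normOn_nonneg _ _
  rw [hfin v hvr, hkv] at hq
  have h1 : c * normOn S (w : L2Forms n φ) ^ 2 ≤ q := by
    refine le_trans ?_ hle
    rw [normOn_sq, ← integral_const_mul]
    refine (setIntegral_mono_on ((integrable_norm_sq _).const_mul c).integrableOn hint.integrableOn hS
      fun x hx => ?_).trans (setIntegral_le_integral hint (Eventually.of_forall fun x =>
        mul_nonneg (hψ0 x).le (sq_nonneg _)))
    exact mul_le_mul_of_nonneg_right (not_lt.1 hx) (sq_nonneg _)
  have h2 : q ≤ M * normOn S (w : L2Forms n φ) := by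
    refine (Complex.re_le_norm _).trans ?_
    rw [hfin w hwr]
    exact hk _
  have h3 : ‖u‖ ^ 2 < 1 := pow_lt_one₀ (norm_nonneg u) hu two_ne_zero
  rcases hM0.eq_or_lt with h4 | h4
  · rwa [← h4]
  have h5 : 0 < q := by
    refine hq0.lt_of_ne fun h6 => ?_
    rw [← h6, zero_mul] at hq
    have : 0 < (M ^ 2) ^ 2 := by positivity
    linarith
  have h6 : c * q ≤ M ^ 2 := by
    refine le_of_mul_le_mul_right ?_ h5
    calc c * q * q = c * q ^ 2 := by ring
      _ ≤ c * (M * normOn S (w : L2Forms n φ)) ^ 2 := by gcongr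
      _ = M ^ 2 * (c * normOn S (w : L2Forms n φ) ^ 2) := by ring
      _ ≤ M ^ 2 * q := by gcongr
  have h7 : c * M ^ 2 ≤ ‖u‖ ^ 2 := by
    refine le_of_mul_le_mul_right ?_ (pow_pos h4 2)
    calc c * M ^ 2 * M ^ 2 = c * (M ^ 2) ^ 2 := by ring
      _ ≤ c * (q * ‖u‖ ^ 2) := by gcongr
      _ = c * q * ‖u‖ ^ 2 := by ring
      _ ≤ M ^ 2 * ‖u‖ ^ 2 := by gcongr
      _ = _ := by ring
  refine lt_of_pow_lt_pow_left₀ 2 hε.le ?_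
  have h8 := h7.trans_lt h3
  rwa [hc, inv_mul_lt_iff₀ (by positivity), mul_one] at h8

end Equivalence

end

end GreenOp

theorem mainTheorem5 (n : ℕ) {X Z : Type*} [TopologicalSpace Z] [T2Space Z]
    [TopologicalSpace X] [T2Space X] [SecondCountableTopology X]
    [MeasurableSpace X] [BorelSpace X]
    [ChartedSpace (Cn n) X] [IsManifold 𝓘(ℂ, Cn n) ω X]
    [RiemannianBundle (fun x : X => TangentSpace 𝓘(ℝ, Cn n) x)]
    [IsContMDiffRiemannianBundle 𝓘(ℝ, Cn n) ∞ (Cn n) (fun x : X => TangentSpace 𝓘(ℝ, Cn n) x)]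
    (hX : IsHermitianMetric n X)
    (ι : X → Z) (hι : Topology.IsOpenEmbedding ι)
    (φ : X → ℝ) (hφ : Continuous φ)
    (T : L2Forms n φ →ₗ.[ℂ] L2Forms n φ)
    (hT : IsClosedDiffOperator T)
    (hTT : ∀ u f, (u, f) ∈ T.graph → (f, 0) ∈ T.graph)
    (hG : GardingInequality T)
    (V₁ V₂ V₃ : Submodule ℂ (L2Forms n φ))
    [CompleteSpace V₁] [CompleteSpace V₂] [CompleteSpace V₃]
    (h₁₂ : IsClosedRangePair T V₁ V₂) (h₂₃ : IsClosedRangePair T V₂ V₃)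
    (hV₂ : StableUnderCutoff n (V₂ : Set (L2Forms n φ))) :
    (∀ u f, (u, f) ∈ (laplacian T).graph → u ∈ V₂ → f ∈ V₂) ∧
    IsSelfAdjoint (boxOp T V₂) ∧
    IsClosed (range (boxOp T V₂)) ∧
    (∃! N : V₂ →L[ℂ] V₂, IsGreenOperator (boxOp T V₂) N) ∧
    ∀ N : V₂ →L[ℂ] V₂, IsGreenOperator (boxOp T V₂) N →
      List.TFAE [
        IsCompactOperator N,
        IsCompactOperator (EnergySpace.incl T V₂),
        ∀ ε > 0, ∃ Ω : Set X, IsOpen Ω ∧ IsCompact (closure Ω) ∧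
          ∀ u : EnergySpace T V₂, ‖u‖ < 1 → normOn Ωᶜ (EnergySpace.incl T V₂ u) < ε,
        ∃ ψ : X → ℝ, ContMDiff 𝓘(ℝ, Cn n) 𝓘(ℝ, ℝ) ∞ ψ ∧ (∀ x, 0 < ψ x) ∧
          Tendsto ψ (approachBoundary ι) atTop ∧
          ∀ u f, (u, f) ∈ (boxOp T V₂).graph → u ∈ range (boxOp T V₂) →
            Integrable (fun x => ψ x * ‖(u : L2Forms n φ) x‖ ^ 2) (weightedVolume n φ) ∧
            ∫ x, ψ x * ‖(u : L2Forms n φ) x‖ ^ 2 ∂weightedVolume n φ ≤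
              (inner ℂ f u).re] := by
  have hQ := isHilbertLaplacian_boxOp hT.closed hTT h₁₂ h₂₃
  refine ⟨fun u f huf hu => mem_of_mem_graph_laplacian h₁₂ h₂₃ huf hu, hQ.isSelfAdjoint,
    hQ.isClosed_range, hQ.existsUnique_green, fun N hN => ?_⟩
  tfae_have 1 ↔ 2 := by
    rw [isCompactOperator_iff_totallyBounded (EnergySpace.incl T V₂)]
    exact isCompactOperator_green_iff hT.closed hTT h₁₂ h₂₃ hN
  tfae_have 2 → 3 := fun h ε hε =>
    exists_tail_lt_of_totallyBounded ((isCompactOperator_iff_totallyBounded _).1 h) hε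
  tfae_have 3 → 2 := fun h => (isCompactOperator_iff_totallyBounded _).2
    (totallyBounded_of_tail hφ hT hTT hG h₁₂ h₂₃ h)
  tfae_have 3 → 4 := by
    intro h
    obtain ⟨ψ, hψ, hψ0, hlim, hle⟩ := exists_weight_of_tail hT.closed hTT h₁₂ h₂₃ h
    refine ⟨ψ, hψ, hψ0, by rwa [approachBoundary_eq_cocompact hι], fun u f huf hu => ?_⟩
    obtain ⟨a, b, ha, hb⟩ := hQ.exists_of_mem_graph huf
    obtain ⟨e, he, hen⟩ := EnergySpace.exists_of_mem_graph h₁₂ hu ha hb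
    have h1 := hle e
    rw [he] at h1
    rwa [hQ.inner_self_eq huf ha hb, Complex.ofReal_re, ← hen]
  tfae_have 4 → 3 := by
    rintro ⟨ψ, hψ, hψ0, hlim, h⟩ ε hε
    rw [approachBoundary_eq_cocompact hι] at hlim
    exact exists_tail_lt_of_weight hT.closed hTT h₁₂ h₂₃ hψ.continuous hψ0 hlim h hε
  tfae_finish
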